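/- Let $k$ be a field of arbitrary characteristic and let $A=\bigoplus_{i\in\mathbb Z}A^i$ be a $\mathbb Z$-graded unital associative $k$-algebra. **Conventions.** A multilinear map with $n$ inputs, of internal degree $r$, has bidegree $(n,r)$ and total degree $|c|=n+r$. For $c_1$ with $n$ inputs, and $c_2$ with $s$ inputs and internal degree $t$, put $$(c_1\bullet_i c_2)(x_1,\dots,x_{i-1},y_1,\dots,y_s,x_{i+1},\dots,x_n)=(-1)^{(s-1)(n-i)+t(n-1+\sum_{j<i}|x_j|)}\,c_1(x_1,\dots,x_{i-1},c_2(y_1,\dots,y_s),x_{i+1},\dots,x_n).$$ Let $HC(A)$ be the bigraded space with $HC^{n,r}(A)=\operatorname{Hom}^r_k(A^{\otimes n},A)$, and let $HC(A|A)$ be the bigraded space with $$HC^{n,r}(A|A)=HC^{n,r}(A)\oplus\bigoplus_{p+1+q=n}\operatorname{Hom}_k^r(A^{\otimes p}\otimes M\otimes A^{\otimes q},M),$$ where $M=A$ is the diagonal bimodule, regarded as formally distinct from $A$; elements of the second summand are called bimodule cochains. On both spaces put $c_1\circ c_2=\sum_i c_1\bullet_i c_2$, the sum being over those inputs of $c_1$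 that match the output of $c_2$ (so $c_1\circ c_2=0$ if $c_1\in HC(A)$ and $c_2$ is a bimodule cochain), and $[c_1,c_2]=c_1\circ c_2-(-1)^{(|c_1|-1)(|c_2|-1)}c_2\circ c_1$. The differential is $d=[m,-]$, where $m$ is the multiplication $m_2$ of $A$ for $HC(A)$, and $m_2$ plus the two actions of $A$ on $M$ for $HC(A|A)$. The cup product is $(c_1\cdot c_2)(x_1,\dots,x_{n+s})=(-1)^{t(n+\sum_{j\le n}|x_j|)}\,c_1(x_1,\dots,x_n)\,c_2(x_{n+1},\dots,x_{n+s})$, the product of two bimodule cochains being $0$. The Gerstenhaber square is $\operatorname{Sq}(c)=c\circ c$, defined for all $c$ if $\operatorname{char}k=2$, and for $|c|$ even otherwise. Write $HH(A)$ and $HH(A|A)$ for the cohomologies; a Gerstenhaber algebra is a graded-commutative algebra with a compatible degree $-1$ shifted Lie bracket and, if $\operatorname{char}k=2$, a Gerstenhaber square with $\operatorname{Sq}(x+y)=\operatorname{Sq}(x)+\operatorname{Sq}(y)+[x,y]$, $\operatorname{Sq}(xy)=\operatorname{Sq}(x)y^2+x[x,y]y+x^2\operatorname{Sq}(y)$ and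 $[\operatorname{Sq}(x),y]=[x,[x,y]]$ (if $\operatorname{char}k\ne2$, $\operatorname{Sq}(x)=\frac12[x,x]$ in even degrees). Let $HC(A)\langle\varepsilon\rangle=HC(A)\oplus HC(A)\varepsilon$, where $\varepsilon$ has bidegree $(1,0)$, $\varepsilon^2=0$, $\varepsilon c=(-1)^{|c|}c\,\varepsilon$ and $d(c\,\varepsilon)=d(c)\varepsilon$. Let $\kappa\colon HC(A|A)\to HC(A)\langle\varepsilon\rangle$ be the linear map that is the identity on $HC(A)$ and sends a bimodule cochain $c\colon A^{\otimes p}\otimes M\otimes A^{\otimes q}\to M$ to $\kappa(c)=c'\varepsilon$, where $c'(x_1,\dots,x_{p+q})=(-1)^q c(x_1,\dots,x_p,1_A,x_{p+1},\dots,x_{p+q})$. **Proposition.** $HC(A|A)$ and $HC(A)\langle\varepsilon\rangle$ are bigraded dg algebras (for the total degree), and $\kappa$ is a bidegree-preserving quasi-isomorphism of dg algebras. Since the cohomology of $HC(A)\langle\varepsilon\rangle$ is $HH(A)[\varepsilon]/(\varepsilon^2)$, with $\varepsilon$ central in the graded sense, $\kappa$ induces an isomorphism of bigraded unital algebras $H(\kappa)\colon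 HH(A|A)\to HH(A)[\varepsilon]/(\varepsilon^2)$. **Corollary.** With the operations induced by those above on cochains, $HH(A)$ and $HH(A|A)$ are Gerstenhaber algebras. The structure transported along $H(\kappa)$ makes $HH(A)[\varepsilon]/(\varepsilon^2)$ a Gerstenhaber algebra, isomorphic to $HH(A|A)$ via $H(\kappa)$, and the following hold. 1. The transported bracket extends the Gerstenhaber bracket of $HH(A)$ and satisfies $[\varepsilon,\varepsilon]=0$ and $[c,\varepsilon]=0$ for $c\in HH(A)$. It is the only shifted Lie bracket satisfying the Gerstenhaber relation with respect to the product of $HH(A)[\varepsilon]/(\varepsilon^2)$ that has these properties. Moreover $[c_1,c_2\varepsilon]=[c_1,c_2]\varepsilon$ and $[c_1\varepsilon,c_2\varepsilon]=0$ for all $c_1,c_2\in HH(A)$. 2. If $\operatorname{char}k=2$, the transported Gerstenhaber square extends that of $HH(A)$ and, for all $c_1,c_2\in HH(A)$, $\operatorname{Sq}(c_1+c_2\varepsilon)=\operatorname{Sq}(c_1)+(c_2^2+[c_1,c_2])\varepsilon$. If $\operatorname{char}k\neq2$, it is $\operatorname{Sq}(x)=\frac12[x,x]$ on elements of even total degree.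 -/

import Mathlib

namespace Hoch

section Signs

/-- The sign `(-1)^n` as a scalar. -/
def sgn (k : Type*) [Field k] (n : ℤ) : k := ((n.negOnePow : ℤ) : k)

end Signs

section Splittings

/-- The sum of `F a b` over all ways of cutting the list `l` as `l = a ++ b`. -/
def splitSum {A V : Type*} [AddCommMonoid V] (F : List A → List A → V) (l : List A) : V :=
  ∑ i ∈ Finset.range (l.length + 1), F (l.take i) (l.drop i)

variable {A V : Type*}

lemma splitSum_add [AddCommMonoid V] (F G : List A → List A → V) (l : List A) :
    splitSum (fun a b => F a b + G a b) l = splitSum F l + splitSum G l := by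
  simp [splitSum, Finset.sum_add_distrib]

lemma splitSum_add' [AddCommMonoid V] (F G : List A → List A → V) :
    splitSum (fun a b => F a b + G a b) = fun l => splitSum F l + splitSum G l :=
  funext fun l => splitSum_add F G l

lemma splitSum_smul {k : Type*} [Semiring k] [AddCommMonoid V] [Module k V] (r : k)
    (F : List A → List A → V) (l : List A) :
    splitSum (fun a b => r • F a b) l = r • splitSum F l := by
  simp [splitSum, Finset.smul_sum]

lemma splitSum_smul' {k : Type*} [Semiring k] [AddCommMonoid V] [Module k V] (r : k)
    (F : List A → List A → V) :
    splitSum (fun a b => r • F a b) = fun l => r • splitSum F l :=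
  funext fun l => splitSum_smul r F l

lemma splitSum_congr [AddCommMonoid V] {F G : List A → List A → V} {l : List A}
    (h : ∀ a b, a ++ b = l → F a b = G a b) : splitSum F l = splitSum G l :=
  Finset.sum_congr rfl fun i _ => h _ _ (List.take_append_drop i l)

lemma splitSum_mem {k : Type*} [Semiring k] [AddCommMonoid V] [Module k V] (S : Submodule k V)
    {F : List A → List A → V} {l : List A} (h : ∀ a b, a ++ b = l → F a b ∈ S) :
    splitSum F l ∈ S :=
  Submodule.sum_mem _ fun i _ => h _ _ (List.take_append_drop i l)

lemma splitSum_eq_zero [AddCommMonoid V] {F : List A → List A → V} {l : List A}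
    (h : ∀ a b, a ++ b = l → F a b = 0) : splitSum F l = 0 :=
  Finset.sum_eq_zero fun i _ => h _ _ (List.take_append_drop i l)

/-- `c (x₁, …, xₙ)` is linear in each of the variables `x₁, …, xₙ`. -/
def IsML (k : Type*) [Semiring k] [AddCommMonoid A] [Module k A] [AddCommMonoid V] [Module k V]
    (c : List A → V) : Prop :=
  ∀ a b : List A, IsLinearMap k fun x => c (a ++ x :: b)

section
variable {k : Type*} [CommSemiring k] [AddCommMonoid V] [Module k V]

lemma IsLinearMap.sum {W ι : Type*} [AddCommMonoid W] [Module k W] (s : Finset ι)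
    {f : ι → W → V} (h : ∀ i ∈ s, IsLinearMap k (f i)) : IsLinearMap k fun x => ∑ i ∈ s, f i x where
  map_add x y := by
    rw [← Finset.sum_add_distrib]
    exact Finset.sum_congr rfl fun i hi => (h i hi).map_add x y
  map_smul r x := by
    rw [Finset.smul_sum]
    exact Finset.sum_congr rfl fun i hi => (h i hi).map_smul r x

lemma IsLinearMap.csmul {W : Type*} [AddCommMonoid W] [Module k W] (r : k)
    {f : W → V} (h : IsLinearMap k f) : IsLinearMap k fun x => r • f x where
  map_add x y := by rw [h.map_add, smul_add]
  map_smul s x := by rw [h.map_smul, smul_comm]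

lemma IsLinearMap.add' {W : Type*} [AddCommMonoid W] [Module k W]
    {f g : W → V} (h : IsLinearMap k f) (h' : IsLinearMap k g) :
    IsLinearMap k fun x => f x + g x where
  map_add x y := by rw [h.map_add, h'.map_add, add_add_add_comm]
  map_smul s x := by rw [h.map_smul, h'.map_smul, smul_add]

lemma IsLinearMap.splitSum {W : Type*} [AddCommMonoid W] [Module k W]
    {F : W → List A → List A → V} (l : List A) (h : ∀ a b, IsLinearMap k fun x => F x a b) :
    IsLinearMap k fun x => Hoch.splitSum (F x) l :=
  IsLinearMap.sum _ fun _ _ => h _ _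

end

section
variable {k : Type*} [CommSemiring k] [AddCommMonoid A] [Module k A] [AddCommMonoid V] [Module k V]

lemma IsML.splitSum {F : List A → List A → V} (h1 : ∀ b, IsML k fun a => F a b)
    (h2 : ∀ a, IsML k fun b => F a b) : IsML k (splitSum F) := by
  intro a b
  simp only [Hoch.splitSum, List.length_append, List.length_cons]
  refine IsLinearMap.sum _ fun i _ => ?_
  rcases Nat.lt_or_ge a.length i with h | h
  · obtain ⟨j, rfl⟩ : ∃ j, i = a.length + (j + 1) := ⟨i - a.length - 1, by omega⟩
    simpa [List.take_append, List.drop_append, List.take_of_length_le, List.drop_of_length_le]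
      using h1 (b.drop j) a (b.take j)
  · have e1 : ∀ x, (a ++ x :: b).take i = a.take i := fun x => by
      rw [List.take_append_of_le_length h]
    have e2 : ∀ x, (a ++ x :: b).drop i = a.drop i ++ x :: b := fun x => by
      rw [List.drop_append_of_le_length h]
    simpa only [e1, e2] using h2 (a.take i) (a.drop i) b

lemma IsML.splitSum_param {F : List A → List A → List A → V} (l : List A)
    (h : ∀ b e, IsML k fun a => F a b e) : IsML k fun a => Hoch.splitSum (F a) l := by
  intro a b
  exact IsLinearMap.sum _ fun i _ => h _ _ a b

lemma IsML.comp_map {c : List A → V} (h : IsML k c) (f : A →ₗ[k] A) :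
    IsML k fun l => c (l.map f) := by
  intro a b
  have := h (a.map f) (b.map f)
  constructor
  · intro x y; simpa using this.map_add (f x) (f y)
  · intro r x; simpa using this.map_smul r (f x)

lemma IsML.smul_length {c : List A → V} (h : IsML k c) (s : ℕ → k) :
    IsML k fun l => s l.length • c l := by
  intro a b
  simpa using IsLinearMap.csmul (s (a.length + (b.length + 1))) (h a b)

end

end Splittings

section Cochains

variable {k A : Type*} [Field k] [Ring A] [Algebra k A] (𝒜 : ℤ → Submodule k A)

/-- The entries of the list are homogeneous and their degrees add up to the given integer. -/
inductive IsHomList : List A → ℤ → Prop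
  | nil : IsHomList [] 0
  | cons {x : A} {l : List A} {i n : ℤ} (hx : x ∈ 𝒜 i) (hl : IsHomList l n) :
      IsHomList (x :: l) (i + n)

variable {𝒜} in
lemma IsHomList.append {a b : List A} {m n : ℤ} (ha : IsHomList 𝒜 a m) (hb : IsHomList 𝒜 b n) :
    IsHomList 𝒜 (a ++ b) (m + n) := by
  induction ha with
  | nil => simpa using hb
  | cons hx _ ih => simpa [add_assoc] using IsHomList.cons hx ih

variable {𝒜} in
lemma IsHomList.split {a b : List A} {n : ℤ} (h : IsHomList 𝒜 (a ++ b) n) :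
    ∃ n1 n2, n = n1 + n2 ∧ IsHomList 𝒜 a n1 ∧ IsHomList 𝒜 b n2 := by
  induction a generalizing n with
  | nil => exact ⟨0, n, by simp, .nil, h⟩
  | cons x a ih =>
    cases h with
    | cons hx hl =>
      obtain ⟨n1, n2, rfl, h1, h2⟩ := ih hl
      exact ⟨_, n2, by rw [add_assoc], .cons hx h1, h2⟩

lemma isHomList_singleton {x : A} {n : ℤ} (h : IsHomList 𝒜 [x] n) : x ∈ 𝒜 n := by
  cases h with
  | cons hx hl => cases hl; simpa using hx

/-- `HCdeg 𝒜 (p, q)` is the space of `k`-linear maps `A^{⊗ p} → A` of degree `q`: a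
cochain is written as a function of the list `[x₁, …, xₙ]` of its arguments which is multilinear,
is extended by zero to lists of length `n ≠ p`, and raises the degree by `q`. -/
def HCdeg (i : ℤ × ℤ) : Submodule k (List A → A) where
  carrier := {c | IsML k c ∧ (∀ l : List A, (l.length : ℤ) ≠ i.1 → c l = 0) ∧
    ∀ l n, IsHomList 𝒜 l n → c l ∈ 𝒜 (n + i.2)}
  add_mem' := by
    rintro c c' ⟨h1, h2, h3⟩ ⟨h1', h2', h3'⟩
    refine ⟨fun a b => IsLinearMap.add' (h1 a b) (h1' a b), fun l hl => ?_, fun l n hl => ?_⟩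
    · simp [h2 l hl, h2' l hl]
    · exact add_mem (h3 l n hl) (h3' l n hl)
  zero_mem' := ⟨fun a b => ⟨by simp, by simp⟩, by simp, by simp⟩
  smul_mem' := by
    rintro r c ⟨h1, h2, h3⟩
    refine ⟨fun a b => IsLinearMap.csmul r (h1 a b), fun l hl => ?_, fun l n hl => ?_⟩
    · simp [h2 l hl]
    · exact Submodule.smul_mem _ _ (h3 l n hl)

/-- `BimDeg 𝒜 (n, r)` is the direct sum over `p + 1 + q = n` of the spaces of `k`-linear maps
`A^{⊗ p} ⊗ M ⊗ A^{⊗ q} → M` of degree `r`, where `M = A` is the diagonal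
bimodule. Such a cochain is written as a function
`c [x₁, …, x_p] m [y₁, …, y_q]`; `n = p + 1 + q` is its arity. -/
def BimDeg (i : ℤ × ℤ) : Submodule k (List A → A → List A → A) where
  carrier := {c | (∀ m b, IsML k fun a => c a m b) ∧ (∀ a b, IsLinearMap k fun m => c a m b) ∧
    (∀ a m, IsML k (c a m)) ∧
    (∀ (a : List A) (m : A) (b : List A), (a.length : ℤ) + 1 + b.length ≠ i.1 → c a m b = 0) ∧
    ∀ a m b na nm nb, IsHomList 𝒜 a na → m ∈ 𝒜 nm → IsHomList 𝒜 b nb →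
      c a m b ∈ 𝒜 (na + nm + nb + i.2)}
  add_mem' := by
    rintro c c' ⟨h1, h2, h3, h4, h5⟩ ⟨h1', h2', h3', h4', h5'⟩
    refine ⟨fun m b a a' => IsLinearMap.add' (h1 m b a a') (h1' m b a a'),
      fun a b => IsLinearMap.add' (h2 a b) (h2' a b),
      fun a m b b' => IsLinearMap.add' (h3 a m b b') (h3' a m b b'),
      fun a m b hl => ?_, fun a m b na nm nb ha hm hb => ?_⟩
    · simp [h4 a m b hl, h4' a m b hl]
    · exact add_mem (h5 a m b na nm nb ha hm hb) (h5' a m b na nm nb ha hm hb)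
  zero_mem' := ⟨fun _ _ _ _ => ⟨by simp, by simp⟩, fun _ _ => ⟨by simp, by simp⟩,
    fun _ _ _ _ => ⟨by simp, by simp⟩, by simp, by simp⟩
  smul_mem' := by
    rintro r c ⟨h1, h2, h3, h4, h5⟩
    refine ⟨fun m b a a' => IsLinearMap.csmul r (h1 m b a a'),
      fun a b => IsLinearMap.csmul r (h2 a b),
      fun a m b b' => IsLinearMap.csmul r (h3 a m b b'),
      fun a m b hl => ?_, fun a m b na nm nb ha hm hb => ?_⟩
    · simp [h4 a m b hl]
    · exact Submodule.smul_mem _ _ (h5 a m b na nm nb ha hm hb)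

variable [GradedAlgebra 𝒜]

/-- The linear map with `par 𝒜 t x = (-1)^(t |x|) x` for homogeneous `x`. -/
noncomputable def par (t : ℤ) : A →ₗ[k] A :=
  (DirectSum.toModule k ℤ A fun n => sgn k (t * n) • (𝒜 n).subtype) ∘ₗ
    (DirectSum.decomposeLinearEquiv 𝒜).toLinearMap

lemma par_of_mem (t : ℤ) {x : A} {n : ℤ} (hx : x ∈ 𝒜 n) : par 𝒜 t x = sgn k (t * n) • x := by
  lift x to 𝒜 n using hx
  simp [par, DirectSum.decomposeLinearEquiv, DirectSum.decompose_coe, ← DirectSum.lof_eq_of k,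
    DirectSum.toModule_lof]

lemma par_mem (t : ℤ) {x : A} {n : ℤ} (hx : x ∈ 𝒜 n) : par 𝒜 t x ∈ 𝒜 n := by
  rw [par_of_mem 𝒜 t hx]; exact Submodule.smul_mem _ _ hx

variable {𝒜} in
lemma IsHomList.map_par {l : List A} {n : ℤ} (t : ℤ) (h : IsHomList 𝒜 l n) :
    IsHomList 𝒜 (l.map (par 𝒜 t)) n := by
  induction h with
  | nil => exact .nil
  | cons hx _ ih => exact .cons (par_mem 𝒜 t hx) ih

/-- `c₁{c₂} = ∑ᵢ c₁ •ᵢ c₂` for Hochschild cochains, `t` being the internal degree of `c₂`. In the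
summand the arguments are `a, b, e`, the arity of `c₂` is `|b|` and that of `c₁` is
`|a| + 1 + |e|`; applying `par 𝒜 t` to the arguments in `a` produces the Koszul sign
`(-1)^(t ∑ |a_j|)`. -/
noncomputable def braceHH (t : ℤ) (c₁ c₂ : List A → A) : List A → A :=
  splitSum fun a => splitSum fun b e =>
    sgn k (((b.length : ℤ) - 1) * e.length + t * (a.length + e.length)) •
      c₁ (a.map (par 𝒜 t) ++ c₂ b :: e)

/-- `c₁{c₂}` for a bimodule cochain `c₁` and a Hochschild cochain `c₂` of internal degree `t`:
`c₂` is inserted in all the entries of `c₁` other than the one of the bimodule. -/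
noncomputable def braceBH (t : ℤ) (c₁ : List A → A → List A → A) (c₂ : List A → A) :
    List A → A → List A → A := fun l m l' =>
  splitSum (fun a => splitSum fun b e =>
    sgn k (((b.length : ℤ) - 1) * (e.length + 1 + l'.length) +
        t * (a.length + e.length + 1 + l'.length)) •
      c₁ (a.map (par 𝒜 t) ++ c₂ b :: e) m l') l +
  splitSum (fun a => splitSum fun b e =>
    sgn k (((b.length : ℤ) - 1) * e.length + t * (l.length + 1 + a.length + e.length)) •
      c₁ (l.map (par 𝒜 t)) (par 𝒜 t m) (a.map (par 𝒜 t) ++ c₂ b :: e)) l'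

/-- `c₁{c₂} = c₁ •_{p+1} c₂` for bimodule cochains, `u` being the internal degree of `c₂`:
`c₂` is inserted in the bimodule entry of `c₁`. -/
noncomputable def braceBB (u : ℤ) (c₁ c₂ : List A → A → List A → A) :
    List A → A → List A → A := fun l m l' =>
  splitSum (fun a b => splitSum (fun b' e =>
    sgn k (((b.length : ℤ) + b'.length) * e.length + u * (a.length + e.length)) •
      c₁ (a.map (par 𝒜 u)) (c₂ b m b') e) l') l

/-- The cup product of Hochschild cochains, `t` being the internal degree of `c₂`. -/
noncomputable def cupHH (t : ℤ) (c₁ c₂ : List A → A) : List A → A :=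
  splitSum fun a b => sgn k (t * a.length) • (c₁ (a.map (par 𝒜 t)) * c₂ b)

/-- The cup product of a Hochschild cochain and a bimodule cochain of internal degree `u`. -/
noncomputable def cupHB (u : ℤ) (c₁ : List A → A) (c₂ : List A → A → List A → A) :
    List A → A → List A → A := fun l m l' =>
  splitSum (fun a b => sgn k (u * a.length) • (c₁ (a.map (par 𝒜 u)) * c₂ b m l')) l

/-- The cup product of a bimodule cochain and a Hochschild cochain of internal degree `t`. -/
noncomputable def cupBH (t : ℤ) (c₁ : List A → A → List A → A) (c₂ : List A → A) :
    List A → A → List A → A := fun l m l' =>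
  splitSum (fun a b => sgn k (t * (l.length + 1 + a.length)) •
    (c₁ (l.map (par 𝒜 t)) (par 𝒜 t m) (a.map (par 𝒜 t)) * c₂ b)) l'

/-- `∑ (-1)^q c (x₁, …, x_p, 1_A, x_{p+1}, …, x_{p+q})`, the coefficient of `ε` in `κ(c)`. -/
noncomputable def kappaFun (k : Type*) [Field k] [Algebra k A] (c : List A → A → List A → A) :
    List A → A :=
  splitSum fun a b => sgn k b.length • c a 1 b

lemma braceHH_mem {i j : ℤ × ℤ} {c₁ c₂ : List A → A} (h₁ : c₁ ∈ HCdeg 𝒜 i)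
    (h₂ : c₂ ∈ HCdeg 𝒜 j) : braceHH 𝒜 j.2 c₁ c₂ ∈ HCdeg 𝒜 (i + j - (1, 0)) := by
  obtain ⟨m1, s1, g1⟩ := h₁
  obtain ⟨m2, s2, g2⟩ := h₂
  refine ⟨?_, ?_, ?_⟩
  · refine IsML.splitSum (fun r => IsML.splitSum_param _ fun b e => ?_) fun a =>
      IsML.splitSum (fun e => ?_) fun b => ?_
    · have : IsML k fun a => c₁ (a ++ c₂ b :: e) := fun x y => by
        simpa using m1 x (y ++ c₂ b :: e)
      exact (this.comp_map _).smul_length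
        fun n => sgn k (((b.length : ℤ) - 1) * e.length + j.2 * (n + e.length))
    · refine IsML.smul_length (c := fun b => c₁ (a.map (par 𝒜 j.2) ++ c₂ b :: e)) (fun x y => ?_)
        fun n => sgn k (((n : ℤ) - 1) * e.length + j.2 * (a.length + e.length))
      exact ((m1 (a.map (par 𝒜 j.2)) e).mk'.comp (m2 x y).mk').isLinear
    · refine IsML.smul_length (c := fun e => c₁ (a.map (par 𝒜 j.2) ++ c₂ b :: e)) (fun x y => ?_)
        fun n => sgn k (((b.length : ℤ) - 1) * n + j.2 * (a.length + n))
      simpa using m1 (a.map (par 𝒜 j.2) ++ c₂ b :: x) y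
  · intro l hl
    refine splitSum_eq_zero fun a r hr => splitSum_eq_zero fun b e he => ?_
    subst he hr
    by_cases hb : (b.length : ℤ) = j.1
    · rw [s1, smul_zero]
      intro h
      apply hl
      simp at h ⊢
      omega
    · rw [s2 b hb]
      have := (m1 (a.map (par 𝒜 j.2)) e).map_zero
      rw [this, smul_zero]
  · intro l n hl
    refine splitSum_mem _ fun a r hr => splitSum_mem _ fun b e he => Submodule.smul_mem _ _ ?_
    subst he hr
    obtain ⟨na, nr, rfl, ha, hr⟩ := hl.split
    obtain ⟨nb, ne, rfl, hb, he⟩ := hr.split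
    have := g1 _ _ ((ha.map_par j.2).append (.cons (g2 b nb hb) he))
    convert this using 2
    simp
    ring

lemma braceBH_mem {i j : ℤ × ℤ} {c₁ : List A → A → List A → A} {c₂ : List A → A}
    (h₁ : c₁ ∈ BimDeg 𝒜 i) (h₂ : c₂ ∈ HCdeg 𝒜 j) :
    braceBH 𝒜 j.2 c₁ c₂ ∈ BimDeg 𝒜 (i + j - (1, 0)) := by
  obtain ⟨l1, m1, r1, s1, g1⟩ := h₁
  obtain ⟨m2, s2, g2⟩ := h₂
  refine ⟨fun m l' => ?_, fun l l' => ?_, fun l m => ?_, fun l m l' hl => ?_,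
    fun l m l' nl nm nl' hl hm hl' => ?_⟩
  · refine fun a0 b0 => IsLinearMap.add' ((IsML.splitSum (F := fun a => splitSum fun b e =>
      sgn k (((b.length : ℤ) - 1) * (e.length + 1 + l'.length) +
        j.2 * (a.length + e.length + 1 + l'.length)) • c₁ (a.map (par 𝒜 j.2) ++ c₂ b :: e) m l')
      (fun r => IsML.splitSum_param _ fun b e => ?_)
      (fun a => IsML.splitSum (fun e => ?_) fun b => ?_)) a0 b0)
      (IsLinearMap.splitSum _ fun a r => IsLinearMap.splitSum _ fun b e => ?_)
    · have : IsML k fun a => c₁ (a ++ c₂ b :: e) m l' := fun x y => by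
        simpa using l1 m l' x (y ++ c₂ b :: e)
      exact (this.comp_map _).smul_length
        fun n => sgn k (((b.length : ℤ) - 1) * (e.length + 1 + l'.length) +
          j.2 * (n + e.length + 1 + l'.length))
    · refine IsML.smul_length (c := fun b => c₁ (a.map (par 𝒜 j.2) ++ c₂ b :: e) m l')
        (fun x y => ?_) fun n => sgn k (((n : ℤ) - 1) * (e.length + 1 + l'.length) +
          j.2 * (a.length + e.length + 1 + l'.length))
      exact ((l1 m l' (a.map (par 𝒜 j.2)) e).mk'.comp (m2 x y).mk').isLinear
    · refine IsML.smul_length (c := fun e => c₁ (a.map (par 𝒜 j.2) ++ c₂ b :: e) m l')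
        (fun x y => ?_) fun n => sgn k (((b.length : ℤ) - 1) * (n + 1 + l'.length) +
          j.2 * (a.length + n + 1 + l'.length))
      simpa using l1 m l' (a.map (par 𝒜 j.2) ++ c₂ b :: x) y
    · exact (((l1 (par 𝒜 j.2 m) _).comp_map (par 𝒜 j.2)).smul_length fun n => sgn k (((b.length : ℤ) - 1) * e.length +
          j.2 * (n + 1 + a.length + e.length))) a0 b0
  · refine IsLinearMap.add' ?_ ?_
    · exact IsLinearMap.splitSum _ fun _ _ => IsLinearMap.splitSum _ fun _ _ => IsLinearMap.csmul _ (m1 _ _)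
    · exact IsLinearMap.splitSum _ fun _ _ => IsLinearMap.splitSum _ fun _ _ => IsLinearMap.csmul _
        ((m1 _ _).mk'.comp (par 𝒜 j.2)).isLinear
  · refine fun a0 b0 => IsLinearMap.add'
      (IsLinearMap.splitSum _ fun a r => IsLinearMap.splitSum _ fun b e => ?_)
      ((IsML.splitSum (F := fun a => splitSum fun b e =>
        sgn k (((b.length : ℤ) - 1) * e.length + j.2 * (l.length + 1 + a.length + e.length)) •
          c₁ (l.map (par 𝒜 j.2)) (par 𝒜 j.2 m) (a.map (par 𝒜 j.2) ++ c₂ b :: e))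
      (fun r => IsML.splitSum_param _ fun b e => ?_)
      (fun a => IsML.splitSum (fun e => ?_) fun b => ?_)) a0 b0)
    · exact ((r1 _ m).smul_length fun n => sgn k (((b.length : ℤ) - 1) * (e.length + 1 + n) +
          j.2 * (a.length + e.length + 1 + n))) a0 b0
    · have : IsML k fun a => c₁ (l.map (par 𝒜 j.2)) (par 𝒜 j.2 m) (a ++ c₂ b :: e) :=
        fun x y => by
          simpa using r1 (l.map (par 𝒜 j.2)) (par 𝒜 j.2 m) x (y ++ c₂ b :: e)
      exact (this.comp_map _).smul_length
        fun n => sgn k (((b.length : ℤ) - 1) * e.length + j.2 * (l.length + 1 + n + e.length))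
    · refine IsML.smul_length (c := fun b => c₁ (l.map (par 𝒜 j.2)) (par 𝒜 j.2 m)
        (a.map (par 𝒜 j.2) ++ c₂ b :: e))
        (fun x y => ?_) fun n => sgn k (((n : ℤ) - 1) * e.length +
          j.2 * (l.length + 1 + a.length + e.length))
      exact ((r1 _ _ (a.map (par 𝒜 j.2)) e).mk'.comp (m2 x y).mk').isLinear
    · refine IsML.smul_length (c := fun e => c₁ (l.map (par 𝒜 j.2)) (par 𝒜 j.2 m)
        (a.map (par 𝒜 j.2) ++ c₂ b :: e))
        (fun x y => ?_) fun n => sgn k (((b.length : ℤ) - 1) * n +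
          j.2 * (l.length + 1 + a.length + n))
      simpa using r1 _ _ (a.map (par 𝒜 j.2) ++ c₂ b :: x) y
  · refine (congrArg₂ (· + ·) ?_ ?_).trans (add_zero 0)
    · refine splitSum_eq_zero fun a r hr => splitSum_eq_zero fun b e he => ?_
      subst he hr
      by_cases hb : (b.length : ℤ) = j.1
      · rw [s1, smul_zero]
        intro h
        apply hl
        simp at h ⊢
        omega
      · have : c₁ (a.map (par 𝒜 j.2) ++ 0 :: e) m l' = 0 :=
          (l1 m l' (a.map (par 𝒜 j.2)) e).map_zero
        rw [s2 b hb, this, smul_zero]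
    · refine splitSum_eq_zero fun a r hr => splitSum_eq_zero fun b e he => ?_
      subst he hr
      by_cases hb : (b.length : ℤ) = j.1
      · rw [s1, smul_zero]
        intro h
        apply hl
        simp at h ⊢
        omega
      · have := (r1 (l.map (par 𝒜 j.2)) (par 𝒜 j.2 m) (a.map (par 𝒜 j.2)) e).map_zero
        rw [s2 b hb, this, smul_zero]
  · refine add_mem ?_ ?_
    · refine splitSum_mem _ fun a r hr => splitSum_mem _ fun b e he => Submodule.smul_mem _ _ ?_
      subst he hr
      obtain ⟨na, nr, rfl, ha, hr⟩ := hl.split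
      obtain ⟨nb, ne, rfl, hb, he⟩ := hr.split
      have := g1 _ m l' _ nm nl' ((ha.map_par j.2).append (.cons (g2 b nb hb) he)) hm hl'
      convert this using 2
      simp
      ring
    · refine splitSum_mem _ fun a r hr => splitSum_mem _ fun b e he => Submodule.smul_mem _ _ ?_
      subst he hr
      obtain ⟨na, nr, rfl, ha, hr⟩ := hl'.split
      obtain ⟨nb, ne, rfl, hb, he⟩ := hr.split
      have := g1 _ _ _ nl nm _ (hl.map_par j.2) (par_mem 𝒜 j.2 hm)
        ((ha.map_par j.2).append (.cons (g2 b nb hb) he))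
      convert this using 2
      simp
      ring

lemma braceBB_mem {i j : ℤ × ℤ} {c₁ c₂ : List A → A → List A → A}
    (h₁ : c₁ ∈ BimDeg 𝒜 i) (h₂ : c₂ ∈ BimDeg 𝒜 j) :
    braceBB 𝒜 j.2 c₁ c₂ ∈ BimDeg 𝒜 (i + j - (1, 0)) := by
  obtain ⟨l1, m1, r1, s1, g1⟩ := h₁
  obtain ⟨l2, m2, r2, s2, g2⟩ := h₂
  refine ⟨fun m l' => ?_, fun l l' => ?_, fun l m => ?_, fun l m l' hl => ?_,
    fun l m l' nl nm nl' hl hm hl' => ?_⟩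
  · refine IsML.splitSum (fun b => IsML.splitSum_param _ fun b' e => ?_) fun a =>
      IsML.splitSum_param _ fun b' e => ?_
    · exact ((l1 _ _).comp_map _).smul_length fun n =>
        sgn k (((b.length : ℤ) + b'.length) * e.length + j.2 * (n + e.length))
    · refine IsML.smul_length (c := fun b => c₁ (a.map (par 𝒜 j.2)) (c₂ b m b') e) (fun x y => ?_)
        fun n => sgn k (((n : ℤ) + b'.length) * e.length + j.2 * (a.length + e.length))
      exact ((m1 _ _).mk'.comp (l2 m b' x y).mk').isLinear
  · exact IsLinearMap.splitSum _ fun _ _ => IsLinearMap.splitSum _ fun _ _ => IsLinearMap.csmul _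
      ((m1 _ _).mk'.comp (m2 _ _).mk').isLinear
  · refine fun a0 b0 => IsLinearMap.splitSum _ fun a b => IsML.splitSum (fun e => ?_) (fun b' => ?_) a0 b0
    · refine IsML.smul_length (c := fun b' => c₁ (a.map (par 𝒜 j.2)) (c₂ b m b') e)
        (fun x y => ?_)
        fun n => sgn k (((b.length : ℤ) + n) * e.length + j.2 * (a.length + e.length))
      exact ((m1 _ _).mk'.comp (r2 _ m x y).mk').isLinear
    · exact (r1 _ _).smul_length fun n => sgn k (((b.length : ℤ) + b'.length) * n + j.2 * (a.length + n))
  · refine splitSum_eq_zero fun a b hr => splitSum_eq_zero fun b' e he => ?_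
    subst he hr
    by_cases hb : (b.length : ℤ) + 1 + b'.length = j.1
    · rw [s1, smul_zero]
      intro h
      apply hl
      simp at h ⊢
      omega
    · have := (m1 (a.map (par 𝒜 j.2)) e).map_zero
      rw [s2 b m b' hb, this, smul_zero]
  · refine splitSum_mem _ fun a b hr => splitSum_mem _ fun b' e he => Submodule.smul_mem _ _ ?_
    subst he hr
    obtain ⟨na, nb, rfl, ha, hb⟩ := hl.split
    obtain ⟨nb', ne, rfl, hb', he⟩ := hl'.split
    have := g1 _ _ _ _ _ _ (ha.map_par j.2) (g2 _ _ _ _ _ _ hb hm hb') he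
    convert this using 2
    simp
    ring

lemma IsLinearMap.mul_right' {W : Type*} [AddCommMonoid W] [Module k W] {f : W → A}
    (h : IsLinearMap k f) (y : A) : IsLinearMap k fun x => f x * y :=
  ((LinearMap.mulRight k y).comp h.mk').isLinear

lemma IsLinearMap.mul_left' {W : Type*} [AddCommMonoid W] [Module k W] {f : W → A}
    (h : IsLinearMap k f) (y : A) : IsLinearMap k fun x => y * f x :=
  ((LinearMap.mulLeft k y).comp h.mk').isLinear

lemma cupHH_mem {i j : ℤ × ℤ} {c₁ c₂ : List A → A} (h₁ : c₁ ∈ HCdeg 𝒜 i)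
    (h₂ : c₂ ∈ HCdeg 𝒜 j) : cupHH 𝒜 j.2 c₁ c₂ ∈ HCdeg 𝒜 (i + j) := by
  obtain ⟨m1, s1, g1⟩ := h₁
  obtain ⟨m2, s2, g2⟩ := h₂
  refine ⟨IsML.splitSum (fun b => ?_) fun a => ?_, fun l hl => ?_, fun l n hl => ?_⟩
  · exact IsML.smul_length (c := fun a => c₁ (a.map (par 𝒜 j.2)) * c₂ b)
      (fun x y => IsLinearMap.mul_right' (m1.comp_map (par 𝒜 j.2) x y) _)
      fun n => sgn k (j.2 * n)
  · exact fun x y => IsLinearMap.csmul _ (IsLinearMap.mul_left' (m2 x y) _)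
  · refine splitSum_eq_zero fun a b hr => ?_
    subst hr
    by_cases hb : (b.length : ℤ) = j.1
    · rw [s1, zero_mul, smul_zero]
      intro h
      apply hl
      simp at h ⊢
      omega
    · rw [s2 b hb, mul_zero, smul_zero]
  · refine splitSum_mem _ fun a b hr => Submodule.smul_mem _ _ ?_
    subst hr
    obtain ⟨na, nb, rfl, ha, hb⟩ := hl.split
    have := SetLike.mul_mem_graded (g1 _ _ (ha.map_par j.2)) (g2 _ _ hb)
    convert this using 2
    simp
    ring

lemma cupHB_mem {i j : ℤ × ℤ} {c₁ : List A → A} {c₂ : List A → A → List A → A}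
    (h₁ : c₁ ∈ HCdeg 𝒜 i) (h₂ : c₂ ∈ BimDeg 𝒜 j) :
    cupHB 𝒜 j.2 c₁ c₂ ∈ BimDeg 𝒜 (i + j) := by
  obtain ⟨m1, s1, g1⟩ := h₁
  obtain ⟨l2, m2, r2, s2, g2⟩ := h₂
  refine ⟨fun m l' => IsML.splitSum (fun b => ?_) fun a => ?_, fun l l' => ?_, fun l m => ?_,
    fun l m l' hl => ?_, fun l m l' nl nm nl' hl hm hl' => ?_⟩
  · exact IsML.smul_length (c := fun a => c₁ (a.map (par 𝒜 j.2)) * c₂ b m l')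
      (fun x y => IsLinearMap.mul_right' (m1.comp_map (par 𝒜 j.2) x y) _)
      fun n => sgn k (j.2 * n)
  · exact fun x y => IsLinearMap.csmul _ (IsLinearMap.mul_left' (l2 m l' x y) _)
  · exact IsLinearMap.splitSum _ fun _ _ => IsLinearMap.csmul _ (IsLinearMap.mul_left' (m2 _ _) _)
  · exact fun x y => IsLinearMap.splitSum _ fun _ _ =>
      IsLinearMap.csmul _ (IsLinearMap.mul_left' (r2 _ _ x y) _)
  · refine splitSum_eq_zero fun a b hr => ?_
    subst hr
    by_cases hb : (b.length : ℤ) + 1 + l'.length = j.1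
    · rw [s1, zero_mul, smul_zero]
      intro h
      apply hl
      simp at h ⊢
      omega
    · rw [s2 b m l' hb, mul_zero, smul_zero]
  · refine splitSum_mem _ fun a b hr => Submodule.smul_mem _ _ ?_
    subst hr
    obtain ⟨na, nb, rfl, ha, hb⟩ := hl.split
    have := SetLike.mul_mem_graded (g1 _ _ (ha.map_par j.2)) (g2 _ _ _ _ _ _ hb hm hl')
    convert this using 2
    simp
    ring

lemma cupBH_mem {i j : ℤ × ℤ} {c₁ : List A → A → List A → A} {c₂ : List A → A}
    (h₁ : c₁ ∈ BimDeg 𝒜 i) (h₂ : c₂ ∈ HCdeg 𝒜 j) :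
    cupBH 𝒜 j.2 c₁ c₂ ∈ BimDeg 𝒜 (i + j) := by
  obtain ⟨l1, m1, r1, s1, g1⟩ := h₁
  obtain ⟨m2, s2, g2⟩ := h₂
  refine ⟨fun m l' => ?_, fun l l' => ?_, fun l m => IsML.splitSum (fun b => ?_) fun a => ?_,
    fun l m l' hl => ?_, fun l m l' nl nm nl' hl hm hl' => ?_⟩
  · refine IsML.splitSum_param _ fun a b => ?_
    exact IsML.smul_length (c := fun l => c₁ (l.map (par 𝒜 j.2)) _ _ * c₂ b)
      (fun x y => IsLinearMap.mul_right' ((l1 _ _).comp_map (par 𝒜 j.2) x y) _)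
      fun n => sgn k (j.2 * (n + 1 + a.length))
  · exact IsLinearMap.splitSum _ fun _ _ => IsLinearMap.csmul _
      (IsLinearMap.mul_right' ((m1 _ _).mk'.comp (par 𝒜 j.2)).isLinear _)
  · exact IsML.smul_length (c := fun a => c₁ _ _ (a.map (par 𝒜 j.2)) * c₂ b)
      (fun x y => IsLinearMap.mul_right' ((r1 _ _).comp_map (par 𝒜 j.2) x y) _)
      fun n => sgn k (j.2 * (l.length + 1 + n))
  · exact fun x y => IsLinearMap.csmul _ (IsLinearMap.mul_left' (m2 x y) _)
  · refine splitSum_eq_zero fun a b hr => ?_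
    subst hr
    by_cases hb : (b.length : ℤ) = j.1
    · rw [s1, zero_mul, smul_zero]
      intro h
      apply hl
      simp at h ⊢
      omega
    · rw [s2 b hb, mul_zero, smul_zero]
  · refine splitSum_mem _ fun a b hr => Submodule.smul_mem _ _ ?_
    subst hr
    obtain ⟨na, nb, rfl, ha, hb⟩ := hl'.split
    have := SetLike.mul_mem_graded
      (g1 _ _ _ _ _ _ (hl.map_par j.2) (par_mem 𝒜 j.2 hm) (ha.map_par j.2)) (g2 _ _ hb)
    convert this using 2
    simp
    ring

lemma kappaFun_mem {i : ℤ × ℤ} {c : List A → A → List A → A} (h : c ∈ BimDeg 𝒜 i) :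
    kappaFun k c ∈ HCdeg 𝒜 (i - (1, 0)) := by
  obtain ⟨l1, m1, r1, s1, g1⟩ := h
  refine ⟨IsML.splitSum (fun b => ?_) fun a => ?_, fun l hl => ?_, fun l n hl => ?_⟩
  · exact fun x y => IsLinearMap.csmul _ (l1 1 b x y)
  · exact (r1 a 1).smul_length fun n => sgn k n
  · refine splitSum_eq_zero fun a b hr => ?_
    subst hr
    rw [s1, smul_zero]
    intro h
    apply hl
    simp at h ⊢
    omega
  · refine splitSum_mem _ fun a b hr => Submodule.smul_mem _ _ ?_
    subst hr
    obtain ⟨na, nb, rfl, ha, hb⟩ := hl.split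
    have := g1 _ _ _ _ _ _ ha (SetLike.one_mem_graded 𝒜) hb
    convert this using 2
    simp

/-- The multiplication `m₂` of `A`, a Hochschild cochain of bidegree `(2, 0)`. -/
def mulFun : List A → A
  | [x, y] => x * y
  | _ => 0

/-- The sum of the two actions `x ⊗ m ↦ x m` and `m ⊗ y ↦ m y` of `A` on the diagonal bimodule. -/
def actFun : List A → A → List A → A
  | [x], m, [] => x * m
  | [], m, [y] => m * y
  | _, _, _ => 0

/-- The unit of `A`, a Hochschild cochain of bidegree `(0, 0)`. -/
def oneFun : List A → A
  | [] => 1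
  | _ => 0

lemma mulFun_mem : mulFun ∈ HCdeg 𝒜 (2, 0) := by
  refine ⟨fun a b => ?_, fun l hl => ?_, fun l n hl => ?_⟩
  · match a, b with
    | [], [] => exact ⟨by simp [mulFun], by simp [mulFun]⟩
    | [], [y] => exact ⟨by simp [mulFun, add_mul], by simp [mulFun]⟩
    | [], _ :: _ :: _ => exact ⟨by simp [mulFun], by simp [mulFun]⟩
    | [y], [] => exact ⟨by simp [mulFun, mul_add], by simp [mulFun]⟩
    | [_], _ :: _ => exact ⟨by simp [mulFun], by simp [mulFun]⟩
    | [_, _], _ => exact ⟨by simp [mulFun], by simp [mulFun]⟩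
    | _ :: _ :: _ :: _, _ => exact ⟨by simp [mulFun], by simp [mulFun]⟩
  · match l with
    | [] => rfl
    | [_] => rfl
    | [_, _] => simp at hl
    | _ :: _ :: _ :: _ => rfl
  · match l with
    | [] => exact zero_mem _
    | [_] => exact zero_mem _
    | [x, y] =>
      obtain ⟨n1, n2, rfl, h1, h2⟩ := IsHomList.split (a := [x]) (b := [y]) hl
      have := SetLike.mul_mem_graded (isHomList_singleton 𝒜 h1) (isHomList_singleton 𝒜 h2)
      simpa [mulFun] using this
    | _ :: _ :: _ :: _ => exact zero_mem _

lemma oneFun_mem : oneFun ∈ HCdeg 𝒜 (0, 0) := by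
  refine ⟨fun a b => ?_, fun l hl => ?_, fun l n hl => ?_⟩
  · cases a <;> exact ⟨by simp [oneFun], by simp [oneFun]⟩
  · match l with
    | [] => simp at hl
    | _ :: _ => rfl
  · match l with
    | [] => cases hl; simpa [oneFun] using SetLike.one_mem_graded 𝒜
    | _ :: _ => exact zero_mem _

lemma actFun_mem : actFun ∈ BimDeg 𝒜 (2, 0) := by
  refine ⟨fun m b a a' => ?_, fun a b => ?_, fun a m b b' => ?_, fun a m b hl => ?_,
    fun a m b na nm nb ha hm hb => ?_⟩
  · match a, a', b with
    | [], [], [] => exact ⟨by simp [actFun, add_mul], by simp [actFun]⟩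
    | [], [], _ :: _ => exact ⟨by simp [actFun], by simp [actFun]⟩
    | [], _ :: _, _ => exact ⟨by simp [actFun], by simp [actFun]⟩
    | [_], _, _ => exact ⟨by simp [actFun], by simp [actFun]⟩
    | _ :: _ :: _, _, _ => exact ⟨by simp [actFun], by simp [actFun]⟩
  · match a, b with
    | [], [] => exact ⟨by simp [actFun], by simp [actFun]⟩
    | [x], [] => exact ⟨by simp [actFun, mul_add], by simp [actFun]⟩
    | [], [y] => exact ⟨by simp [actFun, add_mul], by simp [actFun]⟩
    | [], _ :: _ :: _ => exact ⟨by simp [actFun], by simp [actFun]⟩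
    | _ :: _, _ :: _ => exact ⟨by simp [actFun], by simp [actFun]⟩
    | _ :: _ :: _, [] => exact ⟨by simp [actFun], by simp [actFun]⟩
  · match b, b', a with
    | [], [], [] => exact ⟨by simp [actFun, mul_add], by simp [actFun]⟩
    | [], [], _ :: _ => exact ⟨by simp [actFun], by simp [actFun]⟩
    | [], _ :: _, [] => exact ⟨by simp [actFun], by simp [actFun]⟩
    | [], _ :: _, _ :: _ => exact ⟨by simp [actFun], by simp [actFun]⟩
    | [_], _, [] => exact ⟨by simp [actFun], by simp [actFun]⟩
    | [_], _, _ :: _ => exact ⟨by simp [actFun], by simp [actFun]⟩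
    | _ :: _ :: _, _, [] => exact ⟨by simp [actFun], by simp [actFun]⟩
    | _ :: _ :: _, _, _ :: _ => exact ⟨by simp [actFun], by simp [actFun]⟩
  · match a, b with
    | [], [] => rfl
    | [x], [] => simp at hl
    | [], [y] => simp at hl
    | [], _ :: _ :: _ => rfl
    | [_], _ :: _ => rfl
    | _ :: _ :: _, _ :: _ => rfl
    | _ :: _ :: _, [] => rfl
  · match a, b with
    | [], [] => exact zero_mem _
    | [x], [] =>
      cases hb
      simpa [actFun] using SetLike.mul_mem_graded (isHomList_singleton 𝒜 ha) hm
    | [], [y] =>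
      cases ha
      simpa [actFun] using SetLike.mul_mem_graded hm (isHomList_singleton 𝒜 hb)
    | [], _ :: _ :: _ => exact zero_mem _
    | [_], _ :: _ => exact zero_mem _
    | _ :: _ :: _, _ :: _ => exact zero_mem _
    | _ :: _ :: _, [] => exact zero_mem _

end Cochains

section Totals

/-- The direct sum of the components of a bigraded vector space. -/
def Tot (V : ℤ × ℤ → Type*) [∀ i, AddCommGroup (V i)] : Type _ := DirectSum (ℤ × ℤ) V

variable {k : Type*} [Field k] {V : ℤ × ℤ → Type*} [∀ i, AddCommGroup (V i)] [∀ i, Module k (V i)]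

noncomputable instance : AddCommGroup (Tot V) := inferInstanceAs (AddCommGroup (DirectSum _ V))

noncomputable instance : Module k (Tot V) := inferInstanceAs (Module k (DirectSum _ V))

variable (k V) in
/-- The inclusion of the component of bidegree `i` in the direct sum. -/
noncomputable def Tot.of (i : ℤ × ℤ) : V i →ₗ[k] Tot V := DirectSum.lof k _ V i

/-- The linear map on a direct sum with the given restrictions to the components. -/
noncomputable def Tot.lift {W : Type*} [AddCommGroup W] [Module k W] (f : ∀ i, V i →ₗ[k] W) :
    Tot V →ₗ[k] W :=
  DirectSum.toModule k _ W f

/-- The bilinear map on a direct sum with the given restrictions to the components. -/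
noncomputable def Tot.lift₂ {W : Type*} [AddCommGroup W] [Module k W]
    (f : ∀ i j, V i →ₗ[k] V j →ₗ[k] W) : Tot V →ₗ[k] Tot V →ₗ[k] W :=
  Tot.lift fun i => (Tot.lift fun j => (f i j).flip).flip

/-- The commutator `[x, y] = x ∘ y - (-1)^((|x| - 1) (|y| - 1)) y ∘ x` of a bilinear operation `∘`
on a bigraded vector space, with respect to the shifted total degree. -/
noncomputable def gradedCommutator (P : Tot V →ₗ[k] Tot V →ₗ[k] Tot V) :
    Tot V →ₗ[k] Tot V →ₗ[k] Tot V :=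
  Tot.lift₂ fun i j =>
    P.compl₁₂ (Tot.of k V i) (Tot.of k V j) -
      sgn k ((i.1 + i.2 - 1) * (j.1 + j.2 - 1)) •
        (P.compl₁₂ (Tot.of k V j) (Tot.of k V i)).flip

variable (k V) in
/-- The involution `x ↦ (-1)^|x| x`, where `|x|` is the total degree. -/
noncomputable def totalParity : Tot V →ₗ[k] Tot V :=
  Tot.lift fun i => sgn k (i.1 + i.2) • Tot.of k V i

variable (k V) in
/-- The bihomogeneous elements of bidegree `i` in a direct sum. -/
noncomputable def homPart (i : ℤ × ℤ) : Submodule k (Tot V) :=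
  LinearMap.range (Tot.of k V i)

end Totals

section Complexes

variable {k A : Type*} [Field k] [Ring A] [Algebra k A] (𝒜 : ℤ → Submodule k A)

/-- The Hochschild cochain complex of `A`. -/
abbrev HC : Type _ := Tot fun i => HCdeg 𝒜 i

/-- The component of bidegree `(n, r)` of the bimodule Hochschild complex of the
diagonal bimodule: Hochschild cochains of arity `n` together with bimodule cochains of arity `n`. -/
abbrev RelDeg (i : ℤ × ℤ) : Type _ := HCdeg 𝒜 i × BimDeg 𝒜 i

/-- The bimodule Hochschild cochain complex of the diagonal bimodule. -/
abbrev RelHC : Type _ := Tot fun i => RelDeg 𝒜 i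

/-- The bigraded vector space `HC(A)⟨ε⟩`; the pair `(a, b)` stands for `a + b ε`. -/
abbrev HCeps : Type _ := HC 𝒜 × HC 𝒜

/-- The bigrading of `HC(A)⟨ε⟩`, where `ε` has bidegree `(1, 0)`. -/
noncomputable def epsGr (i : ℤ × ℤ) : Submodule k (HCeps 𝒜) :=
  (homPart k (fun i => HCdeg 𝒜 i) i).prod (homPart k (fun i => HCdeg 𝒜 i) (i - (1, 0)))

variable [GradedAlgebra 𝒜]

lemma map_cons_add {V : Type*} [AddCommGroup V] [Module k V] {c : List A → V} (h : IsML k c)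
    (a b : List A) (x y : A) : c (a ++ (x + y) :: b) = c (a ++ x :: b) + c (a ++ y :: b) :=
  (h a b).map_add x y

lemma map_cons_smul {V : Type*} [AddCommGroup V] [Module k V] {c : List A → V} (h : IsML k c)
    (a b : List A) (r : k) (x : A) : c (a ++ (r • x) :: b) = r • c (a ++ x :: b) :=
  (h a b).map_smul r x

/-- The pre-Lie product on bihomogeneous Hochschild cochains. -/
noncomputable def hcPreDeg (i j : ℤ × ℤ) :
    HCdeg 𝒜 i →ₗ[k] HCdeg 𝒜 j →ₗ[k] HCdeg 𝒜 (i + j - (1, 0)) :=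
  LinearMap.mk₂ k (fun c₁ c₂ => ⟨braceHH 𝒜 j.2 c₁ c₂, braceHH_mem 𝒜 c₁.2 c₂.2⟩)
    (fun c c' c₂ => by
      ext l
      simp [braceHH, splitSum_add'])
    (fun r c c₂ => by
      ext l
      simp [braceHH, splitSum_smul', smul_comm _ r])
    (fun c c₂ c₂' => by
      ext l
      simp [braceHH, splitSum_add', map_cons_add c.2.1])
    (fun r c c₂ => by
      ext l
      simp [braceHH, splitSum_smul', map_cons_smul c.2.1, smul_comm _ r])

/-- The cup product on bihomogeneous Hochschild cochains. -/
noncomputable def hcCupDeg (i j : ℤ × ℤ) :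
    HCdeg 𝒜 i →ₗ[k] HCdeg 𝒜 j →ₗ[k] HCdeg 𝒜 (i + j) :=
  LinearMap.mk₂ k (fun c₁ c₂ => ⟨cupHH 𝒜 j.2 c₁ c₂, cupHH_mem 𝒜 c₁.2 c₂.2⟩)
    (fun c c' c₂ => by
      ext l
      simp [cupHH, splitSum_add', add_mul])
    (fun r c c₂ => by
      ext l
      simp [cupHH, splitSum_smul', smul_comm _ r])
    (fun c c₂ c₂' => by
      ext l
      simp [cupHH, splitSum_add', mul_add])
    (fun r c c₂ => by
      ext l
      simp [cupHH, splitSum_smul', smul_comm _ r])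

/-- The pre-Lie product on bihomogeneous elements of the bimodule Hochschild complex. A bimodule
cochain cannot be inserted into a Hochschild cochain. -/
noncomputable def relPreDeg (i j : ℤ × ℤ) :
    RelDeg 𝒜 i →ₗ[k] RelDeg 𝒜 j →ₗ[k] RelDeg 𝒜 (i + j - (1, 0)) :=
  LinearMap.mk₂ k (fun x y => (⟨braceHH 𝒜 j.2 x.1 y.1, braceHH_mem 𝒜 x.1.2 y.1.2⟩,
      ⟨braceBH 𝒜 j.2 x.2 y.1 + braceBB 𝒜 j.2 x.2 y.2,
        add_mem (braceBH_mem 𝒜 x.2.2 y.1.2) (braceBB_mem 𝒜 x.2.2 y.2.2)⟩))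
    (fun x x' y => by
      ext l
      · simp [braceHH, splitSum_add']
      · simp [braceBH, braceBB, splitSum_add']; abel)
    (fun r x y => by
      ext l
      · simp [braceHH, splitSum_smul', smul_comm _ r]
      · simp [braceBH, braceBB, splitSum_smul', smul_comm _ r])
    (fun x y y' => by
      have h (a b) (m m' : A) : (x.2 : List A → A → List A → A) a (m + m') b = _ :=
        (x.2.2.2.1 a b).map_add m m'
      have h' (m l' a b) (m' m'' : A) : (x.2 : List A → A → List A → A) (a ++ (m' + m'') :: b) m l'
          = _ := (x.2.2.1 m l' a b).map_add m' m''
      ext l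
      · simp [braceHH, splitSum_add', map_cons_add x.1.2.1]
      · simp [braceBH, braceBB, splitSum_add', map_cons_add (x.2.2.2.2.1 _ _), h, h']; abel)
    (fun r x y => by
      have h (a b) (m : A) : (x.2 : List A → A → List A → A) a (r • m) b = _ :=
        (x.2.2.2.1 a b).map_smul r m
      have h' (m l' a b) (m' : A) : (x.2 : List A → A → List A → A) (a ++ (r • m') :: b) m l'
          = _ := (x.2.2.1 m l' a b).map_smul r m'
      ext l
      · simp [braceHH, splitSum_smul', map_cons_smul x.1.2.1, smul_comm _ r]
      · simp [braceBH, braceBB, splitSum_smul', map_cons_smul (x.2.2.2.2.1 _ _), h, h',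
          smul_comm _ r])

/-- The cup product on bihomogeneous elements of the bimodule Hochschild complex. The product
of two bimodule cochains vanishes. -/
noncomputable def relCupDeg (i j : ℤ × ℤ) :
    RelDeg 𝒜 i →ₗ[k] RelDeg 𝒜 j →ₗ[k] RelDeg 𝒜 (i + j) :=
  LinearMap.mk₂ k (fun x y => (⟨cupHH 𝒜 j.2 x.1 y.1, cupHH_mem 𝒜 x.1.2 y.1.2⟩,
      ⟨cupHB 𝒜 j.2 x.1 y.2 + cupBH 𝒜 j.2 x.2 y.1,
        add_mem (cupHB_mem 𝒜 x.1.2 y.2.2) (cupBH_mem 𝒜 x.2.2 y.1.2)⟩))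
    (fun x x' y => by
      ext l
      · simp [cupHH, splitSum_add', add_mul]
      · simp [cupHB, cupBH, splitSum_add', add_mul]; abel)
    (fun r x y => by
      ext l
      · simp [cupHH, splitSum_smul', smul_comm _ r]
      · simp [cupHB, cupBH, splitSum_smul', smul_comm _ r])
    (fun x y y' => by
      ext l
      · simp [cupHH, splitSum_add', mul_add]
      · simp [cupHB, cupBH, splitSum_add', mul_add]; abel)
    (fun r x y => by
      ext l
      · simp [cupHH, splitSum_smul', smul_comm _ r]
      · simp [cupHB, cupBH, splitSum_smul', smul_comm _ r])

/-- The pre-Lie product `x ∘ y = x{y}` on the Hochschild complex. -/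
noncomputable def hcPre : HC 𝒜 →ₗ[k] HC 𝒜 →ₗ[k] HC 𝒜 :=
  Tot.lift₂ fun i j => (hcPreDeg 𝒜 i j).compr₂ (Tot.of k (fun i => HCdeg 𝒜 i) _)

/-- The cup product on the Hochschild complex. -/
noncomputable def hcCup : HC 𝒜 →ₗ[k] HC 𝒜 →ₗ[k] HC 𝒜 :=
  Tot.lift₂ fun i j => (hcCupDeg 𝒜 i j).compr₂ (Tot.of k (fun i => HCdeg 𝒜 i) _)

/-- The Gerstenhaber bracket on the Hochschild complex. -/
noncomputable def hcBracket : HC 𝒜 →ₗ[k] HC 𝒜 →ₗ[k] HC 𝒜 := gradedCommutator (hcPre 𝒜)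

/-- The Hochschild differential `[m₂, -]`. -/
noncomputable def hcD : HC 𝒜 →ₗ[k] HC 𝒜 :=
  hcBracket 𝒜 (Tot.of k (fun i => HCdeg 𝒜 i) (2, 0) ⟨mulFun, mulFun_mem 𝒜⟩)

/-- The unit of the Hochschild complex. -/
noncomputable def hcOne : HC 𝒜 :=
  Tot.of k (fun i => HCdeg 𝒜 i) (0, 0) ⟨oneFun, oneFun_mem 𝒜⟩

/-- The pre-Lie product `x ∘ y = x{y}` on the bimodule Hochschild complex. -/
noncomputable def relPre : RelHC 𝒜 →ₗ[k] RelHC 𝒜 →ₗ[k] RelHC 𝒜 :=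
  Tot.lift₂ fun i j => (relPreDeg 𝒜 i j).compr₂ (Tot.of k (fun i => RelDeg 𝒜 i) _)

/-- The cup product on the bimodule Hochschild complex. -/
noncomputable def relCup : RelHC 𝒜 →ₗ[k] RelHC 𝒜 →ₗ[k] RelHC 𝒜 :=
  Tot.lift₂ fun i j => (relCupDeg 𝒜 i j).compr₂ (Tot.of k (fun i => RelDeg 𝒜 i) _)

/-- The bimodule Gerstenhaber bracket. -/
noncomputable def relBracket : RelHC 𝒜 →ₗ[k] RelHC 𝒜 →ₗ[k] RelHC 𝒜 := gradedCommutator (relPre 𝒜)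

/-- The bimodule Hochschild differential: the bracket with the multiplication of `A` plus the two
actions of `A` on the diagonal bimodule. -/
noncomputable def relD : RelHC 𝒜 →ₗ[k] RelHC 𝒜 :=
  relBracket 𝒜 (Tot.of k (fun i => RelDeg 𝒜 i) (2, 0)
    (⟨mulFun, mulFun_mem 𝒜⟩, ⟨actFun, actFun_mem 𝒜⟩))

/-- The unit of the bimodule Hochschild complex. -/
noncomputable def relOne : RelHC 𝒜 :=
  Tot.of k (fun i => RelDeg 𝒜 i) (0, 0) (⟨oneFun, oneFun_mem 𝒜⟩, 0)

/-- The differential of `HC(A)⟨ε⟩`, `d(a + b ε) = d(a) + d(b) ε`. -/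
noncomputable def epsD : HCeps 𝒜 →ₗ[k] HCeps 𝒜 := (hcD 𝒜).prodMap (hcD 𝒜)

/-- The product of `HC(A)⟨ε⟩`, with `ε² = 0` and `ε c = (-1)^|c| c ε`. -/
noncomputable def epsMul : HCeps 𝒜 →ₗ[k] HCeps 𝒜 →ₗ[k] HCeps 𝒜 :=
  LinearMap.mk₂ k (fun x y => (hcCup 𝒜 x.1 y.1,
      hcCup 𝒜 x.1 y.2 + hcCup 𝒜 x.2 (totalParity k (fun i => HCdeg 𝒜 i) y.1)))
    (fun x x' y => by ext1 <;> simp; abel)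
    (fun r x y => by ext1 <;> simp)
    (fun x y y' => by ext1 <;> simp; abel)
    (fun r x y => by ext1 <;> simp)

/-- The unit of `HC(A)⟨ε⟩`. -/
noncomputable def epsOne : HCeps 𝒜 := (hcOne 𝒜, 0)

lemma kappaFun_add (c c' : List A → A → List A → A) :
    kappaFun k (c + c') = kappaFun k c + kappaFun k c' := by
  ext l; simp [kappaFun, splitSum_add']

lemma kappaFun_smul (r : k) (c : List A → A → List A → A) :
    kappaFun k (r • c) = r • kappaFun k c := by
  ext l; simp [kappaFun, splitSum_smul', smul_comm _ r]

/-- The map `κ` on bimodule cochains. -/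
noncomputable def kappaBim (i : ℤ × ℤ) : BimDeg 𝒜 i →ₗ[k] HCdeg 𝒜 (i - (1, 0)) where
  toFun c := ⟨kappaFun k c, kappaFun_mem 𝒜 c.2⟩
  map_add' _ _ := Subtype.ext (kappaFun_add _ _)
  map_smul' _ _ := Subtype.ext (kappaFun_smul _ _)

/-- The map `κ` from the bimodule Hochschild complex to `HC(A)⟨ε⟩`. -/
noncomputable def kappa : RelHC 𝒜 →ₗ[k] HCeps 𝒜 :=
  Tot.lift fun i =>
    (Tot.of k (fun i => HCdeg 𝒜 i) i).prodMap
      (Tot.of k (fun i => HCdeg 𝒜 i) (i - (1, 0)) ∘ₗ kappaBim 𝒜 i)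

end Complexes

section Cohomology

variable {k : Type*} [Field k]

/-- A dg algebra with respect to the total degree, whose underlying graded vector space is
bigraded by `gr` and whose differential has bidegree `(1, 0)`. -/
structure IsDGAlgebra {V : Type*} [AddCommGroup V] [Module k V] (gr : ℤ × ℤ → Submodule k V)
    (d : V →ₗ[k] V) (mul : V →ₗ[k] V →ₗ[k] V) (one : V) : Prop where
  isInternal : DirectSum.IsInternal gr
  d_mem : ∀ i, ∀ x ∈ gr i, d x ∈ gr (i + (1, 0))
  d_d : ∀ x, d (d x) = 0
  mul_mem : ∀ i j, ∀ x ∈ gr i, ∀ y ∈ gr j, mul x y ∈ gr (i + j)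
  one_mem : one ∈ gr 0
  one_mul : ∀ x, mul one x = x
  mul_one : ∀ x, mul x one = x
  mul_assoc : ∀ x y z, mul (mul x y) z = mul x (mul y z)
  leibniz : ∀ i, ∀ x ∈ gr i, ∀ y, d (mul x y) = mul (d x) y + sgn k (i.1 + i.2) • mul x (d y)

/-- A morphism of (bigraded) dg algebras. -/
structure IsDGAlgebraHom {V W : Type*} [AddCommGroup V] [Module k V] [AddCommGroup W] [Module k W]
    (grV : ℤ × ℤ → Submodule k V) (dV : V →ₗ[k] V) (mulV : V →ₗ[k] V →ₗ[k] V) (oneV : V)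
    (grW : ℤ × ℤ → Submodule k W) (dW : W →ₗ[k] W) (mulW : W →ₗ[k] W →ₗ[k] W) (oneW : W)
    (f : V →ₗ[k] W) : Prop where
  map_mem : ∀ i, ∀ x ∈ grV i, f x ∈ grW i
  map_d : ∀ x, f (dV x) = dW (f x)
  map_one : f oneV = oneW
  map_mul : ∀ x y, f (mulV x y) = mulW (f x) (f y)

/-- The cohomology `ker d / im d` of a differential. -/
abbrev Coh {V : Type*} [AddCommGroup V] [Module k V] (d : V →ₗ[k] V) : Type _ :=
  LinearMap.ker d ⧸ (LinearMap.range d).submoduleOf (LinearMap.ker d)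

/-- `x` is a cocycle and its cohomology class is `h`. -/
def Represents {V : Type*} [AddCommGroup V] [Module k V] (d : V →ₗ[k] V) (x : V) (h : Coh d) :
    Prop :=
  ∃ hx : x ∈ LinearMap.ker d, Submodule.Quotient.mk ⟨x, hx⟩ = h

/-- The classes of the cocycles lying in a subspace. -/
def cohPart {V : Type*} [AddCommGroup V] [Module k V] (d : V →ₗ[k] V) (S : Submodule k V) :
    Submodule k (Coh d) :=
  (S.submoduleOf (LinearMap.ker d)).map (Submodule.mkQ _)

/-- The map induced in cohomology by a cochain map. -/
def cohMap {V W : Type*} [AddCommGroup V] [Module k V] [AddCommGroup W] [Module k W]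
    {dV : V →ₗ[k] V} {dW : W →ₗ[k] W} (f : V →ₗ[k] W) (hf : ∀ x, f (dV x) = dW (f x)) :
    Coh dV →ₗ[k] Coh dW :=
  Submodule.mapQ _ _
    (f.restrict (p := LinearMap.ker dV) (q := LinearMap.ker dW) fun x hx => by
      rw [LinearMap.mem_ker] at hx ⊢
      rw [← hf, hx, map_zero])
    (by
      rintro ⟨x, hx⟩ ⟨y, hy⟩
      exact ⟨f y, by rw [← hf, hy]; rfl⟩)

/-- The grading by total degree underlying a bigrading. -/
def totalGr {V : Type*} [AddCommGroup V] [Module k V] (gr : ℤ × ℤ → Submodule k V) (n : ℤ) :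
    Submodule k V :=
  ⨆ (i : ℤ × ℤ) (_ : i.1 + i.2 = n), gr i

/-- A shifted graded Lie bracket (of degree `-1`). -/
structure IsShiftedLieBracket {G : Type*} [AddCommGroup G] [Module k G] (gr : ℤ → Submodule k G)
    (br : G →ₗ[k] G →ₗ[k] G) : Prop where
  mem : ∀ m n, ∀ x ∈ gr m, ∀ y ∈ gr n, br x y ∈ gr (m + n - 1)
  self_odd : ∀ n, Odd n → ∀ x ∈ gr n, br x x = 0
  self_even : ∀ n, Even n → ∀ x ∈ gr n, br x (br x x) = 0
  antisymm : ∀ m n, ∀ x ∈ gr m, ∀ y ∈ gr n, br x y = -(sgn k ((m - 1) * (n - 1)) • br y x)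
  jacobi : ∀ m n, ∀ x ∈ gr m, ∀ y ∈ gr n, ∀ z,
    br x (br y z) = br (br x y) z + sgn k ((m - 1) * (n - 1)) • br y (br x z)

/-- The Gerstenhaber relation `[x, y z] = [x, y] z + (-1)^((|x| - 1) |y|) y [x, z]`. -/
def GerstenhaberRelation {G : Type*} [AddCommGroup G] [Module k G] (gr : ℤ → Submodule k G)
    (mul br : G →ₗ[k] G →ₗ[k] G) : Prop :=
  ∀ m n, ∀ x ∈ gr m, ∀ y ∈ gr n, ∀ z,
    br x (mul y z) = mul (br x y) z + sgn k ((m - 1) * n) • mul y (br x z)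

/-- The elements on which the Gerstenhaber square is defined: all elements in characteristic `2`,
the homogeneous elements of even degree otherwise. -/
def SqDomain {G : Type*} [AddCommGroup G] [Module k G] (gr : ℤ → Submodule k G) (x : G) : Prop :=
  ringChar k = 2 ∨ ∃ n, Even n ∧ x ∈ gr n

/-- A Gerstenhaber algebra structure on a graded vector space. The values of `sq` outside of
`SqDomain gr` carry no information. -/
structure GerstenhaberAlgebra {G : Type*} [AddCommGroup G] [Module k G]
    (gr : ℤ → Submodule k G) where
  isInternal : DirectSum.IsInternal gr
  /-- the product -/
  mul : G →ₗ[k] G →ₗ[k] G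
  mul_mem : ∀ m n, ∀ x ∈ gr m, ∀ y ∈ gr n, mul x y ∈ gr (m + n)
  mul_assoc : ∀ x y z, mul (mul x y) z = mul x (mul y z)
  mul_comm : ∀ m n, ∀ x ∈ gr m, ∀ y ∈ gr n, mul x y = sgn k (m * n) • mul y x
  /-- the bracket -/
  bracket : G →ₗ[k] G →ₗ[k] G
  isShiftedLieBracket : IsShiftedLieBracket gr bracket
  gerstenhaberRelation : GerstenhaberRelation gr mul bracket
  /-- the Gerstenhaber square -/
  sq : G → G
  sq_mem : ringChar k = 2 → ∀ n, ∀ x ∈ gr n, sq x ∈ gr (2 * n - 1)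
  sq_add : ringChar k = 2 → ∀ x y, sq (x + y) = sq x + sq y + bracket x y
  sq_mul : ringChar k = 2 → ∀ x y, sq (mul x y) =
    mul (sq x) (mul y y) + mul (mul x (bracket x y)) y + mul (mul x x) (sq y)
  bracket_sq : ringChar k = 2 → ∀ x y, bracket (sq x) y = bracket x (bracket x y)
  sq_even : ringChar k ≠ 2 → ∀ n, Even n → ∀ x ∈ gr n, sq x = (2⁻¹ : k) • bracket x x

/-- The Gerstenhaber algebra structure on cohomology is the one induced by the given
operations (product, bracket and pre-Lie product) on cochains. -/
structure GerstenhaberAlgebra.IsInducedBy {V : Type*} [AddCommGroup V] [Module k V]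
    {d : V →ₗ[k] V} {gr : ℤ → Submodule k (Coh d)} (G : GerstenhaberAlgebra gr)
    (grV : ℤ → Submodule k V) (mul br pre : V →ₗ[k] V →ₗ[k] V) : Prop where
  mul : ∀ x y a b, Represents d x a → Represents d y b → Represents d (mul x y) (G.mul a b)
  bracket : ∀ x y a b, Represents d x a → Represents d y b →
    Represents d (br x y) (G.bracket a b)
  sq : ∀ x a, SqDomain grV x → Represents d x a → Represents d (pre x x) (G.sq a)

/-- An isomorphism of Gerstenhaber algebras. -/
structure IsGerstenhaberIso {G H : Type*} [AddCommGroup G] [Module k G] [AddCommGroup H]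
    [Module k H] {grG : ℤ → Submodule k G} {grH : ℤ → Submodule k H}
    (S : GerstenhaberAlgebra grG) (T : GerstenhaberAlgebra grH) (f : G →ₗ[k] H) : Prop where
  bijective : Function.Bijective f
  map_gr : ∀ n, (grG n).map f = grH n
  map_mul : ∀ x y, f (S.mul x y) = T.mul (f x) (f y)
  map_bracket : ∀ x y, f (S.bracket x y) = T.bracket (f x) (f y)
  map_sq : ∀ x, SqDomain grG x → f (S.sq x) = T.sq (f x)

end Cohomology

section HochschildCohomology

variable {k A : Type*} [Field k] [Ring A] [Algebra k A] (𝒜 : ℤ → Submodule k A) [GradedAlgebra 𝒜]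

/-- The bigraded Hochschild cohomology of `A`. -/
abbrev HH : Type _ := Coh (hcD 𝒜)

/-- The bigrading of Hochschild cohomology. -/
noncomputable def hhGr (i : ℤ × ℤ) : Submodule k (HH 𝒜) :=
  cohPart (hcD 𝒜) (homPart k (fun i => HCdeg 𝒜 i) i)

/-- The bimodule Hochschild cohomology of the diagonal bimodule. -/
abbrev RelHH : Type _ := Coh (relD 𝒜)

/-- The bigrading of bimodule Hochschild cohomology. -/
noncomputable def relHHGr (i : ℤ × ℤ) : Submodule k (RelHH 𝒜) :=
  cohPart (relD 𝒜) (homPart k (fun i => RelDeg 𝒜 i) i)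

/-- The underlying vector space of `HH(A)[ε]/(ε²)`; the pair `(a, b)` stands for `a + b ε`. -/
abbrev HHeps : Type _ := HH 𝒜 × HH 𝒜

/-- The bigrading of `HH(A)[ε]/(ε²)`, where `ε` has bidegree `(1, 0)`. -/
noncomputable def hhEpsGr (i : ℤ × ℤ) : Submodule k (HHeps 𝒜) :=
  (hhGr 𝒜 i).prod (hhGr 𝒜 (i - (1, 0)))

/-- The identification `H(HC(A)⟨ε⟩) = HH(A)[ε]/(ε²)`, `[a + b ε] ↦ [a] + [b] ε`. -/
noncomputable def cohEps : Coh (epsD 𝒜) →ₗ[k] HHeps 𝒜 :=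
  (cohMap (LinearMap.fst k (HC 𝒜) (HC 𝒜)) fun _ => rfl).prod
    (cohMap (LinearMap.snd k (HC 𝒜) (HC 𝒜)) fun _ => rfl)

end HochschildCohomology

end Hoch

/-!
The proof separates the formal properties of the operations on Hochschild cochains from the two
computations that are specific to the diagonal bimodule: the acyclicity of the kernel of `κ`, and
a section of `κ` up to coboundaries.

**The Gerstenhaber structures.** A cochain `c` inserts into a multilinear function `φ` of any
number of arguments (`ins`), and two cochains insert simultaneously (`ins₂`). Insertion is a
twisted derivation of the convolution product of such functions (`ins_conv`), simultaneous
insertion a twisted second order derivation (`ins₂_conv`). Two composites of insertions that have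
the same behaviour on products agree as soon as they agree on a single letter, and every
multilinear function is a linear function of a product of letters in a suitable algebra, namely of
its translates (`IsML.exists_eq_comp_letters`). This gives the brace identities `ins_ins` and
`ins₂_ins` with little manipulation of signs. With the identity cochain `ι`, the multiplication is
`m = ι ∪ ι`, so that the differential `[m, -]` is the insertion into `m`, which is a commutator
for the cup product, minus the composition with `m`. What results is recorded in `IsBraceAlgebra`:
an associative cup product, for which the insertion `-{z}` is a derivation; a pre-Lie product; and
the fact, contained in `dFun_ins₂`, that for a cocycle `x` the map `x{-}` is a derivation of the
cup product of cocycles up to coboundaries. These properties alone make the complex a dg algebra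
and its cohomology a Gerstenhaber algebra (`IsBraceAlgebra.exists_gerstenhaberAlgebra`), including
the Gerstenhaber square in characteristic `2`, and they hold for `HC(A)`
(`hc_isBigradedBraceAlgebra`).

For `HC(A|A)` no identity is verified again. The algebra of dual numbers `A ⊕ M` is graded by the
weight, `A` having weight `0` and the diagonal bimodule `M` weight `1`. Cochains of the pair `(A,
M)` are cochains of `A ⊕ M` that preserve the weight: there are an injection `relToDual` into
`HC(A ⊕ M)`, compatible with all operations, and a retraction `dualToRel`, which commutes with the
differential. Hence `HC(A|A)` inherits the identities (`rel_isBigradedBraceAlgebra`).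

**The map `κ`.** Let `e` be the unit of `A` regarded as an element of `M`, as a cochain of `A ⊕ M`
without inputs (`epsFun`). It is a cocycle and central, and the `ε`-component of `κ x` is the
composition of `x` with `e`, restricted to `A` (`kappa_apply`). The formula for the differential
of a composition and the derivation property of `-{e}` thus say that `κ` commutes with the
differentials and with the products (`kappa_d`, `kappa_cup`).

*Injectivity.* Let `θ` be the `1`-cochain of `A ⊕ M` that sends an element of `M` to the same
element of `A` (`thetaFun`), and let `x` be a cocycle of `HC(A|A)` with `κ x = 0`. The cochain `e
∪ θ` is the identity of `M`, and on lists with one entry from `M` the formula for the differential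
of the double insertion `x{e, θ}` says that `x` is, up to sign, its coboundary (`mem_range_relD`).

*Surjectivity.* A Hochschild cochain extends to the diagonal bimodule by the same formula, and
this extension `hcToRel : HC(A) → HC(A|A)` is compatible with insertions, brackets and
differentials. The identity `id` of the diagonal bimodule (`relId`) is a cocycle with `κ id = ε`.
For cocycles `c₁`, `c₂` of `A`, the cocycle `hcToRel c₁ + hcToRel c₂ ∪ id` is sent by `κ` to `c₁ +
c₂ ε` up to `c₁{1} ε`, which is a coboundary since `c₁{-}` is a derivation of the cup product up
to coboundaries (`pre_one_mem_range`).

**Bracket and square.** The class `ε` of `HH(A)[ε]/(ε²)` corresponds to that of `id`. Composition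
with `id` on either side multiplies bimodule cochains by `1` and other cochains by `0`, so that
every bracket with `id` vanishes (`relBracket_relId`), and `id ∘ id = id` (`relPre_relId_relId`).
Since `hcToRel` preserves brackets and squares, the transported bracket extends that of `HH(A)`,
it satisfies `[c, ε] = [ε, ε] = 0`, and in characteristic `2` the transported square extends that
of `HH(A)` and satisfies `Sq(ε) = ε`. The remaining formulas and the uniqueness follow from the
Gerstenhaber relation and from the formulas for the square of a sum and of a product
(`IsEpsProduct.bracket_unique`, `IsEpsProduct.sq_eq`).
-/

namespace Hoch

/-! ### Signs -/

section Signs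

variable {k : Type*} [Field k]

lemma sgn_congr {m n : ℤ} (h : (m : ZMod 2) = n) : sgn k m = sgn k n := by
  have : m.negOnePow = n.negOnePow := by
    rw [Int.negOnePow_eq_iff, ← ZMod.intCast_eq_zero_iff_even, Int.cast_sub, h, sub_self]
  rw [sgn, sgn, this]

lemma sgn_add (m n : ℤ) : sgn k (m + n) = sgn k m * sgn k n := by
  simp [sgn, Int.negOnePow_add]

@[simp] lemma sgn_zero : sgn k 0 = 1 := by simp [sgn]

lemma sgn_even {n : ℤ} (h : Even n) : sgn k n = 1 := by simp [sgn, Int.negOnePow_even n h]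

lemma sgn_odd {n : ℤ} (h : Odd n) : sgn k n = -1 := by simp [sgn, Int.negOnePow_odd n h]

lemma sgn_mul_self (n : ℤ) : sgn k n * sgn k n = 1 := by
  rw [← sgn_add]; exact sgn_even ⟨n, rfl⟩

lemma sgn_eq_or (n : ℤ) : sgn k n = 1 ∨ sgn k n = -1 :=
  (Int.even_or_odd n).imp sgn_even sgn_odd

lemma sgn_sub (m n : ℤ) : sgn k (m - n) = sgn k m * sgn k n := by
  rw [← sgn_add]
  exact sgn_congr (by push_cast; grind)

lemma sgn_one : sgn k 1 = -1 := sgn_odd odd_one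

lemma sgn_succ (n : ℤ) : sgn k (n + 1) = -sgn k n := by
  rw [sgn_add, sgn_odd odd_one, mul_neg_one]

end Signs

/-! ### Sums over the ways to cut a list -/

section Cuts

variable {A B V : Type*} [AddCommMonoid V]

@[simp] lemma splitSum_nil (F : List A → List A → V) : splitSum F [] = F [] [] := by
  simp [splitSum]

lemma splitSum_cons (F : List A → List A → V) (x : A) (l : List A) :
    splitSum F (x :: l) = F [] (x :: l) + splitSum (fun a b => F (x :: a) b) l := by
  rw [splitSum, List.length_cons, Finset.sum_range_succ', add_comm]
  rfl

/-- A cut of `l ++ x :: r` takes place either before or after the entry `x`. -/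
lemma splitSum_append_cons (F : List A → List A → V) (l : List A) (x : A) (r : List A) :
    splitSum F (l ++ x :: r) =
      splitSum (fun a b => F a (b ++ x :: r)) l + splitSum (fun a b => F (l ++ x :: a) b) r := by
  induction l generalizing F with
  | nil => simp [splitSum_cons]
  | cons y l ih => simp [splitSum_cons, ih, add_assoc]

lemma splitSum_map (F : List B → List B → V) (f : A → B) (l : List A) :
    splitSum F (l.map f) = splitSum (fun a b => F (a.map f) (b.map f)) l := by
  induction l generalizing F with
  | nil => simp
  | cons y l ih => simp [splitSum_cons, ih]

/-- Cutting a list into three pieces: the order of the two cuts does not matter. -/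
lemma splitSum_assoc (F : List A → List A → List A → List A → V) (l : List A) :
    splitSum (fun r e => splitSum (fun a b => F r e a b) r) l =
      splitSum (fun a r => splitSum (fun b e => F (a ++ b) e a b) r) l := by
  induction l generalizing F with
  | nil => simp
  | cons y l ih => simp [splitSum_cons, ih, splitSum_add, add_assoc]

lemma splitSum_comm (F : List A → List A → List B → List B → V) (l : List A) (r : List B) :
    splitSum (fun a b => splitSum (fun a' b' => F a b a' b') r) l =
      splitSum (fun a' b' => splitSum (fun a b => F a b a' b') l) r :=
  Finset.sum_comm

lemma map_splitSum {W G : Type*} [AddCommMonoid W] [FunLike G V W] [AddMonoidHomClass G V W] (g : G)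
    (F : List A → List A → V) (l : List A) :
    g (splitSum F l) = splitSum (fun a b => g (F a b)) l := map_sum g _ _

lemma mul_splitSum {R : Type*} [NonUnitalNonAssocSemiring R] (r : R) (F : List A → List A → R)
    (l : List A) : r * splitSum F l = splitSum (fun a b => r * F a b) l := Finset.mul_sum _ _ _

lemma splitSum_mul {R : Type*} [NonUnitalNonAssocSemiring R] (r : R) (F : List A → List A → R)
    (l : List A) : splitSum F l * r = splitSum (fun a b => F a b * r) l := Finset.sum_mul _ _ _

lemma smul_splitSum {k : Type*} [Semiring k] [Module k V] (r : k) (F : List A → List A → V)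
    (l : List A) : r • splitSum F l = splitSum (fun a b => r • F a b) l :=
  (splitSum_smul r F l).symm

/-- If only the cut with empty first piece contributes, the sum is its contribution. -/
lemma splitSum_eq_left {F : List A → List A → V} {l : List A}
    (h : ∀ x a b, F (x :: a) b = 0) : splitSum F l = F [] l := by
  cases l with
  | nil => simp
  | cons x l => rw [splitSum_cons, splitSum_eq_zero (fun a b _ => h x a b), add_zero]

lemma splitSum_eq_right {F : List A → List A → V} {l : List A}
    (h : ∀ a x b, F a (x :: b) = 0) : splitSum F l = F l [] := by
  induction l generalizing F with
  | nil => simp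
  | cons x l ih => rw [splitSum_cons, h, zero_add, ih fun a y b => h _ _ _]

end Cuts

/-! ### Multilinear functions of lists -/

section Multilinear

variable {k A V W : Type*} [Field k] [AddCommGroup A] [Module k A] [AddCommGroup V] [Module k V]
  [AddCommGroup W] [Module k W]

lemma IsML.map_zero {f : List A → V} (h : IsML k f) (a b : List A) : f (a ++ 0 :: b) = 0 :=
  (h a b).map_zero

lemma IsML.map_smul {f : List A → V} (h : IsML k f) (a b : List A) (r : k) (x : A) :
    f (a ++ r • x :: b) = r • f (a ++ x :: b) :=
  (h a b).map_smul r x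

lemma IsML.translate {f : List A → V} (h : IsML k f) (p : List A) : IsML k fun q => f (p ++ q) := by
  intro a b
  simpa using h (p ++ a) b

lemma IsML.comp_linear {f : List A → V} (h : IsML k f) (g : V →ₗ[k] W) :
    IsML k fun l => g (f l) := fun a b => (g.comp (h a b).mk').isLinear

lemma IsML.const_smul {f : List A → V} (h : IsML k f) (r : k) : IsML k fun l => r • f l :=
  fun a b => IsLinearMap.csmul r (h a b)

lemma IsML.add {f g : List A → V} (h : IsML k f) (h' : IsML k g) : IsML k fun l => f l + g l :=
  fun a b => IsLinearMap.add' (h a b) (h' a b)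

lemma IsML.mul_right {R : Type*} [Ring R] [Algebra k R] {f : List A → R} (h : IsML k f) (r : R) :
    IsML k fun l => f l * r := h.comp_linear (LinearMap.mulRight k r)

lemma IsML.mul_left {R : Type*} [Ring R] [Algebra k R] {f : List A → R} (h : IsML k f) (r : R) :
    IsML k fun l => r * f l := h.comp_linear (LinearMap.mulLeft k r)

end Multilinear

/-! ### The parity operators -/

section Parity

variable {k A : Type*} [Field k] [Ring A] [Algebra k A] (𝒜 : ℤ → Submodule k A) [GradedAlgebra 𝒜]

lemma linearMap_ext_of_mem {V : Type*} [AddCommGroup V] [Module k V] {f g : A →ₗ[k] V}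
    (h : ∀ n, ∀ x ∈ 𝒜 n, f x = g x) : f = g := by
  classical
  refine LinearMap.ext fun x => ?_
  rw [← DirectSum.sum_support_decompose 𝒜 x, map_sum, map_sum]
  exact Finset.sum_congr rfl fun i _ => h i _ (SetLike.coe_mem _)

lemma par_comp_par (s t : ℤ) (x : A) : par 𝒜 s (par 𝒜 t x) = par 𝒜 (s + t) x := by
  suffices (par 𝒜 s).comp (par 𝒜 t) = par 𝒜 (s + t) from LinearMap.congr_fun this x
  refine linearMap_ext_of_mem 𝒜 fun n x hx => ?_
  rw [LinearMap.comp_apply, par_of_mem 𝒜 t hx, map_smul, par_of_mem 𝒜 s hx, par_of_mem 𝒜 _ hx,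
    smul_smul, ← sgn_add]
  congr 1
  exact congrArg _ (by ring)

lemma map_par_map_par (s t : ℤ) (l : List A) :
    (l.map (par 𝒜 t)).map (par 𝒜 s) = l.map (par 𝒜 (s + t)) := by
  rw [List.map_map]
  exact List.map_congr_left fun x _ => par_comp_par 𝒜 s t x

@[simp] lemma par_zero : par 𝒜 0 = LinearMap.id :=
  linearMap_ext_of_mem 𝒜 fun n x hx => by simp [par_of_mem 𝒜 0 hx]

lemma map_par_zero (l : List A) : l.map (par 𝒜 0) = l := by simp

/-- Two multilinear functions agree if they agree on lists of homogeneous elements. -/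
lemma IsML.ext_of_isHomList {V : Type*} [AddCommGroup V] [Module k V] {f g : List A → V}
    (hf : IsML k f) (hg : IsML k g) (h : ∀ l n, IsHomList 𝒜 l n → f l = g l) : f = g := by
  suffices ∀ (b a : List A) (n : ℤ), IsHomList 𝒜 a n → f (a ++ b) = g (a ++ b) from
    funext fun l => this l [] 0 .nil
  intro b
  induction b with
  | nil => intro a n ha; simpa using h a n ha
  | cons x b ih =>
    intro a n ha
    refine LinearMap.congr_fun (f := (hf a b).mk') (g := (hg a b).mk')
      (linearMap_ext_of_mem 𝒜 fun i y hy => ?_) x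
    simpa using ih (a ++ [y]) _ (ha.append (.cons hy .nil))

/-- The parity operators commute with a cochain of internal degree `r` up to the sign `(-1)^(v r)`.
-/
lemma par_apply_of_mem_HCdeg {i : ℤ × ℤ} {c : List A → A} (hc : c ∈ HCdeg 𝒜 i) (v : ℤ)
    (l : List A) : par 𝒜 v (c l) = sgn k (v * i.2) • c (l.map (par 𝒜 v)) := by
  obtain ⟨m, s, g⟩ := hc
  refine congrFun (IsML.ext_of_isHomList (V := A) 𝒜 (m.comp_linear (par 𝒜 v))
    ((m.comp_map (par 𝒜 v)).const_smul _) fun l n hl => ?_) l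
  have : c (l.map (par 𝒜 v)) = sgn k (v * n) • c l := by
    have key : ∀ (b a : List A) (n : ℤ), IsHomList 𝒜 b n →
        c (a ++ b.map (par 𝒜 v)) = sgn k (v * n) • c (a ++ b) := by
      intro b
      induction b with
      | nil => intro a n hb; cases hb; simp
      | cons x b ih =>
        intro a n hb
        cases hb with
        | @cons _ _ i n hx hb =>
          have := ih (a ++ [par 𝒜 v x]) n hb
          simp only [List.append_assoc, List.singleton_append] at this
          rw [List.map_cons, this, par_of_mem 𝒜 v hx, m.map_smul, smul_smul, ← sgn_add]
          congr 2
          ring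
    simpa using key l [] n hl
  rw [this, par_of_mem 𝒜 v (g l n hl), smul_smul, ← sgn_add]
  congr 2
  ring

end Parity

/-! ### Convolution and insertion -/

section Convolution

variable {k A : Type*} [Field k] [Ring A] [Algebra k A] (𝒜 : ℤ → Submodule k A) [GradedAlgebra 𝒜]
  {R : Type*} [Ring R] [Algebra k R] {V W : Type*} [AddCommGroup V] [Module k V]
  [AddCommGroup W] [Module k W]

/-- The convolution product `(f ⋆ g)(l) = ∑ ± f(a) g(b)` of functions on lists with values in an
algebra. The integer `t` is the internal degree of `g`; the integer `w` is the parity with which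
`f` passes the entries of `b`. -/
noncomputable def conv (w t : ℤ) (f g : List A → R) : List A → R :=
  splitSum fun a b => sgn k (w * b.length + t * a.length) • (f (a.map (par 𝒜 t)) * g b)

/-- The insertion of a cochain `c` of bidegree `i` in all places of a function `φ` on lists: this
is `φ{c}`, for functions with values in an arbitrary vector space. -/
noncomputable def ins (i : ℤ × ℤ) (c : List A → A) (φ : List A → V) : List A → V :=
  splitSum fun a => splitSum fun b e =>
    sgn k ((i.1 + i.2 - 1) * e.length + i.2 * a.length) • φ (a.map (par 𝒜 i.2) ++ c b :: e)

/-- Only the blocks `b` of length `j.1` contribute to `c₁{c₂}`; for these the sign in the definition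
of `braceHH` is the one in the definition of `ins`. -/
lemma braceHH_eq_ins {j : ℤ × ℤ} {c₁ c₂ : List A → A} (h₁ : IsML k c₁) (h₂ : c₂ ∈ HCdeg 𝒜 j) :
    braceHH 𝒜 j.2 c₁ c₂ = ins 𝒜 j c₂ c₁ := by
  funext l
  refine splitSum_congr fun a r _ => splitSum_congr fun b e _ => ?_
  by_cases hb : (b.length : ℤ) = j.1
  · rw [← hb]
    congr 2
    ring
  · rw [h₂.2.1 b hb, h₁.map_zero, smul_zero, smul_zero]

lemma cupHH_eq_conv (t : ℤ) (c₁ c₂ : List A → A) : cupHH 𝒜 t c₁ c₂ = conv 𝒜 0 t c₁ c₂ := by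
  funext l
  simp [cupHH, conv]

variable {𝒜}

lemma isML_conv {f g : List A → R} (hf : IsML k f) (hg : IsML k g) (w t : ℤ) :
    IsML k (conv 𝒜 w t f g) := by
  refine IsML.splitSum (fun b => ?_) fun a => ?_
  · exact ((hf.comp_map (par 𝒜 t)).mul_right (g b)).smul_length
      fun n => sgn k (w * b.length + t * n)
  · exact (hg.mul_left _).smul_length fun n => sgn k (w * n + t * a.length)

lemma isML_ins {c : List A → A} (hc : IsML k c) {φ : List A → V} (hφ : IsML k φ) (i : ℤ × ℤ) :
    IsML k (ins 𝒜 i c φ) := by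
  refine IsML.splitSum (fun r => IsML.splitSum_param _ fun b e => ?_) fun a =>
      IsML.splitSum (fun e => ?_) fun b => ?_
  · have : IsML k fun a => φ (a ++ c b :: e) := fun x y => by
      simpa using hφ x (y ++ c b :: e)
    exact (this.comp_map _).smul_length fun n => sgn k ((i.1 + i.2 - 1) * e.length + i.2 * n)
  · refine IsML.const_smul (f := fun b => φ (a.map (par 𝒜 i.2) ++ c b :: e)) (fun x y => ?_) _
    exact ((hφ (a.map (par 𝒜 i.2)) e).mk'.comp (hc x y).mk').isLinear
  · refine IsML.smul_length (c := fun e => φ (a.map (par 𝒜 i.2) ++ c b :: e)) (fun x y => ?_)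
      fun n => sgn k ((i.1 + i.2 - 1) * n + i.2 * a.length)
    simpa using hφ (a.map (par 𝒜 i.2) ++ c b :: x) y

lemma conv_assoc (w w' t t' : ℤ) (f g h : List A → R) :
    conv 𝒜 (w + w') t' (conv 𝒜 w t f g) h = conv 𝒜 w (t + t') f (conv 𝒜 w' t' g h) := by
  funext l
  simp only [conv, splitSum_map, splitSum_mul, mul_splitSum, smul_splitSum]
  rw [splitSum_assoc]
  refine splitSum_congr fun a r hr => splitSum_congr fun b e hb => ?_
  subst hb hr
  simp only [smul_mul_assoc, mul_smul_comm, smul_smul, ← sgn_add, map_par_map_par, mul_assoc]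
  congr 1
  refine sgn_congr ?_
  push_cast [List.length_append, List.length_map]
  grind

lemma conv_smul_right (w t : ℤ) (r : k) (f g : List A → R) :
    conv 𝒜 w t f (r • g) = r • conv 𝒜 w t f g := by
  funext l
  simp [conv, splitSum_smul', smul_comm _ r]

lemma conv_add_left (w t : ℤ) (f f' g : List A → R) :
    conv 𝒜 w t (f + f') g = conv 𝒜 w t f g + conv 𝒜 w t f' g := by
  funext l
  simp [conv, add_mul, splitSum_add']

lemma conv_add_right (w t : ℤ) (f g g' : List A → R) :
    conv 𝒜 w t f (g + g') = conv 𝒜 w t f g + conv 𝒜 w t f g' := by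
  funext l
  simp [conv, mul_add, splitSum_add']

lemma conv_zero_left (w t : ℤ) (g : List A → R) : conv 𝒜 w t 0 g = 0 := by
  funext l
  simp [conv, splitSum]

lemma conv_zero_right (w t : ℤ) (f : List A → R) : conv 𝒜 w t f 0 = 0 := by
  funext l
  simp [conv, splitSum]

/-- Convolution only depends on the parities of the degrees. -/
lemma conv_congr {w w' t t' : ℤ} (hw : (w : ZMod 2) = w') (ht : (t : ZMod 2) = t')
    (f g : List A → R) : conv 𝒜 w t f g = conv 𝒜 w' t' f g := by
  have : par 𝒜 t = par 𝒜 t' := linearMap_ext_of_mem 𝒜 fun n x hx => by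
    rw [par_of_mem 𝒜 t hx, par_of_mem 𝒜 t' hx, sgn_congr (n := t' * n) (by push_cast; rw [ht])]
  funext l
  rw [conv, this]
  refine splitSum_congr fun a b _ => ?_
  rw [sgn_congr (n := w' * b.length + t' * a.length) (by push_cast; rw [ht, hw])]

/-- If `f` is supported on lists of length `s`, the first parameter of the convolution with `f`
on the right only contributes a sign. -/
lemma conv_eq_smul_conv {s : ℤ} {g : List A → R} (hg : ∀ l : List A, (l.length : ℤ) ≠ s → g l = 0)
    (w t : ℤ) (f : List A → R) : conv 𝒜 w t f g = sgn k (w * s) • conv 𝒜 0 t f g := by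
  funext l
  rw [Pi.smul_apply, conv, conv, smul_splitSum]
  refine splitSum_congr fun a b _ => ?_
  by_cases hb : (b.length : ℤ) = s
  · rw [smul_smul, ← sgn_add, hb]
    congr 2
    ring
  · rw [hg b hb, mul_zero, smul_zero, smul_zero, smul_zero]

/-- Insertion is a twisted derivation of the convolution product. -/
theorem ins_conv {i : ℤ × ℤ} {c : List A → A} (hc : c ∈ HCdeg 𝒜 i) {f g : List A → R}
    (hf : IsML k f) (hg : IsML k g) (w t : ℤ) :
    ins 𝒜 i c (conv 𝒜 w t f g) =
      sgn k (w * (i.1 - 1)) • conv 𝒜 w (t + i.2) f (ins 𝒜 i c g) +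
      sgn k (t * (i.1 + i.2 - 1)) • conv 𝒜 (w + (i.1 + i.2 - 1)) t (ins 𝒜 i c f) g := by
  funext l
  simp only [ins, conv, splitSum_append_cons, smul_add, splitSum_add', Pi.add_apply, Pi.smul_apply,
    smul_splitSum, splitSum_map, mul_splitSum, splitSum_mul]
  congr 1
  -- `c` is inserted in the argument of `g`, after `f` has been passed
  · refine (splitSum_congr fun a s _ => splitSum_comm _ _ _).trans ?_
    rw [splitSum_assoc]
    refine splitSum_congr fun p r hr => splitSum_congr fun q s hs => splitSum_congr fun b e hb => ?_
    subst hb hs hr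
    by_cases hb : (b.length : ℤ) = i.1
    · simp only [mul_smul_comm, smul_smul, ← sgn_add, map_par_map_par]
      congr 1
      refine sgn_congr ?_
      rw [← hb]
      push_cast [List.length_append, List.length_map, List.length_cons]
      grind
    · simp only [hc.2.1 b hb, hg.map_zero, mul_zero, smul_zero]
  -- `c` is inserted in the argument of `f`
  · simp_rw [splitSum_assoc]
    refine splitSum_congr fun a r hr => splitSum_congr fun b s hs => splitSum_congr fun p q hp => ?_
    subst hp hs hr
    simp only [List.map_append, List.map_cons, par_apply_of_mem_HCdeg 𝒜 hc, map_par_map_par,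
      hf.map_smul, smul_mul_assoc, smul_smul, ← sgn_add, add_comm i.2 t]
    by_cases hb : (b.length : ℤ) = i.1
    · congr 1
      refine sgn_congr ?_
      rw [← hb]
      push_cast [List.length_append, List.length_map, List.length_cons]
      grind
    · rw [hc.2.1 (b.map _) (by simpa using hb), hf.map_zero, zero_mul, smul_zero, smul_zero]

end Convolution

/-! ### Simultaneous insertion of two cochains -/

section DoubleInsertion

variable {k A : Type*} [Field k] [Ring A] [Algebra k A] (𝒜 : ℤ → Submodule k A) [GradedAlgebra 𝒜]
  {R : Type*} [Ring R] [Algebra k R] {V W : Type*} [AddCommGroup V] [Module k V]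
  [AddCommGroup W] [Module k W]

/-- The simultaneous insertion of `c` and `c'`, of bidegrees `i` and `j`, in a function `φ` on
lists, with `c` to the left of `c'`. Up to a sign, this is the brace `φ{c, c'}`. -/
noncomputable def ins₂ (i j : ℤ × ℤ) (c c' : List A → A) (φ : List A → V) : List A → V :=
  splitSum fun a => splitSum fun b r =>
    sgn k ((i.1 + i.2 - 1) * r.length + (i.2 + j.2) * a.length + j.2 * b.length) •
      ins 𝒜 j c' (fun q => φ (a.map (par 𝒜 (i.2 + j.2)) ++ c (b.map (par 𝒜 j.2)) :: q)) r

variable {𝒜}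

lemma ins_add_right (i : ℤ × ℤ) (c : List A → A) (φ ψ : List A → V) :
    ins 𝒜 i c (φ + ψ) = ins 𝒜 i c φ + ins 𝒜 i c ψ := by
  funext l
  simp [ins, splitSum_add']

lemma ins_smul_right (i : ℤ × ℤ) (c : List A → A) (r : k) (φ : List A → V) :
    ins 𝒜 i c (r • φ) = r • ins 𝒜 i c φ := by
  funext l
  simp [ins, splitSum_smul', smul_comm _ r]

lemma ins_comp_linear (i : ℤ × ℤ) (c : List A → A) (φ : List A → V) (g : V →ₗ[k] W) :
    ins 𝒜 i c (fun l => g (φ l)) = fun l => g (ins 𝒜 i c φ l) := by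
  funext l
  simp [ins, map_splitSum]

lemma ins₂_add_right (i j : ℤ × ℤ) (c c' : List A → A) (φ ψ : List A → V) :
    ins₂ 𝒜 i j c c' (φ + ψ) = ins₂ 𝒜 i j c c' φ + ins₂ 𝒜 i j c c' ψ := by
  funext l
  simp [ins₂, ins, splitSum_add', splitSum_add]

lemma ins₂_smul_right (i j : ℤ × ℤ) (c c' : List A → A) (r : k) (φ : List A → V) :
    ins₂ 𝒜 i j c c' (r • φ) = r • ins₂ 𝒜 i j c c' φ := by
  funext l
  simp [ins₂, ins, splitSum_smul', smul_comm _ r]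

lemma ins₂_comp_linear (i j : ℤ × ℤ) (c c' : List A → A) (φ : List A → V) (g : V →ₗ[k] W) :
    ins₂ 𝒜 i j c c' (fun l => g (φ l)) = fun l => g (ins₂ 𝒜 i j c c' φ l) := by
  funext l
  simp [ins₂, ins, map_splitSum]

lemma ins_splitSum (i : ℤ × ℤ) (c : List A → A) {B : Type*} (F : List B → List B → List A → V)
    (l : List B) (r : List A) :
    ins 𝒜 i c (fun q => splitSum (fun a b => F a b q) l) r =
      splitSum (fun a b => ins 𝒜 i c (F a b) r) l := by
  have : (fun q => splitSum (fun a b => F a b q) l) =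
      ∑ n ∈ Finset.range (l.length + 1), F (l.take n) (l.drop n) := by
    funext q
    simp [splitSum]
  rw [this, splitSum]
  generalize Finset.range (l.length + 1) = s
  induction s using Finset.cons_induction with
  | empty => simp [ins, splitSum]
  | cons n s hn ih => rw [Finset.sum_cons, Finset.sum_cons, ins_add_right, Pi.add_apply, ih]

/-- Inserting a cochain of arity `i.1` changes lengths by `i.1 - 1`. -/
lemma ins_smul_length {i : ℤ × ℤ} {c : List A → A} (hc : c ∈ HCdeg 𝒜 i) {φ : List A → V}
    (hφ : IsML k φ) (w : ℤ) (l : List A) :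
    ins 𝒜 i c (fun q => sgn k (w * q.length) • φ q) l =
      sgn k (w * (i.1 - 1)) • sgn k (w * l.length) • ins 𝒜 i c φ l := by
  simp only [ins, smul_splitSum]
  refine splitSum_congr fun a r hr => splitSum_congr fun b e hb => ?_
  subst hb hr
  by_cases hb : (b.length : ℤ) = i.1
  · simp only [smul_smul, ← sgn_add]
    congr 1
    refine sgn_congr ?_
    rw [← hb]
    push_cast [List.length_append, List.length_map, List.length_cons]
    grind
  · simp only [hc.2.1 b hb, hφ.map_zero, smul_zero]

lemma isML_ins₂ {c c' : List A → A} (hc : IsML k c) (hc' : IsML k c') {φ : List A → V}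
    (hφ : IsML k φ) (i j : ℤ × ℤ) : IsML k (ins₂ 𝒜 i j c c' φ) := by
  have h1 (p : List A) (x : A) : IsML k fun q => φ (p ++ x :: q) := by
    simpa using hφ.translate (p ++ [x])
  have h2 (b : List A) (r : List A) : IsML k fun a =>
      ins 𝒜 j c' (fun q => φ (a ++ c b :: q)) r := by
    intro x y
    simp only [ins]
    refine IsLinearMap.splitSum _ fun _ _ => IsLinearMap.splitSum _ fun _ _ =>
      IsLinearMap.csmul _ ?_
    simpa using hφ x _
  have h3 (a : List A) (r : List A) : IsML k fun b =>
      ins 𝒜 j c' (fun q => φ (a ++ c b :: q)) r := by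
    intro x y
    simp only [ins]
    refine IsLinearMap.splitSum _ fun _ _ => IsLinearMap.splitSum _ fun _ _ =>
      IsLinearMap.csmul _ ?_
    exact ((hφ a _).mk'.comp (hc x y).mk').isLinear
  refine IsML.splitSum (fun r => IsML.splitSum_param _ fun b e => ?_) fun a =>
      IsML.splitSum (fun e => ?_) fun b => ?_
  · exact ((h2 (b.map (par 𝒜 j.2)) e).comp_map _).smul_length
      fun n => sgn k ((i.1 + i.2 - 1) * e.length + (i.2 + j.2) * n + j.2 * b.length)
  · exact ((h3 (a.map (par 𝒜 (i.2 + j.2))) e).comp_map _).smul_length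
      fun n => sgn k ((i.1 + i.2 - 1) * e.length + (i.2 + j.2) * a.length + j.2 * n)
  · exact (isML_ins hc' (h1 _ _) j).smul_length
      fun n => sgn k ((i.1 + i.2 - 1) * n + (i.2 + j.2) * a.length + j.2 * b.length)

/-- The convolution on a list with a distinguished entry `x`, which becomes an argument either of
`g` or of `f`. -/
lemma conv_append_cons (w t : ℤ) (f g : List A → R) (p : List A) (x : A) (r : List A) :
    conv 𝒜 w t f g (p ++ x :: r) =
      splitSum (fun p₁ p₂ => sgn k (w * (p₂.length + 1) + t * p₁.length) •
        (f (p₁.map (par 𝒜 t)) * sgn k (w * r.length) • g (p₂ ++ x :: r))) p +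
      sgn k (t * (p.length + 1)) •
        conv 𝒜 w t (fun q => f (p.map (par 𝒜 t) ++ par 𝒜 t x :: q)) g r := by
  simp only [conv, splitSum_append_cons, smul_splitSum]
  congr 1
  · refine splitSum_congr fun a b hb => ?_
    subst hb
    rw [mul_smul_comm, smul_smul, ← sgn_add]
    congr 2
    push_cast [List.length_append, List.length_cons]
    ring
  · refine splitSum_congr fun a b hb => ?_
    subst hb
    rw [smul_smul, ← sgn_add]
    congr 2
    · push_cast [List.length_append, List.length_cons]
      ring
    · simp

/-- Simultaneous insertion of two cochains is a twisted second order derivation of the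
convolution product. -/
theorem ins₂_conv {i j : ℤ × ℤ} {c c' : List A → A} (hc : c ∈ HCdeg 𝒜 i) (hc' : c' ∈ HCdeg 𝒜 j)
    {f g : List A → R} (hf : IsML k f) (hg : IsML k g) (w t : ℤ) :
    ins₂ 𝒜 i j c c' (conv 𝒜 w t f g) =
      sgn k (w * (i.1 - 1 + (j.1 - 1))) • conv 𝒜 w (t + (i.2 + j.2)) f (ins₂ 𝒜 i j c c' g) +
      sgn k (t * (i.1 + i.2 - 1) + w * (j.1 - 1)) •
        conv 𝒜 (w + (i.1 + i.2 - 1)) (t + j.2) (ins 𝒜 i c f) (ins 𝒜 j c' g) +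
      sgn k (t * (i.1 + i.2 - 1 + (j.1 + j.2 - 1))) •
        conv 𝒜 (w + (i.1 + i.2 - 1) + (j.1 + j.2 - 1)) t (ins₂ 𝒜 i j c c' f) g := by
  have hg' (p : List A) (x : A) : IsML k fun q => g (p ++ x :: q) := by
    simpa using hg.translate (p ++ [x])
  have hf' (p : List A) (x : A) : IsML k fun q => f (p ++ x :: q) := by
    simpa using hf.translate (p ++ [x])
  -- the insertion of `c'` to the right of the entry `x`, which is the value of `c` below
  have key (p : List A) (x : A) (r : List A) :
      ins 𝒜 j c' (fun q => conv 𝒜 w t f g (p ++ x :: q)) r =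
        splitSum (fun p₁ p₂ => sgn k (w * (p₂.length + 1) + t * p₁.length + w * (j.1 - 1) +
          w * r.length) •
          (f (p₁.map (par 𝒜 t)) * ins 𝒜 j c' (fun q => g (p₂ ++ x :: q)) r)) p +
        sgn k (t * (p.length + 1) + w * (j.1 - 1)) • conv 𝒜 w (t + j.2)
          (fun q => f (p.map (par 𝒜 t) ++ par 𝒜 t x :: q)) (ins 𝒜 j c' g) r +
        sgn k (t * (p.length + 1) + t * (j.1 + j.2 - 1)) • conv 𝒜 (w + (j.1 + j.2 - 1)) t
          (ins 𝒜 j c' (fun q => f (p.map (par 𝒜 t) ++ par 𝒜 t x :: q))) g r := by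
    have e1 : (fun q => conv 𝒜 w t f g (p ++ x :: q)) = (fun q => splitSum (fun p₁ p₂ =>
        sgn k (w * (p₂.length + 1) + t * p₁.length) •
        (f (p₁.map (par 𝒜 t)) * sgn k (w * q.length) • g (p₂ ++ x :: q))) p) +
        sgn k (t * (p.length + 1)) •
        conv 𝒜 w t (fun q => f (p.map (par 𝒜 t) ++ par 𝒜 t x :: q)) g := by
      funext q
      rw [conv_append_cons]
      rfl
    rw [e1, ins_add_right, ins_smul_right, ins_conv hc' (hf' _ _) hg, smul_add, smul_smul,
      smul_smul, ← sgn_add, ← sgn_add, ← add_assoc, Pi.add_apply, Pi.add_apply, ins_splitSum]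
    refine congrArg₂ _ (congrArg₂ _ (splitSum_congr fun a b _ => ?_) rfl) rfl
    have := ins_comp_linear (𝒜 := 𝒜) j c' (fun q => sgn k (w * q.length) • g (b ++ x :: q))
      (sgn k (w * (b.length + 1) + t * a.length) • LinearMap.mulLeft k (f (a.map (par 𝒜 t))))
    simp only [LinearMap.smul_apply, LinearMap.mulLeft_apply] at this
    rw [this]
    simp only [ins_smul_length hc' (hg' b x), mul_smul_comm, smul_smul, ← sgn_add, add_assoc]
  funext l
  simp only [ins₂, key, smul_add, splitSum_add', Pi.add_apply, Pi.smul_apply]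
  congr 1
  congr 1
  -- both cochains are inserted in the argument of `g`
  · simp only [conv, smul_splitSum, splitSum_map, mul_splitSum]
    refine (splitSum_congr fun a s _ => splitSum_comm _ _ _).trans ?_
    rw [splitSum_assoc]
    refine splitSum_congr fun p r hr => splitSum_congr fun q s hs => splitSum_congr fun b e hb => ?_
    subst hb hs hr
    by_cases hb : (b.length : ℤ) = i.1
    · simp only [mul_smul_comm, smul_smul, ← sgn_add, map_par_map_par]
      congr 1
      refine sgn_congr ?_
      rw [← hb]
      push_cast [List.length_append, List.length_map, List.length_cons]
      grind
    · have : ins 𝒜 j c' (fun r => g (q.map (par 𝒜 (i.2 + j.2)) ++ 0 :: r)) e = 0 := by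
        simp only [hg.map_zero]
        simp [ins, splitSum]
      simp only [hc.2.1 (b.map _) (by simpa using hb), this, mul_zero, smul_zero]
  -- `c` is inserted in the argument of `f` and `c'` in that of `g`
  · have e (L : List A) : ins 𝒜 i c f L = splitSum (fun a => splitSum fun b e =>
        sgn k ((i.1 + i.2 - 1) * e.length + i.2 * a.length) •
          f (a.map (par 𝒜 i.2) ++ c b :: e)) L := rfl
    simp only [conv, e, smul_splitSum, splitSum_mul, splitSum_map]
    simp_rw [splitSum_assoc]
    refine splitSum_congr fun a r hr => splitSum_congr fun b s hs => splitSum_congr fun p q hp => ?_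
    subst hp hs hr
    have e1 : i.2 + (t + j.2) = t + (i.2 + j.2) := by ring
    simp only [par_apply_of_mem_HCdeg 𝒜 hc, map_par_map_par, hf.map_smul, smul_mul_assoc, smul_smul,
      ← sgn_add, e1]
    by_cases hb : (b.length : ℤ) = i.1
    · congr 1
      refine sgn_congr ?_
      rw [← hb]
      push_cast [List.length_append, List.length_map, List.length_cons]
      grind
    · rw [hc.2.1 (b.map _) (by simpa using hb), hf.map_zero, zero_mul, smul_zero, smul_zero]
  -- both cochains are inserted in the argument of `f`
  · simp only [conv, smul_splitSum, splitSum_mul, splitSum_map]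
    simp_rw [splitSum_assoc]
    refine splitSum_congr fun a r hr => splitSum_congr fun b s hs => splitSum_congr fun p q hp => ?_
    subst hp hs hr
    have e1 (p : List A) (r : k) (x : A) (l : List A) :
        ins 𝒜 j c' (fun q => f (p ++ r • x :: q)) l =
          r • ins 𝒜 j c' (fun q => f (p ++ x :: q)) l := by
      have : (fun q => f (p ++ r • x :: q)) = r • fun q => f (p ++ x :: q) :=
        funext fun q => hf.map_smul _ _ _ _
      rw [this, ins_smul_right, Pi.smul_apply]
    simp only [par_apply_of_mem_HCdeg 𝒜 hc, map_par_map_par, e1, smul_mul_assoc, smul_smul,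
      ← sgn_add, add_comm t]
    by_cases hb : (b.length : ℤ) = i.1
    · congr 1
      refine sgn_congr ?_
      rw [← hb]
      push_cast [List.length_append, List.length_map, List.length_cons]
      grind
    · have (P L : List A) : ins 𝒜 j c' (fun r => f (P ++ 0 :: r)) L = 0 := by
        simp only [hf.map_zero]
        simp [ins, splitSum]
      rw [hc.2.1 (b.map _) (by simpa using hb), this, zero_mul, smul_zero, smul_zero]

end DoubleInsertion

/-! ### The brace identities -/

section BraceIdentities

variable {k A : Type*} [Field k] [Ring A] [Algebra k A] {𝒜 : ℤ → Submodule k A} [GradedAlgebra 𝒜]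
  {R : Type*} [Ring R] [Algebra k R]

/-- The product of the images under `η` of the entries of a list. -/
def letters (η : A →ₗ[k] R) (l : List A) : R := (l.map η).prod

lemma isML_letters (η : A →ₗ[k] R) : IsML k (letters η) := by
  intro a b
  constructor
  · intro x y; simp [letters, mul_add, add_mul]
  · intro r x; simp [letters]

lemma letters_append_cons (η : A →ₗ[k] R) (a : List A) (x : A) (b : List A) :
    letters η (a ++ x :: b) = letters η a * (η x * letters η b) := by
  simp [letters]

/-- The insertion of `c` in a product of letters is the product of the letters before `c`, the value
of `c` and the letters after it. -/
lemma ins_letters (i : ℤ × ℤ) (c : List A → A) (η : A →ₗ[k] R) :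
    ins 𝒜 i c (letters η) = conv 𝒜 0 i.2 (letters η)
      (conv 𝒜 (i.1 + i.2 - 1) 0 (fun l => η (c l)) (letters η)) := by
  funext l
  simp only [ins, conv, mul_splitSum, smul_splitSum]
  refine splitSum_congr fun a r hr => splitSum_congr fun b e hb => ?_
  rw [letters_append_cons, mul_smul_comm, smul_smul, ← sgn_add, map_par_zero]
  congr 2
  ring

/-- The simultaneous insertion of `c` and `c'` in a product of letters is the product of the letters
before `c`, the value of `c` and the insertion of `c'` in the remaining letters. -/
lemma ins₂_letters (i j : ℤ × ℤ) (c c' : List A → A) (η : A →ₗ[k] R) :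
    ins₂ 𝒜 i j c c' (letters η) = conv 𝒜 0 (i.2 + j.2) (letters η)
      (conv 𝒜 (i.1 + i.2 - 1) j.2 (fun l => η (c l)) (ins 𝒜 j c' (letters η))) := by
  funext l
  simp only [ins₂, conv, mul_splitSum, smul_splitSum]
  refine splitSum_congr fun a r hr => splitSum_congr fun b e hb => ?_
  have := ins_comp_linear (𝒜 := 𝒜) j c' (letters η) (LinearMap.mulLeft k
    (letters η (a.map (par 𝒜 (i.2 + j.2))) * η (c (b.map (par 𝒜 j.2)))))
  simp only [LinearMap.mulLeft_apply, mul_assoc] at this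
  simp only [letters_append_cons]
  rw [this, mul_smul_comm, smul_smul, ← sgn_add]
  congr 2
  ring

/-- `conv_assoc`, up to the parities of the parameters. -/
lemma conv_assoc' {v w w' t t' s : ℤ} (hv : (v : ZMod 2) = w + w') (hs : (s : ZMod 2) = t + t')
    (f g h : List A → R) :
    conv 𝒜 v t' (conv 𝒜 w t f g) h = conv 𝒜 w s f (conv 𝒜 w' t' g h) := by
  rw [conv_congr (w' := w + w') (t' := t') (by rw [hv]; push_cast; rfl) rfl, conv_assoc]
  exact conv_congr rfl (by rw [hs]; push_cast; rfl) _ _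

/-- The generating case of the pre-Lie identity, from which the general case follows by
functoriality in the values. -/
lemma ins_ins_letters {i j : ℤ × ℤ} {y z : List A → A} (hy : y ∈ HCdeg 𝒜 i) (hz : z ∈ HCdeg 𝒜 j)
    (η : A →ₗ[k] R) :
    ins 𝒜 j z (ins 𝒜 i y (letters η)) =
      ins 𝒜 (i + j - (1, 0)) (ins 𝒜 j z y) (letters η) +
      sgn k ((i.1 + i.2 - 1) * (j.1 - 1)) • ins₂ 𝒜 i j y z (letters η) +
      sgn k (i.2 * (j.1 + j.2 - 1)) • ins₂ 𝒜 j i z y (letters η) := by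
  have hI : IsML k (letters η) := isML_letters η
  have hY : IsML k fun l => η (y l) := hy.1.comp_linear η
  rw [ins_letters, ins_conv hz hI (isML_conv hY hI _ _), ins_conv hz hY hI, ins_letters,
    ins₂_letters, ins₂_letters, ins_letters i y, ← ins_letters j z, ins_comp_linear]
  simp only [zero_mul, sgn_zero, one_smul, zero_add, conv_add_right, conv_smul_right]
  have e1 : conv 𝒜 (j.1 + j.2 - 1) i.2 (ins 𝒜 j z (letters η))
      (conv 𝒜 (i.1 + i.2 - 1) 0 (fun l => η (y l)) (letters η)) =
      conv 𝒜 0 (j.2 + i.2) (letters η) (conv 𝒜 (j.1 + j.2 - 1) i.2 (fun l => η (z l))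
        (conv 𝒜 0 i.2 (letters η)
          (conv 𝒜 (i.1 + i.2 - 1) 0 (fun l => η (y l)) (letters η)))) := by
    rw [ins_letters, conv_assoc' (w' := j.1 + j.2 - 1) (s := j.2 + i.2) (by simp) (by simp),
      conv_assoc' (w' := 0) (s := i.2) (by simp) (by simp)]
  have e2 : ins 𝒜 (i + j - (1, 0)) (ins 𝒜 j z y) (letters η) = conv 𝒜 0 (i.2 + j.2) (letters η)
      (conv 𝒜 (i.1 + i.2 - 1 + (j.1 + j.2 - 1)) 0 (fun l => η (ins 𝒜 j z y l)) (letters η)) := by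
    have e : i + j - (1, 0) = (i.1 + j.1 - 1, i.2 + j.2) := by ext <;> simp
    rw [e, ins_letters]
    exact congrArg _ (conv_congr (by push_cast; ring) rfl _ _)
  rw [e1, e2]
  module

/-- Interchange of the insertion of a single cochain `m` of bidegree `(2, 0)` with the simultaneous
insertion of two cochains, in the generating case. -/
lemma ins₂_ins_letters {i j : ℤ × ℤ} {m y z : List A → A} (hm : m ∈ HCdeg 𝒜 (2, 0))
    (hy : y ∈ HCdeg 𝒜 i) (hz : z ∈ HCdeg 𝒜 j) (η : A →ₗ[k] R) :
    ins₂ 𝒜 i j y z (ins 𝒜 (2, 0) m (letters η)) =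
      sgn k (i.1 + i.2 - 1 + (j.1 + j.2 - 1)) • ins 𝒜 (2, 0) m (ins₂ 𝒜 i j y z (letters η)) +
      ins 𝒜 (i + j) (ins₂ 𝒜 i j y z m) (letters η) +
      sgn k (j.1 - 1) • ins₂ 𝒜 (i + (1, 0)) j (ins 𝒜 i y m) z (letters η) +
      ins₂ 𝒜 i (j + (1, 0)) y (ins 𝒜 j z m) (letters η) -
      sgn k (i.1 + i.2 - 1 + (j.1 + j.2 - 1) + j.2) •
        ins₂ 𝒜 (i + (1, 0)) j (ins 𝒜 (2, 0) m y) z (letters η) -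
      sgn k (j.1 + j.2 - 1) • ins₂ 𝒜 i (j + (1, 0)) y (ins 𝒜 (2, 0) m z) (letters η) := by
  have hI : IsML k (letters η) := isML_letters η
  have hY : IsML k fun l => η (y l) := hy.1.comp_linear η
  have hZ : IsML k fun l => η (z l) := hz.1.comp_linear η
  have hM : IsML k fun l => η (m l) := hm.1.comp_linear η
  have hZI := isML_ins (𝒜 := 𝒜) hz.1 hI j
  -- a product that starts with the insertion of `y` in letters, bracketed to the right
  have star {i : ℤ × ℤ} (y : List A → A) (v t : ℤ) (hv : (v : ZMod 2) = i.1 + i.2 - 1)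
      (H : List A → R) : conv 𝒜 v t (ins 𝒜 i y (letters η)) H = conv 𝒜 0 (i.2 + t) (letters η)
        (conv 𝒜 (i.1 + i.2 - 1) t (fun l => η (y l)) (conv 𝒜 0 t (letters η) H)) := by
    rw [ins_letters, conv_assoc' (w' := i.1 + i.2 - 1) (s := i.2 + t) (by simp [hv]) (by simp),
      conv_assoc' (w' := 0) (s := t) (by simp) (by simp)]
  -- the six terms of the left hand side
  have l1 : ins₂ 𝒜 i j y z (ins 𝒜 (2, 0) m (letters η)) =
      conv 𝒜 0 (i.2 + j.2) (letters η)
        (sgn k (i.1 - 1 + (j.1 - 1)) • conv 𝒜 1 (i.2 + j.2) (fun l => η (m l))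
          (ins₂ 𝒜 i j y z (letters η)) +
        sgn k (j.1 - 1) • conv 𝒜 (1 + (i.1 + i.2 - 1)) j.2 (fun l => η (ins 𝒜 i y m l))
          (ins 𝒜 j z (letters η)) +
        conv 𝒜 (1 + (i.1 + i.2 - 1) + (j.1 + j.2 - 1)) 0 (fun l => η (ins₂ 𝒜 i j y z m l))
          (letters η)) +
      conv 𝒜 (i.1 + i.2 - 1) j.2 (ins 𝒜 i y (letters η))
        (sgn k (j.1 - 1) • conv 𝒜 1 j.2 (fun l => η (m l)) (ins 𝒜 j z (letters η)) +
        conv 𝒜 (1 + (j.1 + j.2 - 1)) 0 (fun l => η (ins 𝒜 j z m l)) (letters η)) +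
      conv 𝒜 (i.1 + i.2 - 1 + (j.1 + j.2 - 1)) 0 (ins₂ 𝒜 i j y z (letters η))
        (conv 𝒜 1 0 (fun l => η (m l)) (letters η)) := by
    rw [ins_letters, ins₂_conv hy hz hI (isML_conv hM hI _ _), ins_conv hz hM hI,
      ins₂_conv hy hz hM hI, ins_comp_linear, ins_comp_linear, ins₂_comp_linear]
    norm_num
  -- the five terms of `(x{y, z}){m}`
  have l2 : ins 𝒜 (2, 0) m (ins₂ 𝒜 i j y z (letters η)) =
      conv 𝒜 0 (i.2 + j.2) (letters η)
        (sgn k (i.1 + i.2 - 1) • conv 𝒜 (i.1 + i.2 - 1) j.2 (fun l => η (y l))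
          (conv 𝒜 0 j.2 (letters η) (sgn k (j.1 + j.2 - 1) • conv 𝒜 (j.1 + j.2 - 1) 0
              (fun l => η (z l)) (ins 𝒜 (2, 0) m (letters η)) +
            conv 𝒜 (j.1 + j.2 - 1 + 1) 0 (fun l => η (ins 𝒜 (2, 0) m z l)) (letters η)) +
          sgn k j.2 • conv 𝒜 1 j.2 (ins 𝒜 (2, 0) m (letters η))
            (conv 𝒜 (j.1 + j.2 - 1) 0 (fun l => η (z l)) (letters η))) +
        sgn k j.2 • conv 𝒜 (i.1 + i.2 - 1 + 1) j.2 (fun l => η (ins 𝒜 (2, 0) m y l))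
          (ins 𝒜 j z (letters η))) +
      sgn k (i.2 + j.2) • conv 𝒜 1 (i.2 + j.2) (ins 𝒜 (2, 0) m (letters η))
        (conv 𝒜 (i.1 + i.2 - 1) j.2 (fun l => η (y l)) (ins 𝒜 j z (letters η))) := by
    rw [ins₂_letters, ins_conv hm hI (isML_conv hY hZI _ _), ins_conv hm hY hZI,
      ins_letters j, ins_conv hm hI (isML_conv hZ hI _ _), ins_conv hm hZ hI, ins_comp_linear,
      ins_comp_linear]
    norm_num
  have r1 : ins 𝒜 (i + j) (ins₂ 𝒜 i j y z m) (letters η) = conv 𝒜 0 (i.2 + j.2) (letters η)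
      (conv 𝒜 (1 + (i.1 + i.2 - 1) + (j.1 + j.2 - 1)) 0 (fun l => η (ins₂ 𝒜 i j y z m l))
        (letters η)) := by
    rw [ins_letters]
    exact congrArg _ (conv_congr (by push_cast [Prod.fst_add, Prod.snd_add]; grind) rfl _ _)
  have r2 (x : List A → A) : ins₂ 𝒜 (i + (1, 0)) j x z (letters η) =
      conv 𝒜 0 (i.2 + j.2) (letters η) (conv 𝒜 (1 + (i.1 + i.2 - 1)) j.2 (fun l => η (x l))
        (ins 𝒜 j z (letters η))) := by
    rw [ins₂_letters, Prod.snd_add, add_zero]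
    exact congrArg _ (conv_congr (by push_cast [Prod.fst_add]; ring) rfl _ _)
  have r3 (x : List A → A) : ins₂ 𝒜 i (j + (1, 0)) y x (letters η) =
      conv 𝒜 0 (i.2 + j.2) (letters η) (conv 𝒜 (i.1 + i.2 - 1) j.2 (fun l => η (y l))
        (conv 𝒜 0 j.2 (letters η) (conv 𝒜 (1 + (j.1 + j.2 - 1)) 0 (fun l => η (x l))
          (letters η)))) := by
    rw [ins₂_letters, ins_letters, Prod.snd_add, add_zero]
    exact congrArg _ (congrArg _ (congrArg _
      (conv_congr (by push_cast [Prod.fst_add]; ring) rfl _ _)))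
  have x6 : conv 𝒜 (i.1 + i.2 - 1 + (j.1 + j.2 - 1)) 0 (ins₂ 𝒜 i j y z (letters η))
      (conv 𝒜 1 0 (fun l => η (m l)) (letters η)) =
      conv 𝒜 0 (i.2 + j.2) (letters η) (conv 𝒜 (i.1 + i.2 - 1) j.2 (fun l => η (y l))
        (conv 𝒜 0 j.2 (letters η) (conv 𝒜 (j.1 + j.2 - 1) 0 (fun l => η (z l))
          (ins 𝒜 (2, 0) m (letters η))))) := by
    rw [ins₂_letters, conv_assoc' (w' := i.1 + i.2 - 1 + (j.1 + j.2 - 1)) (s := i.2 + j.2)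
      (by simp) (by simp), conv_assoc' (w' := j.1 + j.2 - 1) (s := j.2) (by push_cast; ring)
      (by simp), star z _ _ (by simp), ins_letters (2, 0)]
    norm_num
  rw [l1, l2, star y _ _ (by simp), star m 1 j.2 (by norm_num), star m 1 (i.2 + j.2) (by norm_num),
    r1, r2, r2, r3, r3, x6, ← ins_letters j z, zero_add, zero_add, ← ins₂_letters i j,
    add_comm (j.1 + j.2 - 1) 1, add_comm (i.1 + i.2 - 1) 1]
  norm_num only [conv_add_right, conv_smul_right]
  -- the signs only depend on the parities of the four degrees
  rcases sgn_eq_or (k := k) i.1 with h1 | h1 <;> rcases sgn_eq_or (k := k) i.2 with h2 | h2 <;>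
  rcases sgn_eq_or (k := k) j.1 with h3 | h3 <;> rcases sgn_eq_or (k := k) j.2 with h4 | h4 <;>
  simp only [sgn_add, sgn_sub, sgn_one, h1, h2, h3, h4] <;> module

end BraceIdentities

/-! ### Reduction to products of letters -/

section Translations

variable (k A V : Type*) [Field k] [Ring A] [Algebra k A] [AddCommGroup V] [Module k V]

/-- The space of multilinear functions on lists. -/
def MLFun : Submodule k (List A → V) where
  carrier := {f | IsML k f}
  add_mem' := IsML.add
  zero_mem' := fun _ _ => ⟨by simp, by simp⟩
  smul_mem' r _ h := IsML.const_smul h r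

/-- The opposite of the algebra of endomorphisms of the space of multilinear functions. -/
def TranslationAlgebra : Type _ := (Module.End k (MLFun k A V))ᵐᵒᵖ

noncomputable instance : Ring (TranslationAlgebra k A V) :=
  MulOpposite.instRing (R := Module.End k (MLFun k A V))

noncomputable instance : Algebra k (TranslationAlgebra k A V) :=
  MulOpposite.instAlgebra (A := Module.End k (MLFun k A V))

variable {k A V} in
/-- The operator `f ↦ f (x, -)` on multilinear functions, as an element of the opposite of the
endomorphism algebra, so that it is multiplicative in the order of concatenation. -/
def leftTranslate : A →ₗ[k] TranslationAlgebra k A V where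
  toFun x := MulOpposite.op
    { toFun := fun f => ⟨fun l => f.1 (x :: l), f.2.translate [x]⟩
      map_add' := fun _ _ => rfl
      map_smul' := fun _ _ => rfl }
  map_add' x y := by
    refine MulOpposite.unop_injective (LinearMap.ext fun f => Subtype.ext (funext fun l => ?_))
    exact (f.2 [] l).map_add x y
  map_smul' r x := by
    refine MulOpposite.unop_injective (LinearMap.ext fun f => Subtype.ext (funext fun l => ?_))
    exact (f.2 [] l).map_smul r x

variable {k A V}

variable (k A V) in
/-- The value on the empty list of the image of a given function under an operator. -/
def evalNil (φ : MLFun k A V) : TranslationAlgebra k A V →ₗ[k] V where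
  toFun T := (MulOpposite.unop (α := Module.End k (MLFun k A V)) T φ).1 []
  map_add' _ _ := rfl
  map_smul' _ _ := rfl

/-- A multilinear function is the value on the empty list of its successive translates. -/
lemma evalNil_letters (φ : MLFun k A V) (l : List A) :
    evalNil k A V φ (letters leftTranslate l) = φ.1 l := by
  suffices ∀ (φ : MLFun k A V) (r : List A), (MulOpposite.unop (α := Module.End k (MLFun k A V))
      (letters (leftTranslate (k := k) (V := V)) l) φ).1 r = φ.1 (l ++ r) by
    have h := this φ []
    rw [List.append_nil] at h
    exact h
  induction l with
  | nil => exact fun φ r => rfl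
  | cons x l ih =>
    intro φ r
    have : letters (leftTranslate (k := k) (V := V)) (x :: l) =
        leftTranslate x * letters leftTranslate l := by simp [letters]
    exact (congrArg (fun T : TranslationAlgebra k A V =>
      (MulOpposite.unop (α := Module.End k (MLFun k A V)) T φ).1 r) this).trans (ih _ r)

universe u v in
/-- Every multilinear function factors through `letters`, for a suitable algebra: this reduces
identities of insertions to the case of `letters`. -/
lemma IsML.exists_eq_comp_letters {k : Type*} {A : Type u} {V : Type v} [Field k] [Ring A]
    [Algebra k A] [AddCommGroup V] [Module k V] {φ : List A → V} (hφ : IsML k φ) :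
    ∃ (R : Type (max u v)) (_ : Ring R) (_ : Algebra k R) (η : A →ₗ[k] R) (E : R →ₗ[k] V),
      φ = fun l => E (letters η l) :=
  ⟨TranslationAlgebra k A V, inferInstance, inferInstance, leftTranslate, evalNil k A V ⟨φ, hφ⟩,
    funext fun l => (evalNil_letters ⟨φ, hφ⟩ l).symm⟩

end Translations

/-! ### Insertions, the identity cochain and the differential -/

section FunctionIdentities

variable {k A : Type*} [Field k] [Ring A] [Algebra k A] {𝒜 : ℤ → Submodule k A} [GradedAlgebra 𝒜]
  {V : Type*} [AddCommGroup V] [Module k V]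

/-- The graded pre-Lie identity, with the two double insertions made explicit. -/
theorem ins_ins {i j : ℤ × ℤ} {y z : List A → A} (hy : y ∈ HCdeg 𝒜 i) (hz : z ∈ HCdeg 𝒜 j)
    {φ : List A → V} (hφ : IsML k φ) :
    ins 𝒜 j z (ins 𝒜 i y φ) =
      ins 𝒜 (i + j - (1, 0)) (ins 𝒜 j z y) φ +
      sgn k ((i.1 + i.2 - 1) * (j.1 - 1)) • ins₂ 𝒜 i j y z φ +
      sgn k (i.2 * (j.1 + j.2 - 1)) • ins₂ 𝒜 j i z y φ := by
  obtain ⟨R, _, _, η, E, rfl⟩ := hφ.exists_eq_comp_letters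
  have h := ins_ins_letters hy hz η
  rw [ins_comp_linear i y _ E, ins_comp_linear j z _ E, ins_comp_linear _ _ _ E,
    ins₂_comp_linear _ _ _ _ _ E, ins₂_comp_linear _ _ _ _ _ E, h]
  funext l
  simp only [Pi.add_apply, Pi.smul_apply, map_add, map_smul]

/-- Interchange of the insertion of a single cochain `m` of bidegree `(2, 0)` with the simultaneous
insertion of two cochains. -/
theorem ins₂_ins {i j : ℤ × ℤ} {m y z : List A → A} (hm : m ∈ HCdeg 𝒜 (2, 0))
    (hy : y ∈ HCdeg 𝒜 i) (hz : z ∈ HCdeg 𝒜 j) {φ : List A → V} (hφ : IsML k φ) :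
    ins₂ 𝒜 i j y z (ins 𝒜 (2, 0) m φ) =
      sgn k (i.1 + i.2 - 1 + (j.1 + j.2 - 1)) • ins 𝒜 (2, 0) m (ins₂ 𝒜 i j y z φ) +
      ins 𝒜 (i + j) (ins₂ 𝒜 i j y z m) φ +
      sgn k (j.1 - 1) • ins₂ 𝒜 (i + (1, 0)) j (ins 𝒜 i y m) z φ +
      ins₂ 𝒜 i (j + (1, 0)) y (ins 𝒜 j z m) φ -
      sgn k (i.1 + i.2 - 1 + (j.1 + j.2 - 1) + j.2) •
        ins₂ 𝒜 (i + (1, 0)) j (ins 𝒜 (2, 0) m y) z φ -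
      sgn k (j.1 + j.2 - 1) • ins₂ 𝒜 i (j + (1, 0)) y (ins 𝒜 (2, 0) m z) φ := by
  obtain ⟨R, _, _, η, E, rfl⟩ := hφ.exists_eq_comp_letters
  have h := ins₂_ins_letters hm hy hz η
  rw [ins_comp_linear _ m _ E, ins₂_comp_linear _ _ _ _ _ E, ins_comp_linear _ _ _ E,
    ins₂_comp_linear _ _ _ _ _ E, ins₂_comp_linear _ _ _ _ _ E, ins₂_comp_linear _ _ _ _ _ E,
    ins₂_comp_linear _ _ _ _ _ E, ins₂_comp_linear _ _ _ _ _ E, ins_comp_linear _ m _ E, h]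
  funext l
  simp only [Pi.add_apply, Pi.sub_apply, Pi.smul_apply, map_add, map_sub, map_smul]

/-- The identity of `A`, a Hochschild cochain of bidegree `(1, 0)`. -/
def idFun : List A → A
  | [x] => x
  | _ => 0

lemma isML_idFun : IsML k (idFun : List A → A) := by
  intro a b
  match a, b with
  | [], [] => exact ⟨by simp [idFun], by simp [idFun]⟩
  | [], _ :: _ => exact ⟨by simp [idFun], by simp [idFun]⟩
  | [_], _ => exact ⟨by simp [idFun], by simp [idFun]⟩
  | _ :: _ :: _, _ => exact ⟨by simp [idFun], by simp [idFun]⟩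

variable (𝒜) in
omit [GradedAlgebra 𝒜] in
lemma idFun_mem : idFun ∈ HCdeg 𝒜 (1, 0) := by
  refine ⟨isML_idFun, fun l hl => ?_, fun l n hl => ?_⟩
  · match l with
    | [] => rfl
    | [_] => simp at hl
    | _ :: _ :: _ => rfl
  · match l with
    | [] => exact zero_mem _
    | [x] => simpa [idFun] using isHomList_singleton 𝒜 hl
    | _ :: _ :: _ => exact zero_mem _

/-- The multiplication of `A` is the cup square of the identity cochain. Hence all identities for
the differential follow from those for the cup product and the insertions. -/
lemma conv_idFun_idFun : conv 𝒜 0 0 idFun idFun = mulFun := by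
  funext l
  match l with
  | [] => simp [conv, idFun, mulFun]
  | [x] => simp [conv, splitSum_cons, idFun, mulFun]
  | [x, y] => simp [conv, splitSum_cons, idFun, mulFun]
  | x :: y :: z :: l =>
    refine splitSum_eq_zero fun a b h => ?_
    match a, b with
    | [], b => simp [idFun]
    | [_], [] => simp at h
    | [_], [_] => simp at h
    | [_], _ :: _ :: _ => simp [idFun]
    | _ :: _ :: _, b => simp [idFun]

lemma ins_idFun (i : ℤ × ℤ) (c : List A → A) : ins 𝒜 i c idFun = c := by
  funext l
  rw [ins, splitSum_eq_left fun x a b => splitSum_eq_zero fun b e _ => by cases a <;> simp [idFun],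
    splitSum_eq_right fun a x b => by simp [idFun]]
  simp [idFun]

lemma ins₂_idFun (i j : ℤ × ℤ) (c c' : List A → A) : ins₂ 𝒜 i j c c' idFun = 0 := by
  funext l
  refine splitSum_eq_zero fun a r _ => splitSum_eq_zero fun b e _ => ?_
  rw [ins, splitSum_eq_zero fun p s _ => splitSum_eq_zero fun q t _ => ?_, smul_zero]
  match a, p with
  | [], [] => simp [idFun]
  | [], _ :: _ => simp [idFun]
  | [_], _ => simp [idFun]
  | _ :: _ :: _, _ => simp [idFun]

lemma ins_oneFun (i : ℤ × ℤ) (c : List A → A) : ins 𝒜 i c oneFun = 0 := by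
  funext l
  refine splitSum_eq_zero fun a r _ => splitSum_eq_zero fun b e _ => ?_
  cases a <;> simp [oneFun]

lemma ins_add_left {i : ℤ × ℤ} {φ : List A → V} (hφ : IsML k φ) (c c' : List A → A) :
    ins 𝒜 i (c + c') φ = ins 𝒜 i c φ + ins 𝒜 i c' φ := by
  funext l
  simp [ins, splitSum_add', map_cons_add hφ]

lemma ins_smul_left {i : ℤ × ℤ} {φ : List A → V} (hφ : IsML k φ) (r : k) (c : List A → A) :
    ins 𝒜 i (r • c) φ = r • ins 𝒜 i c φ := by
  funext l
  simp [ins, splitSum_smul', map_cons_smul hφ, smul_comm _ r]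

lemma ins₂_add_left {i j : ℤ × ℤ} {φ : List A → V} (hφ : IsML k φ) (c c₁ c' : List A → A) :
    ins₂ 𝒜 i j (c + c₁) c' φ = ins₂ 𝒜 i j c c' φ + ins₂ 𝒜 i j c₁ c' φ := by
  funext l
  simp [ins₂, ins, splitSum_add', splitSum_add, map_cons_add hφ]

lemma ins₂_smul_left {i j : ℤ × ℤ} {φ : List A → V} (hφ : IsML k φ) (r : k) (c c' : List A → A) :
    ins₂ 𝒜 i j (r • c) c' φ = r • ins₂ 𝒜 i j c c' φ := by
  funext l
  simp [ins₂, ins, splitSum_smul', map_cons_smul hφ, smul_comm _ r]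

lemma ins₂_add_middle {i j : ℤ × ℤ} {φ : List A → V} (hφ : IsML k φ) (c c' c₁ : List A → A) :
    ins₂ 𝒜 i j c (c' + c₁) φ = ins₂ 𝒜 i j c c' φ + ins₂ 𝒜 i j c c₁ φ := by
  funext l
  have (p : List A) (x : A) : IsML k fun q => φ (p ++ x :: q) := by
    simpa using hφ.translate (p ++ [x])
  simp [ins₂, ins_add_left (this _ _), splitSum_add']

lemma ins₂_smul_middle {i j : ℤ × ℤ} {φ : List A → V} (hφ : IsML k φ) (r : k) (c c' : List A → A) :
    ins₂ 𝒜 i j c (r • c') φ = r • ins₂ 𝒜 i j c c' φ := by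
  funext l
  have (p : List A) (x : A) : IsML k fun q => φ (p ++ x :: q) := by
    simpa using hφ.translate (p ++ [x])
  simp [ins₂, ins_smul_left (this _ _), splitSum_smul', smul_comm _ r]

lemma ins₂_sub_right (i j : ℤ × ℤ) (c c' : List A → A) (φ ψ : List A → V) :
    ins₂ 𝒜 i j c c' (φ - ψ) = ins₂ 𝒜 i j c c' φ - ins₂ 𝒜 i j c c' ψ := by
  rw [eq_sub_iff_add_eq, ← ins₂_add_right, sub_add_cancel]

variable (𝒜) in
/-- The Hochschild differential `m{c} + (-1)^|c| c{m}` of a cochain of bidegree `i`. -/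
noncomputable def dFun (i : ℤ × ℤ) (c : List A → A) : List A → A :=
  ins 𝒜 i c mulFun + sgn k (i.1 + i.2) • ins 𝒜 (2, 0) mulFun c

lemma ins_mulFun {i : ℤ × ℤ} {c : List A → A} (hc : c ∈ HCdeg 𝒜 i) :
    ins 𝒜 i c mulFun =
      conv 𝒜 0 i.2 idFun c - sgn k (i.1 + i.2) • conv 𝒜 0 0 c idFun := by
  have hI := (idFun_mem 𝒜).1
  rw [← conv_idFun_idFun (𝒜 := 𝒜), ins_conv hc hI hI, ins_idFun,
    conv_eq_smul_conv (idFun_mem 𝒜).2.1 (0 + (i.1 + i.2 - 1))]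
  have : sgn k ((0 + (i.1 + i.2 - 1)) * 1) = - sgn k (i.1 + i.2) := by
    rw [mul_one, zero_add, sgn_sub, sgn_one, mul_neg_one]
  dsimp only
  rw [this]
  simp [sub_eq_add_neg]

lemma ins₂_mem {p i j : ℤ × ℤ} {x y z : List A → A} (hx : x ∈ HCdeg 𝒜 p) (hy : y ∈ HCdeg 𝒜 i)
    (hz : z ∈ HCdeg 𝒜 j) : ins₂ 𝒜 i j y z x ∈ HCdeg 𝒜 (p + i + j - (2, 0)) := by
  refine ⟨isML_ins₂ hy.1 hz.1 hx.1 _ _, fun l hl => ?_, fun l n hl => ?_⟩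
  · refine splitSum_eq_zero fun a r hr => splitSum_eq_zero fun b e he => ?_
    rw [ins, splitSum_eq_zero fun a' r' hr' => splitSum_eq_zero fun b' e' he' => ?_, smul_zero]
    subst he' hr' he hr
    by_cases hb : (b.length : ℤ) = i.1
    · by_cases hb' : (b'.length : ℤ) = j.1
      · rw [hx.2.1, smul_zero]
        intro h
        apply hl
        simp at h ⊢
        omega
      · rw [hz.2.1 b' hb']
        have := hx.1.map_zero (a.map (par 𝒜 (i.2 + j.2)) ++ y (b.map (par 𝒜 j.2)) ::
          a'.map (par 𝒜 j.2)) e'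
        simp only [List.append_assoc, List.cons_append] at this
        rw [this, smul_zero]
    · rw [hy.2.1 _ (by simpa using hb), hx.1.map_zero, smul_zero]
  · refine splitSum_mem _ fun a r hr => splitSum_mem _ fun b e he => Submodule.smul_mem _ _ ?_
    refine splitSum_mem _ fun a' r' hr' => splitSum_mem _ fun b' e' he' =>
      Submodule.smul_mem _ _ ?_
    subst he' hr' he hr
    obtain ⟨na, nr, rfl, ha, hr⟩ := hl.split
    obtain ⟨nb, ne, rfl, hb, he⟩ := hr.split
    obtain ⟨na', nr', rfl, ha', hr'⟩ := he.split
    obtain ⟨nb', ne', rfl, hb', he'⟩ := hr'.split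
    have := hx.2.2 _ _ ((ha.map_par (i.2 + j.2)).append (.cons (hy.2.2 _ nb (hb.map_par j.2))
      ((ha'.map_par j.2).append (.cons (hz.2.2 b' nb' hb') he'))))
    convert this using 2
    simp
    ring

/-- The double insertion is a null homotopy for the failure of `x{-}` to be a derivation of the cup
product, where `x` and `y` are cocycles. -/
theorem dFun_ins₂ {p i j : ℤ × ℤ} {x y z : List A → A} (hx : x ∈ HCdeg 𝒜 p) (hy : y ∈ HCdeg 𝒜 i)
    (hz : z ∈ HCdeg 𝒜 j) (dx : dFun 𝒜 p x = 0) (dy : dFun 𝒜 i y = 0) :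
    dFun 𝒜 (p + i + j - (2, 0)) (ins₂ 𝒜 i j y z x) =
      -(sgn k (p.1 + p.2) • ins₂ 𝒜 i (j + (1, 0)) y (dFun 𝒜 j z) x) -
      sgn k (p.1 + p.2 + (i.1 + i.2 - 1) * j.1) •
        (ins 𝒜 (i + j) (conv 𝒜 0 j.2 y z) x - conv 𝒜 0 j.2 (ins 𝒜 i y x) z -
          sgn k ((p.1 + p.2 - 1) * (i.1 + i.2)) • conv 𝒜 0 (p.2 + j.2) y (ins 𝒜 j z x)) := by
  have hm := mulFun_mem 𝒜
  have hB : ins₂ 𝒜 i j y z x ∈ HCdeg 𝒜 (p + i + j - (2, 0)) := ins₂_mem hx hy hz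
  -- the hypotheses on `x` and `y` enter through `e0` and `e1`, the identity through `e2`
  have e0 : ins₂ 𝒜 i j y z (dFun 𝒜 p x) = 0 := by
    rw [dx]
    funext l
    simp [ins₂, ins, splitSum]
  have e1 : ins₂ 𝒜 (i + (1, 0)) j (dFun 𝒜 i y) z x = 0 := by
    have := ins₂_smul_left (𝒜 := 𝒜) (i := i + (1, 0)) (j := j) hx.1 0 (0 : List A → A) z
    rw [dy]
    simpa using this
  have e2 := ins₂_ins hm hy hz hx.1
  have hI := (idFun_mem 𝒜).1
  have hI1 : ∀ l : List A, (l.length : ℤ) ≠ 1 → (idFun l : A) = 0 := (idFun_mem 𝒜).2.1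
  -- the double insertion in `m`, in `ι x` and in `x ι`
  have f1 : ins₂ 𝒜 i j y z mulFun = sgn k ((i.1 + i.2 - 1) * j.1) • conv 𝒜 0 j.2 y z := by
    rw [← conv_idFun_idFun (𝒜 := 𝒜), ins₂_conv hy hz hI hI, ins_idFun, ins_idFun, ins₂_idFun,
      conv_zero_left, conv_zero_right, zero_add, zero_add,
      conv_eq_smul_conv hz.2.1]
    simp
  have hzx : ∀ l : List A, (l.length : ℤ) ≠ p.1 + j.1 - 1 → ins 𝒜 j z x l = 0 := by
    have := braceHH_mem 𝒜 hx hz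
    rw [braceHH_eq_ins 𝒜 hx.1 hz] at this
    simpa using this.2.1
  have f2 : ins₂ 𝒜 i j y z (conv 𝒜 0 p.2 idFun x) = conv 𝒜 0 (p.2 + (i.2 + j.2)) idFun
      (ins₂ 𝒜 i j y z x) + sgn k (p.2 * (i.1 + i.2 - 1) + (i.1 + i.2 - 1) * (p.1 + j.1 - 1)) •
        conv 𝒜 0 (p.2 + j.2) y (ins 𝒜 j z x) := by
    rw [ins₂_conv hy hz hI hx.1, ins_idFun, ins₂_idFun, conv_zero_left,
      conv_eq_smul_conv hzx (0 + _), smul_smul, ← sgn_add]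
    simp
  have f3 : ins₂ 𝒜 i j y z (conv 𝒜 0 0 x idFun) =
      sgn k ((i.1 + i.2 - 1) * j.1) • conv 𝒜 0 j.2 (ins 𝒜 i y x) z +
      sgn k (i.1 + i.2 - 1 + (j.1 + j.2 - 1)) • conv 𝒜 0 0 (ins₂ 𝒜 i j y z x) idFun := by
    rw [ins₂_conv hy hz hx.1 hI, ins_idFun, ins₂_idFun, conv_zero_right,
      conv_eq_smul_conv hz.2.1 (0 + _), conv_eq_smul_conv hI1]
    simp
  rw [dFun, ins₂_add_right, ins₂_smul_right, e2, ins_mulFun hx] at e0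
  rw [dFun, ins₂_add_left hx.1, ins₂_smul_left hx.1] at e1
  rw [dFun, dFun, ins₂_add_middle hx.1, ins₂_smul_middle hx.1]
  rw [ins_mulFun hB]
  rw [f1, ins₂_sub_right, ins₂_smul_right, f2, f3, ins_smul_left hx.1] at e0
  have g1 : conv 𝒜 0 (p + i + j - (2, 0)).2 idFun (ins₂ 𝒜 i j y z x) =
      conv 𝒜 0 (p.2 + (i.2 + j.2)) idFun (ins₂ 𝒜 i j y z x) :=
    conv_congr rfl (by simp; ring) _ _
  rw [g1]
  have s1 : sgn k (p.2 * (i.1 + i.2 - 1) + (i.1 + i.2 - 1) * (p.1 + j.1 - 1)) =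
      -(sgn k ((i.1 + i.2 - 1) * j.1) * sgn k (p.1 + p.2) *
        sgn k ((p.1 + p.2 - 1) * (i.1 + i.2))) := by
    rw [← sgn_add, ← sgn_add, ← sgn_succ]
    refine sgn_congr ?_
    push_cast
    grind
  have s2 : sgn k ((p + i + j - (2, 0)).1 + (p + i + j - (2, 0)).2) =
      sgn k (p.1 + p.2) * sgn k (i.1 + i.2) * sgn k j.1 * sgn k j.2 := by
    simp only [← sgn_add]
    refine sgn_congr ?_
    simp only [Prod.fst_add, Prod.snd_add, Prod.fst_sub, Prod.snd_sub]
    push_cast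
    grind
  rw [s1] at e0
  rw [s2]
  simp only [sgn_add _ j.2, sgn_sub, sgn_one, sgn_add _ (j.1 + j.2 - 1), sgn_add _ (_ * j.1)]
    at e0 e1 ⊢
  clear e2 hI hI1 f1 f2 f3 hzx hB g1 s1 s2
  generalize sgn k ((p.1 + p.2 - 1) * (i.1 + i.2)) = Q at *
  generalize sgn k ((i.1 + i.2 - 1) * j.1) = P at *
  have h1 := sgn_mul_self (k := k) (p.1 + p.2)
  have h2 := sgn_mul_self (k := k) (i.1 + i.2)
  have h3 := sgn_mul_self (k := k) j.1
  have h4 := sgn_mul_self (k := k) j.2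
  generalize sgn k (p.1 + p.2) = Sp at *
  generalize sgn k (i.1 + i.2) = Si at *
  generalize sgn k j.1 = J1 at *
  generalize sgn k j.2 = J2 at *
  linear_combination (norm := skip) e0 + (Sp * J1) • e1
  match_scalars <;> grind

end FunctionIdentities

/-! ### Gradings -/

section Gradings

variable {k V W ι : Type*} [Field k] [AddCommGroup V] [Module k V] [AddCommGroup W] [Module k W]
  [DecidableEq ι]

/-- Complementary projections exhibit a family of subspaces as a grading. -/
lemma isInternal_of_projections {gr : ι → Submodule k V} (π : ι → V →ₗ[k] V)
    (h_same : ∀ i, ∀ x ∈ gr i, π i x = x) (h_ne : ∀ i j, i ≠ j → ∀ x ∈ gr i, π j x = 0)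
    (h_top : ∀ x, x ∈ ⨆ i, gr i) : DirectSum.IsInternal gr := by
  rw [DirectSum.isInternal_submodule_iff_iSupIndep_and_iSup_eq_top]
  refine ⟨fun i => ?_, by rw [eq_top_iff]; exact fun x _ => h_top x⟩
  rw [Submodule.disjoint_def]
  intro x hx hx'
  rw [← h_same i x hx]
  suffices (⨆ j, ⨆ (_ : j ≠ i), gr j) ≤ LinearMap.ker (π i) from this hx'
  exact iSup₂_le fun j hj y hy => h_ne j i hj y hy

/-- The linear map which is `f i` on the part of degree `i`. -/
noncomputable def gradedLift {gr : ι → Submodule k V} (h : DirectSum.IsInternal gr)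
    (f : ι → V →ₗ[k] W) : V →ₗ[k] W :=
  (DirectSum.toModule k ι W fun i => f i ∘ₗ (gr i).subtype) ∘ₗ
    (LinearEquiv.ofBijective (DirectSum.coeLinearMap gr) h).symm.toLinearMap

lemma gradedLift_of_mem {gr : ι → Submodule k V} (h : DirectSum.IsInternal gr)
    (f : ι → V →ₗ[k] W) {i : ι} {x : V} (hx : x ∈ gr i) : gradedLift h f x = f i x := by
  have : (LinearEquiv.ofBijective (DirectSum.coeLinearMap gr) h).symm x =
      DirectSum.lof k ι (fun i => gr i) i ⟨x, hx⟩ := by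
    rw [LinearEquiv.symm_apply_eq]
    exact (DirectSum.coeLinearMap_lof gr i ⟨x, hx⟩).symm
  rw [gradedLift, LinearMap.comp_apply, LinearEquiv.coe_coe, this, DirectSum.toModule_lof]
  rfl

@[elab_as_elim]
lemma graded_induction {gr : ι → Submodule k V} (h : DirectSum.IsInternal gr) {P : V → Prop}
    (h_zero : P 0) (h_add : ∀ x y, P x → P y → P (x + y)) (h_mem : ∀ i, ∀ x ∈ gr i, P x) (x : V) :
    P x :=
  Submodule.iSup_induction gr (motive := P) (h.submodule_iSup_eq_top ▸ Submodule.mem_top)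
    h_mem h_zero h_add

/-- The projection to the part of degree `i`. -/
noncomputable def gradedProj {gr : ι → Submodule k V} (h : DirectSum.IsInternal gr) (i : ι) :
    V →ₗ[k] V := gradedLift h fun j => if j = i then LinearMap.id else 0

lemma gradedProj_same {gr : ι → Submodule k V} (h : DirectSum.IsInternal gr) {i : ι} {x : V}
    (hx : x ∈ gr i) : gradedProj h i x = x := by
  rw [gradedProj, gradedLift_of_mem h _ hx, if_pos rfl, LinearMap.id_apply]

lemma gradedProj_ne {gr : ι → Submodule k V} (h : DirectSum.IsInternal gr) {i j : ι} (hij : i ≠ j)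
    {x : V} (hx : x ∈ gr i) : gradedProj h j x = 0 := by
  rw [gradedProj, gradedLift_of_mem h _ hx, if_neg hij, LinearMap.zero_apply]

lemma gradedProj_mem {gr : ι → Submodule k V} (h : DirectSum.IsInternal gr) (i : ι) (x : V) :
    gradedProj h i x ∈ gr i := by
  refine graded_induction h (by simp) (fun x y hx hy => ?_) (fun j x hx => ?_) x
  · rw [map_add]; exact add_mem hx hy
  · by_cases hij : j = i
    · subst hij
      rwa [gradedProj_same h hx]
    · rw [gradedProj_ne h hij hx]
      exact zero_mem _

/-- An element lies in the sum of the subspaces `S i` if its component of degree `i` lies in `S i`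
for all `i`. -/
lemma mem_iSup_gradedProj {gr : ι → Submodule k V} (h : DirectSum.IsInternal gr)
    (S : ι → Submodule k V) {x : V} (hx : ∀ i, gradedProj h i x ∈ S i) : x ∈ ⨆ i, S i := by
  classical
  have key : ∀ y : V, ∃ s : Finset ι, y = ∑ i ∈ s, gradedProj h i y := by
    intro y
    suffices ∃ s : Finset ι, ∀ t, s ⊆ t → y = ∑ i ∈ t, gradedProj h i y from
      ⟨this.choose, this.choose_spec _ (Finset.Subset.refl _)⟩
    refine graded_induction h ⟨∅, by simp⟩ ?_ ?_ y
    · rintro x y ⟨s, hs⟩ ⟨t, ht⟩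
      refine ⟨s ∪ t, fun u hu => ?_⟩
      simp only [map_add, Finset.sum_add_distrib]
      rw [← hs u (Finset.union_subset_left hu), ← ht u (Finset.union_subset_right hu)]
    · intro i x hx
      refine ⟨{i}, fun t ht => ?_⟩
      rw [Finset.sum_eq_single_of_mem i (ht (Finset.mem_singleton_self i)), gradedProj_same h hx]
      exact fun j _ hj => gradedProj_ne h hj.symm hx
  obtain ⟨s, hs⟩ := key x
  rw [hs]
  exact Submodule.sum_mem _ fun i _ => Submodule.mem_iSup_of_mem i (hx i)

end Gradings

/-! ### The total degree -/

section TotalDegree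

variable {k V W : Type*} [Field k] [AddCommGroup V] [Module k V] [AddCommGroup W] [Module k W]
  {gr : ℤ × ℤ → Submodule k V}

lemma mem_totalGr {i : ℤ × ℤ} {x : V} (hx : x ∈ gr i) : x ∈ totalGr gr (i.1 + i.2) :=
  Submodule.mem_iSup_of_mem i (Submodule.mem_iSup_of_mem rfl hx)

lemma mem_totalGr' {i : ℤ × ℤ} {n : ℤ} {x : V} (hx : x ∈ gr i) (hi : i.1 + i.2 = n) :
    x ∈ totalGr gr n := hi ▸ mem_totalGr hx

lemma totalGr_le {S : Submodule k V} {n : ℤ} (h : ∀ i, i.1 + i.2 = n → gr i ≤ S) :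
    totalGr gr n ≤ S := iSup₂_le h

@[elab_as_elim]
lemma totalGr_induction {n : ℤ} {P : V → Prop} (h_zero : P 0)
    (h_add : ∀ x y, P x → P y → P (x + y)) (h_mem : ∀ i, i.1 + i.2 = n → ∀ x ∈ gr i, P x) {x : V}
    (hx : x ∈ totalGr gr n) : P x := by
  refine Submodule.iSup_induction _ (motive := P) hx (fun i x hx => ?_) h_zero h_add
  refine Submodule.iSup_induction _ (motive := P) hx (fun hi x hx => h_mem i hi x hx) h_zero h_add

lemma isInternal_totalGr (h : DirectSum.IsInternal gr) : DirectSum.IsInternal (totalGr gr) := by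
  refine isInternal_of_projections
    (fun n => gradedLift h fun i => if i.1 + i.2 = n then LinearMap.id else 0)
    (fun n x hx => ?_) (fun m n hmn x hx => ?_) fun x => ?_
  · refine totalGr_induction (by simp) (fun x y hx hy => by rw [map_add, hx, hy])
      (fun i hi x hx => ?_) hx
    rw [gradedLift_of_mem h _ hx, if_pos hi, LinearMap.id_apply]
  · refine totalGr_induction (by simp) (fun x y hx hy => by rw [map_add, hx, hy, add_zero])
      (fun i hi x hx => ?_) hx
    rw [gradedLift_of_mem h _ hx, if_neg (hi ▸ hmn), LinearMap.zero_apply]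
  · exact graded_induction h (zero_mem _) (fun _ _ => add_mem)
      (fun i x hx => Submodule.mem_iSup_of_mem _ (mem_totalGr hx)) x

/-- The grading of `V ⊕ W ε`, where `ε` has degree `s`. -/
lemma isInternal_prod_shift {gr' : ℤ × ℤ → Submodule k W} (h : DirectSum.IsInternal gr)
    (h' : DirectSum.IsInternal gr') (s : ℤ × ℤ) :
    DirectSum.IsInternal fun i => (gr i).prod (gr' (i - s)) := by
  refine isInternal_of_projections
    (fun i => (gradedProj h i).prodMap (gradedProj h' (i - s)))
    (fun i x hx => ?_) (fun i j hij x hx => ?_) fun x => ?_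
  · exact Prod.ext (gradedProj_same h hx.1) (gradedProj_same h' hx.2)
  · exact Prod.ext (gradedProj_ne h hij hx.1)
      (gradedProj_ne h' (fun e => hij (sub_left_injective e)) hx.2)
  · have h1 : (x.1, (0 : W)) ∈ ⨆ i, (gr i).prod (gr' (i - s)) := by
      refine graded_induction h (P := fun y => (y, (0 : W)) ∈ ⨆ i, (gr i).prod (gr' (i - s)))
        (zero_mem _) (fun y z hy hz => ?_) (fun i y hy => ?_) x.1
      · simpa using add_mem hy hz
      · exact Submodule.mem_iSup_of_mem i ⟨hy, zero_mem _⟩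
    have h2 : ((0 : V), x.2) ∈ ⨆ i, (gr i).prod (gr' (i - s)) := by
      refine graded_induction h' (P := fun y => ((0 : V), y) ∈ ⨆ i, (gr i).prod (gr' (i - s)))
        (zero_mem _) (fun y z hy hz => ?_) (fun i y hy => ?_) x.2
      · simpa using add_mem hy hz
      · exact Submodule.mem_iSup_of_mem (i + s) ⟨zero_mem _, by simpa using hy⟩
    simpa using add_mem h1 h2

end TotalDegree

/-! ### Direct sums over bidegrees -/

section Tot

variable {k : Type*} [Field k] {V : ℤ × ℤ → Type*} [∀ i, AddCommGroup (V i)] [∀ i, Module k (V i)]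
  {W : Type*} [AddCommGroup W] [Module k W]

@[simp] lemma Tot.lift_of (f : ∀ i, V i →ₗ[k] W) (i : ℤ × ℤ) (x : V i) :
    Tot.lift f (Tot.of k V i x) = f i x := DirectSum.toModule_lof k i x

@[simp] lemma Tot.lift₂_of (f : ∀ i j, V i →ₗ[k] V j →ₗ[k] W) (i j : ℤ × ℤ) (x : V i) (y : V j) :
    Tot.lift₂ f (Tot.of k V i x) (Tot.of k V j y) = f i j x y := by
  simp [Tot.lift₂]

lemma Tot.of_mem (i : ℤ × ℤ) (x : V i) : Tot.of k V i x ∈ homPart k V i := ⟨x, rfl⟩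

@[simp] lemma totalParity_of (i : ℤ × ℤ) (x : V i) :
    totalParity k V (Tot.of k V i x) = sgn k (i.1 + i.2) • Tot.of k V i x := by
  simp [totalParity]

variable (k V) in
lemma isInternal_homPart : DirectSum.IsInternal (homPart k V) := by
  refine isInternal_of_projections
    (fun i => Tot.lift fun j => if j = i then Tot.of k V j else 0) ?_ ?_ fun x => ?_
  · rintro i _ ⟨x, rfl⟩
    simp
  · rintro i j hij _ ⟨x, rfl⟩
    simp [hij]
  · exact DirectSum.induction_on x (zero_mem _)
      (fun i x => Submodule.mem_iSup_of_mem i (Tot.of_mem i x)) fun _ _ => add_mem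

/-- The commutator of a bilinear operation on bihomogeneous elements. -/
lemma gradedCommutator_apply (P : Tot V →ₗ[k] Tot V →ₗ[k] Tot V) {i j : ℤ × ℤ} {x y : Tot V}
    (hx : x ∈ homPart k V i) (hy : y ∈ homPart k V j) :
    gradedCommutator P x y =
      P x y - sgn k ((i.1 + i.2 - 1) * (j.1 + j.2 - 1)) • P y x := by
  obtain ⟨x, rfl⟩ := hx
  obtain ⟨y, rfl⟩ := hy
  simp [gradedCommutator]

end Tot

/-! ### Cohomology classes -/

section Cohomology

variable {k V W : Type*} [Field k] [AddCommGroup V] [Module k V] [AddCommGroup W] [Module k W]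
  {d : V →ₗ[k] V} {dW : W →ₗ[k] W}

lemma Represents.d_eq_zero {x : V} {a : Coh d} (h : Represents d x a) : d x = 0 := h.1

lemma exists_represents (a : Coh d) : ∃ x, Represents d x a := by
  obtain ⟨x, rfl⟩ := Submodule.Quotient.mk_surjective _ a
  exact ⟨x, x.2, rfl⟩

lemma Represents.of_d_eq_zero {x : V} (hx : d x = 0) : ∃ a, Represents d x a := ⟨_, hx, rfl⟩

lemma Represents.unique {x y : V} {a b : Coh d} (ha : Represents d x a) (hb : Represents d y b)
    (h : x - y ∈ LinearMap.range d) : a = b := by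
  obtain ⟨hx, rfl⟩ := ha
  obtain ⟨hy, rfl⟩ := hb
  exact (Submodule.Quotient.eq _).2 h

lemma Represents.unique' {x : V} {a b : Coh d} (ha : Represents d x a) (hb : Represents d x b) :
    a = b := ha.unique hb (by simp)

lemma Represents.sub_mem {x y : V} {a : Coh d} (ha : Represents d x a) (hb : Represents d y a) :
    x - y ∈ LinearMap.range d := by
  obtain ⟨hx, rfl⟩ := ha
  obtain ⟨hy, h⟩ := hb
  have := (Submodule.Quotient.eq _).1 h
  rw [← neg_sub]
  exact neg_mem this

lemma Represents.add {x y : V} {a b : Coh d} (ha : Represents d x a) (hb : Represents d y b) :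
    Represents d (x + y) (a + b) := by
  obtain ⟨hx, rfl⟩ := ha
  obtain ⟨hy, rfl⟩ := hb
  exact ⟨add_mem hx hy, rfl⟩

lemma Represents.smul {x : V} {a : Coh d} (r : k) (ha : Represents d x a) :
    Represents d (r • x) (r • a) := by
  obtain ⟨hx, rfl⟩ := ha
  exact ⟨Submodule.smul_mem _ r hx, rfl⟩

lemma Represents.neg {x : V} {a : Coh d} (ha : Represents d x a) : Represents d (-x) (-a) := by
  simpa using ha.smul (-1)

lemma Represents.zero : Represents d 0 0 := ⟨zero_mem _, rfl⟩

lemma Represents.add_range {x y : V} {a : Coh d} (ha : Represents d x a) (hy : d y = 0)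
    (h : y - x ∈ LinearMap.range d) : Represents d y a := by
  obtain ⟨b, hb⟩ := Represents.of_d_eq_zero hy
  rwa [← hb.unique ha h]

lemma represents_zero_iff {x : V} (hx : d x = 0) :
    Represents d x 0 ↔ x ∈ LinearMap.range d := by
  refine ⟨fun h => by simpa using h.sub_mem .zero, fun h => Represents.zero.add_range hx ?_⟩
  simpa using h

lemma mem_cohPart {S : Submodule k V} {a : Coh d} :
    a ∈ cohPart d S ↔ ∃ x ∈ S, Represents d x a := by
  constructor
  · rintro ⟨x, hx, rfl⟩
    exact ⟨x, hx, x.2, rfl⟩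
  · rintro ⟨x, hx, hx', rfl⟩
    exact ⟨⟨x, hx'⟩, hx, rfl⟩

lemma Represents.cohMap {f : V →ₗ[k] W} (hf : ∀ x, f (d x) = dW (f x)) {x : V} {a : Coh d}
    (h : Represents d x a) : Represents dW (f x) (Hoch.cohMap f hf a) := by
  obtain ⟨hx, rfl⟩ := h
  exact ⟨by rw [LinearMap.mem_ker, ← hf, LinearMap.mem_ker.1 hx, map_zero], rfl⟩

/-- The bilinear map induced on cohomology by a bilinear map for which the product of cocycles is a
cocycle, and a coboundary if one of them is. -/
noncomputable def cohMap₂ (b : V →ₗ[k] V →ₗ[k] V) (h : ∀ x y, d x = 0 → d y = 0 → d (b x y) = 0)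
    (hl : ∀ x y, d y = 0 → b (d x) y ∈ LinearMap.range d)
    (hr : ∀ x y, d x = 0 → b x (d y) ∈ LinearMap.range d) : Coh d →ₗ[k] Coh d →ₗ[k] Coh d :=
  let f : LinearMap.ker d →ₗ[k] LinearMap.ker d →ₗ[k] Coh d :=
    LinearMap.mk₂ k (fun x y => Submodule.Quotient.mk ⟨b x y, h x y x.2 y.2⟩)
      (fun x x' y => congrArg Submodule.Quotient.mk (Subtype.ext (by simp)))
      (fun r x y => congrArg Submodule.Quotient.mk (Subtype.ext (by simp)))
      (fun x y y' => congrArg Submodule.Quotient.mk (Subtype.ext (by simp)))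
      (fun r x y => congrArg Submodule.Quotient.mk (Subtype.ext (by simp)))
  have hf : (LinearMap.range d).submoduleOf (LinearMap.ker d) ≤ LinearMap.ker f.flip := by
    rintro ⟨y, hy⟩ ⟨z, rfl⟩
    refine LinearMap.ext fun x => (Submodule.Quotient.mk_eq_zero _).2 ?_
    exact hr x z x.2
  Submodule.liftQ _ (Submodule.liftQ _ f.flip hf).flip (by
    rintro ⟨x, hx⟩ ⟨z, rfl⟩
    refine LinearMap.ext fun a => ?_
    obtain ⟨y, rfl⟩ := Submodule.Quotient.mk_surjective _ a
    exact (Submodule.Quotient.mk_eq_zero _).2 (hl z y y.2))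

lemma Represents.cohMap₂ {b : V →ₗ[k] V →ₗ[k] V} (h hl hr) {x y : V} {u v : Coh d}
    (hu : Represents d x u) (hv : Represents d y v) :
    Represents d (b x y) (cohMap₂ b h hl hr u v) := by
  obtain ⟨hx, rfl⟩ := hu
  obtain ⟨hy, rfl⟩ := hv
  exact ⟨h x y hx hy, rfl⟩

variable {ι : Type*} [DecidableEq ι] {gr : ι → Submodule k V}

/-- A homogeneous differential commutes with the projections to the homogeneous components, up to
the shift of the degree; in particular the components of a cocycle are cocycles. -/
lemma d_gradedProj (h : DirectSum.IsInternal gr) {s : ι ≃ ι} (hd : ∀ i, ∀ x ∈ gr i, d x ∈ gr (s i))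
    (i : ι) (x : V) : d (gradedProj h i x) = gradedProj h (s i) (d x) := by
  refine graded_induction h (by simp) (fun x y hx hy => by simp only [map_add, hx, hy])
    (fun j x hx => ?_) x
  by_cases hij : j = i
  · subst hij
    rw [gradedProj_same h hx, gradedProj_same h (hd j x hx)]
  · rw [gradedProj_ne h hij hx, gradedProj_ne h (s.injective.ne hij) (hd j x hx), map_zero]

@[elab_as_elim]
lemma cocycle_induction (h : DirectSum.IsInternal gr) {s : ι ≃ ι}
    (hd : ∀ i, ∀ x ∈ gr i, d x ∈ gr (s i)) {P : V → Prop}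
    (h_zero : P 0) (h_add : ∀ x y, P x → P y → P (x + y))
    (h_mem : ∀ i, ∀ x ∈ gr i, d x = 0 → P x) {x : V} (hx : d x = 0) : P x := by
  have : x ∈ ⨆ i, gr i ⊓ LinearMap.ker d := mem_iSup_gradedProj h _ fun i =>
    ⟨gradedProj_mem h i x, LinearMap.mem_ker.2 (by rw [d_gradedProj h hd, hx, map_zero])⟩
  exact Submodule.iSup_induction _ (motive := P) this (fun i x hx => h_mem i x hx.1 hx.2) h_zero
    h_add

/-- The cohomology of a graded complex is graded. -/
lemma isInternal_cohPart (h : DirectSum.IsInternal gr) {s : ι ≃ ι}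
    (hd : ∀ i, ∀ x ∈ gr i, d x ∈ gr (s i)) : DirectSum.IsInternal fun i => cohPart d (gr i) := by
  have hK (i : ι) : ∀ x ∈ LinearMap.ker d, gradedProj h i x ∈ LinearMap.ker d := fun x hx => by
    rw [LinearMap.mem_ker, d_gradedProj h hd, LinearMap.mem_ker.1 hx, map_zero]
  have hN (i : ι) : (LinearMap.range d).submoduleOf (LinearMap.ker d) ≤
      ((LinearMap.range d).submoduleOf (LinearMap.ker d)).comap
        ((gradedProj h i).restrict (hK i)) := by
    rintro ⟨_, hx⟩ ⟨y, rfl⟩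
    refine ⟨gradedProj h (s.symm i) y, ?_⟩
    rw [d_gradedProj h hd, Equiv.apply_symm_apply]
    rfl
  refine isInternal_of_projections (fun i => Submodule.mapQ _ _ _ (hN i)) ?_ ?_ ?_
  · rintro i _ ⟨x, hx, rfl⟩
    exact congrArg Submodule.Quotient.mk (Subtype.ext (gradedProj_same h hx))
  · rintro i j hij _ ⟨x, hx, rfl⟩
    refine (Submodule.Quotient.mk_eq_zero _).2 ?_
    have : (gradedProj h j).restrict (hK j) x = 0 := Subtype.ext (gradedProj_ne h hij hx)
    rw [this]
    exact zero_mem _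
  · intro a
    obtain ⟨x, hx⟩ := exists_represents a
    suffices ∀ x, d x = 0 → ∀ a, Represents d x a → a ∈ ⨆ i, cohPart d (gr i) from
      this x hx.d_eq_zero a hx
    intro x hx
    refine cocycle_induction h hd (P := fun x => d x = 0 ∧ ∀ a, Represents d x a →
      a ∈ ⨆ i, cohPart d (gr i)) ?_ ?_ ?_ hx |>.2
    · refine ⟨map_zero _, fun a ha => ?_⟩
      rw [ha.unique' .zero]
      exact zero_mem _
    · rintro x y ⟨dx, hx⟩ ⟨dy, hy⟩
      refine ⟨by rw [map_add, dx, dy, add_zero], fun a ha => ?_⟩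
      obtain ⟨b, hb⟩ := Represents.of_d_eq_zero dx
      obtain ⟨c, hc⟩ := Represents.of_d_eq_zero dy
      rw [ha.unique' (hb.add hc)]
      exact add_mem (hx b hb) (hy c hc)
    · exact fun i x hx dx => ⟨dx, fun a ha =>
        Submodule.mem_iSup_of_mem i (mem_cohPart.2 ⟨x, hx, ha⟩)⟩

end Cohomology

/-! ### Brace algebras -/

section BraceAlgebra

variable {k V : Type*} [Field k] [AddCommGroup V] [Module k V]

lemma sgn_of_ringChar (h : ringChar k = 2) (n : ℤ) : sgn k n = 1 := by
  have : CharP k 2 := ringChar.of_eq h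
  rcases sgn_eq_or (k := k) n with h | h
  · exact h
  · rw [h, CharTwo.neg_eq]

lemma add_self_of_ringChar (h : ringChar k = 2) (x : V) : x + x = 0 := by
  have : CharP k 2 := ringChar.of_eq h
  rw [← one_smul k x, ← add_smul, CharTwo.add_self_eq_zero, zero_smul]

/-- The formal properties of the operations on a Hochschild complex that make its cohomology a
Gerstenhaber algebra: an associative product `cup`, a pre-Lie product `pre` with commutator `br`,
and a cochain `iota` with cup square `m`, where the differential is the bracket with `m`. The
identity `assoc_self` is what `assoc_symm` says for `z = y`, divided by two. The double insertion,
which makes `x{-}` a derivation of the cup product up to homotopy, only enters through its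
consequence `homotopy` for cocycles. -/
structure IsBraceAlgebra (gr : ℤ → Submodule k V) (d : V →ₗ[k] V) (cup pre br : V →ₗ[k] V →ₗ[k] V)
    (one iota : V) : Prop where
  isInternal : DirectSum.IsInternal gr
  cup_mem : ∀ p q, ∀ x ∈ gr p, ∀ y ∈ gr q, cup x y ∈ gr (p + q)
  pre_mem : ∀ p q, ∀ x ∈ gr p, ∀ y ∈ gr q, pre x y ∈ gr (p + q - 1)
  iota_mem : iota ∈ gr 1
  cup_assoc : ∀ x y z, cup (cup x y) z = cup x (cup y z)
  one_cup : ∀ x, cup one x = x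
  cup_one : ∀ x, cup x one = x
  one_mem : one ∈ gr 0
  one_pre : ∀ x, pre one x = 0
  iota_pre : ∀ x, pre iota x = x
  br_eq : ∀ p q, ∀ x ∈ gr p, ∀ y ∈ gr q, br x y = pre x y - sgn k ((p - 1) * (q - 1)) • pre y x
  d_eq : ∀ x, d x = br (cup iota iota) x
  cup_pre : ∀ q r x, ∀ y ∈ gr q, ∀ z ∈ gr r,
    pre (cup x y) z = cup x (pre y z) + sgn k (q * (r - 1)) • cup (pre x z) y
  assoc_symm : ∀ q r x, ∀ y ∈ gr q, ∀ z ∈ gr r, pre (pre x y) z - pre x (pre y z) =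
    sgn k ((q - 1) * (r - 1)) • (pre (pre x z) y - pre x (pre z y))
  assoc_self : ∀ q x, ∀ y ∈ gr q, Even q ∨ ringChar k = 2 → pre (pre x y) y = pre x (pre y y)
  homotopy : ∀ p q r, ∀ x ∈ gr p, ∀ y ∈ gr q, ∀ z ∈ gr r, d x = 0 → d y = 0 → d z = 0 →
    pre x (cup y z) - cup (pre x y) z - sgn k ((p - 1) * q) • cup y (pre x z) ∈ LinearMap.range d

namespace IsBraceAlgebra

variable {gr : ℤ → Submodule k V} {d : V →ₗ[k] V} {cup pre br : V →ₗ[k] V →ₗ[k] V} {one iota : V}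
  (h : IsBraceAlgebra gr d cup pre br one iota)
include h

lemma m_mem : cup iota iota ∈ gr 2 := h.cup_mem 1 1 _ h.iota_mem _ h.iota_mem

lemma m_pre {p : ℤ} {x : V} (hx : x ∈ gr p) :
    pre (cup iota iota) x = cup iota x - sgn k p • cup x iota := by
  rw [h.cup_pre 1 p _ _ h.iota_mem _ hx, h.iota_pre, one_mul, sgn_sub, sgn_one]
  module

lemma d_apply {p : ℤ} {x : V} (hx : x ∈ gr p) :
    d x = cup iota x - sgn k p • cup x iota + sgn k p • pre x (cup iota iota) := by
  rw [h.d_eq, h.br_eq 2 p _ h.m_mem _ hx, h.m_pre hx,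
    show (2 - 1) * (p - 1) = p - 1 by ring, sgn_sub, sgn_one]
  module

lemma d_mem {p : ℤ} {x : V} (hx : x ∈ gr p) : d x ∈ gr (p + 1) := by
  rw [h.d_apply hx]
  refine add_mem (sub_mem ?_ (Submodule.smul_mem _ _ ?_)) (Submodule.smul_mem _ _ ?_)
  · rw [add_comm]; exact h.cup_mem _ _ _ h.iota_mem _ hx
  · exact h.cup_mem _ _ _ hx _ h.iota_mem
  · have := h.pre_mem _ _ _ hx _ h.m_mem
    rwa [show p + 2 - 1 = p + 1 by ring] at this

lemma cup_pre_m (x : V) {q : ℤ} {y : V} (hy : y ∈ gr q) : pre (cup x y) (cup iota iota) =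
    cup x (pre y (cup iota iota)) + sgn k q • cup (pre x (cup iota iota)) y := by
  rw [h.cup_pre q 2 x y hy _ h.m_mem, show q * (2 - 1) = q by ring]

theorem leibniz {p : ℤ} {x : V} (hx : x ∈ gr p) (y : V) :
    d (cup x y) = cup (d x) y + sgn k p • cup x (d y) := by
  refine graded_induction h.isInternal (by simp) (fun y z hy hz => ?_) (fun q y hy => ?_) y
  · simp only [map_add, hy, hz, smul_add]; abel
  · rw [h.d_apply hx, h.d_apply hy, h.d_apply (h.cup_mem _ _ _ hx _ hy), h.cup_pre_m x hy]
    simp only [map_add, map_sub, map_smul, LinearMap.add_apply, LinearMap.sub_apply,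
      LinearMap.smul_apply, h.cup_assoc, sgn_add, smul_add, smul_sub, smul_smul]
    have := sgn_mul_self (k := k) q
    match_scalars <;> grind

/-- The differential squares to zero because `m{m} = 0`, which is the associativity of the cup
product applied to `iota`, and because `x{m}{m} = x{m{m}}`. -/
theorem d_d (x : V) : d (d x) = 0 := by
  refine graded_induction h.isInternal (by simp) (fun y z hy hz => by simp [hy, hz])
    (fun p x hx => ?_) x
  have hm : pre (cup iota iota) (cup iota iota) = 0 := by
    rw [h.m_pre h.m_mem, sgn_even even_two, one_smul, h.cup_assoc, sub_self]
  have e := h.assoc_self 2 x _ h.m_mem (.inl even_two)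
  rw [hm, map_zero] at e
  rw [h.d_apply (h.d_mem hx), h.d_apply hx]
  simp only [map_add, map_sub, map_smul, LinearMap.add_apply, LinearMap.sub_apply,
    LinearMap.smul_apply, h.cup_pre_m _ hx, h.cup_pre_m _ h.iota_mem, h.iota_pre, e, h.cup_assoc,
    sgn_succ, sgn_one]
  have := sgn_mul_self (k := k) p
  match_scalars <;> grind

/-- The pre-Lie product is a null homotopy for the graded commutator of the cup product. -/
theorem d_pre {p q : ℤ} {x y : V} (hx : x ∈ gr p) (hy : y ∈ gr q) :
    d (pre x y) = pre (d x) y - sgn k p • pre x (d y) +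
      sgn k p • (cup x y - sgn k (p * q) • cup y x) := by
  have e1 := h.assoc_symm q 2 x y hy _ h.m_mem
  have s1 : sgn k ((q - 1) * (2 - 1)) = - sgn k q := by
    rw [show (q - 1) * (2 - 1) = q - 1 by ring, sgn_sub, sgn_one, mul_neg_one]
  have e2 := h.cup_pre p q iota x hx y hy
  have e3 := h.cup_pre 1 q x iota h.iota_mem y hy
  rw [h.iota_pre] at e2 e3
  rw [show p * (q - 1) = p * q - p by ring, sgn_sub] at e2
  rw [one_mul, sgn_sub, sgn_one] at e3
  rw [s1] at e1
  rw [h.d_apply (h.pre_mem _ _ _ hx _ hy), h.d_apply hx, h.d_eq y,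
    h.br_eq 2 q _ h.m_mem _ hy]
  simp only [map_add, map_sub, map_smul, LinearMap.add_apply, LinearMap.sub_apply,
    LinearMap.smul_apply, e2, e3]
  rw [show (2 - 1) * (q - 1) = q - 1 by ring, sgn_sub, sgn_sub, sgn_add, sgn_one]
  have hp := sgn_mul_self (k := k) p
  have hq := sgn_mul_self (k := k) q
  linear_combination (norm := skip) (-(sgn k p * sgn k q)) • e1
  match_scalars <;> grind

theorem d_br {p q : ℤ} {x y : V} (hx : x ∈ gr p) (hy : y ∈ gr q) :
    d (br x y) = br (d x) y - sgn k p • br x (d y) := by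
  rw [h.br_eq p q x hx y hy, h.br_eq _ _ _ (h.d_mem hx) _ hy, h.br_eq _ _ _ hx _ (h.d_mem hy),
    map_sub, map_smul, h.d_pre hx hy, h.d_pre hy hx, mul_comm q p]
  have s1 : sgn k ((p - 1) * (q - 1)) = - (sgn k (p * q) * sgn k p * sgn k q) := by
    rw [← sgn_add, ← sgn_add, ← sgn_succ]
    exact sgn_congr (by push_cast; grind)
  have s2 : sgn k ((p + 1 - 1) * (q - 1)) = sgn k (p * q) * sgn k p := by
    rw [← sgn_add]
    exact sgn_congr (by push_cast; grind)
  have s3 : sgn k ((p - 1) * (q + 1 - 1)) = sgn k (p * q) * sgn k q := by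
    rw [← sgn_add]
    exact sgn_congr (by push_cast; grind)
  rw [s1, s2, s3]
  have hp := sgn_mul_self (k := k) p
  have hq := sgn_mul_self (k := k) q
  have hpq := sgn_mul_self (k := k) (p * q)
  match_scalars <;> grind

theorem br_antisymm {p q : ℤ} {x y : V} (hx : x ∈ gr p) (hy : y ∈ gr q) :
    br x y = -(sgn k ((p - 1) * (q - 1)) • br y x) := by
  rw [h.br_eq p q x hx y hy, h.br_eq q p y hy x hx, mul_comm (q - 1) (p - 1)]
  have := sgn_mul_self (k := k) ((p - 1) * (q - 1))
  match_scalars <;> grind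

lemma br_mem {p q : ℤ} {x y : V} (hx : x ∈ gr p) (hy : y ∈ gr q) : br x y ∈ gr (p + q - 1) := by
  rw [h.br_eq p q x hx y hy]
  refine sub_mem (h.pre_mem _ _ _ hx _ hy) (Submodule.smul_mem _ _ ?_)
  rw [add_comm p q]
  exact h.pre_mem _ _ _ hy _ hx

theorem br_self_odd {n : ℤ} (hn : Odd n) {x : V} (hx : x ∈ gr n) : br x x = 0 := by
  rw [h.br_eq n n x hx x hx, sgn_even (Even.mul_left (hn.sub_odd odd_one) _), one_smul, sub_self]

/-- For even `|x|` the bracket `[x, x]` is twice `x{x}`, and `x{x{x}} = x{x}{x}`; this avoids a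
division by three. -/
theorem br_self_even {n : ℤ} (hn : Even n) {x : V} (hx : x ∈ gr n) : br x (br x x) = 0 := by
  have e1 := h.br_eq n n x hx x hx
  rw [sgn_odd ((hn.sub_odd odd_one).mul (hn.sub_odd odd_one)), neg_one_smul, sub_neg_eq_add] at e1
  rw [e1, map_add, h.br_eq _ _ x hx _ (h.pre_mem n n x hx x hx), h.assoc_self n x x hx (.inl hn),
    sgn_even (Even.mul_left ⟨n - 1, by ring⟩ _), one_smul, sub_self, add_zero]

theorem br_jacobi {p q : ℤ} {x y : V} (hx : x ∈ gr p) (hy : y ∈ gr q) (z : V) :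
    br x (br y z) = br (br x y) z + sgn k ((p - 1) * (q - 1)) • br y (br x z) := by
  refine graded_induction h.isInternal (by simp) (fun y z hy hz => ?_) (fun r z hz => ?_) z
  · simp only [map_add, hy, hz, smul_add]; abel
  · rw [h.br_eq _ _ _ hx _ (h.br_mem hy hz), h.br_eq _ _ _ (h.br_mem hx hy) _ hz,
      h.br_eq _ _ _ hy _ (h.br_mem hx hz), h.br_eq _ _ _ hx _ hy, h.br_eq _ _ _ hx _ hz,
      h.br_eq _ _ _ hy _ hz]
    have e1 := h.assoc_symm q r x y hy z hz
    have e2 := h.assoc_symm p r y x hx z hz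
    have e3 := h.assoc_symm p q z x hx y hy
    have s1 : sgn k ((p - 1) * (q + r - 1 - 1)) =
        sgn k ((p - 1) * (q - 1)) * sgn k ((p - 1) * (r - 1)) := by
      rw [← sgn_add]
      exact congrArg _ (by ring)
    have s2 : sgn k ((q - 1) * (p + r - 1 - 1)) =
        sgn k ((p - 1) * (q - 1)) * sgn k ((q - 1) * (r - 1)) := by
      rw [← sgn_add]
      exact congrArg _ (by ring)
    have s3 : sgn k ((p + q - 1 - 1) * (r - 1)) =
        sgn k ((p - 1) * (r - 1)) * sgn k ((q - 1) * (r - 1)) := by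
      rw [← sgn_add]
      exact congrArg _ (by ring)
    rw [s1, s2, s3]
    have hp := sgn_mul_self (k := k) ((p - 1) * (q - 1))
    have hq := sgn_mul_self (k := k) ((p - 1) * (r - 1))
    have hr := sgn_mul_self (k := k) ((q - 1) * (r - 1))
    generalize sgn k ((p - 1) * (q - 1)) = a at *
    generalize sgn k ((p - 1) * (r - 1)) = b at *
    generalize sgn k ((q - 1) * (r - 1)) = c at *
    simp only [map_sub, map_smul, LinearMap.sub_apply, LinearMap.smul_apply]
    linear_combination (norm := skip) (-1 : k) • e1 + a • e2 - (b * c) • e3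
    match_scalars <;> grind

end IsBraceAlgebra

end BraceAlgebra

/-! ### The Gerstenhaber algebra of a brace algebra -/

section InducedStructure

variable {k V : Type*} [Field k] [AddCommGroup V] [Module k V]

namespace IsBraceAlgebra

variable {gr : ℤ → Submodule k V} {d : V →ₗ[k] V} {cup pre br : V →ₗ[k] V →ₗ[k] V} {one iota : V}
  (h : IsBraceAlgebra gr d cup pre br one iota)
include h

lemma d_mem' (p : ℤ) (x : V) (hx : x ∈ gr p) : d x ∈ gr (Equiv.addRight 1 p) := h.d_mem hx

lemma d_one : d one = 0 := by
  rw [h.d_apply h.one_mem, h.one_pre, h.cup_one, h.one_cup]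
  simp

lemma cup_cocycle (x y : V) (hx : d x = 0) (hy : d y = 0) : d (cup x y) = 0 := by
  refine cocycle_induction h.isInternal h.d_mem' (P := fun x => d (cup x y) = 0) (by simp)
    (fun x x' hx hx' => by simp [hx, hx']) (fun p x hx dx => ?_) hx
  rw [h.leibniz hx, dx, hy]
  simp

lemma cup_d_left (x y : V) (hy : d y = 0) : cup (d x) y ∈ LinearMap.range d := by
  refine graded_induction h.isInternal (by simp) (fun x x' hx hx' => ?_) (fun p x hx => ?_) x
  · simp only [map_add, LinearMap.add_apply]; exact add_mem hx hx'
  · exact ⟨cup x y, by rw [h.leibniz hx, hy]; simp⟩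

lemma cup_d_right (x y : V) (hx : d x = 0) : cup x (d y) ∈ LinearMap.range d := by
  refine cocycle_induction h.isInternal h.d_mem' (P := fun x => cup x (d y) ∈ LinearMap.range d)
    (by simp) (fun x x' hx hx' => ?_) (fun p x hx dx => ?_) hx
  · simp only [map_add, LinearMap.add_apply]; exact add_mem hx hx'
  · refine ⟨sgn k p • cup x y, ?_⟩
    rw [map_smul, h.leibniz hx, dx, map_zero, LinearMap.zero_apply, zero_add, smul_smul,
      sgn_mul_self, one_smul]

lemma br_cocycle (x y : V) (hx : d x = 0) (hy : d y = 0) : d (br x y) = 0 := by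
  refine cocycle_induction h.isInternal h.d_mem' (P := fun x => d (br x y) = 0) (by simp)
    (fun x x' hx hx' => by simp [hx, hx']) (fun p x hx dx => ?_) hx
  refine cocycle_induction h.isInternal h.d_mem' (P := fun y => d (br x y) = 0) (by simp)
    (fun x x' hx hx' => by simp [hx, hx']) (fun q y hy dy => ?_) hy
  rw [h.d_br hx hy, dx, dy]
  simp

lemma br_d_left (x y : V) (hy : d y = 0) : br (d x) y ∈ LinearMap.range d := by
  refine cocycle_induction h.isInternal h.d_mem' (P := fun y => br (d x) y ∈ LinearMap.range d)
    (by simp) (fun y y' hy hy' => ?_) (fun q y hy dy => ?_) hy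
  · rw [map_add]; exact add_mem hy hy'
  refine graded_induction h.isInternal (by simp) (fun x x' hx hx' => ?_) (fun p x hx => ?_) x
  · simp only [map_add, LinearMap.add_apply]; exact add_mem hx hx'
  · exact ⟨br x y, by rw [h.d_br hx hy, dy]; simp⟩

lemma br_d_right (x y : V) (hx : d x = 0) : br x (d y) ∈ LinearMap.range d := by
  refine cocycle_induction h.isInternal h.d_mem' (P := fun x => br x (d y) ∈ LinearMap.range d)
    (by simp) (fun x x' hx hx' => ?_) (fun p x hx dx => ?_) hx
  · simp only [map_add, LinearMap.add_apply]; exact add_mem hx hx'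
  refine graded_induction h.isInternal (by simp) (fun x x' hx hx' => ?_) (fun q y hy => ?_) y
  · simp only [map_add]; exact add_mem hx hx'
  · refine ⟨-(sgn k p • br x y), ?_⟩
    rw [map_neg, map_smul, h.d_br hx hy, dx, map_zero, LinearMap.zero_apply, zero_sub, smul_neg,
      neg_neg, smul_smul, sgn_mul_self, one_smul]

/-- The Gerstenhaber relation holds up to coboundaries. -/
theorem br_cup {p q : ℤ} {x y z : V} (hx : x ∈ gr p) (hy : y ∈ gr q) (dx : d x = 0) (dy : d y = 0)
    (dz : d z = 0) : br x (cup y z) - (cup (br x y) z + sgn k ((p - 1) * q) • cup y (br x z)) ∈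
      LinearMap.range d := by
  refine cocycle_induction h.isInternal h.d_mem' (P := fun z => br x (cup y z) -
    (cup (br x y) z + sgn k ((p - 1) * q) • cup y (br x z)) ∈ LinearMap.range d)
    (by simp) (fun z z' hz hz' => ?_) (fun r z hz dz => ?_) dz
  · have := add_mem hz hz'
    convert this using 1
    simp only [map_add, smul_add]
    abel
  · convert h.homotopy p q r x hx y hy z hz dx dy dz using 1
    rw [h.br_eq _ _ _ hx _ (h.cup_mem _ _ _ hy _ hz), h.br_eq _ _ _ hx _ hy,
      h.br_eq _ _ _ hx _ hz, h.cup_pre r p y z hz x hx]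
    have s1 : sgn k ((p - 1) * (q + r - 1)) = sgn k ((p - 1) * q) * sgn k ((p - 1) * (r - 1)) := by
      rw [← sgn_add]
      exact congrArg _ (by ring)
    have s2 : sgn k (r * (p - 1)) = sgn k ((p - 1) * (r - 1)) * sgn k (p - 1) := by
      rw [← sgn_add]
      exact congrArg _ (by ring)
    have s3 : sgn k ((p - 1) * (q - 1)) = sgn k ((p - 1) * q) * sgn k (p - 1) := by
      rw [← sgn_sub]
      exact congrArg _ (by ring)
    rw [s1, s2, s3]
    have hp := sgn_mul_self (k := k) ((p - 1) * (r - 1))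
    simp only [map_sub, map_smul, LinearMap.sub_apply, LinearMap.smul_apply]
    match_scalars <;> grind

section CharTwo

variable (h2 : ringChar k = 2)
include h2

lemma br_eq_of_ringChar (x y : V) : br x y = pre x y + pre y x := by
  refine graded_induction h.isInternal (by simp) (fun x x' hx hx' => ?_) (fun p x hx => ?_) x
  · simp only [map_add, LinearMap.add_apply, hx, hx']; abel
  refine graded_induction h.isInternal (by simp) (fun x x' hx hx' => ?_) (fun q y hy => ?_) y
  · simp only [map_add, LinearMap.add_apply, hx, hx']; abel
  rw [h.br_eq p q x hx y hy, sgn_of_ringChar h2, one_smul, sub_eq_iff_eq_add, add_assoc,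
    add_self_of_ringChar h2, add_zero]

lemma cup_pre_of_ringChar (x y z : V) : pre (cup x y) z = cup x (pre y z) + cup (pre x z) y := by
  refine graded_induction h.isInternal (by simp) (fun y y' hy hy' => ?_) (fun q y hy => ?_) y
  · simp only [map_add, LinearMap.add_apply, hy, hy']; abel
  refine graded_induction h.isInternal (by simp) (fun z z' hz hz' => ?_) (fun r z hz => ?_) z
  · simp only [map_add, LinearMap.add_apply, hz, hz']; abel
  rw [h.cup_pre q r x y hy z hz, sgn_of_ringChar h2, one_smul]

lemma assoc_symm_of_ringChar (x y z : V) :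
    pre (pre x y) z - pre x (pre y z) = pre (pre x z) y - pre x (pre z y) := by
  refine graded_induction h.isInternal (by simp) (fun y y' hy hy' => ?_) (fun q y hy => ?_) y
  · simp only [map_add, LinearMap.add_apply] at *
    linear_combination (norm := module) hy + hy'
  refine graded_induction h.isInternal (by simp) (fun z z' hz hz' => ?_) (fun r z hz => ?_) z
  · simp only [map_add, LinearMap.add_apply] at *
    linear_combination (norm := module) hz + hz'
  rw [h.assoc_symm q r x y hy z hz, sgn_of_ringChar h2, one_smul]

lemma assoc_self_of_ringChar (x y : V) : pre (pre x y) y = pre x (pre y y) := by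
  refine graded_induction h.isInternal (by simp) (fun y z hy hz => ?_)
    (fun q y hy => h.assoc_self q x y hy (.inr h2)) y
  have e := h.assoc_symm_of_ringChar h2 x y z
  have e' := add_self_of_ringChar h2 (pre (pre x z) y - pre x (pre z y))
  simp only [map_add, LinearMap.add_apply]
  linear_combination (norm := module) hy + hz + e + e'

lemma d_pre_of_ringChar (x y : V) :
    d (pre x y) = pre (d x) y + pre x (d y) + (cup x y + cup y x) := by
  refine graded_induction h.isInternal (by simp) (fun x x' hx hx' => ?_) (fun p x hx => ?_) x
  · simp only [map_add, LinearMap.add_apply, hx, hx']; abel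
  refine graded_induction h.isInternal (by simp) (fun x x' hx hx' => ?_) (fun q y hy => ?_) y
  · simp only [map_add, LinearMap.add_apply, hx, hx']; abel
  rw [h.d_pre hx hy]
  simp only [sgn_of_ringChar h2, one_smul]
  have e1 := add_self_of_ringChar h2 (pre x (d y))
  have e2 := add_self_of_ringChar h2 (cup y x)
  linear_combination (norm := module) -e1 - e2

/-- In characteristic two the Gerstenhaber square of any cocycle is a cocycle. -/
lemma d_pre_self (x : V) (hx : d x = 0) : d (pre x x) = 0 := by
  rw [h.d_pre_of_ringChar h2, hx, add_self_of_ringChar h2]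
  simp

lemma leibniz_of_ringChar (x y : V) : d (cup x y) = cup (d x) y + cup x (d y) := by
  refine graded_induction h.isInternal (by simp) (fun x x' hx hx' => ?_) (fun p x hx => ?_) x
  · simp only [map_add, LinearMap.add_apply, hx, hx']; abel
  rw [h.leibniz hx, sgn_of_ringChar h2, one_smul]

/-- In characteristic two the formula for the bracket with a Gerstenhaber square holds on cochains.
-/
lemma br_sq_of_ringChar (x y : V) : br (pre x x) y = br x (br x y) := by
  have e1 := h.assoc_self_of_ringChar h2 y x
  have e2 := h.assoc_symm_of_ringChar h2 x x y
  have e4 := add_self_of_ringChar h2 (pre x (pre y x))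
  simp only [h.br_eq_of_ringChar h2, map_add, LinearMap.add_apply]
  linear_combination (norm := module) e2 - e1 - e4

/-- In characteristic two the class of `x{x}` only depends on the class of `x`. -/
lemma pre_self_sub_mem {x y : V} (hx : d x = 0) (hxy : y - x ∈ LinearMap.range d) :
    pre y y - pre x x ∈ LinearMap.range d := by
  obtain ⟨w, hw⟩ := hxy
  obtain rfl : y = x + d w := by rw [hw]; abel
  have e1 : pre x (d w) + pre (d w) x ∈ LinearMap.range d := by
    rw [← h.br_eq_of_ringChar h2]
    exact h.br_d_right x w hx
  have e2 : pre (d w) (d w) = d (pre w (d w) + cup w w) := by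
    have e3 := add_self_of_ringChar h2 (cup (d w) w)
    have e4 := add_self_of_ringChar h2 (cup w (d w))
    rw [map_add, h.d_pre_of_ringChar h2, h.leibniz_of_ringChar h2, h.d_d, map_zero]
    linear_combination (norm := module) -e3 - e4
  have : pre (x + d w) (x + d w) - pre x x = (pre x (d w) + pre (d w) x) + pre (d w) (d w) := by
    simp only [map_add, LinearMap.add_apply]; abel
  rw [this]
  exact add_mem e1 (e2 ▸ LinearMap.mem_range_self d _)

lemma pre_cup_of_ringChar {x y z : V} (hx : d x = 0) (hy : d y = 0) (hz : d z = 0) :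
    pre x (cup y z) - (cup (pre x y) z + cup y (pre x z)) ∈ LinearMap.range d := by
  refine cocycle_induction h.isInternal h.d_mem' (P := fun x =>
    pre x (cup y z) - (cup (pre x y) z + cup y (pre x z)) ∈ LinearMap.range d) (by simp)
    (fun x x' hx hx' => ?_) (fun p x hx dx => ?_) hx
  · convert add_mem hx hx' using 1
    simp only [map_add, LinearMap.add_apply]; abel
  refine cocycle_induction h.isInternal h.d_mem' (P := fun y =>
    pre x (cup y z) - (cup (pre x y) z + cup y (pre x z)) ∈ LinearMap.range d) (by simp)
    (fun x x' hx hx' => ?_) (fun q y hy dy => ?_) hy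
  · convert add_mem hx hx' using 1
    simp only [map_add, LinearMap.add_apply]; abel
  refine cocycle_induction h.isInternal h.d_mem' (P := fun z =>
    pre x (cup y z) - (cup (pre x y) z + cup y (pre x z)) ∈ LinearMap.range d) (by simp)
    (fun x x' hx hx' => ?_) (fun r z hz dz => ?_) hz
  · convert add_mem hx hx' using 1
    simp only [map_add]; abel
  have := h.homotopy p q r x hx y hy z hz dx dy dz
  rwa [sgn_of_ringChar h2, one_smul, sub_sub] at this

/-- In characteristic two the formula for the Gerstenhaber square of a product holds up to
coboundaries. -/
lemma pre_cup_self_of_ringChar {x y : V} (hx : d x = 0) (hy : d y = 0) :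
    pre (cup x y) (cup x y) - (cup (pre x x) (cup y y) + cup (cup x (br x y)) y +
      cup (cup x x) (pre y y)) ∈ LinearMap.range d := by
  obtain ⟨u, hu⟩ := h.pre_cup_of_ringChar h2 hy hx hy
  obtain ⟨v, hv⟩ := h.pre_cup_of_ringChar h2 hx hx hy
  convert add_mem (h.cup_d_right x u hx) (h.cup_d_left v y hy) using 1
  rw [hu, hv, h.cup_pre_of_ringChar h2, h.br_eq_of_ringChar h2]
  simp only [map_add, map_sub, LinearMap.add_apply, LinearMap.sub_apply, h.cup_assoc]
  abel

end CharTwo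

open Classical in
/-- The cohomology of a brace algebra is a Gerstenhaber algebra. -/
theorem exists_gerstenhaberAlgebra :
    ∃ G : GerstenhaberAlgebra fun n => cohPart d (gr n), G.IsInducedBy gr cup br pre := by
  have rm {x y : V} {a b : Coh d} (ha : Represents d x a) (hb : Represents d y b) :=
    Represents.cohMap₂ h.cup_cocycle h.cup_d_left h.cup_d_right ha hb
  have rb {x y : V} {a b : Coh d} (ha : Represents d x a) (hb : Represents d y b) :=
    Represents.cohMap₂ h.br_cocycle h.br_d_left h.br_d_right ha hb
  choose rep hrep using exists_represents (d := d)
  -- outside of characteristic two, half of the bracket extends the square to all degrees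
  let sq : Coh d → Coh d := fun a =>
    if h2 : ringChar k = 2 then
      Submodule.Quotient.mk ⟨pre (rep a) (rep a), h.d_pre_self h2 _ (hrep a).d_eq_zero⟩
    else (2⁻¹ : k) • cohMap₂ br h.br_cocycle h.br_d_left h.br_d_right a a
  have hsq (h2 : ringChar k = 2) {x : V} {a : Coh d} (ha : Represents d x a) :
      Represents d (pre x x) (sq a) := by
    have : Represents d (pre (rep a) (rep a)) (sq a) := by
      simp only [sq, dif_pos h2]
      exact ⟨_, rfl⟩
    exact this.add_range (h.d_pre_self h2 _ ha.d_eq_zero)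
      (h.pre_self_sub_mem h2 (hrep a).d_eq_zero (ha.sub_mem (hrep a)))
  refine ⟨{
    isInternal := isInternal_cohPart h.isInternal h.d_mem'
    mul := cohMap₂ cup h.cup_cocycle h.cup_d_left h.cup_d_right
    mul_mem := ?_
    mul_assoc := ?_
    mul_comm := ?_
    bracket := cohMap₂ br h.br_cocycle h.br_d_left h.br_d_right
    isShiftedLieBracket := ⟨?_, ?_, ?_, ?_, ?_⟩
    gerstenhaberRelation := ?_
    sq := sq
    sq_mem := ?_
    sq_add := ?_
    sq_mul := ?_
    bracket_sq := ?_
    sq_even := ?_ }, ⟨fun x y a b => rm, fun x y a b => rb, fun x a hx ha => ?_⟩⟩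
  · intro m n a ha b hb
    obtain ⟨x, hx, ha⟩ := mem_cohPart.1 ha
    obtain ⟨y, hy, hb⟩ := mem_cohPart.1 hb
    exact mem_cohPart.2 ⟨_, h.cup_mem _ _ _ hx _ hy, rm ha hb⟩
  · intro a b c
    have := rm (rm (hrep a) (hrep b)) (hrep c)
    rw [h.cup_assoc] at this
    exact this.unique' (rm (hrep a) (rm (hrep b) (hrep c)))
  · intro m n a ha b hb
    obtain ⟨x, hx, ha⟩ := mem_cohPart.1 ha
    obtain ⟨y, hy, hb⟩ := mem_cohPart.1 hb
    refine (rm ha hb).unique ((rm hb ha).smul _) ⟨sgn k m • pre x y, ?_⟩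
    rw [map_smul, h.d_pre hx hy, ha.d_eq_zero, hb.d_eq_zero, map_zero, map_zero,
      LinearMap.zero_apply, smul_zero, sub_zero, zero_add, smul_smul, sgn_mul_self, one_smul]
  · intro m n a ha b hb
    obtain ⟨x, hx, ha⟩ := mem_cohPart.1 ha
    obtain ⟨y, hy, hb⟩ := mem_cohPart.1 hb
    exact mem_cohPart.2 ⟨_, h.br_mem hx hy, rb ha hb⟩
  · intro n hn a ha
    obtain ⟨x, hx, ha⟩ := mem_cohPart.1 ha
    have := rb ha ha
    rw [h.br_self_odd hn hx] at this
    exact this.unique' .zero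
  · intro n hn a ha
    obtain ⟨x, hx, ha⟩ := mem_cohPart.1 ha
    have := rb ha (rb ha ha)
    rw [h.br_self_even hn hx] at this
    exact this.unique' .zero
  · intro m n a ha b hb
    obtain ⟨x, hx, ha⟩ := mem_cohPart.1 ha
    obtain ⟨y, hy, hb⟩ := mem_cohPart.1 hb
    have := rb ha hb
    rw [h.br_antisymm hx hy] at this
    exact this.unique' ((rb hb ha).smul _).neg
  · intro m n a ha b hb c
    obtain ⟨x, hx, ha⟩ := mem_cohPart.1 ha
    obtain ⟨y, hy, hb⟩ := mem_cohPart.1 hb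
    have := rb ha (rb hb (hrep c))
    rw [h.br_jacobi hx hy] at this
    exact this.unique' ((rb (rb ha hb) (hrep c)).add ((rb hb (rb ha (hrep c))).smul _))
  · intro m n a ha b hb c
    obtain ⟨x, hx, ha⟩ := mem_cohPart.1 ha
    obtain ⟨y, hy, hb⟩ := mem_cohPart.1 hb
    exact (rb ha (rm hb (hrep c))).unique
      ((rm (rb ha hb) (hrep c)).add ((rm hb (rb ha (hrep c))).smul _))
      (h.br_cup hx hy ha.d_eq_zero hb.d_eq_zero (hrep c).d_eq_zero)
  · intro h2 n a ha
    obtain ⟨x, hx, ha⟩ := mem_cohPart.1 ha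
    have := h.pre_mem _ _ _ hx _ hx
    rw [← two_mul] at this
    exact mem_cohPart.2 ⟨_, this, hsq h2 ha⟩
  · intro h2 a b
    have := hsq h2 ((hrep a).add (hrep b))
    refine this.unique' ?_
    have := ((hsq h2 (hrep a)).add (hsq h2 (hrep b))).add (rb (hrep a) (hrep b))
    rw [h.br_eq_of_ringChar h2] at this
    convert this using 1
    simp only [map_add, LinearMap.add_apply]
    abel
  · intro h2 a b
    exact (hsq h2 (rm (hrep a) (hrep b))).unique
      (((rm (hsq h2 (hrep a)) (rm (hrep b) (hrep b))).add
        (rm (rm (hrep a) (rb (hrep a) (hrep b))) (hrep b))).add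
        (rm (rm (hrep a) (hrep a)) (hsq h2 (hrep b))))
      (h.pre_cup_self_of_ringChar h2 (hrep a).d_eq_zero (hrep b).d_eq_zero)
  · intro h2 a b
    have := rb (hsq h2 (hrep a)) (hrep b)
    rw [h.br_sq_of_ringChar h2] at this
    exact this.unique' (rb (hrep a) (rb (hrep a) (hrep b)))
  · intro h2 n hn a ha
    simp only [sq, dif_neg h2]
  · by_cases h2 : ringChar k = 2
    · exact hsq h2 ha
    · obtain ⟨n, hn, hx⟩ := hx.resolve_left h2
      have e := (rb ha ha).smul (2⁻¹ : k)
      have h20 : (2 : k) ≠ 0 := Ring.two_ne_zero h2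
      rw [h.br_eq n n x hx x hx, sgn_odd ((hn.sub_odd odd_one).mul (hn.sub_odd odd_one)),
        neg_one_smul, sub_neg_eq_add, ← two_smul k, smul_smul, inv_mul_cancel₀ h20, one_smul] at e
      simp only [sq, dif_neg h2]
      exact e

end IsBraceAlgebra

@[elab_as_elim]
lemma totalGr_cocycle_induction {gr : ℤ × ℤ → Submodule k V} {d : V →ₗ[k] V}
    (h : DirectSum.IsInternal gr) {s : ℤ × ℤ ≃ ℤ × ℤ} (hd : ∀ i, ∀ x ∈ gr i, d x ∈ gr (s i))
    {n : ℤ} {P : V → Prop} (h_zero : P 0) (h_add : ∀ x y, P x → P y → P (x + y))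
    (h_mem : ∀ i, i.1 + i.2 = n → ∀ x ∈ gr i, d x = 0 → P x) {x : V} (hx : x ∈ totalGr gr n)
    (dx : d x = 0) : P x := by
  have : x ∈ totalGr (fun i => gr i ⊓ LinearMap.ker d) n := by
    refine mem_iSup_gradedProj h _ fun i => ?_
    by_cases hi : i.1 + i.2 = n
    · refine Submodule.mem_iSup_of_mem hi ⟨gradedProj_mem h i x, LinearMap.mem_ker.2 ?_⟩
      rw [d_gradedProj h hd, dx, map_zero]
    · have : gradedProj h i x = 0 := by
        refine totalGr_induction (by simp) (fun x y hx hy => by rw [map_add, hx, hy, add_zero])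
          (fun j hj x hx => ?_) hx
        refine gradedProj_ne h ?_ hx
        rintro rfl
        exact hi hj
      rw [this]
      exact zero_mem _
  exact totalGr_induction (gr := fun i => gr i ⊓ LinearMap.ker d) (P := P) h_zero h_add
    (fun i hi x hx => h_mem i hi x hx.1 hx.2) this

/-- Passing to the total degree commutes with passing to cohomology. -/
lemma totalGr_cohPart {gr : ℤ × ℤ → Submodule k V} {d : V →ₗ[k] V}
    (h : DirectSum.IsInternal gr) {s : ℤ × ℤ ≃ ℤ × ℤ}
    (hd : ∀ i, ∀ x ∈ gr i, d x ∈ gr (s i)) :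
    totalGr (fun i => cohPart d (gr i)) = fun n => cohPart d (totalGr gr n) := by
  funext n
  refine le_antisymm (totalGr_le fun i hi => ?_) fun a ha => ?_
  · rintro a ha
    obtain ⟨x, hx, ha⟩ := mem_cohPart.1 ha
    exact mem_cohPart.2 ⟨x, mem_totalGr' hx hi, ha⟩
  · obtain ⟨x, hx, ha⟩ := mem_cohPart.1 ha
    suffices d x = 0 ∧ ∀ a, Represents d x a → a ∈ totalGr (fun i => cohPart d (gr i)) n from
      this.2 a ha
    refine totalGr_cocycle_induction h hd (P := fun x => d x = 0 ∧ ∀ a, Represents d x a →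
        a ∈ totalGr (fun i => cohPart d (gr i)) n) ?_ (fun x y hx hy => ?_)
        (fun i hi x hx dx => ?_) hx ha.d_eq_zero
    · refine ⟨by simp, fun a ha => ?_⟩
      rw [ha.unique' .zero]
      exact zero_mem _
    · refine ⟨by simp [hx.1, hy.1], fun a ha => ?_⟩
      obtain ⟨b, hb⟩ := Represents.of_d_eq_zero hx.1
      obtain ⟨c, hc⟩ := Represents.of_d_eq_zero hy.1
      rw [ha.unique' (hb.add hc)]
      exact add_mem (hx.2 b hb) (hy.2 c hc)
    · exact ⟨dx, fun a ha => mem_totalGr' (gr := fun i => cohPart d (gr i))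
        (mem_cohPart.2 ⟨x, hx, ha⟩) hi⟩

/-- The structure of `IsBraceAlgebra`, for a bigraded space: `cup` preserves bidegrees, `pre` has
bidegree `(-1, 0)`, and the signs are those of the total degree. -/
structure IsBigradedBraceAlgebra (gr : ℤ × ℤ → Submodule k V) (d : V →ₗ[k] V)
    (cup pre br : V →ₗ[k] V →ₗ[k] V) (one iota : V) : Prop where
  isInternal : DirectSum.IsInternal gr
  cup_mem : ∀ i j, ∀ x ∈ gr i, ∀ y ∈ gr j, cup x y ∈ gr (i + j)
  pre_mem : ∀ i j, ∀ x ∈ gr i, ∀ y ∈ gr j, pre x y ∈ gr (i + j - (1, 0))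
  iota_mem : iota ∈ gr (1, 0)
  cup_assoc : ∀ x y z, cup (cup x y) z = cup x (cup y z)
  one_cup : ∀ x, cup one x = x
  cup_one : ∀ x, cup x one = x
  one_mem : one ∈ gr 0
  one_pre : ∀ x, pre one x = 0
  iota_pre : ∀ x, pre iota x = x
  br_eq : ∀ i j, ∀ x ∈ gr i, ∀ y ∈ gr j,
    br x y = pre x y - sgn k ((i.1 + i.2 - 1) * (j.1 + j.2 - 1)) • pre y x
  d_eq : ∀ x, d x = br (cup iota iota) x
  cup_pre : ∀ i j x, ∀ y ∈ gr i, ∀ z ∈ gr j, pre (cup x y) z =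
    cup x (pre y z) + sgn k ((i.1 + i.2) * (j.1 + j.2 - 1)) • cup (pre x z) y
  assoc_symm : ∀ i j x, ∀ y ∈ gr i, ∀ z ∈ gr j, pre (pre x y) z - pre x (pre y z) =
    sgn k ((i.1 + i.2 - 1) * (j.1 + j.2 - 1)) • (pre (pre x z) y - pre x (pre z y))
  assoc_self : ∀ i x, ∀ y ∈ gr i, Even (i.1 + i.2) ∨ ringChar k = 2 →
    pre (pre x y) y = pre x (pre y y)
  homotopy : ∀ l i j, ∀ x ∈ gr l, ∀ y ∈ gr i, ∀ z ∈ gr j, d x = 0 → d y = 0 → d z = 0 →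
    pre x (cup y z) - cup (pre x y) z -
      sgn k ((l.1 + l.2 - 1) * (i.1 + i.2)) • cup y (pre x z) ∈ LinearMap.range d

namespace IsBigradedBraceAlgebra

variable {gr : ℤ × ℤ → Submodule k V} {d : V →ₗ[k] V} {cup pre br : V →ₗ[k] V →ₗ[k] V}
  {one iota : V} (h : IsBigradedBraceAlgebra gr d cup pre br one iota)
include h

lemma d_mem (i : ℤ × ℤ) (x : V) (hx : x ∈ gr i) : d x ∈ gr (Equiv.addRight (1, 0) i) := by
  have hm : cup iota iota ∈ gr (2, 0) := h.cup_mem (1, 0) (1, 0) _ h.iota_mem _ h.iota_mem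
  rw [h.d_eq, h.br_eq _ _ _ hm _ hx]
  have e1 := h.pre_mem _ _ _ hm _ hx
  have e2 := h.pre_mem _ _ _ hx _ hm
  have : i + (2, 0) - (1, 0) = Equiv.addRight (1, 0) i := by
    ext <;> simp
    ring
  rw [this] at e2
  rw [add_comm, this] at e1
  exact sub_mem e1 (Submodule.smul_mem _ _ e2)

theorem isBraceAlgebra : IsBraceAlgebra (totalGr gr) d cup pre br one iota where
  isInternal := isInternal_totalGr h.isInternal
  cup_mem p q x hx y hy := by
    refine totalGr_induction (P := fun x => cup x y ∈ totalGr gr (p + q)) (by simp)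
      (fun x x' hx hx' => ?_) (fun i hi x hx => ?_) hx
    · rw [map_add]; exact add_mem hx hx'
    refine totalGr_induction (P := fun y => cup x y ∈ totalGr gr (p + q)) (by simp)
      (fun x x' hx hx' => ?_) (fun j hj y hy => ?_) hy
    · rw [map_add]; exact add_mem hx hx'
    refine mem_totalGr' (h.cup_mem _ _ _ hx _ hy) ?_
    rw [← hi, ← hj, Prod.fst_add, Prod.snd_add]
    ring
  pre_mem p q x hx y hy := by
    refine totalGr_induction (P := fun x => pre x y ∈ totalGr gr (p + q - 1)) (by simp)
      (fun x x' hx hx' => ?_) (fun i hi x hx => ?_) hx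
    · rw [map_add]; exact add_mem hx hx'
    refine totalGr_induction (P := fun y => pre x y ∈ totalGr gr (p + q - 1)) (by simp)
      (fun x x' hx hx' => ?_) (fun j hj y hy => ?_) hy
    · rw [map_add]; exact add_mem hx hx'
    refine mem_totalGr' (h.pre_mem _ _ _ hx _ hy) ?_
    rw [← hi, ← hj, Prod.fst_sub, Prod.snd_sub, Prod.fst_add, Prod.snd_add]
    ring
  iota_mem := mem_totalGr' h.iota_mem (by simp)
  cup_assoc := h.cup_assoc
  one_cup := h.one_cup
  cup_one := h.cup_one
  one_mem := mem_totalGr' h.one_mem (by simp)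
  one_pre := h.one_pre
  iota_pre := h.iota_pre
  br_eq p q x hx y hy := by
    refine totalGr_induction (P := fun x => br x y = pre x y - sgn k ((p - 1) * (q - 1)) • pre y x)
      (by simp) (fun x x' hx hx' => ?_) (fun i hi x hx => ?_) hx
    · simp only [map_add, LinearMap.add_apply, hx, hx', smul_add]; abel
    refine totalGr_induction (P := fun y => br x y = pre x y - sgn k ((p - 1) * (q - 1)) • pre y x)
      (by simp) (fun x x' hx hx' => ?_) (fun j hj y hy => ?_) hy
    · simp only [map_add, LinearMap.add_apply, hx, hx', smul_add]; abel
    rw [h.br_eq i j x hx y hy, hi, hj]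
  d_eq := h.d_eq
  cup_pre q r x y hy z hz := by
    refine totalGr_induction (P := fun y => pre (cup x y) z = cup x (pre y z) +
      sgn k (q * (r - 1)) • cup (pre x z) y)
      (by simp) (fun x x' hx hx' => ?_) (fun i hi y hy => ?_) hy
    · simp only [map_add, LinearMap.add_apply, hx, hx', smul_add]; abel
    refine totalGr_induction (P := fun z => pre (cup x y) z = cup x (pre y z) +
      sgn k (q * (r - 1)) • cup (pre x z) y)
      (by simp) (fun x x' hx hx' => ?_) (fun j hj z hz => ?_) hz
    · simp only [map_add, LinearMap.add_apply, hx, hx', smul_add]; abel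
    rw [h.cup_pre i j x y hy z hz, hi, hj]
  assoc_symm q r x y hy z hz := by
    refine totalGr_induction (P := fun y => pre (pre x y) z - pre x (pre y z) =
      sgn k ((q - 1) * (r - 1)) • (pre (pre x z) y - pre x (pre z y)))
      (by simp) (fun x x' hx hx' => ?_) (fun i hi y hy => ?_) hy
    · simp only [map_add, LinearMap.add_apply]
      linear_combination (norm := module) hx + hx'
    refine totalGr_induction (P := fun z => pre (pre x y) z - pre x (pre y z) =
      sgn k ((q - 1) * (r - 1)) • (pre (pre x z) y - pre x (pre z y)))
      (by simp) (fun x x' hx hx' => ?_) (fun j hj z hz => ?_) hz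
    · simp only [map_add, LinearMap.add_apply]
      linear_combination (norm := module) hx + hx'
    rw [h.assoc_symm i j x y hy z hz, hi, hj]
  assoc_self q x y hy hq := by
    have hs : sgn k ((q - 1) * (q - 1)) = -1 := by
      rcases hq with hq | hq
      · exact sgn_odd ((hq.sub_odd odd_one).mul (hq.sub_odd odd_one))
      · have : CharP k 2 := ringChar.of_eq hq
        rw [sgn_of_ringChar hq, CharTwo.neg_eq]
    -- the cross terms of two bihomogeneous components cancel by the pre-Lie identity
    have hsymm : ∀ y ∈ totalGr gr q, ∀ z ∈ totalGr gr q,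
        pre (pre x y) z - pre x (pre y z) + (pre (pre x z) y - pre x (pre z y)) = 0 := by
      intro y hy z hz
      refine totalGr_induction (P := fun y => pre (pre x y) z - pre x (pre y z) +
        (pre (pre x z) y - pre x (pre z y)) = 0)
        (by simp) (fun x x' hx hx' => ?_) (fun i hi y hy => ?_) hy
      · simp only [map_add, LinearMap.add_apply]
        linear_combination (norm := module) hx + hx'
      refine totalGr_induction (P := fun z => pre (pre x y) z - pre x (pre y z) +
        (pre (pre x z) y - pre x (pre z y)) = 0)
        (by simp) (fun x x' hx hx' => ?_) (fun j hj z hz => ?_) hz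
      · simp only [map_add, LinearMap.add_apply]
        linear_combination (norm := module) hx + hx'
      rw [h.assoc_symm i j x y hy z hz, hi, hj, hs, neg_one_smul, neg_add_cancel]
    -- the quadratic identity extends to sums, as its polarization `hsymm` holds
    suffices y ∈ totalGr gr q ∧ pre (pre x y) y = pre x (pre y y) from this.2
    refine totalGr_induction (P := fun y => y ∈ totalGr gr q ∧ pre (pre x y) y = pre x (pre y y))
      (by simp) (fun y z hy hz => ⟨add_mem hy.1 hz.1, ?_⟩) (fun i hi y hy => ?_) hy
    · have := hsymm y hy.1 z hz.1
      simp only [map_add, LinearMap.add_apply]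
      linear_combination (norm := module) hy.2 + hz.2 + this
    · exact ⟨mem_totalGr' hy hi, h.assoc_self i x y hy (hi ▸ hq)⟩
  homotopy p q r x hx y hy z hz dx dy dz := by
    refine totalGr_cocycle_induction h.isInternal h.d_mem (P := fun x => pre x (cup y z) -
      cup (pre x y) z - sgn k ((p - 1) * q) • cup y (pre x z) ∈ LinearMap.range d) (by simp)
      (fun x x' hx hx' => ?_) (fun l hl x hx dx => ?_) hx dx
    · convert add_mem hx hx' using 1
      simp only [map_add, LinearMap.add_apply, smul_add]; abel
    refine totalGr_cocycle_induction h.isInternal h.d_mem (P := fun y => pre x (cup y z) -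
      cup (pre x y) z - sgn k ((p - 1) * q) • cup y (pre x z) ∈ LinearMap.range d) (by simp)
      (fun x x' hx hx' => ?_) (fun i hi y hy dy => ?_) hy dy
    · convert add_mem hx hx' using 1
      simp only [map_add, LinearMap.add_apply, smul_add]; abel
    refine totalGr_cocycle_induction h.isInternal h.d_mem (P := fun z => pre x (cup y z) -
      cup (pre x y) z - sgn k ((p - 1) * q) • cup y (pre x z) ∈ LinearMap.range d) (by simp)
      (fun x x' hx hx' => ?_) (fun j hj z hz dz => ?_) hz dz
    · convert add_mem hx hx' using 1
      simp only [map_add, smul_add]; abel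
    rw [← hl, ← hi]
    exact h.homotopy l i j x hx y hy z hz dx dy dz

theorem isDGAlgebra : IsDGAlgebra gr d cup one where
  isInternal := h.isInternal
  d_mem := h.d_mem
  d_d := h.isBraceAlgebra.d_d
  mul_mem := h.cup_mem
  one_mem := h.one_mem
  one_mul := h.one_cup
  mul_one := h.cup_one
  mul_assoc := h.cup_assoc
  leibniz _ _ hx y := h.isBraceAlgebra.leibniz (mem_totalGr hx) y

/-- The cohomology of a bigraded brace algebra is a Gerstenhaber algebra. -/
theorem exists_gerstenhaberAlgebra :
    ∃ G : GerstenhaberAlgebra (totalGr fun i => cohPart d (gr i)),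
      G.IsInducedBy (totalGr gr) cup br pre := by
  rw [totalGr_cohPart h.isInternal h.d_mem]
  exact h.isBraceAlgebra.exists_gerstenhaberAlgebra

end IsBigradedBraceAlgebra

end InducedStructure

/-! ### The Hochschild complex -/

section HochschildComplex

variable {k A : Type*} [Field k] [Ring A] [Algebra k A] {𝒜 : ℤ → Submodule k A}

/-- A Hochschild cochain as a multilinear function on lists. -/
noncomputable def HC.eval : HC 𝒜 →ₗ[k] List A → A := Tot.lift fun i => (HCdeg 𝒜 i).subtype

@[simp] lemma HC.eval_of (i : ℤ × ℤ) (c : HCdeg 𝒜 i) :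
    HC.eval (Tot.of k (fun i => HCdeg 𝒜 i) i c) = c := by
  simp [HC.eval]

lemma HC.eval_mem {i : ℤ × ℤ} {x : HC 𝒜} (hx : x ∈ homPart k (fun i => HCdeg 𝒜 i) i) :
    HC.eval x ∈ HCdeg 𝒜 i := by
  obtain ⟨c, rfl⟩ := hx
  rw [HC.eval_of]
  exact c.2

lemma HC.exists_eval_eq {i : ℤ × ℤ} {c : List A → A} (hc : c ∈ HCdeg 𝒜 i) :
    ∃ x ∈ homPart k (fun i => HCdeg 𝒜 i) i, HC.eval x = c :=
  ⟨_, Tot.of_mem i ⟨c, hc⟩, HC.eval_of i ⟨c, hc⟩⟩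

lemma HC.isML_eval (x : HC 𝒜) : IsML k (HC.eval x) := by
  refine graded_induction (isInternal_homPart k fun i => HCdeg 𝒜 i) ?_ (fun x y hx hy => ?_)
    (fun i x hx => (HC.eval_mem hx).1) x
  · rw [map_zero]
    exact fun _ _ => ⟨by simp, by simp⟩
  · rw [map_add]
    exact hx.add hy

variable [GradedAlgebra 𝒜]

/-- A cochain can be recovered from the function on lists: its components are told apart by the
length of the list and by the degree of the value. -/
lemma HC.eval_injective : Function.Injective (HC.eval (𝒜 := 𝒜)) := by
  have key (i : ℤ × ℤ) (l : List A) (n : ℤ) (hl : IsHomList 𝒜 l n) (hi : (l.length : ℤ) = i.1)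
      (x : HC 𝒜) :
      HC.eval (gradedProj (isInternal_homPart k fun i => HCdeg 𝒜 i) i x) l =
        GradedAlgebra.proj 𝒜 (n + i.2) (HC.eval x l) := by
    refine graded_induction (isInternal_homPart k fun i => HCdeg 𝒜 i) (by simp)
      (fun x y hx hy => by simp only [map_add, Pi.add_apply, hx, hy]) (fun j x hx => ?_) x
    obtain ⟨m, s, g⟩ := HC.eval_mem hx
    by_cases hj : j = i
    · subst hj
      rw [gradedProj_same _ hx, GradedAlgebra.proj_apply,
        DirectSum.decompose_of_mem_same _ (g l n hl)]
    · rw [gradedProj_ne _ hj hx, map_zero, Pi.zero_apply]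
      by_cases hj1 : j.1 = i.1
      · have : j.2 ≠ i.2 := fun h => hj (Prod.ext hj1 h)
        rw [GradedAlgebra.proj_apply, DirectSum.decompose_of_mem_ne _ (g l n hl) (by omega)]
      · rw [s l (by omega), map_zero]
  rw [← LinearMap.ker_eq_bot, LinearMap.ker_eq_bot']
  intro x hx
  suffices ∀ i, gradedProj (isInternal_homPart k fun i => HCdeg 𝒜 i) i x = 0 by
    have h := mem_iSup_gradedProj (isInternal_homPart k fun i => HCdeg 𝒜 i) (fun _ => ⊥)
      (x := x) fun i => by rw [this]; exact zero_mem _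
    simpa using h
  intro i
  have hi := gradedProj_mem (isInternal_homPart k fun i => HCdeg 𝒜 i) i x
  obtain ⟨c, hc⟩ := hi
  have e : HC.eval (gradedProj (isInternal_homPart k fun i => HCdeg 𝒜 i) i x) = c := by
    rw [← hc, HC.eval_of]
  suffices (c : List A → A) = 0 by
    rw [← hc, show c = 0 from Subtype.ext this, map_zero]
  refine IsML.ext_of_isHomList 𝒜 c.2.1 (fun _ _ => ⟨by simp, by simp⟩) fun l n hl => ?_
  by_cases hli : (l.length : ℤ) = i.1
  · rw [← e, key i l n hl hli, hx]
    simp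
  · exact c.2.2.1 l hli

lemma HC.eval_pre (x : HC 𝒜) {j : ℤ × ℤ} {y : HC 𝒜}
    (hy : y ∈ homPart k (fun i => HCdeg 𝒜 i) j) :
    HC.eval (hcPre 𝒜 x y) = ins 𝒜 j (HC.eval y) (HC.eval x) := by
  refine graded_induction (isInternal_homPart k fun i => HCdeg 𝒜 i) ?_ (fun x x' hx hx' => ?_)
    (fun i x hx => ?_) x
  · simpa using (ins_smul_right j (HC.eval y) (0 : k) (0 : List A → A)).symm
  · rw [map_add, map_add, ins_add_right, LinearMap.add_apply, map_add, hx, hx']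
  · obtain ⟨c, rfl⟩ := hx
    obtain ⟨c', rfl⟩ := hy
    rw [hcPre, Tot.lift₂_of]
    simp only [LinearMap.compr₂_apply, HC.eval_of]
    rw [← braceHH_eq_ins 𝒜 c.2.1 c'.2]
    rfl

lemma HC.eval_cup (x : HC 𝒜) {j : ℤ × ℤ} {y : HC 𝒜}
    (hy : y ∈ homPart k (fun i => HCdeg 𝒜 i) j) :
    HC.eval (hcCup 𝒜 x y) = conv 𝒜 0 j.2 (HC.eval x) (HC.eval y) := by
  refine graded_induction (isInternal_homPart k fun i => HCdeg 𝒜 i) ?_ (fun x x' hx hx' => ?_)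
    (fun i x hx => ?_) x
  · simp [conv_zero_left]
  · rw [map_add, map_add, conv_add_left, LinearMap.add_apply, map_add, hx, hx']
  · obtain ⟨c, rfl⟩ := hx
    obtain ⟨c', rfl⟩ := hy
    rw [hcCup, Tot.lift₂_of]
    simp only [LinearMap.compr₂_apply, HC.eval_of]
    rw [← cupHH_eq_conv]
    rfl

variable (𝒜) in
/-- The identity cochain as an element of the Hochschild complex. -/
noncomputable def hcIota : HC 𝒜 :=
  Tot.of k (fun i => HCdeg 𝒜 i) (1, 0) ⟨idFun, idFun_mem 𝒜⟩

omit [GradedAlgebra 𝒜] in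
lemma hcIota_mem : hcIota 𝒜 ∈ homPart k (fun i => HCdeg 𝒜 i) (1, 0) := Tot.of_mem _ _

lemma hcOne_mem : hcOne 𝒜 ∈ homPart k (fun i => HCdeg 𝒜 i) 0 := Tot.of_mem _ _

omit [GradedAlgebra 𝒜] in
@[simp] lemma HC.eval_iota : HC.eval (hcIota 𝒜) = idFun := HC.eval_of _ _

@[simp] lemma HC.eval_one : HC.eval (hcOne 𝒜) = oneFun := HC.eval_of _ _

lemma hc_pre_mem (i j : ℤ × ℤ) (x : HC 𝒜) (hx : x ∈ homPart k (fun i => HCdeg 𝒜 i) i) (y : HC 𝒜)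
    (hy : y ∈ homPart k (fun i => HCdeg 𝒜 i) j) :
    hcPre 𝒜 x y ∈ homPart k (fun i => HCdeg 𝒜 i) (i + j - (1, 0)) := by
  obtain ⟨c, rfl⟩ := hx
  obtain ⟨c', rfl⟩ := hy
  rw [hcPre, Tot.lift₂_of]
  exact Tot.of_mem _ _

lemma hc_cup_mem (i j : ℤ × ℤ) (x : HC 𝒜) (hx : x ∈ homPart k (fun i => HCdeg 𝒜 i) i) (y : HC 𝒜)
    (hy : y ∈ homPart k (fun i => HCdeg 𝒜 i) j) :
    hcCup 𝒜 x y ∈ homPart k (fun i => HCdeg 𝒜 i) (i + j) := by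
  obtain ⟨c, rfl⟩ := hx
  obtain ⟨c', rfl⟩ := hy
  rw [hcCup, Tot.lift₂_of]
  exact Tot.of_mem _ _

lemma conv_oneFun_left (f : List A → A) (t : ℤ) : conv 𝒜 0 t oneFun f = f := by
  funext l
  rw [conv, splitSum_eq_left fun x a b => by simp [oneFun]]
  simp [oneFun]

lemma conv_oneFun_right (f : List A → A) : conv 𝒜 0 0 f oneFun = f := by
  funext l
  rw [conv, splitSum_eq_right fun a x b => by simp [oneFun]]
  simp [oneFun]

lemma hc_mul_eq : Tot.of k (fun i => HCdeg 𝒜 i) (2, 0) ⟨mulFun, mulFun_mem 𝒜⟩ =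
    hcCup 𝒜 (hcIota 𝒜) (hcIota 𝒜) := by
  apply HC.eval_injective
  rw [HC.eval_of, HC.eval_cup _ hcIota_mem, HC.eval_iota, conv_idFun_idFun]

lemma HC.eval_d {i : ℤ × ℤ} {x : HC 𝒜} (hx : x ∈ homPart k (fun i => HCdeg 𝒜 i) i) :
    HC.eval (hcD 𝒜 x) = dFun 𝒜 i (HC.eval x) := by
  rw [hcD, hcBracket, gradedCommutator_apply _ (Tot.of_mem _ _) hx, map_sub, map_smul,
    HC.eval_pre _ hx, HC.eval_pre _ (Tot.of_mem _ _), HC.eval_of, dFun]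
  have : sgn k ((((2, 0) : ℤ × ℤ).1 + ((2, 0) : ℤ × ℤ).2 - 1) * (i.1 + i.2 - 1)) =
      - sgn k (i.1 + i.2) := by
    rw [show ((((2, 0) : ℤ × ℤ).1 + ((2, 0) : ℤ × ℤ).2 - 1) * (i.1 + i.2 - 1)) = i.1 + i.2 - 1 by
      norm_num, sgn_sub, sgn_one, mul_neg_one]
  rw [this, neg_smul, sub_neg_eq_add]

variable (𝒜) in
/-- The Hochschild complex of a graded algebra is a brace algebra. -/
theorem hc_isBigradedBraceAlgebra :
    IsBigradedBraceAlgebra (homPart k fun i => HCdeg 𝒜 i) (hcD 𝒜) (hcCup 𝒜) (hcPre 𝒜)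
      (hcBracket 𝒜) (hcOne 𝒜) (hcIota 𝒜) where
  isInternal := isInternal_homPart k _
  cup_mem := hc_cup_mem
  pre_mem := hc_pre_mem
  iota_mem := hcIota_mem
  cup_assoc x y z := by
    refine graded_induction (isInternal_homPart k fun i => HCdeg 𝒜 i) (by simp)
      (fun x x' hx hx' => by simp only [map_add, LinearMap.add_apply, hx, hx']) (fun i y hy => ?_) y
    refine graded_induction (isInternal_homPart k fun i => HCdeg 𝒜 i) (by simp)
      (fun x x' hx hx' => by simp only [map_add, hx, hx']) (fun j z hz => ?_) z
    apply HC.eval_injective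
    rw [HC.eval_cup _ hz, HC.eval_cup _ hy, HC.eval_cup _ (hc_cup_mem _ _ _ hy _ hz),
      HC.eval_cup _ hz]
    exact conv_assoc' (by simp) (by simp) _ _ _
  one_cup x := by
    refine graded_induction (isInternal_homPart k fun i => HCdeg 𝒜 i) (by simp)
      (fun x x' hx hx' => by simp only [map_add, hx, hx']) (fun j x hx => ?_) x
    apply HC.eval_injective
    rw [HC.eval_cup _ hx, HC.eval_one, conv_oneFun_left]
  cup_one x := by
    apply HC.eval_injective
    rw [HC.eval_cup _ hcOne_mem, HC.eval_one]
    exact conv_oneFun_right _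
  one_mem := hcOne_mem
  one_pre x := by
    refine graded_induction (isInternal_homPart k fun i => HCdeg 𝒜 i) (by simp)
      (fun x x' hx hx' => by simp only [map_add, hx, hx', add_zero]) (fun j x hx => ?_) x
    apply HC.eval_injective
    rw [HC.eval_pre _ hx, HC.eval_one, ins_oneFun, map_zero]
  iota_pre x := by
    refine graded_induction (isInternal_homPart k fun i => HCdeg 𝒜 i) (by simp)
      (fun x x' hx hx' => by simp only [map_add, hx, hx']) (fun j x hx => ?_) x
    apply HC.eval_injective
    rw [HC.eval_pre _ hx, HC.eval_iota, ins_idFun]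
  br_eq i j x hx y hy := gradedCommutator_apply _ hx hy
  d_eq x := by rw [hcD, hc_mul_eq]
  cup_pre i j x y hy z hz := by
    apply HC.eval_injective
    rw [map_add, map_smul, HC.eval_pre _ hz, HC.eval_cup _ hy, HC.eval_cup _ hy,
      HC.eval_cup _ (hc_pre_mem _ _ _ hy _ hz), HC.eval_pre _ hz, HC.eval_pre _ hz,
      ins_conv (HC.eval_mem hz) (HC.isML_eval x) (HC.isML_eval y),
      conv_eq_smul_conv (HC.eval_mem hy).2.1 (0 + _), smul_smul, ← sgn_add]
    congr 1
    · simp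
    · congr 1
      exact congrArg _ (by ring)
  assoc_symm i j x y hy z hz := by
    apply HC.eval_injective
    rw [map_smul, map_sub, map_sub, HC.eval_pre _ hz, HC.eval_pre _ hy, HC.eval_pre _ hy,
      HC.eval_pre _ hz, HC.eval_pre _ (hc_pre_mem _ _ _ hy _ hz),
      HC.eval_pre _ (hc_pre_mem _ _ _ hz _ hy), HC.eval_pre _ hy, HC.eval_pre _ hz,
      ins_ins (HC.eval_mem hy) (HC.eval_mem hz) (HC.isML_eval x),
      ins_ins (HC.eval_mem hz) (HC.eval_mem hy) (HC.isML_eval x)]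
    have s1 : sgn k ((i.1 + i.2 - 1) * (j.1 + j.2 - 1)) =
        sgn k ((i.1 + i.2 - 1) * (j.1 - 1)) * sgn k (j.2 * (i.1 + i.2 - 1)) := by
      rw [← sgn_add]
      exact congrArg _ (by ring)
    have s2 : sgn k ((i.1 + i.2 - 1) * (j.1 + j.2 - 1)) =
        sgn k (i.2 * (j.1 + j.2 - 1)) * sgn k ((j.1 + j.2 - 1) * (i.1 - 1)) := by
      rw [← sgn_add]
      exact congrArg _ (by ring)
    have h1 := sgn_mul_self (k := k) (j.2 * (i.1 + i.2 - 1))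
    have h2 := sgn_mul_self (k := k) ((j.1 + j.2 - 1) * (i.1 - 1))
    match_scalars <;> grind
  assoc_self i x y hy hi := by
    apply HC.eval_injective
    rw [HC.eval_pre _ hy, HC.eval_pre _ hy, HC.eval_pre _ (hc_pre_mem _ _ _ hy _ hy),
      HC.eval_pre _ hy, ins_ins (HC.eval_mem hy) (HC.eval_mem hy) (HC.isML_eval x), add_assoc,
      ← add_smul]
    -- the two double insertions of `y` and `y` cancel
    have : sgn k ((i.1 + i.2 - 1) * (i.1 - 1)) + sgn k (i.2 * (i.1 + i.2 - 1)) = 0 := by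
      rcases hi with hi | hi
      · have : sgn k ((i.1 + i.2 - 1) * (i.1 - 1)) = - sgn k (i.2 * (i.1 + i.2 - 1)) := by
          rw [← sgn_succ]
          refine sgn_congr ?_
          have := (ZMod.intCast_eq_zero_iff_even.2 hi)
          push_cast at this ⊢
          grind
        rw [this, neg_add_cancel]
      · have := add_self_of_ringChar hi (1 : k)
        rwa [sgn_of_ringChar hi, sgn_of_ringChar hi]
    rw [this, zero_smul, add_zero]
  homotopy l i j x hx y hy z hz dx dy dz := by
    have e (i : ℤ × ℤ) (x : HC 𝒜) (hx : x ∈ homPart k (fun i => HCdeg 𝒜 i) i)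
        (dx : hcD 𝒜 x = 0) : dFun 𝒜 i (HC.eval x) = 0 := by
      rw [← HC.eval_d hx, dx, map_zero]
    obtain ⟨w, hw, ew⟩ := HC.exists_eval_eq
      (ins₂_mem (HC.eval_mem hx) (HC.eval_mem hy) (HC.eval_mem hz))
    refine ⟨-(sgn k (l.1 + l.2 + (i.1 + i.2 - 1) * j.1) • w), ?_⟩
    apply HC.eval_injective
    have h0 : ins₂ 𝒜 i (j + (1, 0)) (HC.eval y) 0 (HC.eval x) = 0 := by
      simpa using ins₂_smul_middle (𝒜 := 𝒜) (i := i) (j := j + (1, 0)) (HC.isML_eval x) (0 : k)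
        (HC.eval y) 0
    rw [map_neg, map_smul, map_neg, map_smul, HC.eval_d hw, ew, dFun_ins₂ (HC.eval_mem hx)
      (HC.eval_mem hy) (HC.eval_mem hz) (e l x hx dx) (e i y hy dy), e j z hz dz, h0, map_sub,
      map_sub, map_smul, HC.eval_pre _ (hc_cup_mem _ _ _ hy _ hz), HC.eval_cup _ hz,
      HC.eval_cup _ hz, HC.eval_pre _ hy, HC.eval_cup _ (hc_pre_mem _ _ _ hx _ hz),
      HC.eval_pre _ hz, smul_zero, neg_zero, zero_sub, smul_neg, neg_neg, smul_smul, sgn_mul_self,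
      one_smul]
    simp

end HochschildComplex

end Hoch

namespace Hoch

open TrivSqZeroExt (inl fst snd)

/-! ### Dual numbers -/

section DualNumbers

variable {k A : Type*} [Field k] [Ring A] [Algebra k A]

/-- The inclusion of the diagonal bimodule in the dual numbers over `A`, which are the square zero
extension of `A` by `A` itself. -/
def inr (m : A) : DualNumber A := TrivSqZeroExt.inr m

@[simp] lemma fst_inr (m : A) : fst (inr m) = 0 := rfl
@[simp] lemma snd_inr (m : A) : snd (inr m) = m := rfl
@[simp] lemma inr_zero : inr (0 : A) = 0 := rfl

lemma inr_add (m m' : A) : inr (m + m') = inr m + inr m' := TrivSqZeroExt.inr_add A m m'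

lemma inl_fst_add_inr_snd (x : DualNumber A) : inl (fst x) + inr (snd x) = x :=
  TrivSqZeroExt.inl_fst_add_inr_snd_eq x

variable (k A) in
/-- The inclusion of `A` in the dual numbers over `A`. -/
def dualInl : A →ₗ[k] DualNumber A where
  toFun := inl
  map_add' := by simp
  map_smul' := by simp

variable (k A) in
/-- The inclusion of the diagonal bimodule in the dual numbers over `A`. -/
def dualInr : A →ₗ[k] DualNumber A where
  toFun := inr
  map_add' := inr_add
  map_smul' r m := TrivSqZeroExt.inr_smul A r m

variable (k A) in
/-- The projection of the dual numbers onto `A`. -/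
def dualFst : DualNumber A →ₗ[k] A where
  toFun := fst
  map_add' := by simp
  map_smul' := by simp

variable (k A) in
/-- The projection of the dual numbers onto the diagonal bimodule. -/
def dualSnd : DualNumber A →ₗ[k] A where
  toFun := snd
  map_add' := by simp
  map_smul' := by simp

@[simp] lemma dualInl_apply (x : A) : dualInl k A x = inl x := rfl
@[simp] lemma dualInr_apply (x : A) : dualInr k A x = inr x := rfl
@[simp] lemma dualFst_apply (x : DualNumber A) : dualFst k A x = fst x := rfl
@[simp] lemma dualSnd_apply (x : DualNumber A) : dualSnd k A x = snd x := rfl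

variable (𝒜 : ℤ → Submodule k A)

/-- The grading of the dual numbers over a graded algebra, the infinitesimal having degree `0`. -/
def dualGr (n : ℤ) : Submodule k (DualNumber A) :=
  (𝒜 n).comap (dualFst k A) ⊓ (𝒜 n).comap (dualSnd k A)

variable {𝒜}

lemma mem_dualGr {n : ℤ} {x : DualNumber A} : x ∈ dualGr 𝒜 n ↔ fst x ∈ 𝒜 n ∧ snd x ∈ 𝒜 n :=
  Iff.rfl

lemma inl_mem_dualGr {n : ℤ} {x : A} (hx : x ∈ 𝒜 n) : (inl x : DualNumber A) ∈ dualGr 𝒜 n :=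
  ⟨by simpa using hx, by simp⟩

lemma inr_mem_dualGr {n : ℤ} {x : A} (hx : x ∈ 𝒜 n) : inr x ∈ dualGr 𝒜 n :=
  ⟨by simp, by simpa using hx⟩

variable [GradedAlgebra 𝒜]

variable (𝒜) in
lemma isInternal_dualGr : DirectSum.IsInternal (dualGr 𝒜) := by
  have h := DirectSum.Decomposition.isInternal 𝒜
  refine isInternal_of_projections (fun n => dualInl k A ∘ₗ gradedProj h n ∘ₗ dualFst k A +
    dualInr k A ∘ₗ gradedProj h n ∘ₗ dualSnd k A) (fun n x hx => ?_) (fun m n hmn x hx => ?_)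
    fun x => ?_
  · obtain ⟨h1, h2⟩ := mem_dualGr.1 hx
    simp [gradedProj_same h h1, gradedProj_same h h2, inl_fst_add_inr_snd]
  · obtain ⟨h1, h2⟩ := mem_dualGr.1 hx
    simp [gradedProj_ne h hmn h1, gradedProj_ne h hmn h2]
  · rw [← inl_fst_add_inr_snd x]
    refine add_mem ?_ ?_
    · exact graded_induction h (P := fun y => (inl y : DualNumber A) ∈ ⨆ i, dualGr 𝒜 i) (by simp)
        (fun y z hy hz => by rw [TrivSqZeroExt.inl_add]; exact add_mem hy hz)
        (fun n y hy => Submodule.mem_iSup_of_mem n (inl_mem_dualGr hy)) _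
    · exact graded_induction h (P := fun y => inr y ∈ ⨆ i, dualGr 𝒜 i) (by simp)
        (fun y z hy hz => by rw [inr_add]; exact add_mem hy hz)
        (fun n y hy => Submodule.mem_iSup_of_mem n (inr_mem_dualGr hy)) _

noncomputable instance : GradedAlgebra (dualGr 𝒜) :=
  { (isInternal_dualGr 𝒜).chooseDecomposition with
    one_mem := ⟨by simpa using SetLike.one_mem_graded 𝒜, by simp⟩
    mul_mem := fun m n x y hx hy => by
      obtain ⟨hx, hx'⟩ := mem_dualGr.1 hx
      obtain ⟨hy, hy'⟩ := mem_dualGr.1 hy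
      refine mem_dualGr.2 ⟨?_, ?_⟩
      · rw [TrivSqZeroExt.fst_mul]
        exact SetLike.mul_mem_graded hx hy
      · rw [TrivSqZeroExt.snd_mul]
        exact add_mem (SetLike.mul_mem_graded hx hy') (SetLike.mul_mem_graded hx' hy) }

@[simp] lemma par_inl (t : ℤ) (x : A) :
    par (dualGr 𝒜) t (inl x) = inl (par 𝒜 t x) := by
  suffices par (dualGr 𝒜) t ∘ₗ dualInl k A = dualInl k A ∘ₗ par 𝒜 t from LinearMap.congr_fun this x
  refine linearMap_ext_of_mem 𝒜 fun n x hx => ?_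
  simp [par_of_mem _ t (inl_mem_dualGr hx), par_of_mem _ t hx]

@[simp] lemma par_inr (t : ℤ) (x : A) :
    par (dualGr 𝒜) t (inr x) = inr (par 𝒜 t x) := by
  suffices par (dualGr 𝒜) t ∘ₗ dualInr k A = dualInr k A ∘ₗ par 𝒜 t from LinearMap.congr_fun this x
  refine linearMap_ext_of_mem 𝒜 fun n x hx => ?_
  simp [par_of_mem _ t (inr_mem_dualGr hx), par_of_mem _ t hx]

@[simp] lemma map_par_map_inl (t : ℤ) (l : List A) :
    (l.map inl).map (par (dualGr 𝒜) t) = (l.map (par 𝒜 t)).map inl := by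
  simp

end DualNumbers

/-! ### Weights -/

section Weights

variable {k A : Type*} [Field k] [Ring A] [Algebra k A]

/-- The entries of the list lie in `A` or in the diagonal bimodule, the latter as many times as
the given number says. -/
inductive IsPure : List (DualNumber A) → ℕ → Prop
  | nil : IsPure [] 0
  | cons_inl (x : A) {l : List (DualNumber A)} {n : ℕ} (hl : IsPure l n) : IsPure (inl x :: l) n
  | cons_inr (x : A) {l : List (DualNumber A)} {n : ℕ} (hl : IsPure l n) :
    IsPure (inr x :: l) (n + 1)

variable (k A) in
/-- The weight grading of the dual numbers: `A` has weight `0`, the diagonal bimodule weight `1`,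
and there is nothing of higher weight. -/
def weight : ℕ → Submodule k (DualNumber A)
  | 0 => LinearMap.ker (dualSnd k A)
  | 1 => LinearMap.ker (dualFst k A)
  | _ + 2 => ⊥

lemma IsPure.append {a b : List (DualNumber A)} {m n : ℕ} (ha : IsPure a m) (hb : IsPure b n) :
    IsPure (a ++ b) (m + n) := by
  induction ha with
  | nil => simpa using hb
  | cons_inl x _ ih => exact .cons_inl x ih
  | cons_inr x _ ih => rw [add_right_comm]; exact .cons_inr x ih

lemma IsPure.split {a b : List (DualNumber A)} {n : ℕ} (h : IsPure (a ++ b) n) :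
    ∃ n₁ n₂, n = n₁ + n₂ ∧ IsPure a n₁ ∧ IsPure b n₂ := by
  induction a generalizing n with
  | nil => exact ⟨0, n, by simp, .nil, h⟩
  | cons x a ih =>
    cases h with
    | cons_inl x hl =>
      obtain ⟨n₁, n₂, rfl, h₁, h₂⟩ := ih hl
      exact ⟨n₁, n₂, rfl, .cons_inl x h₁, h₂⟩
    | cons_inr x hl =>
      obtain ⟨n₁, n₂, rfl, h₁, h₂⟩ := ih hl
      exact ⟨n₁ + 1, n₂, by omega, .cons_inr x h₁, h₂⟩

lemma isPure_map_inl (l : List A) : IsPure (l.map inl) 0 := by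
  induction l with
  | nil => exact .nil
  | cons x l ih => exact .cons_inl x ih

lemma IsPure.eq_map_inl {l : List (DualNumber A)} (h : IsPure l 0) :
    ∃ l' : List A, l = l'.map inl := by
  generalize hn : 0 = n at h
  induction h with
  | nil => exact ⟨[], rfl⟩
  | cons_inl x _ ih =>
    obtain ⟨l', rfl⟩ := ih hn
    exact ⟨x :: l', rfl⟩
  | cons_inr x _ _ => omega

lemma IsPure.eq_append_inr {l : List (DualNumber A)} {n : ℕ} (h : IsPure l (n + 1)) :
    ∃ (a : List A) (m : A) (r : List (DualNumber A)), l = a.map inl ++ inr m :: r ∧ IsPure r n := by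
  generalize hn : n + 1 = n' at h
  induction h with
  | nil => omega
  | cons_inl x _ ih =>
    obtain ⟨a, m, r, rfl, hr⟩ := ih hn
    exact ⟨x :: a, m, r, rfl, hr⟩
  | cons_inr x hl _ =>
    obtain rfl := Nat.succ.inj hn
    exact ⟨[], x, _, rfl, hl⟩

variable {V : Type*} [AddCommGroup V] [Module k V]

/-- Two multilinear functions on lists of dual numbers agree if they agree on lists whose entries
lie in `A` or in the diagonal bimodule. -/
lemma IsML.ext_of_isPure {F G : List (DualNumber A) → V} (hF : IsML k F) (hG : IsML k G)
    (h : ∀ l n, IsPure l n → F l = G l) : F = G := by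
  suffices ∀ (b a : List (DualNumber A)) (n : ℕ), IsPure a n → F (a ++ b) = G (a ++ b) from
    funext fun l => this l [] 0 .nil
  intro b
  induction b with
  | nil => intro a n ha; simpa using h a n ha
  | cons x b ih =>
    intro a n ha
    rw [← inl_fst_add_inr_snd x, (hF a b).map_add, (hG a b).map_add]
    have e1 := ih (a ++ [inl (fst x)]) _ (ha.append (.cons_inl _ .nil))
    have e2 := ih (a ++ [inr (snd x)]) _ (ha.append (.cons_inr _ .nil))
    simp only [List.append_assoc, List.cons_append, List.nil_append] at e1 e2
    rw [e1, e2]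

variable (k) in
/-- Multilinear functions whose value on a list with `n` entries in the diagonal bimodule and all
others in `A` has weight `n`. -/
structure PreservesWeight (F : List (DualNumber A) → DualNumber A) : Prop where
  isML : IsML k F
  mem : ∀ l n, IsPure l n → F l ∈ weight k A n

lemma PreservesWeight.mem_cons {F : List (DualNumber A) → DualNumber A}
    (hF : PreservesWeight k F) {a b : List (DualNumber A)} {x : DualNumber A} {n₁ n₂ n₃ : ℕ}
    (ha : IsPure a n₁) (hx : x ∈ weight k A n₂) (hb : IsPure b n₃) :
    F (a ++ x :: b) ∈ weight k A (n₁ + (n₂ + n₃)) := by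
  match n₂, hx with
  | 0, hx =>
    have : x = inl (fst x) := by
      ext
      · simp
      · exact hx
    rw [this, zero_add]
    exact hF.mem _ _ (ha.append (.cons_inl _ hb))
  | 1, hx =>
    have : x = inr (snd x) := by
      ext
      · exact hx
      · simp
    rw [this, add_comm 1]
    exact hF.mem _ _ (ha.append (.cons_inr _ hb))
  | n + 2, hx =>
    have : x = 0 := by simpa [weight] using hx
    rw [this, hF.isML.map_zero]
    exact zero_mem _

lemma mul_mem_weight {x y : DualNumber A} {m n : ℕ} (hx : x ∈ weight k A m)
    (hy : y ∈ weight k A n) : x * y ∈ weight k A (m + n) := by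
  match m, n, hx, hy with
  | 0, 0, hx, hy =>
    have hx : snd x = 0 := hx
    have hy : snd y = 0 := hy
    simp [weight, hx, hy]
  | 0, 1, hx, hy =>
    have hx : snd x = 0 := hx
    have hy : fst y = 0 := hy
    simp [weight, hy]
  | 1, 0, hx, hy =>
    have hx : fst x = 0 := hx
    simp [weight, hx]
  | 1, 1, hx, hy =>
    have hx : fst x = 0 := hx
    have hy : fst y = 0 := hy
    have : x * y = 0 := by ext <;> simp [hx, hy]
    rw [this]
    exact zero_mem _
  | m + 2, n, hx, hy =>
    have : x = 0 := by simpa [weight] using hx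
    rw [this, zero_mul]
    exact zero_mem _
  | m, n + 2, hx, hy =>
    have : y = 0 := by simpa [weight] using hy
    rw [this, mul_zero]
    exact zero_mem _

variable {𝒜 : ℤ → Submodule k A} [GradedAlgebra 𝒜]

lemma IsPure.map_par {l : List (DualNumber A)} {n : ℕ} (h : IsPure l n) (t : ℤ) :
    IsPure (l.map (par (dualGr 𝒜) t)) n := by
  induction h with
  | nil => exact .nil
  | cons_inl x _ ih => rw [List.map_cons, par_inl]; exact .cons_inl _ ih
  | cons_inr x _ ih => rw [List.map_cons, par_inr]; exact .cons_inr _ ih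

lemma PreservesWeight.ins {F c : List (DualNumber A) → DualNumber A} (hF : PreservesWeight k F)
    (hc : PreservesWeight k c) (i : ℤ × ℤ) : PreservesWeight k (ins (dualGr 𝒜) i c F) := by
  refine ⟨isML_ins hc.isML hF.isML i, fun l n hl => ?_⟩
  refine splitSum_mem _ fun a r hr => splitSum_mem _ fun b e he => Submodule.smul_mem _ _ ?_
  subst he hr
  obtain ⟨na, nr, rfl, ha, hr⟩ := hl.split
  obtain ⟨nb, ne, rfl, hb, he⟩ := hr.split
  exact hF.mem_cons (ha.map_par _) (hc.mem _ _ hb) he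

lemma PreservesWeight.conv {F G : List (DualNumber A) → DualNumber A} (hF : PreservesWeight k F)
    (hG : PreservesWeight k G) (w t : ℤ) : PreservesWeight k (conv (dualGr 𝒜) w t F G) := by
  refine ⟨isML_conv hF.isML hG.isML w t, fun l n hl => ?_⟩
  refine splitSum_mem _ fun a b hr => Submodule.smul_mem _ _ ?_
  subst hr
  obtain ⟨na, nb, rfl, ha, hb⟩ := hl.split
  exact mul_mem_weight (hF.mem _ _ (ha.map_par _)) (hG.mem _ _ hb)

end Weights

/-! ### Bimodule cochains as cochains of the dual numbers -/

section Restriction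

variable {k A : Type*} [Field k] [Ring A] [Algebra k A]

/-- The sum of the values of a bimodule cochain on a list of dual numbers, over the choices of the
entry whose bimodule component is used. -/
def markSum (c : List A → A → List A → A) : List (DualNumber A) → A :=
  splitSum fun a r => match r with
    | [] => 0
    | m :: b => c (a.map fst) (snd m) (b.map fst)

/-- The function on lists of dual numbers defined by a Hochschild cochain and a bimodule cochain. On
lists of elements of `A` and of the diagonal bimodule it is the former if there is no entry from the
bimodule, the latter if there is one, and zero otherwise. -/
def relFun (c₀ : List A → A) (c₁ : List A → A → List A → A) (l : List (DualNumber A)) :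
    DualNumber A :=
  inl (c₀ (l.map fst)) + inr (markSum c₁ l)

/-- The Hochschild cochain underlying a function on lists of dual numbers. -/
def restrictA (F : List (DualNumber A) → DualNumber A) (l : List A) : A := fst (F (l.map inl))

/-- The bimodule cochain underlying a function on lists of dual numbers. -/
def restrictM (F : List (DualNumber A) → DualNumber A) (a : List A) (m : A) (b : List A) : A :=
  snd (F (a.map inl ++ inr m :: b.map inl))

@[simp] lemma map_fst_map_inl (l : List A) : (l.map inl : List (DualNumber A)).map fst = l := by
  rw [List.map_map]
  exact List.map_id l

lemma snd_splitSum {B : Type*} (F : List B → List B → DualNumber A) (l : List B) :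
    snd (splitSum F l) = splitSum (fun a b => snd (F a b)) l :=
  map_splitSum (TrivSqZeroExt.sndHom A A) F l

lemma fst_splitSum {B : Type*} (F : List B → List B → DualNumber A) (l : List B) :
    fst (splitSum F l) = splitSum (fun a b => fst (F a b)) l :=
  map_sum (AddMonoidHom.mk' (fst (R := A) (M := A)) fun _ _ => rfl) _ _

variable {𝒜 : ℤ → Submodule k A} {i : ℤ × ℤ} {c₀ : List A → A} {c₁ : List A → A → List A → A}

lemma BimDeg.map_zero (h₁ : c₁ ∈ BimDeg 𝒜 i) (a b : List A) : c₁ a 0 b = 0 :=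
  (h₁.2.1 a b).map_zero

lemma relFun_map_inl (h₁ : c₁ ∈ BimDeg 𝒜 i) (l : List A) :
    relFun c₀ c₁ (l.map inl) = inl (c₀ l) := by
  rw [relFun, markSum, splitSum_map, splitSum_eq_zero, map_fst_map_inl, inr_zero, add_zero]
  intro a b _
  cases b with
  | nil => rfl
  | cons x b => exact BimDeg.map_zero h₁ _ _

lemma relFun_append_inr (h₀ : IsML k c₀) (h₁ : c₁ ∈ BimDeg 𝒜 i) (a : List A) (m : A) (b : List A) :
    relFun c₀ c₁ (a.map inl ++ inr m :: b.map inl) = inr (c₁ a m b) := by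
  rw [relFun, List.map_append, List.map_cons, fst_inr, h₀.map_zero, TrivSqZeroExt.inl_zero,
    zero_add, markSum, splitSum_append_cons, splitSum_map, splitSum_map]
  congr 1
  rw [splitSum_eq_right fun p x q => by exact BimDeg.map_zero h₁ _ _, splitSum_eq_zero, add_zero]
  · simp
  · intro p q _
    cases q with
    | nil => rfl
    | cons x q => exact BimDeg.map_zero h₁ _ _

lemma IsPure.map_fst_eq_zero {V : Type*} [AddCommGroup V] [Module k V] {f : List A → V}
    (hf : IsML k f) {l : List (DualNumber A)} {n : ℕ} (hl : IsPure l (n + 1)) :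
    f (l.map fst) = 0 := by
  obtain ⟨a, m, r, rfl, _⟩ := hl.eq_append_inr
  rw [List.map_append, List.map_cons, fst_inr, hf.map_zero]

lemma isML_markSum (h₁ : c₁ ∈ BimDeg 𝒜 i) : IsML k (markSum c₁) := by
  refine IsML.splitSum (fun r => ?_) fun a => ?_
  · cases r with
    | nil => exact fun _ _ => ⟨by simp, by simp⟩
    | cons m b =>
      intro x y
      have := h₁.1 (snd m) (b.map fst) (x.map fst) (y.map fst)
      constructor
      · intro z w; simpa using this.map_add (fst z) (fst w)
      · intro r z; simpa using this.map_smul r (fst z)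
  · intro x y
    cases x with
    | nil =>
      have := h₁.2.1 (a.map fst) (y.map fst)
      constructor
      · intro z w; simpa using this.map_add (snd z) (snd w)
      · intro r z; simpa using this.map_smul r (snd z)
    | cons m x =>
      have := h₁.2.2.1 (a.map fst) (snd m) (x.map fst) (y.map fst)
      constructor
      · intro z w; simpa using this.map_add (fst z) (fst w)
      · intro r z; simpa using this.map_smul r (fst z)

lemma isML_relFun (h₀ : IsML k c₀) (h₁ : c₁ ∈ BimDeg 𝒜 i) : IsML k (relFun c₀ c₁) := by
  have e0 : IsML k fun l : List (DualNumber A) => inl (R := A) (M := A) (c₀ (l.map fst)) := by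
    intro x y
    have := h₀ (x.map fst) (y.map fst)
    constructor
    · intro z w; simpa using congrArg (dualInl k A) (this.map_add (fst z) (fst w))
    · intro r z; simpa using congrArg (dualInl k A) (this.map_smul r (fst z))
  exact e0.add ((isML_markSum h₁).comp_linear (dualInr k A))

/-- The function defined by a Hochschild cochain and a bimodule cochain takes values in `A` if there
is no argument from the bimodule, and in the bimodule if there is one. -/
lemma relFun_preservesWeight (h₀ : IsML k c₀) (h₁ : c₁ ∈ BimDeg 𝒜 i) :
    PreservesWeight k (relFun c₀ c₁) := by
  refine ⟨isML_relFun h₀ h₁, fun l n hl => ?_⟩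
  match n, hl with
  | 0, hl =>
    obtain ⟨l, rfl⟩ := hl.eq_map_inl
    rw [relFun_map_inl h₁]
    exact TrivSqZeroExt.snd_inl A (c₀ l)
  | 1, hl =>
    change fst (relFun c₀ c₁ l) = 0
    rw [relFun, hl.map_fst_eq_zero h₀]
    simp
  | n + 2, hl =>
    have : markSum c₁ l = 0 := by
      refine splitSum_eq_zero fun a r hr => ?_
      subst hr
      obtain ⟨n₁, n₂, hn, ha, hr⟩ := hl.split
      cases r with
      | nil => rfl
      | cons m b =>
        change c₁ (a.map fst) (snd m) (b.map fst) = 0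
        match n₁, ha with
        | n₁ + 1, ha => exact ha.map_fst_eq_zero (h₁.1 (snd m) (b.map fst))
        | 0, _ =>
          cases hr with
          | cons_inl x hr => exact BimDeg.map_zero h₁ _ _
          | @cons_inr x _ n₂ hr =>
            obtain rfl : n₂ = n + 1 := by omega
            exact hr.map_fst_eq_zero (h₁.2.2.1 _ _)
    rw [relFun, this, hl.map_fst_eq_zero h₀]
    simp

lemma restrictA_relFun (h₁ : c₁ ∈ BimDeg 𝒜 i) : restrictA (relFun c₀ c₁) = c₀ := by
  funext l
  rw [restrictA, relFun_map_inl h₁, TrivSqZeroExt.fst_inl]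

lemma restrictM_relFun (h₀ : IsML k c₀) (h₁ : c₁ ∈ BimDeg 𝒜 i) :
    restrictM (relFun c₀ c₁) = c₁ := by
  funext a m b
  rw [restrictM, relFun_append_inr h₀ h₁, snd_inr]

lemma IsHomList.map_fst {l : List (DualNumber A)} {n : ℤ} (h : IsHomList (dualGr 𝒜) l n) :
    IsHomList 𝒜 (l.map fst) n := by
  induction h with
  | nil => exact .nil
  | cons hx _ ih => exact .cons hx.1 ih

lemma IsHomList.map_inl {l : List A} {n : ℤ} (h : IsHomList 𝒜 l n) :
    IsHomList (dualGr 𝒜) (l.map inl) n := by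
  induction h with
  | nil => exact .nil
  | cons hx _ ih => exact .cons (inl_mem_dualGr hx) ih

lemma relFun_mem (h₀ : c₀ ∈ HCdeg 𝒜 i) (h₁ : c₁ ∈ BimDeg 𝒜 i) :
    relFun c₀ c₁ ∈ HCdeg (dualGr 𝒜) i := by
  refine ⟨isML_relFun h₀.1 h₁, fun l hl => ?_, fun l n hl => ?_⟩
  · have : markSum c₁ l = 0 := by
      refine splitSum_eq_zero fun a r hr => ?_
      subst hr
      cases r with
      | nil => rfl
      | cons m b =>
        refine h₁.2.2.2.1 _ _ _ fun h => hl ?_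
        simp at h ⊢
        omega
    rw [relFun, this, h₀.2.1 _ (by simpa using hl)]
    simp
  · refine mem_dualGr.2 ⟨?_, ?_⟩
    · rw [relFun, TrivSqZeroExt.fst_add, TrivSqZeroExt.fst_inl, fst_inr, add_zero]
      exact h₀.2.2 _ _ hl.map_fst
    · rw [relFun, TrivSqZeroExt.snd_add, TrivSqZeroExt.snd_inl, snd_inr, zero_add]
      refine splitSum_mem _ fun a r hr => ?_
      subst hr
      obtain ⟨na, nr, rfl, ha, hr⟩ := hl.split
      cases hr with
      | nil => exact zero_mem _
      | cons hx hb =>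
        have := h₁.2.2.2.2 _ _ _ _ _ _ ha.map_fst hx.2 hb.map_fst
        simpa [add_assoc] using this

lemma restrictA_mem {F : List (DualNumber A) → DualNumber A} (hF : F ∈ HCdeg (dualGr 𝒜) i) :
    restrictA F ∈ HCdeg 𝒜 i := by
  refine ⟨fun a b => ?_, fun l hl => ?_, fun l n hl => (hF.2.2 _ _ hl.map_inl).1⟩
  · have := hF.1 (a.map inl) (b.map inl)
    constructor
    · intro x y
      simpa [restrictA] using congrArg fst (this.map_add (inl x) (inl y))
    · intro r x
      simpa [restrictA] using congrArg fst (this.map_smul r (inl x))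
  · rw [restrictA, hF.2.1 _ (by simpa using hl)]
    rfl

lemma restrictM_mem {F : List (DualNumber A) → DualNumber A} (hF : F ∈ HCdeg (dualGr 𝒜) i) :
    restrictM F ∈ BimDeg 𝒜 i := by
  refine ⟨fun m b x y => ?_, fun a b => ?_, fun a m x y => ?_, fun a m b h => ?_,
    fun a m b na nm nb ha hm hb => ?_⟩
  · have := hF.1 (x.map inl) (y.map inl ++ inr m :: b.map inl)
    constructor
    · intro z w
      simpa [restrictM] using congrArg snd (this.map_add (inl z) (inl w))
    · intro r z
      simpa [restrictM] using congrArg snd (this.map_smul r (inl z))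
  · have := hF.1 (a.map inl) (b.map inl)
    constructor
    · intro z w
      simpa [restrictM, inr_add] using congrArg snd (this.map_add (inr z) (inr w))
    · intro r z
      have := congrArg snd (this.map_smul r (inr z))
      rwa [← show inr (r • z) = r • inr z from (dualInr k A).map_smul r z] at this
  · have := hF.1 (a.map inl ++ inr m :: x.map inl) (y.map inl)
    constructor
    · intro z w
      simpa [restrictM] using congrArg snd (this.map_add (inl z) (inl w))
    · intro r z
      simpa [restrictM] using congrArg snd (this.map_smul r (inl z))
  · rw [restrictM, hF.2.1]
    · rfl
    · intro h'
      apply h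
      simp at h' ⊢
      omega
  · have := (hF.2.2 _ _ (ha.map_inl.append (.cons (inr_mem_dualGr hm) hb.map_inl))).2
    rwa [← add_assoc] at this

/-- A function that preserves weights is determined by its restrictions. -/
lemma relFun_restrict {F : List (DualNumber A) → DualNumber A} (hF : F ∈ HCdeg (dualGr 𝒜) i)
    (hF' : PreservesWeight k F) : relFun (restrictA F) (restrictM F) = F := by
  have h0 := (restrictA_mem hF).1
  have h1 := restrictM_mem hF
  refine IsML.ext_of_isPure (isML_relFun h0 h1) hF.1 fun l n hl => ?_
  have hw := hF'.mem l n hl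
  have hw' := (relFun_preservesWeight h0 h1).mem l n hl
  match n, hl with
  | 0, hl =>
    obtain ⟨l, rfl⟩ := hl.eq_map_inl
    rw [relFun_map_inl h1]
    have hw : snd (F (l.map inl)) = 0 := hw
    ext
    · rfl
    · simp [hw]
  | 1, hl =>
    obtain ⟨a, m, r, rfl, hr⟩ := hl.eq_append_inr
    obtain ⟨b, rfl⟩ := hr.eq_map_inl
    rw [relFun_append_inr h0 h1]
    have hw : fst (F (a.map inl ++ inr m :: b.map inl)) = 0 := hw
    ext
    · simp [hw]
    · rfl
  | n + 2, hl =>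
    have hw : F l = 0 := hw
    rw [hw]
    exact hw'

end Restriction

/-! ### Restriction of insertions and products -/

section RestrictionOfOperations

variable {k A : Type*} [Field k] [Ring A] [Algebra k A] {𝒜 : ℤ → Submodule k A} [GradedAlgebra 𝒜]
  {i j : ℤ × ℤ} {c₀ : List A → A} {c₁ : List A → A → List A → A}
  {F : List (DualNumber A) → DualNumber A}

lemma restrictA_ins (h₁ : c₁ ∈ BimDeg 𝒜 i) :
    restrictA (ins (dualGr 𝒜) i (relFun c₀ c₁) F) = ins 𝒜 i c₀ (restrictA F) := by
  funext l
  simp only [restrictA, ins, splitSum_map, fst_splitSum, relFun_map_inl h₁, map_par_map_inl,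
    List.length_map, List.map_append, List.map_cons, TrivSqZeroExt.fst_smul]

/-- On the bimodule part, inserting a pair `(c₀, c₁)` means inserting `c₀` in an entry from `A` or
`c₁` in the entry from the bimodule. -/
lemma restrictM_ins (h₀ : c₀ ∈ HCdeg 𝒜 i) (h₁ : c₁ ∈ BimDeg 𝒜 i)
    (hF : IsML k F) : restrictM (ins (dualGr 𝒜) i (relFun c₀ c₁) F) =
      braceBH 𝒜 i.2 (restrictM F) c₀ + braceBB 𝒜 i.2 (restrictM F) c₁ := by
  funext a m b
  simp only [restrictM, ins, splitSum_append_cons, splitSum_map, snd_splitSum, relFun_map_inl h₁,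
    relFun_append_inr h₀.1 h₁, map_par_map_inl, List.length_map, List.map_append, List.map_cons,
    TrivSqZeroExt.snd_add, TrivSqZeroExt.snd_smul, Pi.add_apply, braceBH, braceBB, splitSum_add',
    List.length_append, List.length_cons, par_inr, List.append_assoc, List.cons_append]
  rw [add_right_comm]
  congr 1
  · congr 1
    · refine splitSum_congr fun p q _ => splitSum_congr fun s e _ => ?_
      by_cases hs : (s.length : ℤ) = i.1
      · rw [← hs]
        congr 1
        exact sgn_congr (by push_cast; grind)
      · rw [h₀.2.1 s hs, TrivSqZeroExt.inl_zero, hF.map_zero]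
        simp
    · refine splitSum_congr fun p q _ => splitSum_congr fun s e _ => ?_
      by_cases hs : (s.length : ℤ) = i.1
      · rw [← hs]
        congr 1
        exact sgn_congr (by push_cast; grind)
      · have := hF.map_zero (a.map (fun x => inl (par 𝒜 i.2 x)) ++ inr (par 𝒜 i.2 m) ::
          p.map (fun x => inl (par 𝒜 i.2 x))) (e.map inl)
        rw [h₀.2.1 s hs, TrivSqZeroExt.inl_zero]
        simp only [List.append_assoc, List.cons_append] at this
        rw [List.map_map]
        simp [Function.comp_def, this]
  · refine splitSum_congr fun p q _ => splitSum_congr fun s e _ => ?_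
    by_cases hs : (q.length : ℤ) + 1 + s.length = i.1
    · rw [← hs]
      congr 1
      exact sgn_congr (by push_cast; grind)
    · rw [h₁.2.2.2.1 q m s hs, inr_zero, hF.map_zero]
      simp

lemma restrictA_conv_left (h₁ : c₁ ∈ BimDeg 𝒜 i) (t : ℤ) :
    restrictA (conv (dualGr 𝒜) 0 t (relFun c₀ c₁) F) = cupHH 𝒜 t c₀ (restrictA F) := by
  funext l
  simp only [restrictA, conv, cupHH, splitSum_map, fst_splitSum, map_par_map_inl, relFun_map_inl h₁,
    List.length_map, zero_mul, zero_add, TrivSqZeroExt.fst_smul, TrivSqZeroExt.fst_mul,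
    TrivSqZeroExt.fst_inl]

lemma restrictA_conv_right (h₁ : c₁ ∈ BimDeg 𝒜 i) (t : ℤ) :
    restrictA (conv (dualGr 𝒜) 0 t F (relFun c₀ c₁)) = cupHH 𝒜 t (restrictA F) c₀ := by
  funext l
  simp only [restrictA, conv, cupHH, splitSum_map, fst_splitSum, map_par_map_inl, relFun_map_inl h₁,
    List.length_map, zero_mul, zero_add, TrivSqZeroExt.fst_smul, TrivSqZeroExt.fst_mul,
    TrivSqZeroExt.fst_inl]

lemma restrictM_conv_left (h₀ : IsML k c₀) (h₁ : c₁ ∈ BimDeg 𝒜 i) (t : ℤ) :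
    restrictM (conv (dualGr 𝒜) 0 t (relFun c₀ c₁) F) =
      cupHB 𝒜 t c₀ (restrictM F) + cupBH 𝒜 t c₁ (restrictA F) := by
  funext a m b
  simp only [restrictM, restrictA, conv, cupHB, cupBH, splitSum_append_cons, splitSum_map,
    snd_splitSum, map_par_map_inl, relFun_map_inl h₁, relFun_append_inr h₀ h₁, par_inr,
    List.map_append, List.map_cons, List.length_append, List.length_cons, Pi.add_apply,
    List.length_map, zero_mul, zero_add, TrivSqZeroExt.snd_add, TrivSqZeroExt.snd_smul,
    TrivSqZeroExt.snd_mul, TrivSqZeroExt.fst_inl, TrivSqZeroExt.snd_inl, fst_inr, snd_inr,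
    smul_zero, smul_eq_mul, op_smul_eq_mul, add_zero, zero_add]
  congr 1
  refine splitSum_congr fun p q _ => ?_
  congr 1
  exact sgn_congr (by push_cast; ring)

lemma restrictM_conv_right (h₀ : IsML k c₀) (h₁ : c₁ ∈ BimDeg 𝒜 i) (t : ℤ) :
    restrictM (conv (dualGr 𝒜) 0 t F (relFun c₀ c₁)) =
      cupHB 𝒜 t (restrictA F) c₁ + cupBH 𝒜 t (restrictM F) c₀ := by
  funext a m b
  simp only [restrictM, restrictA, conv, cupHB, cupBH, splitSum_append_cons, splitSum_map,
    snd_splitSum, map_par_map_inl, relFun_map_inl h₁, relFun_append_inr h₀ h₁, par_inr,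
    List.map_append, List.map_cons, List.length_append, List.length_cons, Pi.add_apply,
    List.length_map, zero_mul, zero_add, TrivSqZeroExt.snd_add, TrivSqZeroExt.snd_smul,
    TrivSqZeroExt.snd_mul, TrivSqZeroExt.fst_inl, TrivSqZeroExt.snd_inl, fst_inr, snd_inr,
    MulOpposite.op_zero, zero_smul, mul_zero, smul_eq_mul, op_smul_eq_mul, add_zero, zero_add]
  congr 1
  refine splitSum_congr fun p q _ => ?_
  congr 1
  exact sgn_congr (by push_cast; ring)

end RestrictionOfOperations

/-! ### The bimodule Hochschild complex -/

section RelativeComplex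

variable {k A : Type*} [Field k] [Ring A] [Algebra k A] {𝒜 : ℤ → Submodule k A}

lemma markSum_add (c c' : List A → A → List A → A) :
    markSum (c + c') = markSum c + markSum c' := by
  funext l
  rw [Pi.add_apply, markSum, markSum, markSum, ← splitSum_add]
  refine splitSum_congr fun a r _ => ?_
  cases r <;> simp

lemma markSum_smul (r : k) (c : List A → A → List A → A) : markSum (r • c) = r • markSum c := by
  funext l
  rw [Pi.smul_apply, markSum, markSum, smul_splitSum]
  refine splitSum_congr fun a r _ => ?_
  cases r <;> simp

/-- The isomorphism of the bimodule Hochschild complex with the weight preserving cochains of the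
dual numbers, in bidegree `i`. -/
def relToDualDeg (i : ℤ × ℤ) : RelDeg 𝒜 i →ₗ[k] HCdeg (dualGr 𝒜) i where
  toFun c := ⟨relFun c.1 c.2, relFun_mem c.1.2 c.2.2⟩
  map_add' c c' := by
    ext l
    · simp [relFun]
    · simp [relFun, markSum_add]
  map_smul' r c := by
    ext l
    · simp [relFun]
    · simp [relFun, markSum_smul]

/-- The restriction of cochains of the dual numbers to the lists that contain at most one element
of the bimodule, in bidegree `i`. -/
def dualToRelDeg (i : ℤ × ℤ) : HCdeg (dualGr 𝒜) i →ₗ[k] RelDeg 𝒜 i where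
  toFun F := (⟨restrictA F, restrictA_mem F.2⟩, ⟨restrictM F, restrictM_mem F.2⟩)
  map_add' F F' := by
    ext
    · simp [restrictA]
    · simp [restrictM]
  map_smul' r F := by
    ext
    · simp [restrictA]
    · simp [restrictM]

lemma dualToRelDeg_relToDualDeg (i : ℤ × ℤ) (c : RelDeg 𝒜 i) :
    dualToRelDeg i (relToDualDeg i c) = c :=
  Prod.ext (Subtype.ext (restrictA_relFun c.2.2)) (Subtype.ext (restrictM_relFun c.1.2.1 c.2.2))

/-- The embedding of the bimodule Hochschild complex of `A` in the Hochschild complex of the dual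
numbers over `A`. -/
noncomputable def relToDual : RelHC 𝒜 →ₗ[k] HC (dualGr 𝒜) :=
  Tot.lift fun i => Tot.of k (fun i => HCdeg (dualGr 𝒜) i) i ∘ₗ relToDualDeg i

/-- The retraction of the embedding of the bimodule Hochschild complex of `A` in the Hochschild
complex of the dual numbers over `A`. -/
noncomputable def dualToRel : HC (dualGr 𝒜) →ₗ[k] RelHC 𝒜 :=
  Tot.lift fun i => Tot.of k (fun i => RelDeg 𝒜 i) i ∘ₗ dualToRelDeg i

@[simp] lemma relToDual_of (i : ℤ × ℤ) (c : RelDeg 𝒜 i) :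
    relToDual (Tot.of k (fun i => RelDeg 𝒜 i) i c) =
      Tot.of k (fun i => HCdeg (dualGr 𝒜) i) i (relToDualDeg i c) := Tot.lift_of _ _ _

@[simp] lemma dualToRel_of (i : ℤ × ℤ) (c : HCdeg (dualGr 𝒜) i) :
    dualToRel (Tot.of k (fun i => HCdeg (dualGr 𝒜) i) i c) =
      Tot.of k (fun i => RelDeg 𝒜 i) i (dualToRelDeg i c) := Tot.lift_of _ _ _

lemma relToDual_mem {i : ℤ × ℤ} {x : RelHC 𝒜} (hx : x ∈ homPart k (fun i => RelDeg 𝒜 i) i) :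
    relToDual x ∈ homPart k (fun i => HCdeg (dualGr 𝒜) i) i := by
  obtain ⟨c, rfl⟩ := hx
  rw [relToDual_of]
  exact Tot.of_mem _ _

lemma dualToRel_relToDual (x : RelHC 𝒜) : dualToRel (relToDual x) = x := by
  refine graded_induction (isInternal_homPart k fun i => RelDeg 𝒜 i) (by simp)
    (fun x y hx hy => by simp only [map_add, hx, hy]) (fun i x hx => ?_) x
  obtain ⟨c, rfl⟩ := hx
  rw [relToDual_of, dualToRel_of, dualToRelDeg_relToDualDeg]

lemma relToDual_injective : Function.Injective (relToDual (𝒜 := 𝒜)) :=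
  Function.LeftInverse.injective dualToRel_relToDual

variable [GradedAlgebra 𝒜]

/-- The retraction is linear for the insertion of bimodule cochains. -/
lemma dualToRel_pre (F : HC (dualGr 𝒜)) (x : RelHC 𝒜) :
    dualToRel (hcPre _ F (relToDual x)) = relPre 𝒜 (dualToRel F) x := by
  refine graded_induction (isInternal_homPart k fun i => HCdeg (dualGr 𝒜) i) (by simp)
    (fun x y hx hy => by simp only [map_add, LinearMap.add_apply, hx, hy]) (fun i F hF => ?_) F
  refine graded_induction (isInternal_homPart k fun i => RelDeg 𝒜 i) (by simp)
    (fun x y hx hy => by simp only [map_add, hx, hy]) (fun j x hx => ?_) x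
  obtain ⟨F, rfl⟩ := hF
  obtain ⟨c, rfl⟩ := hx
  rw [relToDual_of, hcPre, Tot.lift₂_of, dualToRel_of, relPre, Tot.lift₂_of,
    LinearMap.compr₂_apply, LinearMap.compr₂_apply, dualToRel_of]
  congr 1
  have e : braceHH (dualGr 𝒜) j.2 F (relFun c.1 c.2) = ins (dualGr 𝒜) j (relFun c.1 c.2) F :=
    braceHH_eq_ins _ F.2.1 (relFun_mem c.1.2 c.2.2)
  refine Prod.ext (Subtype.ext ?_) (Subtype.ext ?_)
  · change restrictA (braceHH (dualGr 𝒜) j.2 F (relFun c.1 c.2)) = braceHH 𝒜 j.2 (restrictA F) c.1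
    rw [e, restrictA_ins c.2.2, braceHH_eq_ins _ (restrictA_mem F.2).1 c.1.2]
  · change restrictM (braceHH (dualGr 𝒜) j.2 F (relFun c.1 c.2)) = _
    rw [e, restrictM_ins c.1.2 c.2.2 F.2.1]
    rfl

lemma dualToRel_cup_left (x : RelHC 𝒜) (F : HC (dualGr 𝒜)) :
    dualToRel (hcCup _ (relToDual x) F) = relCup 𝒜 x (dualToRel F) := by
  refine graded_induction (isInternal_homPart k fun i => HCdeg (dualGr 𝒜) i) (by simp)
    (fun x y hx hy => by simp only [map_add, hx, hy]) (fun i F hF => ?_) F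
  refine graded_induction (isInternal_homPart k fun i => RelDeg 𝒜 i) (by simp)
    (fun x y hx hy => by simp only [map_add, LinearMap.add_apply, hx, hy]) (fun j x hx => ?_) x
  obtain ⟨F, rfl⟩ := hF
  obtain ⟨c, rfl⟩ := hx
  rw [relToDual_of, hcCup, Tot.lift₂_of, dualToRel_of, relCup, Tot.lift₂_of,
    LinearMap.compr₂_apply, LinearMap.compr₂_apply, dualToRel_of]
  congr 1
  have e : cupHH (dualGr 𝒜) i.2 (relFun c.1 c.2) F = conv (dualGr 𝒜) 0 i.2 (relFun c.1 c.2) F :=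
    cupHH_eq_conv _ _ _ _
  refine Prod.ext (Subtype.ext ?_) (Subtype.ext ?_)
  · change restrictA (cupHH (dualGr 𝒜) i.2 (relFun c.1 c.2) F) = cupHH 𝒜 i.2 c.1 (restrictA F)
    rw [e, restrictA_conv_left c.2.2]
  · change restrictM (cupHH (dualGr 𝒜) i.2 (relFun c.1 c.2) F) = _
    rw [e, restrictM_conv_left c.1.2.1 c.2.2]
    rfl

lemma dualToRel_cup_right (F : HC (dualGr 𝒜)) (x : RelHC 𝒜) :
    dualToRel (hcCup _ F (relToDual x)) = relCup 𝒜 (dualToRel F) x := by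
  refine graded_induction (isInternal_homPart k fun i => HCdeg (dualGr 𝒜) i) (by simp)
    (fun x y hx hy => by simp only [map_add, LinearMap.add_apply, hx, hy]) (fun i F hF => ?_) F
  refine graded_induction (isInternal_homPart k fun i => RelDeg 𝒜 i) (by simp)
    (fun x y hx hy => by simp only [map_add, hx, hy]) (fun j x hx => ?_) x
  obtain ⟨F, rfl⟩ := hF
  obtain ⟨c, rfl⟩ := hx
  rw [relToDual_of, hcCup, Tot.lift₂_of, dualToRel_of, relCup, Tot.lift₂_of,
    LinearMap.compr₂_apply, LinearMap.compr₂_apply, dualToRel_of]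
  congr 1
  have e : cupHH (dualGr 𝒜) j.2 F (relFun c.1 c.2) = conv (dualGr 𝒜) 0 j.2 F (relFun c.1 c.2) :=
    cupHH_eq_conv _ _ _ _
  refine Prod.ext (Subtype.ext ?_) (Subtype.ext ?_)
  · change restrictA (cupHH (dualGr 𝒜) j.2 F (relFun c.1 c.2)) = cupHH 𝒜 j.2 (restrictA F) c.1
    rw [e, restrictA_conv_right c.2.2]
  · change restrictM (cupHH (dualGr 𝒜) j.2 F (relFun c.1 c.2)) = _
    rw [e, restrictM_conv_right c.1.2.1 c.2.2]
    rfl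

omit [GradedAlgebra 𝒜] in
lemma relToDual_dualToRel_of {i : ℤ × ℤ} (F : HCdeg (dualGr 𝒜) i)
    (hF : PreservesWeight k (F : List (DualNumber A) → DualNumber A)) :
    relToDual (dualToRel (Tot.of k (fun i => HCdeg (dualGr 𝒜) i) i F)) =
      Tot.of k (fun i => HCdeg (dualGr 𝒜) i) i F := by
  rw [dualToRel_of, relToDual_of]
  exact congrArg _ (Subtype.ext (relFun_restrict F.2 hF))

/-- The pre-Lie product of the bimodule complex is that of the complex of the dual numbers: both
sides preserve weights, and they have the same restriction. -/
theorem relToDual_pre (x y : RelHC 𝒜) :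
    relToDual (relPre 𝒜 x y) = hcPre _ (relToDual x) (relToDual y) := by
  conv_lhs => rw [← dualToRel_relToDual x]
  rw [← dualToRel_pre]
  refine graded_induction (isInternal_homPart k fun i => RelDeg 𝒜 i) (by simp)
    (fun x y hx hy => by simp only [map_add, LinearMap.add_apply, hx, hy]) (fun i x hx => ?_) x
  refine graded_induction (isInternal_homPart k fun i => RelDeg 𝒜 i) (by simp)
    (fun x y hx hy => by simp only [map_add, hx, hy]) (fun j y hy => ?_) y
  obtain ⟨c, rfl⟩ := hx
  obtain ⟨c', rfl⟩ := hy
  rw [relToDual_of, relToDual_of, hcPre, Tot.lift₂_of, LinearMap.compr₂_apply]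
  refine relToDual_dualToRel_of _ ?_
  have e : braceHH (dualGr 𝒜) j.2 (relFun c.1 c.2) (relFun c'.1 c'.2) =
      ins (dualGr 𝒜) j (relFun c'.1 c'.2) (relFun c.1 c.2) :=
    braceHH_eq_ins _ (relFun_mem c.1.2 c.2.2).1 (relFun_mem c'.1.2 c'.2.2)
  change PreservesWeight k (braceHH (dualGr 𝒜) j.2 (relFun c.1 c.2) (relFun c'.1 c'.2))
  rw [e]
  exact (relFun_preservesWeight c.1.2.1 c.2.2).ins (relFun_preservesWeight c'.1.2.1 c'.2.2) j

theorem relToDual_cup (x y : RelHC 𝒜) :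
    relToDual (relCup 𝒜 x y) = hcCup _ (relToDual x) (relToDual y) := by
  conv_lhs => rw [← dualToRel_relToDual x]
  rw [← dualToRel_cup_right]
  refine graded_induction (isInternal_homPart k fun i => RelDeg 𝒜 i) (by simp)
    (fun x y hx hy => by simp only [map_add, LinearMap.add_apply, hx, hy]) (fun i x hx => ?_) x
  refine graded_induction (isInternal_homPart k fun i => RelDeg 𝒜 i) (by simp)
    (fun x y hx hy => by simp only [map_add, hx, hy]) (fun j y hy => ?_) y
  obtain ⟨c, rfl⟩ := hx
  obtain ⟨c', rfl⟩ := hy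
  rw [relToDual_of, relToDual_of, hcCup, Tot.lift₂_of, LinearMap.compr₂_apply]
  refine relToDual_dualToRel_of _ ?_
  change PreservesWeight k (cupHH (dualGr 𝒜) j.2 (relFun c.1 c.2) (relFun c'.1 c'.2))
  rw [cupHH_eq_conv]
  exact (relFun_preservesWeight c.1.2.1 c.2.2).conv (relFun_preservesWeight c'.1.2.1 c'.2.2) 0 j.2

variable (𝒜) in
/-- The sum of the identities of `A` and of the diagonal bimodule, which corresponds to the
identity of the dual numbers. -/
noncomputable def relIota : RelHC 𝒜 := dualToRel (hcIota (dualGr 𝒜))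

omit [GradedAlgebra 𝒜] in
lemma relIota_mem : relIota 𝒜 ∈ homPart k (fun i => RelDeg 𝒜 i) (1, 0) := by
  rw [relIota, hcIota, dualToRel_of]
  exact Tot.of_mem _ _

lemma idFun_preservesWeight : PreservesWeight k (idFun : List (DualNumber A) → DualNumber A) := by
  refine ⟨isML_idFun, fun l n hl => ?_⟩
  match l, n, hl with
  | [], _, _ => exact zero_mem _
  | [_], _, .cons_inl x .nil => exact TrivSqZeroExt.snd_inl A x
  | [_], _, .cons_inr x .nil => exact fst_inr x
  | _ :: _ :: _, _, _ => exact zero_mem _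

omit [GradedAlgebra 𝒜] in
lemma relToDual_iota : relToDual (relIota 𝒜) = hcIota (dualGr 𝒜) :=
  relToDual_dualToRel_of _ idFun_preservesWeight

lemma relToDual_one : relToDual (relOne 𝒜) = hcOne (dualGr 𝒜) := by
  apply HC.eval_injective
  rw [relOne, relToDual_of, HC.eval_of, HC.eval_one]
  change relFun oneFun 0 = oneFun
  have h0 : markSum (0 : List A → A → List A → A) = 0 := by
    simpa using markSum_smul (0 : k) (0 : List A → A → List A → A)
  funext l
  cases l <;> simp [relFun, h0, oneFun]

lemma rel_mul_eq : Tot.of k (fun i => RelDeg 𝒜 i) (2, 0)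
    (⟨mulFun, mulFun_mem 𝒜⟩, ⟨actFun, actFun_mem 𝒜⟩) = relCup 𝒜 (relIota 𝒜) (relIota 𝒜) := by
  apply relToDual_injective
  rw [relToDual_cup, relToDual_iota, ← hc_mul_eq, relToDual_of]
  refine congrArg _ (Subtype.ext ?_)
  change relFun mulFun actFun = mulFun
  have : PreservesWeight k (mulFun : List (DualNumber A) → DualNumber A) := by
    rw [← conv_idFun_idFun (𝒜 := dualGr 𝒜)]
    exact idFun_preservesWeight.conv idFun_preservesWeight 0 0
  rw [← relFun_restrict (mulFun_mem (dualGr 𝒜)) this]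
  congr 1
  · funext l
    match l with
    | [] => rfl
    | [_] => rfl
    | [x, y] => simp [restrictA, mulFun]
    | _ :: _ :: _ :: _ => rfl
  · funext a m b
    match a, b with
    | [], [] => rfl
    | [x], [] => simp [restrictM, mulFun, actFun]
    | [], [y] => simp [restrictM, mulFun, actFun]
    | [], _ :: _ :: _ => rfl
    | [_], _ :: _ => rfl
    | [_, _], [] => rfl
    | [_, _], _ :: _ => rfl
    | _ :: _ :: _ :: _, [] => rfl
    | _ :: _ :: _ :: _, _ :: _ => rfl

lemma rel_pre_mem (i j : ℤ × ℤ) (x : RelHC 𝒜) (hx : x ∈ homPart k (fun i => RelDeg 𝒜 i) i)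
    (y : RelHC 𝒜) (hy : y ∈ homPart k (fun i => RelDeg 𝒜 i) j) :
    relPre 𝒜 x y ∈ homPart k (fun i => RelDeg 𝒜 i) (i + j - (1, 0)) := by
  obtain ⟨c, rfl⟩ := hx
  obtain ⟨c', rfl⟩ := hy
  rw [relPre, Tot.lift₂_of]
  exact Tot.of_mem _ _

lemma rel_cup_mem (i j : ℤ × ℤ) (x : RelHC 𝒜) (hx : x ∈ homPart k (fun i => RelDeg 𝒜 i) i)
    (y : RelHC 𝒜) (hy : y ∈ homPart k (fun i => RelDeg 𝒜 i) j) :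
    relCup 𝒜 x y ∈ homPart k (fun i => RelDeg 𝒜 i) (i + j) := by
  obtain ⟨c, rfl⟩ := hx
  obtain ⟨c', rfl⟩ := hy
  rw [relCup, Tot.lift₂_of]
  exact Tot.of_mem _ _

theorem relToDual_bracket (x y : RelHC 𝒜) :
    relToDual (relBracket 𝒜 x y) = hcBracket _ (relToDual x) (relToDual y) := by
  refine graded_induction (isInternal_homPart k fun i => RelDeg 𝒜 i) (by simp)
    (fun x y hx hy => by simp only [map_add, LinearMap.add_apply, hx, hy]) (fun i x hx => ?_) x
  refine graded_induction (isInternal_homPart k fun i => RelDeg 𝒜 i) (by simp)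
    (fun x y hx hy => by simp only [map_add, hx, hy]) (fun j y hy => ?_) y
  rw [relBracket, hcBracket, gradedCommutator_apply _ hx hy,
    gradedCommutator_apply _ (relToDual_mem hx) (relToDual_mem hy), map_sub, map_smul,
    relToDual_pre, relToDual_pre]

theorem relToDual_d (x : RelHC 𝒜) : relToDual (relD 𝒜 x) = hcD _ (relToDual x) := by
  rw [relD, rel_mul_eq, relToDual_bracket, relToDual_cup, relToDual_iota, hcD, hc_mul_eq]

omit [GradedAlgebra 𝒜] in
lemma dualToRel_mem {i : ℤ × ℤ} {F : HC (dualGr 𝒜)}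
    (hF : F ∈ homPart k (fun i => HCdeg (dualGr 𝒜) i) i) :
    dualToRel F ∈ homPart k (fun i => RelDeg 𝒜 i) i := by
  obtain ⟨F, rfl⟩ := hF
  rw [dualToRel_of]
  exact Tot.of_mem _ _

/-- The retraction commutes with the composition with the multiplication on the left, because
this composition is a commutator for the cup product. -/
lemma dualToRel_mul_pre {i : ℤ × ℤ} {F : HC (dualGr 𝒜)}
    (hF : F ∈ homPart k (fun i => HCdeg (dualGr 𝒜) i) i) :
    dualToRel (hcPre _ (hcCup _ (hcIota _) (hcIota _)) F) =
      relPre 𝒜 (relCup 𝒜 (relIota 𝒜) (relIota 𝒜)) (dualToRel F) := by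
  have hB := (hc_isBigradedBraceAlgebra (dualGr 𝒜)).isBraceAlgebra
  have e1 := hB.m_pre (mem_totalGr hF)
  have e2 := hB.m_pre (mem_totalGr (relToDual_mem (dualToRel_mem hF)))
  rw [← relToDual_iota, ← relToDual_cup, ← relToDual_cup, ← relToDual_cup, ← relToDual_pre,
    ← map_smul, ← map_sub] at e2
  rw [relToDual_injective e2, e1, ← relToDual_iota, map_sub, map_smul, dualToRel_cup_left,
    dualToRel_cup_right]

/-- Although the retraction is not compatible with insertions, it commutes with the differential. -/
theorem dualToRel_d (F : HC (dualGr 𝒜)) : dualToRel (hcD _ F) = relD 𝒜 (dualToRel F) := by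
  refine graded_induction (isInternal_homPart k fun i => HCdeg (dualGr 𝒜) i) (by simp)
    (fun x y hx hy => by simp only [map_add, hx, hy]) (fun i F hF => ?_) F
  have hm : relCup 𝒜 (relIota 𝒜) (relIota 𝒜) ∈ homPart k (fun i => RelDeg 𝒜 i) (2, 0) := by
    rw [← rel_mul_eq]
    exact Tot.of_mem _ _
  have hm' : hcCup (dualGr 𝒜) (hcIota _) (hcIota _) ∈
      homPart k (fun i => HCdeg (dualGr 𝒜) i) (2, 0) := by
    rw [← hc_mul_eq]
    exact Tot.of_mem _ _
  have e : dualToRel (hcPre _ F (hcCup (dualGr 𝒜) (hcIota _) (hcIota _))) =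
      relPre 𝒜 (dualToRel F) (relCup 𝒜 (relIota 𝒜) (relIota 𝒜)) := by
    rw [← dualToRel_pre, relToDual_cup, relToDual_iota]
  rw [hcD, hc_mul_eq, relD, rel_mul_eq, hcBracket, relBracket, gradedCommutator_apply _ hm' hF,
    gradedCommutator_apply _ hm (dualToRel_mem hF), map_sub, map_smul, dualToRel_mul_pre hF, e]

variable (𝒜) in
/-- The bimodule Hochschild complex of a graded algebra is a brace algebra, because it is a retract
of the Hochschild complex of the dual numbers. -/
theorem rel_isBigradedBraceAlgebra :
    IsBigradedBraceAlgebra (homPart k fun i => RelDeg 𝒜 i) (relD 𝒜) (relCup 𝒜) (relPre 𝒜)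
      (relBracket 𝒜) (relOne 𝒜) (relIota 𝒜) := by
  have hB := hc_isBigradedBraceAlgebra (dualGr 𝒜)
  exact {
    isInternal := isInternal_homPart k _
    cup_mem := rel_cup_mem
    pre_mem := rel_pre_mem
    iota_mem := relIota_mem
    cup_assoc := fun x y z => relToDual_injective (by simp only [relToDual_cup, hB.cup_assoc])
    one_cup := fun x => relToDual_injective (by rw [relToDual_cup, relToDual_one, hB.one_cup])
    cup_one := fun x => relToDual_injective (by rw [relToDual_cup, relToDual_one, hB.cup_one])
    one_mem := Tot.of_mem _ _
    one_pre := fun x => relToDual_injective (by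
      rw [relToDual_pre, relToDual_one, hB.one_pre, map_zero])
    iota_pre := fun x => relToDual_injective (by rw [relToDual_pre, relToDual_iota, hB.iota_pre])
    br_eq := fun i j x hx y hy => gradedCommutator_apply _ hx hy
    d_eq := fun x => by rw [relD, rel_mul_eq]
    cup_pre := fun i j x y hy z hz => relToDual_injective (by
      simp only [map_add, map_smul, relToDual_cup, relToDual_pre,
        hB.cup_pre i j _ _ (relToDual_mem hy) _ (relToDual_mem hz)])
    assoc_symm := fun i j x y hy z hz => relToDual_injective (by
      simp only [map_sub, map_smul, relToDual_pre]
      exact hB.assoc_symm i j _ _ (relToDual_mem hy) _ (relToDual_mem hz))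
    assoc_self := fun i x y hy hi => relToDual_injective (by
      simp only [relToDual_pre]
      exact hB.assoc_self i _ _ (relToDual_mem hy) hi)
    homotopy := fun l i j x hx y hy z hz dx dy dz => by
      obtain ⟨w, hw⟩ := hB.homotopy l i j _ (relToDual_mem hx) _ (relToDual_mem hy) _
        (relToDual_mem hz) (by rw [← relToDual_d, dx, map_zero])
        (by rw [← relToDual_d, dy, map_zero]) (by rw [← relToDual_d, dz, map_zero])
      refine ⟨dualToRel w, ?_⟩
      rw [← dualToRel_d, hw]
      simp only [← relToDual_pre, ← relToDual_cup, ← map_smul, ← map_sub, dualToRel_relToDual] }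

end RelativeComplex

/-! ### The map `κ` -/

section Kappa

variable {k A : Type*} [Field k] [Ring A] [Algebra k A] {𝒜 : ℤ → Submodule k A}

/-- The function on lists of elements of `A` given by the bimodule component of a function on lists
of dual numbers. For the insertion of the unit of the bimodule in a bimodule cochain `c` this is the
coefficient of `ε` in `κ(c)`. -/
def restrictS (F : List (DualNumber A) → DualNumber A) (l : List A) : A := snd (F (l.map inl))

lemma restrictS_mem {i : ℤ × ℤ} {F : List (DualNumber A) → DualNumber A}
    (hF : F ∈ HCdeg (dualGr 𝒜) i) : restrictS F ∈ HCdeg 𝒜 i := by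
  refine ⟨fun a b => ?_, fun l hl => ?_, fun l n hl => (hF.2.2 _ _ hl.map_inl).2⟩
  · have := hF.1 (a.map inl) (b.map inl)
    constructor
    · intro x y
      simpa [restrictS] using congrArg snd (this.map_add (inl x) (inl y))
    · intro r x
      simpa [restrictS] using congrArg snd (this.map_smul r (inl x))
  · rw [restrictS, hF.2.1 _ (by simpa using hl)]
    rfl

/-- The linear map `restrictS` on Hochschild complexes. -/
noncomputable def dualToHC : HC (dualGr 𝒜) →ₗ[k] HC 𝒜 :=
  Tot.lift fun i => Tot.of k (fun i => HCdeg 𝒜 i) i ∘ₗ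
    ({ toFun := fun F => ⟨restrictS F, restrictS_mem F.2⟩
       map_add' := fun _ _ => rfl
       map_smul' := fun _ _ => rfl } : HCdeg (dualGr 𝒜) i →ₗ[k] HCdeg 𝒜 i)

lemma eval_dualToHC (F : HC (dualGr 𝒜)) : HC.eval (dualToHC F) = restrictS (HC.eval F) := by
  refine graded_induction (isInternal_homPart k fun i => HCdeg (dualGr 𝒜) i) ?_
    (fun x y hx hy => ?_) (fun i F hF => ?_) F
  · simp only [map_zero]
    rfl
  · simp only [map_add, hx, hy]
    rfl
  · obtain ⟨F, rfl⟩ := hF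
    rw [dualToHC, Tot.lift_of, LinearMap.comp_apply, HC.eval_of, HC.eval_of]
    rfl

lemma dualToHC_mem {i : ℤ × ℤ} {F : HC (dualGr 𝒜)}
    (hF : F ∈ homPart k (fun i => HCdeg (dualGr 𝒜) i) i) :
    dualToHC F ∈ homPart k (fun i => HCdeg 𝒜 i) i := by
  obtain ⟨F, rfl⟩ := hF
  rw [dualToHC, Tot.lift_of]
  exact Tot.of_mem _ _

/-- The projection of the bimodule Hochschild complex onto the Hochschild complex. -/
noncomputable def relFst : RelHC 𝒜 →ₗ[k] HC 𝒜 :=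
  Tot.lift fun i => Tot.of k (fun i => HCdeg 𝒜 i) i ∘ₗ LinearMap.fst k _ _

@[simp] lemma relFst_of (i : ℤ × ℤ) (c : RelDeg 𝒜 i) :
    relFst (Tot.of k (fun i => RelDeg 𝒜 i) i c) = Tot.of k (fun i => HCdeg 𝒜 i) i c.1 :=
  Tot.lift_of _ _ _

lemma relFst_mem {i : ℤ × ℤ} {x : RelHC 𝒜} (hx : x ∈ homPart k (fun i => RelDeg 𝒜 i) i) :
    relFst x ∈ homPart k (fun i => HCdeg 𝒜 i) i := by
  obtain ⟨c, rfl⟩ := hx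
  rw [relFst_of]
  exact Tot.of_mem _ _

variable (A) in
/-- The unit of the diagonal bimodule as a `0`-cochain of the dual numbers. -/
def epsFun : List (DualNumber A) → DualNumber A
  | [] => inr 1
  | _ => 0

lemma epsFun_cons (x : DualNumber A) (l : List (DualNumber A)) : epsFun A (x :: l) = 0 := rfl

variable [GradedAlgebra 𝒜]

lemma relFst_pre (x y : RelHC 𝒜) : relFst (relPre 𝒜 x y) = hcPre 𝒜 (relFst x) (relFst y) := by
  refine graded_induction (isInternal_homPart k fun i => RelDeg 𝒜 i) (by simp)
    (fun x y hx hy => by simp only [map_add, LinearMap.add_apply, hx, hy]) (fun i x hx => ?_) x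
  refine graded_induction (isInternal_homPart k fun i => RelDeg 𝒜 i) (by simp)
    (fun x y hx hy => by simp only [map_add, hx, hy]) (fun j y hy => ?_) y
  obtain ⟨c, rfl⟩ := hx
  obtain ⟨c', rfl⟩ := hy
  rw [relFst_of, relFst_of, relPre, hcPre, Tot.lift₂_of, Tot.lift₂_of, LinearMap.compr₂_apply,
    LinearMap.compr₂_apply, relFst_of]
  rfl

lemma relFst_cup (x y : RelHC 𝒜) : relFst (relCup 𝒜 x y) = hcCup 𝒜 (relFst x) (relFst y) := by
  refine graded_induction (isInternal_homPart k fun i => RelDeg 𝒜 i) (by simp)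
    (fun x y hx hy => by simp only [map_add, LinearMap.add_apply, hx, hy]) (fun i x hx => ?_) x
  refine graded_induction (isInternal_homPart k fun i => RelDeg 𝒜 i) (by simp)
    (fun x y hx hy => by simp only [map_add, hx, hy]) (fun j y hy => ?_) y
  obtain ⟨c, rfl⟩ := hx
  obtain ⟨c', rfl⟩ := hy
  rw [relFst_of, relFst_of, relCup, hcCup, Tot.lift₂_of, Tot.lift₂_of, LinearMap.compr₂_apply,
    LinearMap.compr₂_apply, relFst_of]
  rfl

lemma relFst_d (x : RelHC 𝒜) : relFst (relD 𝒜 x) = hcD 𝒜 (relFst x) := by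
  refine graded_induction (isInternal_homPart k fun i => RelDeg 𝒜 i) (by simp)
    (fun x y hx hy => by simp only [map_add, hx, hy]) (fun i x hx => ?_) x
  rw [relD, hcD, relBracket, hcBracket, gradedCommutator_apply _ (Tot.of_mem _ _) hx,
    gradedCommutator_apply _ (Tot.of_mem _ _) (relFst_mem hx), map_sub, map_smul, relFst_pre,
    relFst_pre, relFst_of]

lemma dualToHC_pre (F : HC (dualGr 𝒜)) (x : RelHC 𝒜) :
    dualToHC (hcPre _ F (relToDual x)) = hcPre 𝒜 (dualToHC F) (relFst x) := by
  refine graded_induction (isInternal_homPart k fun i => RelDeg 𝒜 i) (by simp)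
    (fun x y hx hy => by simp only [map_add, hx, hy]) (fun j x hx => ?_) x
  apply HC.eval_injective
  rw [eval_dualToHC, HC.eval_pre _ (relToDual_mem hx), HC.eval_pre _ (relFst_mem hx),
    eval_dualToHC]
  obtain ⟨c, rfl⟩ := hx
  rw [relToDual_of, relFst_of, HC.eval_of, HC.eval_of]
  funext l
  change restrictS (ins (dualGr 𝒜) j (relFun c.1 c.2) (HC.eval F)) l = _
  simp only [restrictS, ins, splitSum_map, snd_splitSum, relFun_map_inl c.2.2, map_par_map_inl,
    List.length_map, List.map_append, List.map_cons, TrivSqZeroExt.snd_smul]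

lemma dualToHC_cup_left (x : RelHC 𝒜) (F : HC (dualGr 𝒜)) :
    dualToHC (hcCup _ (relToDual x) F) = hcCup 𝒜 (relFst x) (dualToHC F) := by
  refine graded_induction (isInternal_homPart k fun i => RelDeg 𝒜 i) (by simp)
    (fun x y hx hy => by simp only [map_add, LinearMap.add_apply, hx, hy]) (fun j x hx => ?_) x
  refine graded_induction (isInternal_homPart k fun i => HCdeg (dualGr 𝒜) i) (by simp)
    (fun x y hx hy => by simp only [map_add, hx, hy]) (fun i F hF => ?_) F
  apply HC.eval_injective
  rw [eval_dualToHC, HC.eval_cup _ hF, HC.eval_cup _ (dualToHC_mem hF), eval_dualToHC]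
  obtain ⟨c, rfl⟩ := hx
  rw [relToDual_of, relFst_of, HC.eval_of, HC.eval_of]
  funext l
  change restrictS (conv (dualGr 𝒜) 0 i.2 (relFun c.1 c.2) (HC.eval F)) l = _
  simp only [restrictS, conv, splitSum_map, snd_splitSum, relFun_map_inl c.2.2, map_par_map_inl,
    List.length_map, TrivSqZeroExt.snd_smul, TrivSqZeroExt.snd_mul, TrivSqZeroExt.fst_inl,
    TrivSqZeroExt.snd_inl, smul_zero, add_zero, smul_eq_mul]

lemma dualToHC_cup_right (F : HC (dualGr 𝒜)) (x : RelHC 𝒜) :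
    dualToHC (hcCup _ F (relToDual x)) = hcCup 𝒜 (dualToHC F) (relFst x) := by
  refine graded_induction (isInternal_homPart k fun i => RelDeg 𝒜 i) (by simp)
    (fun x y hx hy => by simp only [map_add, hx, hy]) (fun j x hx => ?_) x
  apply HC.eval_injective
  rw [eval_dualToHC, HC.eval_cup _ (relToDual_mem hx), HC.eval_cup _ (relFst_mem hx),
    eval_dualToHC]
  obtain ⟨c, rfl⟩ := hx
  rw [relToDual_of, relFst_of, HC.eval_of, HC.eval_of]
  funext l
  change restrictS (conv (dualGr 𝒜) 0 j.2 (HC.eval F) (relFun c.1 c.2)) l = _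
  simp only [restrictS, conv, splitSum_map, snd_splitSum, relFun_map_inl c.2.2, map_par_map_inl,
    List.length_map, TrivSqZeroExt.snd_smul, TrivSqZeroExt.snd_mul, TrivSqZeroExt.fst_inl,
    TrivSqZeroExt.snd_inl, smul_zero, zero_add, op_smul_eq_mul]

lemma relFst_iota : relFst (relIota 𝒜) = hcIota 𝒜 := by
  apply HC.eval_injective
  rw [relIota, hcIota, dualToRel_of, relFst_of, HC.eval_of, HC.eval_iota]
  change restrictA idFun = idFun
  funext l
  match l with
  | [] => rfl
  | [_] => rfl
  | _ :: _ :: _ => rfl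

lemma dualToHC_d (F : HC (dualGr 𝒜)) : dualToHC (hcD _ F) = hcD 𝒜 (dualToHC F) := by
  refine graded_induction (isInternal_homPart k fun i => HCdeg (dualGr 𝒜) i) (by simp)
    (fun x y hx hy => by simp only [map_add, hx, hy]) (fun i F hF => ?_) F
  rw [(hc_isBigradedBraceAlgebra (dualGr 𝒜)).isBraceAlgebra.d_apply (mem_totalGr hF),
    (hc_isBigradedBraceAlgebra 𝒜).isBraceAlgebra.d_apply (mem_totalGr (dualToHC_mem hF)),
    ← relToDual_iota, ← relToDual_cup, map_add, map_sub, map_smul, map_smul, dualToHC_cup_left,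
    dualToHC_cup_right, dualToHC_pre, relFst_cup, relFst_iota]

variable (𝒜) in
omit [GradedAlgebra 𝒜] in
lemma epsFun_mem [GradedAlgebra 𝒜] : epsFun A ∈ HCdeg (dualGr 𝒜) (0, 0) := by
  refine ⟨fun a b => ?_, fun l hl => ?_, fun l n hl => ?_⟩
  · cases a <;> exact ⟨by simp [epsFun], by simp [epsFun]⟩
  · match l with
    | [] => simp at hl
    | _ :: _ => rfl
  · match l with
    | [] => cases hl; simpa [epsFun] using inr_mem_dualGr (SetLike.one_mem_graded 𝒜)
    | _ :: _ => exact zero_mem _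

lemma conv_epsFun_left (t : ℤ) (F : List (DualNumber A) → DualNumber A) (l : List (DualNumber A)) :
    conv (dualGr 𝒜) 0 t (epsFun A) F l = inr 1 * F l := by
  rw [conv, splitSum_eq_left fun x a b => by simp [epsFun_cons]]
  simp [epsFun]

lemma conv_epsFun_right (F : List (DualNumber A) → DualNumber A) (l : List (DualNumber A)) :
    conv (dualGr 𝒜) 0 0 F (epsFun A) l = F l * inr 1 := by
  rw [conv, splitSum_eq_right fun a x b => by simp [epsFun_cons]]
  simp [epsFun]

lemma inr_one_mul_comm (x : DualNumber A) : inr 1 * x = x * inr 1 := by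
  ext <;> simp

/-- The unit of the bimodule is a cocycle because it is central in the dual numbers. -/
lemma dFun_epsFun : dFun (dualGr 𝒜) (0, 0) (epsFun A) = 0 := by
  have e : ins (dualGr 𝒜) (2, 0) mulFun (epsFun A) = 0 := by
    funext l
    refine splitSum_eq_zero fun a r _ => splitSum_eq_zero fun b e _ => ?_
    cases a <;> simp [epsFun]
  rw [dFun, ins_mulFun (epsFun_mem 𝒜), e]
  funext l
  simp only [Pi.add_apply, Pi.sub_apply, Pi.smul_apply, conv_epsFun_left, conv_epsFun_right,
    inr_one_mul_comm]
  simp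

/-- The coefficient of `ε` in `κ(c)` arises by insertion of the unit of the bimodule. -/
lemma restrictS_ins_epsFun {i : ℤ × ℤ} (c : RelDeg 𝒜 i) :
    restrictS (ins (dualGr 𝒜) (0, 0) (epsFun A) (relFun c.1 c.2)) =
      kappaFun k (c.2 : List A → A → List A → A) := by
  funext l
  rw [restrictS, ins, kappaFun, splitSum_map, snd_splitSum]
  refine splitSum_congr fun a r _ => ?_
  have h0 : ∀ x b e, sgn k (((((0, 0) : ℤ × ℤ).1 + ((0, 0) : ℤ × ℤ).2 - 1)) * (e.length : ℤ) +
      ((0, 0) : ℤ × ℤ).2 * ((a.map inl : List (DualNumber A)).length : ℤ)) •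
      relFun (c.1 : List A → A) c.2 (List.map (par (dualGr 𝒜) ((0, 0) : ℤ × ℤ).2) (a.map inl) ++
        epsFun A (x :: b) :: e) = 0 := fun x b e => by
    rw [epsFun_cons, (isML_relFun c.1.2.1 c.2.2).map_zero, smul_zero]
  rw [splitSum_eq_left h0, epsFun, map_par_zero, relFun_append_inr c.1.2.1 c.2.2,
    TrivSqZeroExt.snd_smul, snd_inr]
  congr 1
  exact sgn_congr (by simp)

variable (𝒜) in
/-- The cochain `epsFun` as an element of the Hochschild complex. -/
noncomputable def hcEps : HC (dualGr 𝒜) :=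
  Tot.of k (fun i => HCdeg (dualGr 𝒜) i) (0, 0) ⟨epsFun A, epsFun_mem 𝒜⟩

lemma hcEps_mem : hcEps 𝒜 ∈ homPart k (fun i => HCdeg (dualGr 𝒜) i) (0, 0) := Tot.of_mem _ _

lemma eval_hcEps : HC.eval (hcEps 𝒜) = epsFun A := HC.eval_of _ _

lemma hcD_hcEps : hcD _ (hcEps 𝒜) = 0 := by
  apply HC.eval_injective
  rw [HC.eval_d hcEps_mem, eval_hcEps, dFun_epsFun, map_zero]

/-- The map `κ` is the composition with the unit of the bimodule. -/
theorem kappa_apply (x : RelHC 𝒜) :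
    kappa 𝒜 x = (relFst x, dualToHC (hcPre _ (relToDual x) (hcEps 𝒜))) := by
  refine graded_induction (isInternal_homPart k fun i => RelDeg 𝒜 i) (by simp; rfl)
    (fun x y hx hy => by simp only [map_add, LinearMap.add_apply, hx, hy]; rfl) (fun i x hx => ?_) x
  obtain ⟨c, rfl⟩ := hx
  rw [kappa, Tot.lift_of, relFst_of]
  refine Prod.ext rfl ?_
  apply HC.eval_injective
  rw [eval_dualToHC, HC.eval_pre _ hcEps_mem, relToDual_of, HC.eval_of, eval_hcEps]
  refine (HC.eval_of _ _).trans ?_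
  exact (restrictS_ins_epsFun c).symm

/-- By `d_pre`, the composition with the cocycle `ε` commutes with the differential up to the graded
commutator of the cup product with `ε`, which vanishes as `ε` is central. -/
theorem kappa_d (x : RelHC 𝒜) : kappa 𝒜 (relD 𝒜 x) = epsD 𝒜 (kappa 𝒜 x) := by
  refine graded_induction (isInternal_homPart k fun i => RelDeg 𝒜 i) (by simp)
    (fun x y hx hy => by simp only [map_add, hx, hy]) (fun i x hx => ?_) x
  rw [kappa_apply, kappa_apply, relFst_d, relToDual_d]
  refine Prod.ext rfl ?_
  change _ = hcD 𝒜 (dualToHC (hcPre _ (relToDual x) (hcEps 𝒜)))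
  have hB := hc_isBigradedBraceAlgebra (dualGr 𝒜)
  rw [← dualToHC_d,
    hB.isBraceAlgebra.d_pre (mem_totalGr (relToDual_mem hx)) (mem_totalGr hcEps_mem),
    hcD_hcEps, map_zero, smul_zero, sub_zero, map_add]
  have : hcCup _ (relToDual x) (hcEps 𝒜) - sgn k ((i.1 + i.2) * (((0, 0) : ℤ × ℤ).1 +
      ((0, 0) : ℤ × ℤ).2)) • hcCup _ (hcEps 𝒜) (relToDual x) = 0 := by
    apply HC.eval_injective
    rw [map_sub, map_smul, HC.eval_cup _ hcEps_mem, HC.eval_cup _ (relToDual_mem hx), eval_hcEps]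
    funext l
    simp [conv_epsFun_left, conv_epsFun_right, inr_one_mul_comm]
  rw [this, smul_zero, map_zero, add_zero]

theorem kappa_one : kappa 𝒜 (relOne 𝒜) = epsOne 𝒜 := by
  rw [kappa_apply, relToDual_one, (hc_isBigradedBraceAlgebra (dualGr 𝒜)).one_pre, map_zero, relOne,
    relFst_of]
  rfl

/-- The map `κ` is multiplicative because `(x ∪ y){ε} = x ∪ y{ε} ± x{ε} ∪ y`. -/
theorem kappa_cup (x y : RelHC 𝒜) :
    kappa 𝒜 (relCup 𝒜 x y) = epsMul 𝒜 (kappa 𝒜 x) (kappa 𝒜 y) := by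
  refine graded_induction (isInternal_homPart k fun i => RelDeg 𝒜 i) (by simp)
    (fun x y hx hy => by simp only [map_add, hx, hy]) (fun j y hy => ?_) y
  rw [kappa_apply, kappa_apply, kappa_apply, relFst_cup, relToDual_cup]
  refine Prod.ext rfl ?_
  change _ = hcCup 𝒜 (relFst x) (dualToHC (hcPre _ (relToDual y) (hcEps 𝒜))) +
    hcCup 𝒜 (dualToHC (hcPre _ (relToDual x) (hcEps 𝒜)))
      (totalParity k (fun i => HCdeg 𝒜 i) (relFst y))
  have hp : totalParity k (fun i => HCdeg 𝒜 i) (relFst y) = sgn k (j.1 + j.2) • relFst y := by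
    obtain ⟨c, rfl⟩ := hy
    rw [relFst_of, totalParity_of]
  rw [hp, (hc_isBigradedBraceAlgebra (dualGr 𝒜)).cup_pre j (0, 0) _ _ (relToDual_mem hy) _
    hcEps_mem, map_add, map_smul, dualToHC_cup_left, dualToHC_cup_right, map_smul]
  have s : sgn k ((j.1 + j.2) * (((0, 0) : ℤ × ℤ).1 + ((0, 0) : ℤ × ℤ).2 - 1)) =
      sgn k (j.1 + j.2) := sgn_congr (by push_cast; grind)
  rw [s]

theorem kappa_mem {i : ℤ × ℤ} {x : RelHC 𝒜} (hx : x ∈ homPart k (fun i => RelDeg 𝒜 i) i) :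
    kappa 𝒜 x ∈ epsGr 𝒜 i := by
  obtain ⟨c, rfl⟩ := hx
  rw [kappa, Tot.lift_of]
  exact ⟨Tot.of_mem _ _, Tot.of_mem _ _⟩

end Kappa

/-! ### Cocycles in the kernel of `κ` -/

section Homotopy

variable {k A : Type*} [Field k] [Ring A] [Algebra k A] {𝒜 : ℤ → Submodule k A}

variable (A) in
/-- The linear map of dual numbers that sends an element of the bimodule to the same element of
the algebra, as a `1`-cochain. -/
def thetaFun : List (DualNumber A) → DualNumber A
  | [x] => inl (snd x)
  | _ => 0

variable (𝒜) in
lemma thetaFun_mem : thetaFun A ∈ HCdeg (dualGr 𝒜) (1, 0) := by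
  refine ⟨fun a b => ?_, fun l hl => ?_, fun l n hl => ?_⟩
  · match a, b with
    | [], [] => exact ⟨by simp [thetaFun], by simp [thetaFun]⟩
    | [], _ :: _ => exact ⟨by simp [thetaFun], by simp [thetaFun]⟩
    | [_], _ => exact ⟨by simp [thetaFun], by simp [thetaFun]⟩
    | _ :: _ :: _, _ => exact ⟨by simp [thetaFun], by simp [thetaFun]⟩
  · match l with
    | [] => rfl
    | [_] => simp at hl
    | _ :: _ :: _ => rfl
  · match l with
    | [] => exact zero_mem _
    | [x] =>
      rw [Prod.snd, add_zero]
      exact inl_mem_dualGr (isHomList_singleton _ hl).2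
    | _ :: _ :: _ => exact zero_mem _

variable [GradedAlgebra 𝒜]

/-- The insertion of a linear map of degree `0` applies it to one entry at a time, without signs. -/
lemma ins_of_mem_one_zero {B V : Type*} [Ring B] [Algebra k B] {ℬ : ℤ → Submodule k B}
    [GradedAlgebra ℬ] [AddCommGroup V] [Module k V] {c : List B → B} (hc : c ∈ HCdeg ℬ (1, 0))
    {φ : List B → V} (hφ : IsML k φ) (l : List B) :
    ins ℬ (1, 0) c φ l = splitSum (fun a r => match r with
      | [] => 0
      | x :: e => φ (a ++ c [x] :: e)) l := by
  refine splitSum_congr fun a r _ => ?_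
  have hc' : ∀ l : List B, l.length ≠ 1 → c l = 0 := fun l hl => hc.2.1 l (by simpa using hl)
  cases r with
  | nil => simp [hc' [], hφ.map_zero]
  | cons x e =>
    rw [splitSum_cons, splitSum_eq_left fun y b e => by
      rw [hc' (x :: y :: b) (by simp), hφ.map_zero, smul_zero], hc' [] (by simp), hφ.map_zero,
      smul_zero, zero_add]
    simp

/-- The coboundary of `thetaFun` vanishes on lists with at most one entry in the bimodule. -/
lemma dFun_thetaFun {l : List (DualNumber A)} {n : ℕ} (hl : IsPure l n) (hn : n ≤ 1) :
    dFun (dualGr 𝒜) (1, 0) (thetaFun A) l = 0 := by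
  by_cases hl2 : l.length = 2
  swap
  · obtain ⟨x, hx, hx'⟩ := HC.exists_eval_eq (thetaFun_mem 𝒜)
    rw [← hx', ← HC.eval_d hx]
    refine (HC.eval_mem ((hc_isBigradedBraceAlgebra (dualGr 𝒜)).d_mem _ _ hx)).2.1 l fun h => hl2 ?_
    have h : (l.length : ℤ) = 2 := by simpa using h
    exact_mod_cast h
  rw [dFun, ins_mulFun (thetaFun_mem 𝒜)]
  simp only [Pi.add_apply, Pi.sub_apply, Pi.smul_apply, sgn_one, add_zero, ins, conv]
  match l, n, hl with
  | [_, _], _, .cons_inl x (.cons_inl y .nil) => simp [splitSum_cons, thetaFun, idFun, mulFun]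
  | [_, _], _, .cons_inl x (.cons_inr y .nil) => simp [splitSum_cons, thetaFun, idFun, mulFun]
  | [_, _], _, .cons_inr x (.cons_inl y .nil) => simp [splitSum_cons, thetaFun, idFun, mulFun]
  | [_, _], _, .cons_inr x (.cons_inr y .nil) => omega

omit [GradedAlgebra 𝒜] in
/-- The retraction only depends on the values on lists with at most one entry from the bimodule. -/
lemma dualToRel_eq_zero {i : ℤ × ℤ} {F : HC (dualGr 𝒜)}
    (hF : F ∈ homPart k (fun i => HCdeg (dualGr 𝒜) i) i)
    (h : ∀ l n, IsPure l n → n ≤ 1 → HC.eval F l = 0) : dualToRel F = 0 := by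
  obtain ⟨F, rfl⟩ := hF
  rw [HC.eval_of] at h
  rw [dualToRel_of, show dualToRelDeg i F = 0 from ?_, map_zero]
  refine Prod.ext (Subtype.ext (funext fun l => ?_))
    (Subtype.ext (funext fun a => funext fun m => funext fun b => ?_))
  · exact congrArg fst (h _ 0 (isPure_map_inl l) zero_le_one)
  · exact congrArg snd (h _ 1
      ((isPure_map_inl a).append (.cons_inr m (isPure_map_inl b))) le_rfl)

lemma epsFun_mem_weight (l : List (DualNumber A)) : epsFun A l ∈ weight k A 1 := by
  cases l with
  | nil => exact fst_inr 1
  | cons _ _ => exact zero_mem _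

/-- Moving the only entry from the bimodule to `A` leaves nothing that a bimodule cochain could be
evaluated on. -/
lemma ins_thetaFun_relFun {i : ℤ × ℤ} {c₁ : List A → A → List A → A} (h₁ : c₁ ∈ BimDeg 𝒜 i)
    {l : List (DualNumber A)} {n : ℕ} (hl : IsPure l n) (hn : n ≤ 1) :
    ins (dualGr 𝒜) (1, 0) (thetaFun A) (relFun 0 c₁) l = 0 := by
  have h0 : IsML k (0 : List A → A) := fun _ _ => ⟨by simp, by simp⟩
  rw [ins_of_mem_one_zero (thetaFun_mem 𝒜) (isML_relFun h0 h₁)]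
  refine splitSum_eq_zero fun a r hr => ?_
  subst hr
  obtain ⟨na, nr, rfl, ha, hr⟩ := hl.split
  cases hr with
  | nil => rfl
  | cons_inl x hr =>
    change relFun 0 c₁ (a ++ inl (snd (inl x)) :: _) = 0
    rw [TrivSqZeroExt.snd_inl, TrivSqZeroExt.inl_zero, (isML_relFun h0 h₁).map_zero]
  | @cons_inr x e ne he =>
    obtain ⟨rfl, rfl⟩ : na = 0 ∧ ne = 0 := by omega
    obtain ⟨a, rfl⟩ := ha.eq_map_inl
    obtain ⟨e, rfl⟩ := he.eq_map_inl
    change relFun 0 c₁ (a.map inl ++ inl x :: e.map inl) = 0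
    rw [← List.map_cons, ← List.map_append, relFun_map_inl h₁]
    rfl

/-- The product of `epsFun` and `thetaFun` is the projection of the dual numbers onto the bimodule,
so that its insertion does not change a bimodule cochain. -/
lemma ins_conv_epsFun_thetaFun {i : ℤ × ℤ} {c₁ : List A → A → List A → A} (h₁ : c₁ ∈ BimDeg 𝒜 i)
    {l : List (DualNumber A)} {n : ℕ} (hl : IsPure l n) (hn : n ≤ 1) :
    ins (dualGr 𝒜) (1, 0) (conv (dualGr 𝒜) 0 0 (epsFun A) (thetaFun A)) (relFun 0 c₁) l =
      relFun 0 c₁ l := by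
  have h0 : IsML k (0 : List A → A) := fun _ _ => ⟨by simp, by simp⟩
  have hm : conv (dualGr 𝒜) 0 0 (epsFun A) (thetaFun A) ∈ HCdeg (dualGr 𝒜) (1, 0) := by
    have := cupHH_mem _ (epsFun_mem 𝒜) (thetaFun_mem 𝒜)
    rwa [cupHH_eq_conv, show ((0, 0) + (1, 0) : ℤ × ℤ) = (1, 0) by simp] at this
  have hi (x : A) : conv (dualGr 𝒜) 0 0 (epsFun A) (thetaFun A) [inl x] = 0 := by
    rw [conv_epsFun_left, thetaFun, TrivSqZeroExt.snd_inl, TrivSqZeroExt.inl_zero, mul_zero]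
  have hr (x : A) : conv (dualGr 𝒜) 0 0 (epsFun A) (thetaFun A) [inr x] = inr x := by
    rw [conv_epsFun_left, thetaFun, snd_inr]
    ext <;> simp
  rw [ins_of_mem_one_zero hm (isML_relFun h0 h₁)]
  have hz (a b : List (DualNumber A)) : relFun 0 c₁ (a ++ 0 :: b) = 0 :=
    (isML_relFun h0 h₁).map_zero a b
  match n, hl with
  | 0, hl =>
    obtain ⟨l, rfl⟩ := hl.eq_map_inl
    rw [relFun_map_inl h₁, splitSum_map]
    refine splitSum_eq_zero fun a r _ => ?_
    cases r with
    | nil => rfl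
    | cons x r => simp only [List.map_cons, hi, hz]
  | 1, hl =>
    obtain ⟨a, m, r, rfl, hr'⟩ := hl.eq_append_inr
    obtain ⟨b, rfl⟩ := hr'.eq_map_inl
    rw [splitSum_append_cons, splitSum_map, splitSum_map, splitSum_eq_right, splitSum_eq_zero,
      add_zero]
    · simp only [List.map_nil, List.nil_append, hr]
    · intro p q _
      cases q with
      | nil => rfl
      | cons x q => simp only [List.map_cons, hi, hz]
    · intro p x q
      simp only [List.map_cons, List.cons_append, hi, hz]

/-- The term with the coboundary of `thetaFun` does not contribute on lists with at most one entry
from the bimodule. -/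
lemma ins₂_epsFun_dFun_thetaFun {i : ℤ × ℤ} {φ : List (DualNumber A) → DualNumber A}
    (hφ : IsML k φ) {l : List (DualNumber A)} {n : ℕ} (hl : IsPure l n) (hn : n ≤ 1) :
    ins₂ (dualGr 𝒜) (0, 0) i (epsFun A) (dFun (dualGr 𝒜) (1, 0) (thetaFun A)) φ l = 0 := by
  refine splitSum_eq_zero fun a r hr => splitSum_eq_zero fun b e he => ?_
  rw [ins, splitSum_eq_zero, smul_zero]
  intro p q hq
  refine splitSum_eq_zero fun s t hs => ?_
  subst hs hq he hr
  obtain ⟨_, _, rfl, -, hl⟩ := hl.split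
  obtain ⟨_, _, rfl, -, hl⟩ := hl.split
  obtain ⟨_, _, rfl, -, hl⟩ := hl.split
  obtain ⟨_, _, rfl, hs, -⟩ := hl.split
  rw [dFun_thetaFun hs (by omega)]
  have := hφ.map_zero (a.map (par (dualGr 𝒜) (((0, 0) : ℤ × ℤ).2 + i.2)) ++
    epsFun A (b.map (par (dualGr 𝒜) i.2)) :: p.map (par (dualGr 𝒜) i.2)) t
  simp only [List.append_assoc, List.cons_append] at this
  rw [this, smul_zero]

/-- If `F` vanishes on lists of elements of `A`, the product of `F` with `thetaFun` vanishes on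
lists with at most one entry from the bimodule, as `thetaFun` uses up this entry. -/
lemma conv_ins_epsFun_thetaFun {F : List (DualNumber A) → DualNumber A}
    (hF : ∀ l : List A, F (l.map inl) = 0) {l : List (DualNumber A)} {n : ℕ} (hl : IsPure l n)
    (hn : n ≤ 1) : conv (dualGr 𝒜) 0 0 F (thetaFun A) l = 0 := by
  refine splitSum_eq_zero fun a r hr => ?_
  subst hr
  obtain ⟨na, nr, rfl, ha, hr⟩ := hl.split
  suffices F (a.map (par (dualGr 𝒜) 0)) * thetaFun A r = 0 by rw [this, smul_zero]
  match r, nr, hr with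
  | [], _, _ => exact mul_zero _
  | _ :: _ :: _, _, _ => exact mul_zero _
  | [_], _, .cons_inl x .nil =>
    rw [thetaFun, TrivSqZeroExt.snd_inl, TrivSqZeroExt.inl_zero, mul_zero]
  | [_], _, .cons_inr x .nil =>
    obtain rfl : na = 0 := by omega
    obtain ⟨a, rfl⟩ := ha.eq_map_inl
    rw [map_par_zero, hF, zero_mul]

/-- A bihomogeneous cocycle in the kernel of `κ` is a coboundary: up to a sign, it is the
coboundary of the cochain in which the unit of the bimodule and the element of the bimodule,
regarded as an element of the algebra, are inserted. -/
lemma mem_range_relD_of_homPart {i : ℤ × ℤ} {x : RelHC 𝒜}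
    (hx : x ∈ homPart k (fun i => RelDeg 𝒜 i) i) (dx : relD 𝒜 x = 0) (kx : kappa 𝒜 x = 0) :
    x ∈ LinearMap.range (relD 𝒜) := by
  have hx' := hx
  obtain ⟨⟨c₀, c₁⟩, rfl⟩ := hx'
  have h0 : c₀ = 0 := by
    have := congrArg (fun y => HC.eval y.1) kx
    rw [kappa_apply] at this
    simp only [relFst_of, HC.eval_of] at this
    exact Subtype.ext (this.trans (map_zero _))
  subst h0
  have h1 : kappaFun k (c₁ : List A → A → List A → A) = 0 := by
    have := congrArg (fun y => HC.eval y.2) kx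
    rw [kappa, Tot.lift_of] at this
    have e := HC.eval_of (i - (1, 0)) (kappaBim 𝒜 i c₁)
    exact e.symm.trans (this.trans (map_zero _))
  set F := relToDual (Tot.of k (fun i => RelDeg 𝒜 i) i ((0 : HCdeg 𝒜 i), c₁)) with hFdef
  have hF := relToDual_mem hx
  have eF : HC.eval F = relFun 0 c₁ := by
    rw [hFdef, relToDual_of, HC.eval_of]
    rfl
  have dF : dFun (dualGr 𝒜) i (HC.eval F) = 0 := by
    rw [← HC.eval_d hF, ← relToDual_d, dx, map_zero, map_zero]
  have hM := HC.isML_eval F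
  rw [eF] at hM
  obtain ⟨w, hw, ew⟩ := HC.exists_eval_eq
    (ins₂_mem (HC.eval_mem hF) (epsFun_mem 𝒜) (thetaFun_mem 𝒜))
  have hE (l : List A) :
      ins (dualGr 𝒜) (0, 0) (epsFun A) (relFun 0 c₁) (l.map inl) = 0 := by
    ext
    · rw [TrivSqZeroExt.fst_zero]
      have : ins (dualGr 𝒜) (0, 0) (epsFun A) (relFun 0 c₁) (l.map inl) ∈
          weight k A (0 + (1 + 0)) := by
        refine splitSum_mem _ fun a r hr => splitSum_mem _ fun b e he => Submodule.smul_mem _ _ ?_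
        have hl := isPure_map_inl l
        rw [← hr, ← he] at hl
        obtain ⟨na, _, e0, ha, hl⟩ := hl.split
        obtain ⟨nb, ne, e1, -, he⟩ := hl.split
        obtain ⟨rfl, rfl⟩ : na = 0 ∧ ne = 0 := by omega
        exact (relFun_preservesWeight (c₀ := 0) (fun _ _ => ⟨by simp, by simp⟩) c₁.2).mem_cons
          (ha.map_par _) (epsFun_mem_weight b) he
      exact this
    · exact congrFun ((restrictS_ins_epsFun ((0 : HCdeg 𝒜 i), c₁)).trans h1) l
  -- the sign of `x{ε ∪ θ}` in the formula `dFun_ins₂` for the coboundary of `x{ε, θ}`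
  set s := sgn k (i.1 + i.2 + (((0, 0) : ℤ × ℤ).1 + ((0, 0) : ℤ × ℤ).2 - 1) * ((1, 0) : ℤ × ℤ).1)
  -- of the terms in that formula, only `x{ε ∪ θ} = x` survives the restriction
  have key : dualToRel (hcD _ w + s • F) = 0 := by
    refine dualToRel_eq_zero (i := i) (add_mem ?_ (Submodule.smul_mem _ _ hF)) fun l n hl hn => ?_
    · have := (hc_isBigradedBraceAlgebra (dualGr 𝒜)).d_mem _ _ hw
      rwa [show Equiv.addRight (1, 0) (i + (0, 0) + (1, 0) - (2, 0)) = i by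
        ext <;> simp; ring] at this
    · rw [map_add, map_smul, HC.eval_d hw, ew, dFun_ins₂ (HC.eval_mem hF) (epsFun_mem 𝒜)
        (thetaFun_mem 𝒜) dF dFun_epsFun, eF]
      simp only [Pi.add_apply, Pi.sub_apply, Pi.smul_apply, Pi.neg_apply,
        ins₂_epsFun_dFun_thetaFun hM hl hn, conv_ins_epsFun_thetaFun hE hl hn, conv_epsFun_left,
        ins_thetaFun_relFun c₁.2 hl hn, mul_zero, smul_zero, neg_zero, sub_zero]
      have := ins_conv_epsFun_thetaFun c₁.2 hl hn
      change 0 - s • ins (dualGr 𝒜) ((0, 0) + (1, 0)) _ _ l + s • _ = 0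
      rw [show ((0, 0) + (1, 0) : ℤ × ℤ) = (1, 0) by simp, this, zero_sub, neg_add_cancel]
  rw [map_add, map_smul, dualToRel_d, hFdef, dualToRel_relToDual] at key
  refine ⟨-(s • dualToRel w), ?_⟩
  have hs : s * s = 1 := sgn_mul_self _
  rw [map_neg, map_smul, eq_neg_of_add_eq_zero_left key, smul_neg, neg_neg, smul_smul, hs, one_smul]

/-- A cocycle in the kernel of `κ` is a coboundary. -/
lemma mem_range_relD {x : RelHC 𝒜} (dx : relD 𝒜 x = 0) (kx : kappa 𝒜 x = 0) :
    x ∈ LinearMap.range (relD 𝒜) := by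
  have h := isInternal_homPart k fun i => RelDeg 𝒜 i
  have h' := isInternal_homPart k fun i => HCdeg 𝒜 i
  have hk (i : ℤ × ℤ) (y : RelHC 𝒜) : kappa 𝒜 (gradedProj h i y) =
      (gradedProj h' i).prodMap (gradedProj h' (i - (1, 0))) (kappa 𝒜 y) := by
    refine graded_induction h (by simp; rfl) (fun x y hx hy => by simp only [map_add, hx, hy])
      (fun j y hy => ?_) y
    have hky := kappa_mem hy
    by_cases hij : j = i
    · subst hij
      rw [gradedProj_same h hy]
      exact (Prod.ext (gradedProj_same h' hky.1) (gradedProj_same h' hky.2)).symm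
    · rw [gradedProj_ne h hij hy, map_zero]
      exact (Prod.ext (gradedProj_ne h' hij hky.1)
        (gradedProj_ne h' (fun e => hij (sub_left_injective e)) hky.2)).symm
  have := mem_iSup_gradedProj h (fun _ => LinearMap.range (relD 𝒜)) (x := x) fun i =>
    mem_range_relD_of_homPart (gradedProj_mem h i x)
      (by rw [d_gradedProj h (rel_isBigradedBraceAlgebra 𝒜).d_mem, dx, map_zero])
      (by rw [hk, kx, map_zero])
  simpa using this

end Homotopy

end Hoch

namespace Hoch

/-! ### Extension of cochains to the diagonal bimodule -/

section Diagonal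

variable {k A : Type*} [Field k] [Ring A] [Algebra k A] {𝒜 : ℤ → Submodule k A}

/-- A Hochschild cochain, regarded as a bimodule cochain by allowing one of its arguments to be an
element of the diagonal bimodule. -/
def diagFun (c : List A → A) (a : List A) (m : A) (b : List A) : A := c (a ++ m :: b)

lemma diagFun_mem {i : ℤ × ℤ} {c : List A → A} (hc : c ∈ HCdeg 𝒜 i) : diagFun c ∈ BimDeg 𝒜 i := by
  refine ⟨fun m b x y => ?_, fun a b => hc.1 a b, fun a m x y => ?_, fun a m b h => ?_,
    fun a m b na nm nb ha hm hb => ?_⟩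
  · have := hc.1 x (y ++ m :: b)
    simpa only [diagFun, List.append_assoc, List.cons_append] using this
  · have := hc.1 (a ++ m :: x) y
    simpa only [diagFun, List.append_assoc, List.cons_append] using this
  · refine hc.2.1 _ fun h' => h ?_
    simp at h' ⊢
    omega
  · have := hc.2.2 _ _ (ha.append (.cons hm hb))
    rwa [← add_assoc] at this

/-- The map `diagFun` in bidegree `i`, with the identity as the first component. -/
def hcToRelDeg (i : ℤ × ℤ) : HCdeg 𝒜 i →ₗ[k] RelDeg 𝒜 i where
  toFun c := (c, ⟨diagFun c, diagFun_mem c.2⟩)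
  map_add' _ _ := rfl
  map_smul' _ _ := rfl

/-- The map from the Hochschild complex to the bimodule Hochschild complex that extends a cochain
of `A` to the diagonal bimodule. -/
noncomputable def hcToRel : HC 𝒜 →ₗ[k] RelHC 𝒜 :=
  Tot.lift fun i => Tot.of k (fun i => RelDeg 𝒜 i) i ∘ₗ hcToRelDeg i

@[simp] lemma hcToRel_of (i : ℤ × ℤ) (c : HCdeg 𝒜 i) :
    hcToRel (Tot.of k (fun i => HCdeg 𝒜 i) i c) =
      Tot.of k (fun i => RelDeg 𝒜 i) i (c, ⟨diagFun c, diagFun_mem c.2⟩) := Tot.lift_of _ _ _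

lemma hcToRel_mem {i : ℤ × ℤ} {c : HC 𝒜} (hc : c ∈ homPart k (fun i => HCdeg 𝒜 i) i) :
    hcToRel c ∈ homPart k (fun i => RelDeg 𝒜 i) i := by
  obtain ⟨c, rfl⟩ := hc
  rw [hcToRel_of]
  exact Tot.of_mem _ _

lemma relFst_hcToRel (c : HC 𝒜) : relFst (hcToRel c) = c := by
  refine graded_induction (isInternal_homPart k fun i => HCdeg 𝒜 i) (by simp)
    (fun x y hx hy => by simp only [map_add, hx, hy]) (fun i c hc => ?_) c
  obtain ⟨c, rfl⟩ := hc
  rw [hcToRel_of, relFst_of]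

variable [GradedAlgebra 𝒜]

lemma diagFun_braceHH (t : ℤ) (c₁ c₂ : List A → A) :
    diagFun (braceHH 𝒜 t c₁ c₂) =
      braceBH 𝒜 t (diagFun c₁) c₂ + braceBB 𝒜 t (diagFun c₁) (diagFun c₂) := by
  funext a m b
  simp only [diagFun, braceHH, splitSum_append_cons, Pi.add_apply, braceBH, braceBB, splitSum_add',
    List.map_append, List.map_cons, List.length_append, List.length_cons, List.append_assoc,
    List.cons_append]
  rw [add_right_comm]
  congr 1
  · congr 1
    · refine splitSum_congr fun p q _ => splitSum_congr fun s e _ => ?_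
      congr 1
      exact sgn_congr (by push_cast; grind)
    · refine splitSum_congr fun p q _ => splitSum_congr fun s e _ => ?_
      congr 1
      exact sgn_congr (by push_cast; grind)
  · refine splitSum_congr fun p q _ => splitSum_congr fun s e _ => ?_
    congr 1
    exact sgn_congr (by push_cast; grind)

/-- Extending cochains to the diagonal bimodule is compatible with the pre-Lie products: the
inserted cochain either contains the entry from the bimodule or does not. -/
theorem hcToRel_pre (c c' : HC 𝒜) :
    hcToRel (hcPre 𝒜 c c') = relPre 𝒜 (hcToRel c) (hcToRel c') := by
  refine graded_induction (isInternal_homPart k fun i => HCdeg 𝒜 i) (by simp)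
    (fun x y hx hy => by simp only [map_add, LinearMap.add_apply, hx, hy]) (fun i c hc => ?_) c
  refine graded_induction (isInternal_homPart k fun i => HCdeg 𝒜 i) (by simp)
    (fun x y hx hy => by simp only [map_add, hx, hy]) (fun j c' hc' => ?_) c'
  obtain ⟨c, rfl⟩ := hc
  obtain ⟨c', rfl⟩ := hc'
  rw [hcToRel_of, hcToRel_of, hcPre, relPre, Tot.lift₂_of, Tot.lift₂_of, LinearMap.compr₂_apply,
    LinearMap.compr₂_apply, hcToRel_of]
  refine congrArg _ (Prod.ext rfl (Subtype.ext ?_))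
  exact diagFun_braceHH _ _ _

theorem hcToRel_bracket (c c' : HC 𝒜) :
    hcToRel (hcBracket 𝒜 c c') = relBracket 𝒜 (hcToRel c) (hcToRel c') := by
  refine graded_induction (isInternal_homPart k fun i => HCdeg 𝒜 i) (by simp)
    (fun x y hx hy => by simp only [map_add, LinearMap.add_apply, hx, hy]) (fun i x hx => ?_) c
  refine graded_induction (isInternal_homPart k fun i => HCdeg 𝒜 i) (by simp)
    (fun x y hx hy => by simp only [map_add, hx, hy]) (fun j y hy => ?_) c'
  rw [relBracket, hcBracket, gradedCommutator_apply _ hx hy,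
    gradedCommutator_apply _ (hcToRel_mem hx) (hcToRel_mem hy), map_sub, map_smul,
    hcToRel_pre, hcToRel_pre]

lemma hcToRel_mul : hcToRel (Tot.of k (fun i => HCdeg 𝒜 i) (2, 0) ⟨mulFun, mulFun_mem 𝒜⟩) =
    Tot.of k (fun i => RelDeg 𝒜 i) (2, 0) (⟨mulFun, mulFun_mem 𝒜⟩, ⟨actFun, actFun_mem 𝒜⟩) := by
  rw [hcToRel_of]
  refine congrArg _ (Prod.ext rfl (Subtype.ext ?_))
  funext a m b
  match a, b with
  | [], [] => rfl
  | [x], [] => rfl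
  | [], [y] => rfl
  | [], _ :: _ :: _ => rfl
  | [_], _ :: _ => rfl
  | [_, _], [] => rfl
  | [_, _], _ :: _ => rfl
  | _ :: _ :: _ :: _, [] => rfl
  | _ :: _ :: _ :: _, _ :: _ => rfl

theorem hcToRel_d (c : HC 𝒜) : hcToRel (hcD 𝒜 c) = relD 𝒜 (hcToRel c) := by
  rw [hcD, relD, hcToRel_bracket, hcToRel_mul]

/-- The identity of the diagonal bimodule, as a bimodule cochain. -/
def idBim : List A → A → List A → A
  | [], m, [] => m
  | _, _, _ => 0

lemma idBim_cons_left (x : A) (a : List A) (m : A) (b : List A) : idBim (x :: a) m b = 0 := rfl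

lemma idBim_cons_right (a : List A) (m : A) (x : A) (b : List A) : idBim a m (x :: b) = 0 := by
  cases a <;> rfl

lemma idBim_append_cons (a b : List A) (x m : A) (c : List A) : idBim (a ++ x :: b) m c = 0 := by
  cases a <;> rfl

lemma idBim_append_cons' (a b c : List A) (x m : A) : idBim a m (b ++ x :: c) = 0 := by
  cases b <;> exact idBim_cons_right _ _ _ _

variable (𝒜) in
omit [GradedAlgebra 𝒜] in
lemma idBim_mem : idBim ∈ BimDeg 𝒜 (1, 0) := by
  refine ⟨fun m b x y => ?_, fun a b => ?_, fun a m x y => ?_, fun a m b h => ?_,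
    fun a m b na nm nb ha hm hb => ?_⟩
  · simp only [idBim_append_cons]
    exact ⟨by simp, by simp⟩
  · match a, b with
    | [], [] => exact ⟨by simp [idBim], by simp [idBim]⟩
    | [], _ :: _ => exact ⟨by simp [idBim], by simp [idBim]⟩
    | _ :: _, _ => exact ⟨by simp [idBim], by simp [idBim]⟩
  · simp only [idBim_append_cons']
    exact ⟨by simp, by simp⟩
  · match a, b with
    | [], [] => simp at h
    | [], _ :: _ => rfl
    | _ :: _, _ => rfl
  · match a, b, ha, hb with
    | [], [], .nil, .nil => simpa [idBim] using hm
    | [], _ :: _, _, _ => exact zero_mem _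
    | _ :: _, _, _, _ => exact zero_mem _

variable (𝒜) in
/-- The identity of the diagonal bimodule as an element of the bimodule Hochschild complex. It
represents the class which corresponds to `ε`. -/
noncomputable def relId : RelHC 𝒜 := Tot.of k (fun i => RelDeg 𝒜 i) (1, 0) (0, ⟨idBim, idBim_mem 𝒜⟩)

omit [GradedAlgebra 𝒜] in
lemma relId_mem : relId 𝒜 ∈ homPart k (fun i => RelDeg 𝒜 i) (1, 0) := Tot.of_mem _ _

lemma braceBB_idBim_right {c : List A → A → List A → A} (hc : ∀ a b, c a 0 b = 0) :
    braceBB 𝒜 0 c idBim = c := by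
  funext l m l'
  rw [braceBB, splitSum_eq_right, splitSum_eq_left]
  · simp [idBim]
  · intro x a b
    rw [idBim_cons_right, hc, smul_zero]
  · intro a x b
    exact splitSum_eq_zero fun _ _ _ => by rw [idBim_cons_left, hc, smul_zero]

lemma braceBB_idBim_left (c : List A → A → List A → A) (t : ℤ) : braceBB 𝒜 t idBim c = c := by
  funext l m l'
  rw [braceBB, splitSum_eq_left, splitSum_eq_right]
  · simp [idBim]
  · intro a x b
    rw [idBim_cons_right, smul_zero]
  · intro x a b
    exact splitSum_eq_zero fun _ _ _ => by rw [List.map_cons, idBim_cons_left, smul_zero]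

lemma braceBH_idBim (c : List A → A) (t : ℤ) : braceBH 𝒜 t idBim c = 0 := by
  funext l m l'
  simp [braceBH, idBim_append_cons, idBim_append_cons', splitSum]

omit [GradedAlgebra 𝒜] in
lemma RelHC.of_eq_of {i j : ℤ × ℤ} (h : i = j) {x : RelDeg 𝒜 i} {y : RelDeg 𝒜 j}
    (h₁ : (x.1 : List A → A) = y.1) (h₂ : (x.2 : List A → A → List A → A) = y.2) :
    Tot.of k (fun i => RelDeg 𝒜 i) i x = Tot.of k (fun i => RelDeg 𝒜 i) j y := by
  subst h
  exact congrArg _ (Prod.ext (Subtype.ext h₁) (Subtype.ext h₂))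

lemma relPre_relId_of {i : ℤ × ℤ} (c : RelDeg 𝒜 i) :
    relPre 𝒜 (Tot.of k (fun i => RelDeg 𝒜 i) i c) (relId 𝒜) =
      Tot.of k (fun i => RelDeg 𝒜 i) i (0, c.2) := by
  rw [relId, relPre, Tot.lift₂_of, LinearMap.compr₂_apply]
  refine RelHC.of_eq_of (by simp) ?_ ?_
  · change braceHH 𝒜 0 c.1 0 = 0
    have : (0 : List A → A) ∈ HCdeg 𝒜 (1, 0) := zero_mem _
    rw [braceHH_eq_ins 𝒜 c.1.2.1 this]
    simpa using ins_smul_left (𝒜 := 𝒜) (i := (1, 0)) c.1.2.1 (0 : k) 0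
  · change braceBH 𝒜 0 c.2 0 + braceBB 𝒜 0 c.2 idBim = c.2
    rw [braceBB_idBim_right (BimDeg.map_zero c.2.2), add_eq_right]
    funext l m l'
    have h1 := (c.2.2.1 · · : ∀ m b, IsML k fun a => (c.2 : List A → A → List A → A) a m b)
    have h2 (a m p q) : (c.2 : List A → A → List A → A) a m (p ++ 0 :: q) = 0 :=
      (c.2.2.2.2.1 a m p q).map_zero
    have h3 (m b p q) : (c.2 : List A → A → List A → A) (p ++ 0 :: q) m b = 0 :=
      (h1 m b p q).map_zero
    simp [braceBH, h2, h3, splitSum]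

lemma relId_relPre_of {i : ℤ × ℤ} (c : RelDeg 𝒜 i) :
    relPre 𝒜 (relId 𝒜) (Tot.of k (fun i => RelDeg 𝒜 i) i c) =
      Tot.of k (fun i => RelDeg 𝒜 i) i (0, c.2) := by
  rw [relId, relPre, Tot.lift₂_of, LinearMap.compr₂_apply]
  refine RelHC.of_eq_of (by simp) ?_ ?_
  · change braceHH 𝒜 i.2 0 c.1 = 0
    funext l
    simp [braceHH, splitSum]
  · change braceBH 𝒜 i.2 idBim c.1 + braceBB 𝒜 i.2 idBim c.2 = c.2
    rw [braceBH_idBim, braceBB_idBim_left, zero_add]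

/-- Both compositions of `x` with the identity of the bimodule are the bimodule component of `x`. -/
lemma relPre_relId (x : RelHC 𝒜) : relPre 𝒜 x (relId 𝒜) = relPre 𝒜 (relId 𝒜) x := by
  refine graded_induction (isInternal_homPart k fun i => RelDeg 𝒜 i) (by simp)
    (fun x y hx hy => by simp only [map_add, LinearMap.add_apply, hx, hy]) (fun i x hx => ?_) x
  obtain ⟨c, rfl⟩ := hx
  rw [relPre_relId_of, relId_relPre_of]

lemma relPre_relId_relId : relPre 𝒜 (relId 𝒜) (relId 𝒜) = relId 𝒜 := relPre_relId_of _

/-- The identity of the bimodule is central for the bracket, already on cochains. This is where the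
relations `[c, ε] = 0` and `[ε, ε] = 0` come from. -/
theorem relBracket_relId (x : RelHC 𝒜) : relBracket 𝒜 x (relId 𝒜) = 0 := by
  refine graded_induction (isInternal_homPart k fun i => RelDeg 𝒜 i) (by simp)
    (fun x y hx hy => by simp only [map_add, LinearMap.add_apply, hx, hy, add_zero])
    (fun i x hx => ?_) x
  rw [relBracket, gradedCommutator_apply _ hx relId_mem, relPre_relId]
  simp

theorem relD_relId : relD 𝒜 (relId 𝒜) = 0 := relBracket_relId _

lemma kappa_relId : kappa 𝒜 (relId 𝒜) = (0, hcOne 𝒜) := by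
  rw [relId, kappa, Tot.lift_of]
  refine Prod.ext (map_zero (Tot.of k (fun i => HCdeg 𝒜 i) (1, 0))) ?_
  apply HC.eval_injective
  rw [HC.eval_one]
  refine (HC.eval_of ((1, 0) - (1, 0)) (kappaBim 𝒜 (1, 0) ⟨idBim, idBim_mem 𝒜⟩)).trans ?_
  change kappaFun k idBim = oneFun
  funext l
  cases l with
  | nil => simp [kappaFun, splitSum, idBim, oneFun]
  | cons x l =>
    refine splitSum_eq_zero fun a b h => ?_
    cases a with
    | nil => rw [List.nil_append] at h; rw [h, idBim_cons_right, smul_zero]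
    | cons y a => rw [idBim_cons_left, smul_zero]

/-- Under `κ`, the extension of `c` to the diagonal bimodule becomes `c + c{1} ε`. -/
lemma kappa_hcToRel (c : HC 𝒜) : kappa 𝒜 (hcToRel c) = (c, hcPre 𝒜 c (hcOne 𝒜)) := by
  refine graded_induction (isInternal_homPart k fun i => HCdeg 𝒜 i) (by simp; rfl)
    (fun x y hx hy => by simp only [map_add, LinearMap.add_apply, hx, hy]; rfl) (fun i c hc => ?_) c
  obtain ⟨c, rfl⟩ := hc
  rw [hcToRel_of, kappa, Tot.lift_of]
  refine Prod.ext rfl ?_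
  apply HC.eval_injective
  rw [HC.eval_pre _ hcOne_mem, HC.eval_one, HC.eval_of]
  refine (HC.eval_of (i - (1, 0)) (kappaBim 𝒜 i ⟨diagFun c, diagFun_mem c.2⟩)).trans ?_
  funext l
  change splitSum (fun a r => sgn k r.length • diagFun c a 1 r) l = _
  rw [ins]
  refine splitSum_congr fun a r _ => ?_
  rw [splitSum_eq_left fun x b e => by
    rw [show oneFun (x :: b) = (0 : A) from rfl, c.2.1.map_zero, smul_zero]]
  rw [oneFun, Prod.snd_zero, map_par_zero]
  change _ = sgn k _ • diagFun c a 1 r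
  congr 1
  exact sgn_congr (by simp)

/-- The composition of a Hochschild cocycle with the unit is a coboundary, by the derivation
property of `c{-}` applied to `1 = 1 ∪ 1`. -/
lemma pre_one_mem_range {c : HC 𝒜} (dc : hcD 𝒜 c = 0) :
    hcPre 𝒜 c (hcOne 𝒜) ∈ LinearMap.range (hcD 𝒜) := by
  have hB := hc_isBigradedBraceAlgebra 𝒜
  refine cocycle_induction hB.isInternal hB.d_mem (P := fun c => hcPre 𝒜 c (hcOne 𝒜) ∈
    LinearMap.range (hcD 𝒜)) (by simp) (fun x y hx hy => ?_) (fun i c hc dc => ?_) dc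
  · simp only [map_add, LinearMap.add_apply]
    exact add_mem hx hy
  · have d1 := hB.isBraceAlgebra.d_one
    have := hB.homotopy i 0 0 c hc _ hB.one_mem _ hB.one_mem dc d1 d1
    simpa [hB.one_cup, hB.cup_one] using this

end Diagonal

/-! ### `κ` is a quasi-isomorphism -/

section QuasiIsomorphism

variable {k A : Type*} [Field k] [Ring A] [Algebra k A] {𝒜 : ℤ → Submodule k A} [GradedAlgebra 𝒜]

lemma kappa_cup_relId (x : RelHC 𝒜) :
    kappa 𝒜 (relCup 𝒜 x (relId 𝒜)) = (0, relFst x) := by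
  have hB := hc_isBigradedBraceAlgebra 𝒜
  rw [kappa_cup, kappa_relId, kappa_apply]
  refine Prod.ext (map_zero _) ?_
  change hcCup 𝒜 (relFst x) (hcOne 𝒜) + hcCup 𝒜 _ (totalParity k (fun i => HCdeg 𝒜 i) 0) = _
  rw [hB.cup_one, map_zero, map_zero, add_zero]

/-- `κ` is a quasi-isomorphism: `c₁ + c₂ ε ↦ c₁ + c₂ ∪ id`, where `id` is the identity of the
diagonal bimodule and cochains are extended to the diagonal bimodule, is a section of `κ` up to
coboundaries. -/
theorem bijective_cohMap_kappa : Function.Bijective (cohMap (kappa 𝒜) kappa_d) := by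
  have hR := rel_isBigradedBraceAlgebra 𝒜
  constructor
  · rw [← LinearMap.ker_eq_bot, LinearMap.ker_eq_bot']
    intro a ha
    obtain ⟨x, hx⟩ := exists_represents a
    have dx := hx.d_eq_zero
    have kx := hx.cohMap kappa_d
    rw [ha, represents_zero_iff kx.d_eq_zero] at kx
    obtain ⟨⟨u, v⟩, huv⟩ := kx
    -- `y` is chosen such that `κ y = (u, v)`, so that `x - d y` is a cocycle in the kernel of `κ`
    set v' := v - hcPre 𝒜 u (hcOne 𝒜)
    set y := hcToRel u + relCup 𝒜 (hcToRel v') (relId 𝒜)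
    have hy : kappa 𝒜 y = (u, v) := by
      rw [map_add, kappa_hcToRel, kappa_cup_relId, relFst_hcToRel]
      exact Prod.ext (add_zero u) (add_sub_cancel _ _)
    have hxy : x - relD 𝒜 y ∈ LinearMap.range (relD 𝒜) := mem_range_relD
      (by rw [map_sub, dx, hR.isBraceAlgebra.d_d, sub_zero])
      (by rw [map_sub, kappa_d, hy, huv, sub_self])
    have : x ∈ LinearMap.range (relD 𝒜) := by
      have := add_mem hxy (LinearMap.mem_range_self (relD 𝒜) y)
      rwa [sub_add_cancel] at this
    exact hx.unique' ((represents_zero_iff dx).2 this)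
  · intro a
    obtain ⟨⟨u, v⟩, huv⟩ := exists_represents a
    have du : hcD 𝒜 u = 0 := congrArg Prod.fst huv.d_eq_zero
    have dv : hcD 𝒜 v = 0 := congrArg Prod.snd huv.d_eq_zero
    set y := hcToRel u + relCup 𝒜 (hcToRel v) (relId 𝒜)
    have hy : kappa 𝒜 y = (u, hcPre 𝒜 u (hcOne 𝒜) + v) := by
      rw [map_add, kappa_hcToRel, kappa_cup_relId, relFst_hcToRel]
      exact Prod.ext (add_zero u) rfl
    have dy : relD 𝒜 y = 0 := by
      rw [map_add, ← hcToRel_d, du, map_zero, zero_add]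
      exact hR.isBraceAlgebra.cup_cocycle _ _ (by rw [← hcToRel_d, dv, map_zero]) relD_relId
    obtain ⟨b, hb⟩ := Represents.of_d_eq_zero dy
    refine ⟨b, (hb.cohMap kappa_d).unique huv ?_⟩
    obtain ⟨w, hw⟩ := pre_one_mem_range du
    refine ⟨(0, w), ?_⟩
    rw [hy]
    refine Prod.ext ?_ ?_
    · exact (map_zero (hcD 𝒜)).trans (sub_self u).symm
    · exact hw.trans (add_sub_cancel_right _ _).symm

end QuasiIsomorphism

/-! ### Transport of structure -/

section Transport

variable {k G H : Type*} [Field k] [AddCommGroup G] [Module k G] [AddCommGroup H] [Module k H]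
  {grG : ℤ → Submodule k G} {grH : ℤ → Submodule k H}

/-- The Gerstenhaber algebra structure transported along an isomorphism of graded vector spaces. -/
def GerstenhaberAlgebra.transport (S : GerstenhaberAlgebra grG) (e : G ≃ₗ[k] H)
    (he : ∀ n, (grG n).map e.toLinearMap = grH n) : GerstenhaberAlgebra grH :=
  have hm : ∀ {n x}, x ∈ grH n → e.symm x ∈ grG n := fun {n x} hx => by
    rw [← he n] at hx
    obtain ⟨y, hy, rfl⟩ := hx
    simpa using hy
  have hm' : ∀ {n x}, x ∈ grG n → e x ∈ grH n := fun {n x} hx => he n ▸ ⟨x, hx, rfl⟩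
  { isInternal := by
      have h := S.isInternal
      refine isInternal_of_projections
        (fun n => e.toLinearMap ∘ₗ gradedProj h n ∘ₗ e.symm.toLinearMap)
        (fun n x hx => ?_) (fun m n hmn x hx => ?_) fun x => ?_
      · simp [gradedProj_same h (hm hx)]
      · simp [gradedProj_ne h hmn (hm hx)]
      · rw [← e.apply_symm_apply x]
        exact graded_induction h (P := fun y => e y ∈ ⨆ i, grH i) (by simp)
          (fun x y hx hy => by rw [map_add]; exact add_mem hx hy)
          (fun i x hx => Submodule.mem_iSup_of_mem i (hm' hx)) _
    mul := (S.mul.compl₁₂ e.symm.toLinearMap e.symm.toLinearMap).compr₂ e.toLinearMap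
    mul_mem := fun m n x hx y hy => hm' (S.mul_mem m n _ (hm hx) _ (hm hy))
    mul_assoc := fun x y z => by simp [S.mul_assoc]
    mul_comm := fun m n x hx y hy => by simp [S.mul_comm m n _ (hm hx) _ (hm hy)]
    bracket := (S.bracket.compl₁₂ e.symm.toLinearMap e.symm.toLinearMap).compr₂ e.toLinearMap
    isShiftedLieBracket :=
      { mem := fun m n x hx y hy => hm' (S.isShiftedLieBracket.mem m n _ (hm hx) _ (hm hy))
        self_odd := fun n hn x hx => by simp [S.isShiftedLieBracket.self_odd n hn _ (hm hx)]
        self_even := fun n hn x hx => by simp [S.isShiftedLieBracket.self_even n hn _ (hm hx)]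
        antisymm := fun m n x hx y hy => by
          simp [S.isShiftedLieBracket.antisymm m n _ (hm hx) _ (hm hy)]
        jacobi := fun m n x hx y hy z => by
          simp [S.isShiftedLieBracket.jacobi m n _ (hm hx) _ (hm hy) (e.symm z)] }
    gerstenhaberRelation := fun m n x hx y hy z => by
      simp [S.gerstenhaberRelation m n _ (hm hx) _ (hm hy) (e.symm z)]
    sq := fun x => e (S.sq (e.symm x))
    sq_mem := fun h n x hx => hm' (S.sq_mem h n _ (hm hx))
    sq_add := fun h x y => by simp [S.sq_add h]
    sq_mul := fun h x y => by simp [S.sq_mul h]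
    bracket_sq := fun h x y => by simp [S.bracket_sq h]
    sq_even := fun h n hn x hx => by simp [S.sq_even h n hn _ (hm hx)] }

lemma GerstenhaberAlgebra.isGerstenhaberIso_transport (S : GerstenhaberAlgebra grG) (e : G ≃ₗ[k] H)
    (he : ∀ n, (grG n).map e.toLinearMap = grH n) :
    IsGerstenhaberIso S (S.transport e he) e.toLinearMap where
  bijective := e.bijective
  map_gr := he
  map_mul x y := by simp [transport]
  map_bracket x y := by simp [transport]
  map_sq x _ := by simp [transport]

end Transport

/-! ### The dg algebra `HC(A)⟨ε⟩` -/

section DualNumbersOverCochains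

variable {k A : Type*} [Field k] [Ring A] [Algebra k A] {𝒜 : ℤ → Submodule k A}

lemma totalParity_apply {i : ℤ × ℤ} {x : HC 𝒜} (hx : x ∈ homPart k (fun i => HCdeg 𝒜 i) i) :
    totalParity k (fun i => HCdeg 𝒜 i) x = sgn k (i.1 + i.2) • x := by
  obtain ⟨c, rfl⟩ := hx
  rw [totalParity_of]

lemma totalParity_apply' {n : ℤ} {x : HC 𝒜}
    (hx : x ∈ totalGr (homPart k fun i => HCdeg 𝒜 i) n) :
    totalParity k (fun i => HCdeg 𝒜 i) x = sgn k n • x := by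
  refine totalGr_induction (by simp) (fun x y hx hy => by rw [map_add, hx, hy, smul_add])
    (fun i hi x hx => ?_) hx
  rw [totalParity_apply hx, hi]

variable [GradedAlgebra 𝒜]

lemma totalParity_cup (x y : HC 𝒜) : totalParity k (fun i => HCdeg 𝒜 i) (hcCup 𝒜 x y) =
    hcCup 𝒜 (totalParity k (fun i => HCdeg 𝒜 i) x) (totalParity k (fun i => HCdeg 𝒜 i) y) := by
  refine graded_induction (isInternal_homPart k fun i => HCdeg 𝒜 i) (by simp)
    (fun x y hx hy => by simp only [map_add, LinearMap.add_apply, hx, hy]) (fun i x hx => ?_) x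
  refine graded_induction (isInternal_homPart k fun i => HCdeg 𝒜 i) (by simp)
    (fun x y hx hy => by simp only [map_add, hx, hy]) (fun j y hy => ?_) y
  rw [totalParity_apply hx, totalParity_apply hy, totalParity_apply (hc_cup_mem i j x hx y hy),
    map_smul, map_smul, LinearMap.smul_apply, smul_smul, ← sgn_add, Prod.fst_add, Prod.snd_add]
  congr 2
  ring

/-- The parity operator anticommutes with the differential, which is odd. -/
lemma totalParity_d (x : HC 𝒜) : totalParity k (fun i => HCdeg 𝒜 i) (hcD 𝒜 x) =
    -hcD 𝒜 (totalParity k (fun i => HCdeg 𝒜 i) x) := by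
  refine graded_induction (isInternal_homPart k fun i => HCdeg 𝒜 i) (by simp)
    (fun x y hx hy => by simp only [map_add, hx, hy, neg_add]) (fun i x hx => ?_) x
  rw [totalParity_apply hx, totalParity_apply ((hc_isBigradedBraceAlgebra 𝒜).d_mem i x hx),
    map_smul, ← neg_smul, ← sgn_succ]
  congr 1
  exact sgn_congr (by simp; ring)

lemma epsMul_apply (x y : HCeps 𝒜) : epsMul 𝒜 x y = (hcCup 𝒜 x.1 y.1,
    hcCup 𝒜 x.1 y.2 + hcCup 𝒜 x.2 (totalParity k (fun i => HCdeg 𝒜 i) y.1)) := rfl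

lemma epsD_apply (x : HCeps 𝒜) : epsD 𝒜 x = (hcD 𝒜 x.1, hcD 𝒜 x.2) := rfl

variable (𝒜) in
theorem eps_isDGAlgebra : IsDGAlgebra (epsGr 𝒜) (epsD 𝒜) (epsMul 𝒜) (epsOne 𝒜) := by
  have hB := hc_isBigradedBraceAlgebra 𝒜
  have h := hB.isDGAlgebra
  exact {
    isInternal := isInternal_prod_shift h.isInternal h.isInternal (1, 0)
    d_mem := fun i x hx => by
      refine ⟨h.d_mem i _ hx.1, ?_⟩
      have := h.d_mem _ _ hx.2
      rwa [sub_add_eq_add_sub] at this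
    d_d := fun x => Prod.ext (h.d_d x.1) (h.d_d x.2)
    mul_mem := fun i j x hx y hy => by
      refine ⟨h.mul_mem i j _ hx.1 _ hy.1, add_mem ?_ ?_⟩
      · have := h.mul_mem _ _ _ hx.1 _ hy.2
        rwa [← add_sub_assoc] at this
      · have := h.mul_mem _ _ _ hx.2 _ hy.1
        rw [totalParity_apply hy.1, map_smul, add_sub_right_comm]
        exact Submodule.smul_mem _ _ this
    one_mem := ⟨h.one_mem, zero_mem _⟩
    one_mul := fun x => by
      simp [epsMul_apply, epsOne, h.one_mul]
    mul_one := fun x => by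
      simp [epsMul_apply, epsOne, h.mul_one, totalParity_apply h.one_mem, sgn_zero]
    mul_assoc := fun x y z => by
      refine Prod.ext (h.mul_assoc _ _ _) ?_
      simp only [epsMul_apply, map_add, LinearMap.add_apply, h.mul_assoc, totalParity_cup,
        add_assoc]
    leibniz := fun i x hx y => by
      refine Prod.ext (h.leibniz i _ hx.1 _) ?_
      have s : sgn k ((i - (1, 0)).1 + (i - (1, 0)).2) = -sgn k (i.1 + i.2) := by
        rw [← sgn_succ]
        exact sgn_congr (by simp; grind)
      simp only [epsMul_apply, epsD_apply, map_add, h.leibniz i _ hx.1, h.leibniz _ _ hx.2, s,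
        totalParity_d, Prod.snd_add, Prod.smul_snd, map_neg, smul_add, neg_smul, smul_neg]
      abel }

end DualNumbersOverCochains

/-! ### The isomorphism `H(κ)` -/

section HochschildCohomology

variable {k A : Type*} [Field k] [Ring A] [Algebra k A] {𝒜 : ℤ → Submodule k A} [GradedAlgebra 𝒜]

lemma Represents.cohEps {x : HCeps 𝒜} {a : Coh (epsD 𝒜)} (h : Represents (epsD 𝒜) x a) :
    Represents (hcD 𝒜) x.1 (Hoch.cohEps 𝒜 a).1 ∧ Represents (hcD 𝒜) x.2 (Hoch.cohEps 𝒜 a).2 :=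
  ⟨h.cohMap (f := LinearMap.fst k (HC 𝒜) (HC 𝒜)) fun _ => rfl,
    h.cohMap (f := LinearMap.snd k (HC 𝒜) (HC 𝒜)) fun _ => rfl⟩

variable (𝒜) in
theorem bijective_cohEps : Function.Bijective (cohEps 𝒜) := by
  constructor
  · rw [← LinearMap.ker_eq_bot, LinearMap.ker_eq_bot']
    intro a ha
    obtain ⟨x, hx⟩ := exists_represents a
    obtain ⟨h1, h2⟩ := hx.cohEps
    rw [ha] at h1 h2
    obtain ⟨u, hu⟩ := (represents_zero_iff h1.d_eq_zero).1 h1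
    obtain ⟨v, hv⟩ := (represents_zero_iff h2.d_eq_zero).1 h2
    exact hx.unique' ((represents_zero_iff hx.d_eq_zero).2 ⟨(u, v), Prod.ext hu hv⟩)
  · rintro ⟨b, c⟩
    obtain ⟨x, hx⟩ := exists_represents b
    obtain ⟨y, hy⟩ := exists_represents c
    obtain ⟨a, ha⟩ := Represents.of_d_eq_zero (d := epsD 𝒜) (x := (x, y))
      (Prod.ext hx.d_eq_zero hy.d_eq_zero)
    exact ⟨a, Prod.ext (ha.cohEps.1.unique' hx) (ha.cohEps.2.unique' hy)⟩

variable (𝒜) in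
/-- The isomorphism `H(κ)` of `HH(A|A)` with `HH(A)[ε]/(ε²)`. -/
noncomputable def cohKappa : RelHH 𝒜 ≃ₗ[k] HHeps 𝒜 :=
  LinearEquiv.ofBijective (cohEps 𝒜 ∘ₗ cohMap (kappa 𝒜) kappa_d)
    ((bijective_cohEps 𝒜).comp bijective_cohMap_kappa)

lemma Represents.cohKappa {x : RelHC 𝒜} {a : RelHH 𝒜} (h : Represents (relD 𝒜) x a) :
    Represents (hcD 𝒜) (kappa 𝒜 x).1 (Hoch.cohKappa 𝒜 a).1 ∧
      Represents (hcD 𝒜) (kappa 𝒜 x).2 (Hoch.cohKappa 𝒜 a).2 :=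
  (h.cohMap kappa_d).cohEps

lemma relD_section {x y : HC 𝒜} (dx : hcD 𝒜 x = 0) (dy : hcD 𝒜 y = 0) :
    relD 𝒜 (hcToRel x + relCup 𝒜 (hcToRel y) (relId 𝒜)) = 0 := by
  rw [map_add, ← hcToRel_d, dx, map_zero, zero_add]
  exact (rel_isBigradedBraceAlgebra 𝒜).isBraceAlgebra.cup_cocycle _ _
    (by rw [← hcToRel_d, dy, map_zero]) relD_relId

lemma kappa_section (x y : HC 𝒜) : kappa 𝒜 (hcToRel x + relCup 𝒜 (hcToRel y) (relId 𝒜)) =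
    (x, hcPre 𝒜 x (hcOne 𝒜) + y) := by
  rw [map_add, kappa_hcToRel, kappa_cup_relId, relFst_hcToRel]
  exact Prod.ext (add_zero x) rfl

lemma Represents.pre_one_add {x y : HC 𝒜} {b : HH 𝒜} (dx : hcD 𝒜 x = 0)
    (hy : Represents (hcD 𝒜) y b) : Represents (hcD 𝒜) (hcPre 𝒜 x (hcOne 𝒜) + y) b := by
  obtain ⟨w, hw⟩ := pre_one_mem_range dx
  refine hy.add_range ?_ ⟨w, by rw [hw, add_sub_cancel_right]⟩
  rw [← hw, map_add, (hc_isBigradedBraceAlgebra 𝒜).isBraceAlgebra.d_d, hy.d_eq_zero, add_zero]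

/-- The class `a + b ε` corresponds to the extension of a representative of `a` to the diagonal
bimodule, plus the product of such an extension for `b` with the identity of the bimodule. -/
lemma Represents.section {x y : HC 𝒜} {a b : HH 𝒜} (hx : Represents (hcD 𝒜) x a)
    (hy : Represents (hcD 𝒜) y b) :
    Represents (relD 𝒜) (hcToRel x + relCup 𝒜 (hcToRel y) (relId 𝒜))
      ((Hoch.cohKappa 𝒜).symm (a, b)) := by
  obtain ⟨c, hc⟩ := Represents.of_d_eq_zero (relD_section hx.d_eq_zero hy.d_eq_zero)
  obtain ⟨h1, h2⟩ := hc.cohKappa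
  rw [kappa_section] at h1 h2
  convert hc
  rw [LinearEquiv.symm_apply_eq]
  exact Prod.ext (hx.unique' h1) ((hy.pre_one_add hx.d_eq_zero).unique' h2)

lemma Represents.hcToRel {x : HC 𝒜} {a : HH 𝒜} (hx : Represents (hcD 𝒜) x a) :
    Represents (relD 𝒜) (hcToRel x) ((Hoch.cohKappa 𝒜).symm (a, 0)) := by
  simpa using hx.section .zero

lemma represents_relId {u : HH 𝒜} (hu : Represents (hcD 𝒜) (hcOne 𝒜) u) :
    Represents (relD 𝒜) (relId 𝒜) ((cohKappa 𝒜).symm (0, u)) := by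
  obtain ⟨c, hc⟩ := Represents.of_d_eq_zero (relD_relId (𝒜 := 𝒜))
  obtain ⟨h1, h2⟩ := hc.cohKappa
  rw [kappa_relId] at h1 h2
  convert hc
  rw [LinearEquiv.symm_apply_eq]
  exact Prod.ext (Represents.zero.unique' h1) (hu.unique' h2)

variable (𝒜) in
lemma map_relHHGr (i : ℤ × ℤ) :
    (relHHGr 𝒜 i).map (cohEps 𝒜 ∘ₗ cohMap (kappa 𝒜) kappa_d) = hhEpsGr 𝒜 i := by
  apply le_antisymm
  · rintro _ ⟨a, ha, rfl⟩
    obtain ⟨x, hx, hxa⟩ := mem_cohPart.1 ha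
    obtain ⟨h1, h2⟩ := hxa.cohKappa
    exact ⟨mem_cohPart.2 ⟨_, (kappa_mem hx).1, h1⟩, mem_cohPart.2 ⟨_, (kappa_mem hx).2, h2⟩⟩
  · rintro ⟨a, b⟩ ⟨ha, hb⟩
    obtain ⟨x, hx, hxa⟩ := mem_cohPart.1 ha
    obtain ⟨y, hy, hyb⟩ := mem_cohPart.1 hb
    refine ⟨(cohKappa 𝒜).symm (a, b), mem_cohPart.2 ⟨_, add_mem (hcToRel_mem hx) ?_,
      hxa.section hyb⟩, (cohKappa 𝒜).apply_symm_apply (a, b)⟩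
    have := rel_cup_mem _ _ _ (hcToRel_mem hy) _ relId_mem
    rwa [sub_add_cancel] at this

lemma map_totalGr {V W : Type*} [AddCommGroup V] [Module k V] [AddCommGroup W] [Module k W]
    {gr : ℤ × ℤ → Submodule k V} {gr' : ℤ × ℤ → Submodule k W} (f : V →ₗ[k] W)
    (hf : ∀ i, (gr i).map f = gr' i) (n : ℤ) : (totalGr gr n).map f = totalGr gr' n := by
  simp only [totalGr, Submodule.map_iSup, hf]

lemma totalGr_hhEpsGr_left {n : ℤ} {a : HH 𝒜} (ha : a ∈ totalGr (hhGr 𝒜) n) :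
    (a, (0 : HH 𝒜)) ∈ totalGr (hhEpsGr 𝒜) n := by
  refine totalGr_induction (P := fun a => (a, (0 : HH 𝒜)) ∈ totalGr (hhEpsGr 𝒜) n) (zero_mem _)
    (fun x y hx hy => by simpa using add_mem hx hy) (fun i hi x hx => ?_) ha
  exact mem_totalGr' (gr := hhEpsGr 𝒜) (i := i) ⟨hx, zero_mem _⟩ hi

lemma totalGr_hhEpsGr_right {n : ℤ} {a : HH 𝒜} (ha : a ∈ totalGr (hhGr 𝒜) n) :
    ((0 : HH 𝒜), a) ∈ totalGr (hhEpsGr 𝒜) (n + 1) := by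
  refine totalGr_induction (P := fun a => ((0 : HH 𝒜), a) ∈ totalGr (hhEpsGr 𝒜) (n + 1))
    (zero_mem _) (fun x y hx hy => by simpa using add_mem hx hy) (fun i hi x hx => ?_) ha
  refine mem_totalGr' (gr := hhEpsGr 𝒜) (i := i + (1, 0)) ⟨zero_mem _, ?_⟩ ?_
  · rwa [add_sub_cancel_right]
  · rw [← hi, Prod.fst_add, Prod.snd_add]
    ring

end HochschildCohomology

/-! ### Brackets and squares on `W[ε]/(ε²)` -/

section Uniqueness

variable {k W : Type*} [Field k] [AddCommGroup W] [Module k W]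

/-- The bilinear map `P` is the product of `W[ε]/(ε²)`, where `W` is graded by `gr` with product
`mul` and right unit `u`, and `ε` is central of degree `1`. -/
structure IsEpsProduct (gr : ℤ → Submodule k W) (mul : W →ₗ[k] W →ₗ[k] W) (u : W)
    (P : W × W →ₗ[k] W × W →ₗ[k] W × W) : Prop where
  mul_one : ∀ c, mul c u = c
  apply : ∀ n, ∀ c₁ c₂ c₃ c₄, c₃ ∈ gr n →
    P (c₁, c₂) (c₃, c₄) = (mul c₁ c₃, mul c₁ c₄ + sgn k n • mul c₂ c₃)

/-- The bilinear map `B` extends the bracket `br`, and `ε` commutes with everything for `B`. -/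
structure IsEpsBracket (br : W →ₗ[k] W →ₗ[k] W) (u : W)
    (B : W × W →ₗ[k] W × W →ₗ[k] W × W) : Prop where
  left_left : ∀ c₁ c₂, B (c₁, 0) (c₂, 0) = (br c₁ c₂, 0)
  eps_eps : B (0, u) (0, u) = 0
  left_eps : ∀ c, B (c, 0) (0, u) = 0

variable {gr : ℤ → Submodule k W} {mul br : W →ₗ[k] W →ₗ[k] W} {u : W}
  {P B : W × W →ₗ[k] W × W →ₗ[k] W × W} {grE : ℤ → Submodule k (W × W)}

namespace IsEpsProduct

variable (hP : IsEpsProduct gr mul u P)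
include hP

lemma apply_eps (c₁ c₂ : W) : P (c₁, c₂) (0, u) = (0, c₁) := by
  rw [hP.apply 0 c₁ c₂ 0 u (zero_mem _), hP.mul_one]
  simp

lemma eps_eps : P (0, u) (0, u) = 0 := hP.apply_eps 0 u

lemma left_left (h : DirectSum.IsInternal gr) (c₁ c₂ : W) :
    P (c₁, 0) (c₂, 0) = (mul c₁ c₂, 0) := by
  refine graded_induction h (P := fun c => P (c₁, 0) (c, 0) = (mul c₁ c, 0))
    (by simp [Prod.mk_zero_zero]) (fun x y hx hy => ?_) (fun n x hx => ?_) c₂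
  · rw [← add_zero (0 : W), ← Prod.mk_add_mk, map_add, add_zero, hx, hy]
    simp
  · rw [hP.apply n _ _ _ _ hx]
    simp

variable (h : DirectSum.IsInternal gr) (hl : ∀ n, ∀ c ∈ gr n, ((c, 0) : W × W) ∈ grE n)
  (hr : ∀ n, ∀ c ∈ gr n, ((0, c) : W × W) ∈ grE (n + 1)) (hB : IsShiftedLieBracket grE B)
  (hPB : GerstenhaberRelation grE P B) (hε : IsEpsBracket br u B)

include h hl hPB hε

/-- The Gerstenhaber relation for `c₂ ε` and `[c₁, ε] = 0`. -/
lemma bracket_left_right (c₁ c₂ : W) : B (c₁, 0) (0, c₂) = (0, br c₁ c₂) := by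
  refine graded_induction h (P := fun c => B (c, 0) (0, c₂) = (0, br c c₂))
    (by simp [Prod.mk_zero_zero]) (fun x y hx hy => ?_) (fun m x hx => ?_) c₁
  · rw [← add_zero (0 : W), ← Prod.mk_add_mk, map_add, LinearMap.add_apply, add_zero, hx, hy]
    simp
  refine graded_induction h (P := fun c => B (x, 0) (0, c) = (0, br x c))
    (by simp [Prod.mk_zero_zero]) (fun y z hy hz => ?_) (fun n y hy => ?_) c₂
  · rw [← add_zero (0 : W), ← Prod.mk_add_mk, map_add, add_zero, hy, hz]
    simp
  rw [← hP.apply_eps y 0, hPB m n _ (hl m x hx) _ (hl n y hy), hε.left_left, hε.left_eps, map_zero,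
    smul_zero, add_zero, hP.apply_eps]

include hr hB

lemma bracket_right_left {m n : ℤ} {x y : W} (hx : x ∈ gr m) (hy : y ∈ gr n) :
    B (0, x) (y, 0) = -(sgn k (m * (n - 1)) • (0, br y x)) := by
  rw [hB.antisymm _ _ _ (hr m x hx) _ (hl n y hy), hP.bracket_left_right h hl hPB hε,
    add_sub_cancel_right]

include u in
/-- First `[x ε, ε] = 0`, by the Gerstenhaber relation for `[ε, x ε]`; then `[x ε, y ε] = [x ε, y]
ε`, which is a multiple of `ε² = 0`. -/
lemma bracket_right_right (hu : u ∈ gr 0) (c₁ c₂ : W) : B (0, c₁) (0, c₂) = 0 := by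
  have e : ∀ c, B (0, u) (c, 0) = 0 := fun c => by
    refine graded_induction h (P := fun c => B (0, u) (c, 0) = 0) (by simp [Prod.mk_zero_zero])
      (fun x y hx hy => ?_) (fun m x hx => ?_) c
    · rw [← add_zero (0 : W), ← Prod.mk_add_mk, map_add, add_zero, hx, hy, add_zero]
    · rw [hB.antisymm _ _ _ (hr 0 u hu) _ (hl m x hx), hε.left_eps, smul_zero, neg_zero]
  refine graded_induction h (P := fun c => B (0, c) (0, c₂) = 0) (by simp [Prod.mk_zero_zero])
    (fun x y hx hy => ?_) (fun m x hx => ?_) c₁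
  · rw [← add_zero (0 : W), ← Prod.mk_add_mk, map_add, LinearMap.add_apply, add_zero, hx, hy,
      add_zero]
  -- `[ε, x ε] = 0`, hence `[x ε, ε] = 0`
  have e' : B (0, x) (0, u) = 0 := by
    rw [hB.antisymm _ _ _ (hr m x hx) _ (hr 0 u hu), ← hP.apply_eps x 0,
      hPB _ m _ (hr 0 u hu) _ (hl m x hx), e, hε.eps_eps]
    simp
  refine graded_induction h (P := fun c => B (0, x) (0, c) = 0) (by simp [Prod.mk_zero_zero])
    (fun y z hy hz => ?_) (fun n y hy => ?_) c₂
  · rw [← add_zero (0 : W), ← Prod.mk_add_mk, map_add, add_zero, hy, hz, add_zero]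
  rw [← hP.apply_eps y 0, hPB _ n _ (hr m x hx) _ (hl n y hy), e', map_zero, smul_zero, add_zero,
    hP.bracket_right_left h hl hr hB hPB hε hx hy, map_neg, map_smul, LinearMap.neg_apply,
    LinearMap.smul_apply, hP.apply_eps]
  simp

/-- An extension of the bracket for which `ε` commutes with everything is unique: bilinearity,
antisymmetry and the Gerstenhaber relation express it in terms of `br`. -/
theorem bracket_unique (hu : u ∈ gr 0) {B' : W × W →ₗ[k] W × W →ₗ[k] W × W}
    (hB' : IsShiftedLieBracket grE B') (hPB' : GerstenhaberRelation grE P B')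
    (hε' : IsEpsBracket br u B') : B' = B := by
  have e1 (c₁ c₂ : W) : B' (0, c₁) (c₂, 0) = B (0, c₁) (c₂, 0) := by
    refine graded_induction h (P := fun c => B' (0, c) (c₂, 0) = B (0, c) (c₂, 0))
      (by simp [Prod.mk_zero_zero]) (fun x y hx hy => ?_) (fun m x hx => ?_) c₁
    · rw [← add_zero (0 : W), ← Prod.mk_add_mk, map_add, map_add, LinearMap.add_apply,
        LinearMap.add_apply, add_zero, hx, hy]
    refine graded_induction h (P := fun c => B' (0, x) (c, 0) = B (0, x) (c, 0))
      (by simp [Prod.mk_zero_zero]) (fun y z hy hz => ?_) (fun n y hy => ?_) c₂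
    · rw [← add_zero (0 : W), ← Prod.mk_add_mk, map_add, map_add, add_zero, hy, hz]
    rw [hP.bracket_right_left h hl hr hB hPB hε hx hy,
      hP.bracket_right_left h hl hr hB' hPB' hε' hx hy]
  refine LinearMap.ext fun x => LinearMap.ext fun y => ?_
  have hx : x = (x.1, 0) + (0, x.2) := by simp
  have hy : y = (y.1, 0) + (0, y.2) := by simp
  rw [hx, hy]
  simp only [map_add, LinearMap.add_apply, e1, hε.left_left, hε'.left_left,
    hP.bracket_left_right h hl hPB hε, hP.bracket_left_right h hl hPB' hε',
    hP.bracket_right_right h hl hr hB hPB hε hu, hP.bracket_right_right h hl hr hB' hPB' hε' hu]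

end IsEpsProduct

/-- In characteristic `2`, a square that extends the one on `W`, and for which `ε` is its own
square, is determined by the formulas for the squares of sums and of products. -/
theorem IsEpsProduct.sq_eq {E : GerstenhaberAlgebra grE} (h : DirectSum.IsInternal gr)
    (hl : ∀ n, ∀ c ∈ gr n, ((c, 0) : W × W) ∈ grE n) (hP : IsEpsProduct gr mul u E.mul)
    (hε : IsEpsBracket br u E.bracket) (h2 : ringChar k = 2) {sq : W → W}
    (h_left : ∀ c, E.sq (c, 0) = (sq c, 0)) (h_eps : E.sq (0, u) = (0, u)) (c₁ c₂ : W) :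
    E.sq (c₁, c₂) = (sq c₁, mul c₂ c₂ + br c₁ c₂) := by
  have e : E.sq (0, c₂) = (0, mul c₂ c₂) := by
    rw [← hP.apply_eps c₂ 0, E.sq_mul h2, hP.eps_eps, hε.left_eps, h_eps, hP.left_left h,
      hP.apply_eps]
    simp [hP.apply_eps]
  have hc : (c₁, c₂) = (c₁, 0) + (0, c₂) := by simp
  rw [hc, E.sq_add h2, h_left, e, hP.bracket_left_right h hl E.gerstenhaberRelation hε]
  simp

end Uniqueness

/-! ### The Gerstenhaber algebras `HH(A)` and `HH(A|A)` -/

section Existence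

variable {k A : Type*} [Field k] [Ring A] [Algebra k A] (𝒜 : ℤ → Submodule k A) [GradedAlgebra 𝒜]

theorem exists_gerstenhaberAlgebra_hh : ∃ G : GerstenhaberAlgebra (totalGr (hhGr 𝒜)),
    G.IsInducedBy (totalGr (homPart k fun i => HCdeg 𝒜 i)) (hcCup 𝒜) (hcBracket 𝒜) (hcPre 𝒜) :=
  (hc_isBigradedBraceAlgebra 𝒜).exists_gerstenhaberAlgebra

theorem exists_gerstenhaberAlgebra_relHH : ∃ R : GerstenhaberAlgebra (totalGr (relHHGr 𝒜)),
    R.IsInducedBy (totalGr (homPart k fun i => RelDeg 𝒜 i)) (relCup 𝒜) (relBracket 𝒜) (relPre 𝒜) :=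
  (rel_isBigradedBraceAlgebra 𝒜).exists_gerstenhaberAlgebra

end Existence

/-! ### The structure transported along `H(κ)` -/

section TransportedStructure

variable {k A : Type*} [Field k] [Ring A] [Algebra k A] {𝒜 : ℤ → Submodule k A} [GradedAlgebra 𝒜]
  {G : GerstenhaberAlgebra (totalGr (hhGr 𝒜))} {R : GerstenhaberAlgebra (totalGr (relHHGr 𝒜))}
  {E : GerstenhaberAlgebra (totalGr (hhEpsGr 𝒜))} {u : HH 𝒜}
  (hG : G.IsInducedBy (totalGr (homPart k fun i => HCdeg 𝒜 i)) (hcCup 𝒜) (hcBracket 𝒜) (hcPre 𝒜))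
  (hR : R.IsInducedBy (totalGr (homPart k fun i => RelDeg 𝒜 i)) (relCup 𝒜) (relBracket 𝒜)
    (relPre 𝒜))
  (hE : IsGerstenhaberIso R E (cohKappa 𝒜).toLinearMap) (hu : Represents (hcD 𝒜) (hcOne 𝒜) u)

include hE in
lemma eps_mul_eq (p q : HHeps 𝒜) :
    E.mul p q = cohKappa 𝒜 (R.mul ((cohKappa 𝒜).symm p) ((cohKappa 𝒜).symm q)) := by
  simpa using (hE.map_mul ((cohKappa 𝒜).symm p) ((cohKappa 𝒜).symm q)).symm

include hE in
lemma eps_bracket_eq (p q : HHeps 𝒜) :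
    E.bracket p q = cohKappa 𝒜 (R.bracket ((cohKappa 𝒜).symm p) ((cohKappa 𝒜).symm q)) := by
  simpa using (hE.map_bracket ((cohKappa 𝒜).symm p) ((cohKappa 𝒜).symm q)).symm

include hE in
lemma eps_sq_eq (h : ringChar k = 2) (p : HHeps 𝒜) :
    E.sq p = cohKappa 𝒜 (R.sq ((cohKappa 𝒜).symm p)) := by
  simpa using (hE.map_sq ((cohKappa 𝒜).symm p) (.inl h)).symm

include hG hu in
lemma one_mul_and_mul_one (c : HH 𝒜) : G.mul u c = c ∧ G.mul c u = c := by
  have hC := hc_isBigradedBraceAlgebra 𝒜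
  obtain ⟨x, hx⟩ := exists_represents c
  have h1 := hG.mul _ _ _ _ hu hx
  have h2 := hG.mul _ _ _ _ hx hu
  rw [hC.one_cup] at h1
  rw [hC.cup_one] at h2
  exact ⟨h1.unique' hx, h2.unique' hx⟩

include hu in
lemma unit_mem : u ∈ totalGr (hhGr 𝒜) 0 :=
  mem_totalGr' (gr := hhGr 𝒜) (i := 0)
    (mem_cohPart.2 ⟨_, (hc_isBigradedBraceAlgebra 𝒜).one_mem, hu⟩) (by simp)

include hG hR hE hu in
theorem isEpsProduct_eps : IsEpsProduct (totalGr (hhGr 𝒜)) G.mul u E.mul := by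
  refine ⟨fun c => (one_mul_and_mul_one hG hu c).2,
    fun n c₁ c₂ c₃ c₄ h₃ => ?_⟩
  have hC := hc_isBigradedBraceAlgebra 𝒜
  have h₃ : c₃ ∈ totalGr (fun i => cohPart (hcD 𝒜) (homPart k (fun i => HCdeg 𝒜 i) i)) n := h₃
  rw [totalGr_cohPart hC.isInternal hC.d_mem] at h₃
  obtain ⟨x₃, hx₃, h₃⟩ := mem_cohPart.1 h₃
  obtain ⟨x₁, h₁⟩ := exists_represents c₁
  obtain ⟨x₂, h₂⟩ := exists_represents c₂
  obtain ⟨x₄, h₄⟩ := exists_represents c₄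
  obtain ⟨e1, e2⟩ := (hR.mul _ _ _ _ (h₁.section h₂) (h₃.section h₄)).cohKappa
  rw [← eps_mul_eq hE, kappa_cup, kappa_section, kappa_section, epsMul_apply] at e1 e2
  simp only [totalParity_apply' hx₃, map_smul] at e2
  refine Prod.ext (e1.unique' (hG.mul _ _ _ _ h₁ h₃)) (e2.unique' ?_)
  exact (hG.mul _ _ _ _ h₁ (h₄.pre_one_add h₃.d_eq_zero)).add
    ((hG.mul _ _ _ _ (h₂.pre_one_add h₁.d_eq_zero) h₃).smul _)

include hG hR hE hu in
theorem isEpsBracket_eps : IsEpsBracket G.bracket u E.bracket := by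
  refine ⟨fun c₁ c₂ => ?_, ?_, fun c => ?_⟩
  · obtain ⟨x₁, h₁⟩ := exists_represents c₁
    obtain ⟨x₂, h₂⟩ := exists_represents c₂
    have e := hR.bracket _ _ _ _ h₁.hcToRel h₂.hcToRel
    rw [← hcToRel_bracket] at e
    rw [eps_bracket_eq hE, ← LinearEquiv.eq_symm_apply]
    exact e.unique' (hG.bracket _ _ _ _ h₁ h₂).hcToRel
  · have e := hR.bracket _ _ _ _ (represents_relId hu) (represents_relId hu)
    rw [relBracket_relId] at e
    rw [eps_bracket_eq hE, e.unique' .zero, map_zero]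
  · obtain ⟨x, h⟩ := exists_represents c
    have e := hR.bracket _ _ _ _ h.hcToRel (represents_relId hu)
    rw [relBracket_relId] at e
    rw [eps_bracket_eq hE, e.unique' .zero, map_zero]

include hG hR hE in
lemma eps_sq_left (h2 : ringChar k = 2) (c : HH 𝒜) : E.sq (c, 0) = (G.sq c, 0) := by
  obtain ⟨x, h⟩ := exists_represents c
  have e := hR.sq _ _ (.inl h2) h.hcToRel
  rw [← hcToRel_pre] at e
  rw [eps_sq_eq hE h2, ← LinearEquiv.eq_symm_apply]
  exact e.unique' (hG.sq _ _ (.inl h2) h).hcToRel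

include hR hE hu in
/-- The class `ε` is its own square, like the identity of the diagonal bimodule. -/
lemma eps_sq_eps (h2 : ringChar k = 2) : E.sq (0, u) = (0, u) := by
  have e := hR.sq _ _ (.inl h2) (represents_relId hu)
  rw [relPre_relId_relId] at e
  rw [eps_sq_eq hE h2, ← LinearEquiv.eq_symm_apply]
  exact e.unique' (represents_relId hu)

include hG hR hE hu in
theorem eps_bracket_left_right (c₁ c₂ : HH 𝒜) :
    E.bracket (c₁, 0) (0, c₂) = (0, G.bracket c₁ c₂) :=
  (isEpsProduct_eps hG hR hE hu).bracket_left_right G.isInternal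
    (fun _ _ => totalGr_hhEpsGr_left) E.gerstenhaberRelation (isEpsBracket_eps hG hR hE hu) c₁ c₂

include hG hR hE hu in
theorem eps_bracket_right_right (c₁ c₂ : HH 𝒜) : E.bracket (0, c₁) (0, c₂) = 0 :=
  (isEpsProduct_eps hG hR hE hu).bracket_right_right G.isInternal
    (fun _ _ => totalGr_hhEpsGr_left) (fun _ _ => totalGr_hhEpsGr_right) E.isShiftedLieBracket
    E.gerstenhaberRelation (isEpsBracket_eps hG hR hE hu) (unit_mem hu) c₁ c₂

include hG hR hE hu in
theorem eps_bracket_unique {B : HHeps 𝒜 →ₗ[k] HHeps 𝒜 →ₗ[k] HHeps 𝒜}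
    (hB : IsShiftedLieBracket (totalGr (hhEpsGr 𝒜)) B)
    (hPB : GerstenhaberRelation (totalGr (hhEpsGr 𝒜)) E.mul B)
    (hε : IsEpsBracket G.bracket u B) : B = E.bracket :=
  (isEpsProduct_eps hG hR hE hu).bracket_unique G.isInternal
    (fun _ _ => totalGr_hhEpsGr_left) (fun _ _ => totalGr_hhEpsGr_right) E.isShiftedLieBracket
    E.gerstenhaberRelation (isEpsBracket_eps hG hR hE hu) (unit_mem hu) hB hPB hε

include hG hR hE hu in
theorem eps_sq (h2 : ringChar k = 2) (c₁ c₂ : HH 𝒜) :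
    E.sq (c₁, c₂) = (G.sq c₁, G.mul c₂ c₂ + G.bracket c₁ c₂) :=
  IsEpsProduct.sq_eq G.isInternal (fun _ _ => totalGr_hhEpsGr_left)
    (isEpsProduct_eps hG hR hE hu) (isEpsBracket_eps hG hR hE hu) h2
    (eps_sq_left hG hR hE h2) (eps_sq_eps hR hE hu h2) c₁ c₂

variable (𝒜) in
theorem exists_represents_relOne (hu : Represents (hcD 𝒜) (hcOne 𝒜) u) :
    ∃ v, Represents (relD 𝒜) (relOne 𝒜) v ∧ cohKappa 𝒜 v = (u, 0) := by
  obtain ⟨v, hv⟩ := Represents.of_d_eq_zero (rel_isBigradedBraceAlgebra 𝒜).isBraceAlgebra.d_one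
  obtain ⟨e1, e2⟩ := hv.cohKappa
  rw [kappa_one] at e1 e2
  exact ⟨v, hv, Prod.ext (e1.unique' hu) (e2.unique' .zero)⟩

variable (𝒜) in
theorem exists_transport (R : GerstenhaberAlgebra (totalGr (relHHGr 𝒜))) :
    ∃ E : GerstenhaberAlgebra (totalGr (hhEpsGr 𝒜)),
      IsGerstenhaberIso R E (cohKappa 𝒜).toLinearMap :=
  ⟨_, R.isGerstenhaberIso_transport (cohKappa 𝒜) (map_totalGr _ (map_relHHGr 𝒜))⟩

end TransportedStructure

end Hoch

set_option maxHeartbeats 1000000 in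
open Hoch in
theorem mainTheorem7 {k A : Type*} [Field k] [Ring A] [Algebra k A] (𝒜 : ℤ → Submodule k A)
    [GradedAlgebra 𝒜] :
    -- `κ` is a quasi-isomorphism of dg algebras
    IsDGAlgebra (homPart k fun i => RelDeg 𝒜 i) (relD 𝒜) (relCup 𝒜) (relOne 𝒜) ∧
    IsDGAlgebra (epsGr 𝒜) (epsD 𝒜) (epsMul 𝒜) (epsOne 𝒜) ∧
    IsDGAlgebraHom (homPart k fun i => RelDeg 𝒜 i) (relD 𝒜) (relCup 𝒜) (relOne 𝒜)
      (epsGr 𝒜) (epsD 𝒜) (epsMul 𝒜) (epsOne 𝒜) (kappa 𝒜) ∧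
    ∃ hκ : ∀ x, kappa 𝒜 (relD 𝒜 x) = epsD 𝒜 (kappa 𝒜 x),
    Function.Bijective (cohMap (kappa 𝒜) hκ) ∧
    Function.Bijective (cohEps 𝒜) ∧
    -- the Gerstenhaber algebras `HH(A)`, `HH(A|A)` and `HH(A)[ε]/(ε²)`, and the unit of `HH(A)`
    ∃ (G : GerstenhaberAlgebra (totalGr (hhGr 𝒜)))
      (R : GerstenhaberAlgebra (totalGr (relHHGr 𝒜)))
      (E : GerstenhaberAlgebra (totalGr (hhEpsGr 𝒜))) (u : HH 𝒜),
    G.IsInducedBy (totalGr (homPart k fun i => HCdeg 𝒜 i)) (hcCup 𝒜) (hcBracket 𝒜) (hcPre 𝒜) ∧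
    R.IsInducedBy (totalGr (homPart k fun i => RelDeg 𝒜 i)) (relCup 𝒜) (relBracket 𝒜) (relPre 𝒜) ∧
    Represents (hcD 𝒜) (hcOne 𝒜) u ∧ (∀ c, G.mul u c = c ∧ G.mul c u = c) ∧
    -- the product of `HH(A)[ε]/(ε²)`: `ε` is central of total degree `1` and `ε² = 0`
    (∀ n, ∀ c₁ c₂ c₃ c₄, c₃ ∈ totalGr (hhGr 𝒜) n →
      E.mul (c₁, c₂) (c₃, c₄) = (G.mul c₁ c₃, G.mul c₁ c₄ + sgn k n • G.mul c₂ c₃)) ∧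
    -- `H(κ)` is an isomorphism of bigraded unital algebras and of Gerstenhaber algebras
    (∀ i, (relHHGr 𝒜 i).map (cohEps 𝒜 ∘ₗ cohMap (kappa 𝒜) hκ) = hhEpsGr 𝒜 i) ∧
    (∃ v, Represents (relD 𝒜) (relOne 𝒜) v ∧ cohEps 𝒜 (cohMap (kappa 𝒜) hκ v) = (u, 0)) ∧
    IsGerstenhaberIso R E (cohEps 𝒜 ∘ₗ cohMap (kappa 𝒜) hκ) ∧
    -- the bracket, where `ε = (0, u)`
    (∀ c₁ c₂, E.bracket (c₁, 0) (c₂, 0) = (G.bracket c₁ c₂, 0)) ∧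
    E.bracket (0, u) (0, u) = 0 ∧
    (∀ c, E.bracket (c, 0) (0, u) = 0) ∧
    (∀ c₁ c₂, E.bracket (c₁, 0) (0, c₂) = (0, G.bracket c₁ c₂)) ∧
    (∀ c₁ c₂, E.bracket (0, c₁) (0, c₂) = 0) ∧
    (∀ B : HHeps 𝒜 →ₗ[k] HHeps 𝒜 →ₗ[k] HHeps 𝒜,
      IsShiftedLieBracket (totalGr (hhEpsGr 𝒜)) B →
      GerstenhaberRelation (totalGr (hhEpsGr 𝒜)) E.mul B →
      (∀ c₁ c₂, B (c₁, 0) (c₂, 0) = (G.bracket c₁ c₂, 0)) →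
      B (0, u) (0, u) = 0 → (∀ c, B (c, 0) (0, u) = 0) → B = E.bracket) ∧
    -- the Gerstenhaber square
    (ringChar k = 2 → (∀ c, E.sq (c, 0) = (G.sq c, 0)) ∧
      ∀ c₁ c₂, E.sq (c₁, c₂) = (G.sq c₁, G.mul c₂ c₂ + G.bracket c₁ c₂)) := by
  obtain ⟨G, hG⟩ := exists_gerstenhaberAlgebra_hh 𝒜
  obtain ⟨R, hR⟩ := exists_gerstenhaberAlgebra_relHH 𝒜
  obtain ⟨E, hE⟩ := exists_transport 𝒜 R
  obtain ⟨u, hu⟩ := Represents.of_d_eq_zero (hc_isBigradedBraceAlgebra 𝒜).isBraceAlgebra.d_one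
  have hε := isEpsBracket_eps hG hR hE hu
  exact ⟨(rel_isBigradedBraceAlgebra 𝒜).isDGAlgebra, eps_isDGAlgebra 𝒜,
    ⟨fun i x hx => kappa_mem hx, kappa_d, kappa_one, kappa_cup⟩, kappa_d, bijective_cohMap_kappa,
    bijective_cohEps 𝒜, G, R, E, u, hG, hR, hu, one_mul_and_mul_one hG hu,
    (isEpsProduct_eps hG hR hE hu).apply, map_relHHGr 𝒜, exists_represents_relOne 𝒜 hu, hE,
    hε.left_left, hε.eps_eps, hε.left_eps, eps_bracket_left_right hG hR hE hu,
    eps_bracket_right_right hG hR hE hu,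
    fun B hB hPB h1 h2 h3 => eps_bracket_unique hG hR hE hu hB hPB ⟨h1, h2, h3⟩,
    fun h2 => ⟨eps_sq_left hG hR hE h2, eps_sq hG hR hE hu h2⟩⟩
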